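/- Notation. On $\mathbb R\times\mathbb R^3$ write $r=|x|$, $\langle s\rangle=(1+s^2)^{1/2}$, $\partial=(\partial_t,\partial_1,\partial_2,\partial_3)$, $\Omega=(x^i\partial_j-x^j\partial_i)_{i<j}$, $S=t\partial_t+\sum_i x^i\partial_i$. For a multi-index $J=(i,j,k)$ put $u_J=Z^Ju=\partial^i\Omega^jS^ku$ and $|J|=|i|+3|j|+6k$; $|u_{\le M}|\le w$ means $|u_J|\le w$ on $[0,\infty)\times\mathbb R^3$ for all $|J|\le M$. $S^Z(w)$ is the class of smooth $u$ with $|u_J|\lesssim_J |w|$ on $t\ge0$ for every $J$. Let $$Pu=\partial_\alpha(g^{\alpha\beta}\partial_\beta u)+\partial_\mu(A^\mu u)+Vu .$$ Local energy norms: with $A_1=\{|x|<2\}$ and $A_R=\{R<|x|<2R\}$ for $R=2^j$, $j\ge1$, and an interval $I\subset[0,\infty)$, $$\|u\|_{LE(I)}=\sup_R\|\langle r\rangle^{-1/2}u\|_{L^2(I\times A_R)},\quad \|f\|_{LE^*(I)}=\sum_R\|\langle r\rangle^{1/2}f\|_{L^2(I\times A_R)},\quad \|u\|_{LE^1(I)}=\|\partial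 u\|_{LE(I)}+\|\langle r\rangle^{-1}u\|_{LE(I)},$$ and for $\chi\in C_c^\infty(\mathbb R^3)$, $\|u\|_{LE^1_w(I)}=\|(1-\chi)\partial u\|_{LE(I)}+\|\langle r\rangle^{-1}u\|_{LE(I)}$, $\|f\|_{LE^*_w(I)}=\|(1-\chi)f\|_{LE^*(I)}+\|\chi f\|_{L^2(I)H^1}$. A superscript $k$ (as in $LE^{1,k}$, $LE^{0,k}$, $LE^{*,k}$) denotes the sum of the norms of $\partial^\alpha u$ over $|\alpha|\le k$. Assumptions. Let $\sigma,\delta>0$, let $g^{\alpha\beta}(t,x)$ be a Lorentzian metric whose slices $\{t=t_0\}$, $t_0\ge0$, are space-like, let $m=\mathrm{diag}(-1,1,1,1)$, and suppose $g^{\alpha\beta}-m^{\alpha\beta}\in S^Z(\langle r\rangle^{-1-\sigma})$, $A^\mu\in S^Z(\langle r\rangle^{-1-\sigma})$, $\partial_tA^\mu\in S^Z(\langle r\rangle^{-2-\sigma})$, $V\in S^Z(\langle r\rangle^{-2-\delta})$. Suppose that at least one of the following holds for all smooth $u$ whose support in each slab $[0,T]\times\mathbb R^3$ is compact: * (weak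 local energy decay) for some $\chi\in C_c^\infty(\mathbb R^3)$, every $k\ge0$ and every $T_0\ge0$, $\ \|u\|_{LE^{1,k}_w[T_0,\infty)}\lesssim_k\|\partial u(T_0)\|_{H^k}+\|Pu\|_{LE^{*,k}_w[T_0,\infty)}$; * (stationary local energy decay) for every $k\ge0$ and $0\le T_1<T_2$, $\ \|u\|_{LE^{1,k}[T_1,T_2]}\lesssim_k\sum_{j=1}^2\|\partial u(T_j)\|_{H^k}+\|Pu\|_{LE^{*,k}[T_1,T_2]}+\|\partial_tu\|_{LE^{0,k}[T_1,T_2]}$, with constants independent of $u$, $T_0$, $T_1$, $T_2$. Theorem. There is an absolute $M\in\mathbb N$ such that, under these assumptions, the following holds. (1) Let $p\le1$ and $q,\eta\in\mathbb R$. There is $K$, depending only on $g,A,V,p,q,\eta$, such that if $\phi$ is smooth up to $t=0$, solves $P\phi=0$ in $(0,\infty)\times\mathbb R^3$ (with any data $\phi_0,\phi_1$ for $\phi$ and its normal derivative at $t=0$) and $$|\phi_{\le M}|\le C\,\langle r\rangle^{-p}\langle t\rangle^{-q}\langle t-r\rangle^{-\eta}\quad\text{on }[0,\infty)\times\mathbb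 R^3,$$ then $$|\phi(t,x)|\le KC\,\langle t\rangle^{-p-q}\langle t-r\rangle^{-\eta}$$ at all points with $0\le r\le t$, and if $p\ge0$ at all points of $[0,\infty)\times\mathbb R^3$. (2) Let $k\ge1$, $p_j\le1$, $q_j,\eta_j\in\mathbb R$ $(1\le j\le k)$. There is $K$, depending only on $g,A,V$ and these exponents, such that if $\phi$ is as in (1) but with $|\phi_{\le M}|\le C\sum_{j}\langle r\rangle^{-p_j}\langle t\rangle^{-q_j}\langle t-r\rangle^{-\eta_j}$ on $[0,\infty)\times\mathbb R^3$, then $$|\phi(t,x)|\le KC\sum_{j=1}^k\langle t\rangle^{-p_j-q_j}\langle t-r\rangle^{-\eta_j}$$ at all points with $0\le r\le t$, and if all $p_j\ge0$ at all points of $[0,\infty)\times\mathbb R^3$. -/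

import Mathlib

open scoped ContDiff NNReal ENNReal

noncomputable section

namespace WaveDecay

open MeasureTheory

/-- Physical space `ℝ³` with its Euclidean norm. -/
abbrev Space : Type := EuclideanSpace ℝ (Fin 3)

/-- Spacetime `ℝ × ℝ³`; a point is `z = (t, x)`, and `r = ‖x‖`. -/
abbrev Spacetime : Type := ℝ × Space

/-- The Japanese bracket `⟨s⟩ = (1 + s²)^{1/2}`. -/
def jb (s : ℝ) : ℝ := Real.sqrt (1 + s ^ 2)

/-- The coordinate vectors of `ℝ × ℝ³`; index `0` is time. -/
def coordVec : Fin 4 → Spacetime :=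
  Fin.cons (1, 0) (fun i : Fin 3 => (0, EuclideanSpace.single i 1))

/-- The partial derivative `∂_α`, `α = 0, …, 3`. -/
def pd (α : Fin 4) (u : Spacetime → ℝ) : Spacetime → ℝ :=
  fun z => fderiv ℝ u z (coordVec α)

/-- The rotation `x^{a+1} ∂_{a+2} - x^{a+2} ∂_{a+1}` (indices modulo `3`). -/
def rot (a : Fin 3) (u : Spacetime → ℝ) : Spacetime → ℝ :=
  fun z => z.2 (a + 1) * pd (a + 2).succ u z - z.2 (a + 2) * pd (a + 1).succ u z

/-- The scaling field `S = t ∂_t + ∑ xⁱ ∂_i`. -/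
def scal (u : Spacetime → ℝ) : Spacetime → ℝ :=
  fun z => z.1 * pd 0 u z + ∑ i : Fin 3, z.2 i * pd i.succ u z

/-- `∂^α = ∂_0^{α 0} ∂_1^{α 1} ∂_2^{α 2} ∂_3^{α 3}`. -/
def pdMulti (α : Fin 4 → ℕ) (u : Spacetime → ℝ) : Spacetime → ℝ :=
  (pd 0)^[α 0] ((pd 1)^[α 1] ((pd 2)^[α 2] ((pd 3)^[α 3] u)))

/-- `Ω^j = Ω_0^{j 0} Ω_1^{j 1} Ω_2^{j 2}`. -/
def rotMulti (j : Fin 3 → ℕ) (u : Spacetime → ℝ) : Spacetime → ℝ :=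
  (rot 0)^[j 0] ((rot 1)^[j 1] ((rot 2)^[j 2] u))

/-- A multi-index `J = (i, j, k)` for the vector fields `∂^i Ω^j S^k`. -/
structure VFIndex where
  i : Fin 4 → ℕ
  j : Fin 3 → ℕ
  k : ℕ

/-- The weighted length `|J| = |i| + 3|j| + 6k`. -/
def VFIndex.len (J : VFIndex) : ℕ := (∑ a, J.i a) + 3 * (∑ a, J.j a) + 6 * J.k

/-- `u_J = Z^J u = ∂^i Ω^j S^k u`. -/
def vf (J : VFIndex) (u : Spacetime → ℝ) : Spacetime → ℝ :=
  pdMulti J.i (rotMulti J.j (scal^[J.k] u))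

/-- The class `S^Z(w)`: smooth functions with `|Z^J u| ≲_J |w|` for every `J`.  The bounds are only
required on `t ≥ 0`, where the evolution takes place. -/
def SZ (w u : Spacetime → ℝ) : Prop :=
  ContDiff ℝ ∞ u ∧ ∀ J : VFIndex, ∃ C : ℝ, ∀ z : Spacetime, 0 ≤ z.1 → |vf J u z| ≤ C * |w z|

/-- The weight `⟨r⟩^k`. -/
def rWeight (k : ℝ) : Spacetime → ℝ := fun z => jb ‖z.2‖ ^ k

/-- The bound `|u_{≤ M}| ≤ C w` on `[0, ∞) × ℝ³`. -/
def BoundUpTo (M : ℕ) (u : Spacetime → ℝ) (C : ℝ) (w : Spacetime → ℝ) : Prop :=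
  ∀ J : VFIndex, J.len ≤ M → ∀ z : Spacetime, 0 ≤ z.1 → |vf J u z| ≤ C * w z

/-! ### The wave operator -/

/-- The Minkowski metric `diag(-1, 1, 1, 1)`. -/
def mink : Matrix (Fin 4) (Fin 4) ℝ := Matrix.diagonal (Fin.cons (-1) (fun _ => 1))

/-- `G` is the matrix `(g^{αβ})` at a point of a Lorentzian metric of signature `(-,+,+,+)`. -/
def IsLorentzian (G : Matrix (Fin 4) (Fin 4) ℝ) : Prop :=
  G.IsSymm ∧ ∃ Q : Matrix (Fin 4) (Fin 4) ℝ, IsUnit Q.det ∧ Q.transpose * G * Q = mink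

/-- The slice `t = const` is space-like: the metric `(g_{αβ}) = (g^{αβ})⁻¹` is positive definite on
the span of `∂_1, ∂_2, ∂_3`. -/
def SliceSpacelike (G : Matrix (Fin 4) (Fin 4) ℝ) : Prop :=
  (G⁻¹.submatrix (Fin.succ : Fin 3 → Fin 4) (Fin.succ : Fin 3 → Fin 4)).PosDef

/-- `P u = ∂_α (g^{αβ} ∂_β u) + ∂_μ (A^μ u) + V u`. -/
def waveOp (g : Spacetime → Matrix (Fin 4) (Fin 4) ℝ) (A : Fin 4 → Spacetime → ℝ)
    (V u : Spacetime → ℝ) : Spacetime → ℝ :=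
  fun z => (∑ α, ∑ β, pd α (fun y => g y α β * pd β u y) z)
    + (∑ μ, pd μ (fun y => A μ y * u y) z) + V z * u z

/-- The derivative of `u` along the future unit normal `-g^{0α} ∂_α / (-g^{00})^{1/2}` of the slice
`t = const`. -/
def normalDeriv (g : Spacetime → Matrix (Fin 4) (Fin 4) ℝ) (u : Spacetime → ℝ) : Spacetime → ℝ :=
  fun z => (∑ α, -(g z 0 α) * pd α u z) / Real.sqrt (-(g z 0 0))

/-- The assumptions on the metric, the first-order coefficients and the potential. -/
structure AdmissibleCoeffs (σ δ : ℝ) (g : Spacetime → Matrix (Fin 4) (Fin 4) ℝ)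
    (A : Fin 4 → Spacetime → ℝ) (V : Spacetime → ℝ) : Prop where
  lorentzian : ∀ z : Spacetime, 0 ≤ z.1 → IsLorentzian (g z)
  spacelike : ∀ z : Spacetime, 0 ≤ z.1 → SliceSpacelike (g z)
  metric_decay : ∀ α β, SZ (rWeight (-1 - σ)) (fun z => g z α β - mink α β)
  A_decay : ∀ μ, SZ (rWeight (-1 - σ)) (A μ)
  dtA_decay : ∀ μ, SZ (rWeight (-2 - σ)) (pd 0 (A μ))
  V_decay : SZ (rWeight (-2 - δ)) V

/-- `φ` solves `P φ = 0` for `t > 0` with data `(φ₀, φ₁)` at `t = 0`.  A function that is smooth on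
`[0, ∞) × ℝ³` up to the boundary is given by a smooth extension to `ℝ × ℝ³`. -/
structure SolvesMain (g : Spacetime → Matrix (Fin 4) (Fin 4) ℝ) (A : Fin 4 → Spacetime → ℝ)
    (V : Spacetime → ℝ) (φ₀ φ₁ : Space → ℝ) (φ : Spacetime → ℝ) : Prop where
  smooth : ContDiff ℝ ∞ φ
  eqn : ∀ z : Spacetime, 0 < z.1 → waveOp g A V φ z = 0
  data₀ : ∀ x : Space, φ (0, x) = φ₀ x
  data₁ : ∀ x : Space, normalDeriv g φ (0, x) = φ₁ x

/-! ### Local energy norms, with values in `[0, ∞]` -/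

/-- The dyadic regions `A_R`, `R = 2^j`: the ball `|x| < 2` for `j = 0`, the shell
`2^j < |x| < 2^{j+1}` for `j ≥ 1`. -/
def shell (j : ℕ) : Set Space :=
  if j = 0 then {x | ‖x‖ < 2} else {x | 2 ^ j < ‖x‖ ∧ ‖x‖ < 2 ^ (j + 1)}

/-- `‖u‖_{LE(I)} = sup_R ‖⟨r⟩^{-1/2} u‖_{L²(I × A_R)}`. -/
def normLE (I : Set ℝ) (u : Spacetime → ℝ) : ℝ≥0∞ :=
  ⨆ j : ℕ, eLpNorm (fun z => rWeight (-1 / 2) z * u z) 2 (volume.restrict (I ×ˢ shell j))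

/-- `‖f‖_{LE^*(I)} = ∑_R ‖⟨r⟩^{1/2} f‖_{L²(I × A_R)}`. -/
def normLEstar (I : Set ℝ) (f : Spacetime → ℝ) : ℝ≥0∞ :=
  ∑' j : ℕ, eLpNorm (fun z => rWeight (1 / 2) z * f z) 2 (volume.restrict (I ×ˢ shell j))

/-- `‖u‖_{LE^1(I)} = ‖∂u‖_{LE(I)} + ‖⟨r⟩^{-1} u‖_{LE(I)}`. -/
def normLE1 (I : Set ℝ) (u : Spacetime → ℝ) : ℝ≥0∞ :=
  (∑ α, normLE I (pd α u)) + normLE I (fun z => rWeight (-1) z * u z)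

/-- The multi-indices of length at most `k` in `n` variables. -/
def multiIdx (n k : ℕ) : Finset (Fin n → ℕ) :=
  (Fintype.piFinset fun _ => Finset.range (k + 1)).filter fun α => ∑ a, α a ≤ k

/-- The norm obtained from `N` by summing over all `∂^α u`, `|α| ≤ k`. -/
def normUpTo (N : (Spacetime → ℝ) → ℝ≥0∞) (k : ℕ) (u : Spacetime → ℝ) : ℝ≥0∞ :=
  ∑ α ∈ multiIdx 4 k, N (pdMulti α u)

/-- `‖∂u(T)‖_{H^k(ℝ³)}`. -/
def energyH (k : ℕ) (u : Spacetime → ℝ) (T : ℝ) : ℝ≥0∞ :=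
  ∑ α : Fin 4, ∑ β ∈ multiIdx 3 k,
    eLpNorm (fun x : Space => pdMulti (Fin.cons 0 β) (pd α u) (T, x)) 2 volume

/-- `‖u‖_{LE^1_w(I)} = ‖(1 - χ) ∂u‖_{LE(I)} + ‖⟨r⟩^{-1} u‖_{LE(I)}`. -/
def normLE1w (χ : Space → ℝ) (I : Set ℝ) (u : Spacetime → ℝ) : ℝ≥0∞ :=
  (∑ α, normLE I (fun z => (1 - χ z.2) * pd α u z)) + normLE I (fun z => rWeight (-1) z * u z)

/-- `‖f‖_{L²(I) H¹}`. -/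
def normL2H1 (I : Set ℝ) (f : Spacetime → ℝ) : ℝ≥0∞ :=
  eLpNorm f 2 (volume.restrict (I ×ˢ Set.univ))
    + ∑ i : Fin 3, eLpNorm (pd i.succ f) 2 (volume.restrict (I ×ˢ Set.univ))

/-- `‖f‖_{LE^*_w(I)} = ‖(1 - χ) f‖_{LE^*(I)} + ‖χ f‖_{L²(I) H¹}`. -/
def normLEstarw (χ : Space → ℝ) (I : Set ℝ) (f : Spacetime → ℝ) : ℝ≥0∞ :=
  normLEstar I (fun z => (1 - χ z.2) * f z) + normL2H1 I (fun z => χ z.2 * f z)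

/-! ### Local energy decay -/

/-- Smooth functions whose support in every slab `[0, T] × ℝ³` is bounded: the solutions of
`P u = f` with smooth, compactly supported data and sources, by finite speed of propagation. -/
def SlabCompact (u : Spacetime → ℝ) : Prop :=
  ContDiff ℝ ∞ u ∧ ∀ T : ℝ, ∃ ρ : ℝ, ∀ z : Spacetime, 0 ≤ z.1 → z.1 ≤ T → ρ < ‖z.2‖ → u z = 0

/-- Weak local energy decay for `P u = f`, with respect to some smooth cutoff `χ` of compact
support; the constants are uniform in the initial time `T₀`. -/
def WeakLED (g : Spacetime → Matrix (Fin 4) (Fin 4) ℝ) (A : Fin 4 → Spacetime → ℝ)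
    (V : Spacetime → ℝ) : Prop :=
  ∃ χ : Space → ℝ, ContDiff ℝ ∞ χ ∧ HasCompactSupport χ ∧
    ∀ k : ℕ, ∃ C : ℝ≥0, ∀ T₀ : ℝ, 0 ≤ T₀ → ∀ u : Spacetime → ℝ, SlabCompact u →
      normUpTo (normLE1w χ (Set.Ici T₀)) k u
        ≤ C * (energyH k u T₀ + normUpTo (normLEstarw χ (Set.Ici T₀)) k (waveOp g A V u))

/-- Stationary local energy decay for `P u = f`; the constants are uniform in the interval. -/
def StationaryLED (g : Spacetime → Matrix (Fin 4) (Fin 4) ℝ) (A : Fin 4 → Spacetime → ℝ)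
    (V : Spacetime → ℝ) : Prop :=
  ∀ k : ℕ, ∃ C : ℝ≥0, ∀ T₁ T₂ : ℝ, 0 ≤ T₁ → T₁ < T₂ → ∀ u : Spacetime → ℝ, SlabCompact u →
    normUpTo (normLE1 (Set.Icc T₁ T₂)) k u
      ≤ C * (energyH k u T₁ + energyH k u T₂
          + normUpTo (normLEstar (Set.Icc T₁ T₂)) k (waveOp g A V u)
          + normUpTo (normLE (Set.Icc T₁ T₂)) k (pd 0 u))

end WaveDecay

end

open WaveDecay

noncomputable section

namespace WaveDecay

open MeasureTheory

/-! ### Calculus of the vector fields -/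

section Fields

variable {u v f : Spacetime → ℝ}

/-! Reduction. Where r > t/2, or at bounded times, ⟨t⟩ is at most a constant times ⟨r⟩ and the claim
is read off from the hypothesis. Where r ≤ t/2 and t is large, ⟨t-r⟩ is comparable to ⟨t⟩, and since
p ≤ 1 every term of the hypothesis is at most a constant times ⟨t⟩^{1-p-q-η}/⟨r⟩, also at nearby
times. Everything thus rests on one fact, `exists_interior_decay`: a solution that is O(D/⟨r⟩),
together with enough vector fields, in r ≤ t/2 at times comparable to T is O(D/T) there at time T.

Elliptic part. The identity t²∂_t² = S² - S - 2x·∇S + r²Δ - ΣΩ² turns the equation on a time slice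
into (1 - r²/t²)Δv = div G + F for φ and its space derivatives (`slice_equation`,
`exists_sliceSystem`). G and F consist of multiples of v and ∇v with coefficients decaying in r, and
of terms with an explicit t⁻¹ or t⁻², which are known from the hypothesis. The equation is tested
with v times a cutoff to r ≥ R times the superharmonic weight ⟨x-x₀⟩⁻¹. This bounds the weighted
gradient and, by a Sobolev inequality at unit scale, v(x₀)². The perturbation produces convolutions
of powers of total decay 3+s, so it gains ⟨x₀⟩^{-s/2} (`kernel_integral`) and is absorbed for R
large. As a result (`SliceSystem.outer_estimate`, `SliceSystem.exterior_bounds`), outside a fixed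
ball φ is controlled by D/t and by its size near that ball, and its energy in a shell |x| ~ ρ is at
most ρ^{-s/2} times that size plus ρ^{s/2}(D/t)². Two Caccioppoli inequalities
(`exists_exterior_bounds`) express the size near the ball by fewer derivatives than the shell energy
contains; without this gain the absorption below would not close.

Inner part. Both forms of local energy decay give the same bound for functions that vanish near the
ends of a time interval (`exists_led_bound`). It is applied to φ cut off to a time window of length
L and to |x| ≲ ρ. The source consists of terms of size L⁻¹φ and ∂_tφ in the cylinder, and of terms
with derivatives of the space cutoff in the shell |x| ~ ρ. Hence (`exists_local_energy_bound`) the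
energy in a fixed ball is at most C times the shell energy plus C_ρ(L⁻¹φ + ∂_tφ)², where C does not
depend on ρ. The factor ρ^{-s/2} of the exterior bound lets the shell energy be absorbed once ρ is
fixed large.

Iteration (`exists_improve_decay`). Suppose φ = O(D T^{-α}) in a ball. There ∂_tφ = O(D/T), because
t∂_t = S - x·∇, and interpolation with ∂_t²φ = O(D/T²) gives ∂_tφ = O(D T^{-1-α/2}). With L = T^λ
the source is O(D T^{-α-λ} + D/T), and φ varies by O(D T^{-1-α/2+λ}) during the window, so the time
integral can be replaced by the value at T. The new rate is the minimum of 1, α+λ and 1+α/2-λ. Three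
rounds lead from 0 through 1/2 and 7/8 to 1. The exterior bound carries the rate D/T from the ball
to all of r ≤ t/2. -/

lemma differentiableAt_of_smooth (hu : ContDiff ℝ ∞ u) (z : Spacetime) : DifferentiableAt ℝ u z :=
  (hu.differentiable (by simp)) z

@[fun_prop]
lemma contDiff_pd (α : Fin 4) (hu : ContDiff ℝ ∞ u) : ContDiff ℝ ∞ (pd α u) := by
  unfold pd
  exact (hu.fderiv_right (m := ∞) (by simp)).clm_apply contDiff_const

@[fun_prop]
lemma contDiff_time : ContDiff ℝ ∞ (fun z : Spacetime => z.1) := contDiff_fst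

@[fun_prop]
lemma contDiff_coord (i : Fin 3) : ContDiff ℝ ∞ (fun z : Spacetime => z.2 i) :=
  (contDiff_piLp_apply (p := 2)).comp contDiff_snd

lemma pd_add (α : Fin 4) (hu : ContDiff ℝ ∞ u) (hv : ContDiff ℝ ∞ v) :
    pd α (fun z => u z + v z) = fun z => pd α u z + pd α v z := by
  ext z
  simp only [pd]
  rw [fderiv_fun_add (differentiableAt_of_smooth hu z) (differentiableAt_of_smooth hv z)]
  rfl

lemma pd_sub (α : Fin 4) (hu : ContDiff ℝ ∞ u) (hv : ContDiff ℝ ∞ v) :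
    pd α (fun z => u z - v z) = fun z => pd α u z - pd α v z := by
  ext z
  simp only [pd]
  rw [fderiv_fun_sub (differentiableAt_of_smooth hu z) (differentiableAt_of_smooth hv z)]
  rfl

lemma pd_const (α : Fin 4) (c : ℝ) : pd α (fun _ => c) = fun _ => 0 := by
  ext z
  simp [pd]

lemma pd_mul (α : Fin 4) (hu : ContDiff ℝ ∞ u) (hv : ContDiff ℝ ∞ v) :
    pd α (fun z => u z * v z) = fun z => pd α u z * v z + u z * pd α v z := by
  ext z
  simp only [pd]
  rw [fderiv_fun_mul (differentiableAt_of_smooth hu z) (differentiableAt_of_smooth hv z)]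
  simp only [add_apply, smul_apply, smul_eq_mul]
  ring

lemma pd_const_mul (α : Fin 4) (c : ℝ) (hu : ContDiff ℝ ∞ u) :
    pd α (fun z => c * u z) = fun z => c * pd α u z := by
  rw [pd_mul α contDiff_const hu, pd_const]
  simp

lemma pd_sum {ι : Type*} (α : Fin 4) (s : Finset ι) {U : ι → Spacetime → ℝ}
    (hU : ∀ i ∈ s, ContDiff ℝ ∞ (U i)) :
    pd α (fun z => ∑ i ∈ s, U i z) = fun z => ∑ i ∈ s, pd α (U i) z := by
  ext z
  simp only [pd]
  rw [fderiv_fun_sum (fun i hi => differentiableAt_of_smooth (hU i hi) z)]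
  simp

lemma pd_comm (α β : Fin 4) (hu : ContDiff ℝ ∞ u) : pd α (pd β u) = pd β (pd α u) := by
  ext z
  have h2 : ContDiffAt ℝ 2 u z := (contDiff_infty.1 hu 2).contDiffAt
  have hs := h2.isSymmSndFDerivAt (by simp)
  have hd : DifferentiableAt ℝ (fderiv ℝ u) z :=
    ((hu.fderiv_right (m := ∞) (by simp)).differentiable (by simp)) z
  change fderiv ℝ (fun y => fderiv ℝ u y (coordVec β)) z (coordVec α)
    = fderiv ℝ (fun y => fderiv ℝ u y (coordVec α)) z (coordVec β)
  rw [fderiv_clm_apply hd (by fun_prop), fderiv_clm_apply hd (by fun_prop)]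
  simpa using hs (coordVec α) (coordVec β)

lemma pd_time (α : Fin 4) : pd α (fun z => z.1) = fun _ => if α = 0 then 1 else 0 := by
  ext z
  simp only [pd]
  rw [fderiv_fst]
  refine Fin.cases ?_ (fun i => ?_) α <;> simp [coordVec]

lemma pd_coord (α : Fin 4) (i : Fin 3) :
    pd α (fun z => z.2 i) = fun _ => if α = i.succ then 1 else 0 := by
  ext z
  simp only [pd]
  have : (fun z : Spacetime => z.2 i) =
      ((EuclideanSpace.proj i : Space →L[ℝ] ℝ).comp (ContinuousLinearMap.snd ℝ ℝ Space)) := by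
    ext; simp
  rw [this, ContinuousLinearMap.fderiv]
  refine Fin.cases ?_ (fun j => ?_) α
  · simp [coordVec, eq_comm]
  · simp [coordVec, eq_comm]

lemma pd_time_mul (α : Fin 4) (hu : ContDiff ℝ ∞ u) :
    pd α (fun z => z.1 * u z) = fun z => (if α = 0 then 1 else 0) * u z + z.1 * pd α u z := by
  rw [pd_mul α contDiff_time hu, pd_time]

lemma pd_coord_mul (α : Fin 4) (i : Fin 3) (hu : ContDiff ℝ ∞ u) :
    pd α (fun z => z.2 i * u z) =
      fun z => (if α = i.succ then 1 else 0) * u z + z.2 i * pd α u z := by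
  rw [pd_mul α (contDiff_coord i) hu, pd_coord]

@[fun_prop]
lemma contDiff_rot (a : Fin 3) (hu : ContDiff ℝ ∞ u) : ContDiff ℝ ∞ (rot a u) := by
  unfold rot
  fun_prop

@[fun_prop]
lemma contDiff_scal (hu : ContDiff ℝ ∞ u) : ContDiff ℝ ∞ (scal u) := by
  unfold scal
  fun_prop

lemma scal_apply (u : Spacetime → ℝ) (z : Spacetime) :
    scal u z = z.1 * pd 0 u z + z.2 0 * pd 1 u z + z.2 1 * pd 2 u z + z.2 2 * pd 3 u z := by
  simp only [scal, Fin.sum_univ_three]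
  rw [show (Fin.succ 0 : Fin 4) = 1 from rfl, show (Fin.succ 1 : Fin 4) = 2 from rfl,
    show (Fin.succ 2 : Fin 4) = 3 from rfl]
  ring

lemma scal_add (hu : ContDiff ℝ ∞ u) (hv : ContDiff ℝ ∞ v) :
    scal (fun z => u z + v z) = fun z => scal u z + scal v z := by
  ext z; simp only [scal_apply, pd_add _ hu hv]; ring

lemma scal_const_mul (c : ℝ) (hu : ContDiff ℝ ∞ u) :
    scal (fun z => c * u z) = fun z => c * scal u z := by
  ext z; simp only [scal_apply, pd_const_mul _ c hu]; ring

lemma scal_mul (hu : ContDiff ℝ ∞ u) (hv : ContDiff ℝ ∞ v) :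
    scal (fun z => u z * v z) = fun z => scal u z * v z + u z * scal v z := by
  ext z; simp only [scal_apply, pd_mul _ hu hv]; ring

lemma rot_add (a : Fin 3) (hu : ContDiff ℝ ∞ u) (hv : ContDiff ℝ ∞ v) :
    rot a (fun z => u z + v z) = fun z => rot a u z + rot a v z := by
  ext z; simp only [rot, pd_add _ hu hv]; ring

lemma rot_const_mul (a : Fin 3) (c : ℝ) (hu : ContDiff ℝ ∞ u) :
    rot a (fun z => c * u z) = fun z => c * rot a u z := by
  ext z; simp only [rot, pd_const_mul _ c hu]; ring

/-- The commutator is just -∂_β. It is written as a sum with Kronecker coefficients so that scaling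
and rotations both fit the structure `IsField`. -/
lemma scal_pd (β : Fin 4) (hu : ContDiff ℝ ∞ u) :
    scal (pd β u) = fun z => pd β (scal u) z + ∑ β', (if β' = β then -1 else 0) * pd β' u z := by
  have h : scal u = fun z =>
      z.1 * pd 0 u z + z.2 0 * pd 1 u z + z.2 1 * pd 2 u z + z.2 2 * pd 3 u z :=
    funext (scal_apply u)
  ext z
  rw [h, pd_add β (by fun_prop) (by fun_prop), pd_add β (by fun_prop) (by fun_prop),
    pd_add β (by fun_prop) (by fun_prop), pd_time_mul β (by fun_prop),
    pd_coord_mul β 0 (by fun_prop), pd_coord_mul β 1 (by fun_prop), pd_coord_mul β 2 (by fun_prop)]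
  rw [pd_comm β 0 hu, pd_comm β 1 hu, pd_comm β 2 hu, pd_comm β 3 hu, Fin.sum_univ_four,
    scal_apply]
  fin_cases β <;> simp [Fin.ext_iff] <;> ring

/-- The coefficients of `[Ω_a, ∂_β]` in terms of the coordinate derivatives. -/
def rotCoeff (a : Fin 3) (β β' : Fin 4) : ℝ :=
  if β = (a + 1).succ ∧ β' = (a + 2).succ then -1
  else if β = (a + 2).succ ∧ β' = (a + 1).succ then 1 else 0

lemma rot_pd (a : Fin 3) (β : Fin 4) (hu : ContDiff ℝ ∞ u) :
    rot a (pd β u) = fun z => pd β (rot a u) z + ∑ β', rotCoeff a β β' * pd β' u z := by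
  have h : rot a u = fun z =>
    z.2 (a + 1) * pd (a + 2).succ u z - z.2 (a + 2) * pd (a + 1).succ u z := rfl
  ext z
  rw [h, pd_sub β (by fun_prop) (by fun_prop), pd_coord_mul β _ (by fun_prop),
    pd_coord_mul β _ (by fun_prop)]
  rw [pd_comm β (a + 2).succ hu, pd_comm β (a + 1).succ hu]
  simp only [rot, rotCoeff, Fin.sum_univ_four]
  fin_cases a <;> fin_cases β <;> simp [Fin.ext_iff] <;> ring

/-- The Laplacian in the space variables. -/
def lap (u : Spacetime → ℝ) : Spacetime → ℝ := fun z => ∑ i : Fin 3, pd i.succ (pd i.succ u) z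

lemma norm_sq_coord (x : Space) : ‖x‖ ^ 2 = x 0 ^ 2 + x 1 ^ 2 + x 2 ^ 2 := by
  rw [EuclideanSpace.norm_sq_eq]; simp [Fin.sum_univ_three]

/-- The second time derivative through the scaling field, the rotations and the Laplacian. -/
lemma time_sq_mul_pd_pd (hv : ContDiff ℝ ∞ v) (z : Spacetime) :
    z.1 ^ 2 * pd 0 (pd 0 v) z = scal (scal v) z - scal v z
      - 2 * ∑ i : Fin 3, z.2 i * pd i.succ (scal v) z
      + ‖z.2‖ ^ 2 * lap v z - ∑ a, rot a (rot a v) z := by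
  -- S²v - Sv equals t²v_tt + 2t x·∇v_t + x^i x^j v_ij. Subtracting 2x·∇Sv removes the mixed term
  -- and leaves -x^i x^j v_ij - 2x·∇v, and this is cancelled by (r²Δ - ΣΩ²)v = x^i x^j v_ij + 2x·∇v.
  -- What follows is this computation in coordinates.
  have h : scal v = fun z =>
      z.1 * pd 0 v z + z.2 0 * pd 1 v z + z.2 1 * pd 2 v z + z.2 2 * pd 3 v z :=
    funext (scal_apply v)
  have hs : ∀ β, pd β (scal v) = fun z => ((if β = 0 then 1 else 0) * pd 0 v z + z.1 * pd β (pd 0 v) z)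
      + ((if β = 1 then 1 else 0) * pd 1 v z + z.2 0 * pd β (pd 1 v) z)
      + ((if β = 2 then 1 else 0) * pd 2 v z + z.2 1 * pd β (pd 2 v) z)
      + ((if β = 3 then 1 else 0) * pd 3 v z + z.2 2 * pd β (pd 3 v) z) := by
    intro β
    rw [h, pd_add β (by fun_prop) (by fun_prop), pd_add β (by fun_prop) (by fun_prop),
    pd_add β (by fun_prop) (by fun_prop), pd_time_mul β (by fun_prop),
    pd_coord_mul β 0 (by fun_prop), pd_coord_mul β 1 (by fun_prop), pd_coord_mul β 2 (by fun_prop)]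
    rfl
  have hr : ∀ a β, pd β (rot a v) = fun z =>
      ((if β = (a + 1).succ then 1 else 0) * pd (a + 2).succ v z
        + z.2 (a + 1) * pd β (pd (a + 2).succ v) z)
      - ((if β = (a + 2).succ then 1 else 0) * pd (a + 1).succ v z
        + z.2 (a + 2) * pd β (pd (a + 1).succ v) z) := by
    intro a β
    rw [show rot a v = fun z =>
      z.2 (a + 1) * pd (a + 2).succ v z - z.2 (a + 2) * pd (a + 1).succ v z from rfl,
      pd_sub β (by fun_prop) (by fun_prop), pd_coord_mul β _ (by fun_prop),
      pd_coord_mul β _ (by fun_prop)]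
  have hrr : ∀ a, rot a (rot a v) z = z.2 (a + 1) * pd (a + 2).succ (rot a v) z
      - z.2 (a + 2) * pd (a + 1).succ (rot a v) z := fun a => rfl
  rw [scal_apply (scal v), norm_sq_coord]
  simp only [Fin.sum_univ_three, hrr, hr, hs, lap]
  rw [scal_apply]
  have e1 : (Fin.succ 0 : Fin 4) = 1 := rfl
  have e2 : (Fin.succ 1 : Fin 4) = 2 := rfl
  have e3 : (Fin.succ 2 : Fin 4) = 3 := rfl
  have a1 : (1 + 2 : Fin 3) = 0 := rfl
  have a2 : (2 + 1 : Fin 3) = 0 := rfl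
  have a3 : (2 + 2 : Fin 3) = 1 := rfl
  have a4 : (1 + 1 : Fin 3) = 2 := rfl
  simp only [zero_add, a1, a2, a3, a4, e1, e2, e3]
  simp only [pd_comm 1 0 hv, pd_comm 2 0 hv, pd_comm 3 0 hv, pd_comm 2 1 hv, pd_comm 3 1 hv,
    pd_comm 3 2 hv]
  simp [Fin.ext_iff]
  ring

end Fields

/-! ### Iterated partial derivatives -/

section Iterated

variable {u v f : Spacetime → ℝ}

/-- Iterated partial derivatives; the head of the list acts first. -/
def pdl : List (Fin 4) → (Spacetime → ℝ) → (Spacetime → ℝ)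
  | [], u => u
  | β :: l, u => pdl l (pd β u)

@[fun_prop]
lemma contDiff_pdl (l : List (Fin 4)) (hu : ContDiff ℝ ∞ u) : ContDiff ℝ ∞ (pdl l u) := by
  induction l generalizing u with
  | nil => exact hu
  | cons β l ih => exact ih (contDiff_pd β hu)

lemma pdl_append (l l' : List (Fin 4)) (u : Spacetime → ℝ) :
    pdl (l ++ l') u = pdl l' (pdl l u) := by
  induction l generalizing u with
  | nil => rfl
  | cons β l ih => exact ih _

lemma pd_pdl (β : Fin 4) (l : List (Fin 4)) (hu : ContDiff ℝ ∞ u) :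
    pd β (pdl l u) = pdl (β :: l) u := by
  induction l generalizing u with
  | nil => rfl
  | cons γ l ih =>
    change pd β (pdl l (pd γ u)) = pdl l (pd γ (pd β u))
    rw [ih (contDiff_pd γ hu), pd_comm γ β hu]
    rfl

lemma pdl_add (l : List (Fin 4)) (hu : ContDiff ℝ ∞ u) (hv : ContDiff ℝ ∞ v) :
    pdl l (fun z => u z + v z) = fun z => pdl l u z + pdl l v z := by
  induction l generalizing u v with
  | nil => rfl
  | cons β l ih =>
    simp only [pdl]
    rw [pd_add β hu hv, ih (contDiff_pd β hu) (contDiff_pd β hv)]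

lemma pdl_const_mul (l : List (Fin 4)) (c : ℝ) (hu : ContDiff ℝ ∞ u) :
    pdl l (fun z => c * u z) = fun z => c * pdl l u z := by
  induction l generalizing u with
  | nil => rfl
  | cons β l ih =>
    simp only [pdl]
    rw [pd_const_mul β c hu, ih (contDiff_pd β hu)]

lemma pdl_sum {ι : Type*} (l : List (Fin 4)) (s : Finset ι) {U : ι → Spacetime → ℝ}
    (hU : ∀ i ∈ s, ContDiff ℝ ∞ (U i)) :
    pdl l (fun z => ∑ i ∈ s, U i z) = fun z => ∑ i ∈ s, pdl l (U i) z := by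
  induction l generalizing U with
  | nil => rfl
  | cons β l ih =>
    simp only [pdl]
    rw [pd_sum β s hU, ih (fun i hi => contDiff_pd β (hU i hi))]

lemma pdl_replicate (n : ℕ) (β : Fin 4) (u : Spacetime → ℝ) :
    pdl (List.replicate n β) u = (pd β)^[n] u := by
  induction n generalizing u with
  | zero => rfl
  | succ n ih => rw [List.replicate_succ, Function.iterate_succ_apply]; exact ih _

lemma pdMulti_eq_pdl (α : Fin 4 → ℕ) (u : Spacetime → ℝ) :
    pdMulti α u = pdl (List.replicate (α 3) 3 ++ List.replicate (α 2) 2 ++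
      List.replicate (α 1) 1 ++ List.replicate (α 0) 0) u := by
  simp only [pdl_append, pdl_replicate, pdMulti]

lemma exists_pdMulti_eq_pdl (α : Fin 4 → ℕ) :
    ∃ l : List (Fin 4), l.length = ∑ a, α a ∧ ∀ u, pdMulti α u = pdl l u := by
  refine ⟨_, ?_, pdMulti_eq_pdl α⟩
  simp [Fin.sum_univ_four]
  ring

lemma pdl_perm {l l' : List (Fin 4)} (h : l.Perm l') (hu : ContDiff ℝ ∞ u) :
    pdl l u = pdl l' u := by
  induction h generalizing u with
  | nil => rfl
  | cons β _ ih => exact ih (contDiff_pd β hu)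
  | swap β γ l => simp only [pdl]; rw [pd_comm γ β hu]
  | trans _ _ ih₁ ih₂ => exact (ih₁ hu).trans (ih₂ hu)

/-- Lists are convenient for inductions, multi-indices occur in the hypotheses. Since partial
derivatives commute, only the number of occurrences of each index matters. -/
lemma pdl_eq_pdMulti (l : List (Fin 4)) (hu : ContDiff ℝ ∞ u) :
    pdl l u = pdMulti (fun a => l.count a) u := by
  rw [pdMulti_eq_pdl]
  refine pdl_perm (List.perm_iff_count.2 fun a => ?_) hu
  fin_cases a <;> simp [List.count_replicate]

lemma sum_count_eq_length (l : List (Fin 4)) : ∑ a, l.count a = l.length := by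
  induction l with
  | nil => simp
  | cons β l ih =>
    simp only [List.count_cons, Finset.sum_add_distrib, ih, List.length_cons]
    simp

/-- Leibniz bound for iterated derivatives of a product. -/
lemma abs_pdl_mul_le (l : List (Fin 4)) (hu : ContDiff ℝ ∞ u) (hv : ContDiff ℝ ∞ v)
    {z : Spacetime} {a b : ℝ} (ha : ∀ l', l'.Sublist l → |pdl l' u z| ≤ a)
    (hb : ∀ l', l'.Sublist l → |pdl l' v z| ≤ b) :
    |pdl l (fun y => u y * v y) z| ≤ 2 ^ l.length * (a * b) := by
  induction l generalizing u v with
  | nil =>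
    have h1 := ha [] (List.Sublist.refl _)
    have h2 := hb [] (List.Sublist.refl _)
    simp only [pdl, List.length_nil, pow_zero, one_mul] at *
    rw [abs_mul]
    exact mul_le_mul h1 h2 (abs_nonneg _) ((abs_nonneg _).trans h1)
  | cons β l ih =>
    simp only [pdl]
    rw [pd_mul β hu hv, pdl_add l (by fun_prop) (by fun_prop)]
    have h1 := ih (contDiff_pd β hu) hv (fun l' hl' => ha (β :: l') (hl'.cons_cons β))
      (fun l' hl' => hb l' (hl'.cons β))
    have h2 := ih hu (contDiff_pd β hv) (fun l' hl' => ha l' (hl'.cons β))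
      (fun l' hl' => hb (β :: l') (hl'.cons_cons β))
    refine (abs_add_le _ _).trans ?_
    rw [List.length_cons, pow_succ]
    linarith

/-- A first-order operator whose commutators with the `∂_β` are combinations of the `∂_β`. -/
structure IsField (Z : (Spacetime → ℝ) → (Spacetime → ℝ)) (c : Fin 4 → Fin 4 → ℝ) : Prop where
  smooth : ∀ {u}, ContDiff ℝ ∞ u → ContDiff ℝ ∞ (Z u)
  add : ∀ {u v}, ContDiff ℝ ∞ u → ContDiff ℝ ∞ v →
    Z (fun z => u z + v z) = fun z => Z u z + Z v z
  const_mul : ∀ {u} (c : ℝ), ContDiff ℝ ∞ u → Z (fun z => c * u z) = fun z => c * Z u z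
  comm : ∀ {u} (β : Fin 4), ContDiff ℝ ∞ u →
    Z (pd β u) = fun z => pd β (Z u) z + ∑ β', c β β' * pd β' u z
  coeff_le : ∀ β β', |c β β'| ≤ 1

lemma isField_scal : IsField scal (fun β β' => if β' = β then -1 else 0) where
  smooth := contDiff_scal
  add := scal_add
  const_mul := scal_const_mul
  comm := scal_pd
  coeff_le := by intro β β'; split_ifs <;> simp

lemma isField_rot (a : Fin 3) : IsField (rot a) (rotCoeff a) where
  smooth := contDiff_rot a
  add := rot_add a
  const_mul := rot_const_mul a
  comm := rot_pd a
  coeff_le := by intro β β'; unfold rotCoeff; split_ifs <;> simp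

variable {Z : (Spacetime → ℝ) → (Spacetime → ℝ)} {c : Fin 4 → Fin 4 → ℝ}

lemma abs_sum_coeff_le (hZ : IsField Z c) (β : Fin 4) {a : Fin 4 → ℝ} {B : ℝ}
    (ha : ∀ β', |a β'| ≤ B) : |∑ β', c β β' * a β'| ≤ 4 * B := by
  refine (Finset.abs_sum_le_sum_abs _ _).trans ?_
  have : ∀ β' ∈ Finset.univ, |c β β' * a β'| ≤ B := fun β' _ => by
    rw [abs_mul]
    have := hZ.coeff_le β β'
    nlinarith [abs_nonneg (a β'), ha β', abs_nonneg (c β β')]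
  refine (Finset.sum_le_sum this).trans ?_
  simp

lemma IsField.pdl_comm_eq (hZ : IsField Z c) (l : List (Fin 4)) (β : Fin 4)
    (hf : ContDiff ℝ ∞ f) :
    pdl l (Z (pd β f)) = fun z => pdl (β :: l) (Z f) z + ∑ β', c β β' * pdl (β' :: l) f z := by
  rw [hZ.comm β hf, pdl_add l (contDiff_pd β (hZ.smooth hf))
    (ContDiff.sum fun i _ => contDiff_const.mul (contDiff_pd i hf)),
    pdl_sum l _ (fun i _ => contDiff_const.mul (contDiff_pd i hf))]
  simp only [pdl_const_mul l _ (contDiff_pd _ hf)]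
  rfl

/-- Moving Z past one derivative costs one term with Zf and four terms with f, whose coefficients
are at most 1: a factor 5 per derivative, and no increase of the order. -/
lemma IsField.abs_pdl_le (hZ : IsField Z c) (l : List (Fin 4)) (hf : ContDiff ℝ ∞ f)
    {z : Spacetime} {B : ℝ}
    (h₀ : ∀ l' : List (Fin 4), l'.length ≤ l.length → |pdl l' f z| ≤ B)
    (h₁ : ∀ l' : List (Fin 4), l'.length ≤ l.length → |pdl l' (Z f) z| ≤ B) :
    |Z (pdl l f) z| ≤ 5 ^ l.length * B := by
  induction l generalizing f B with
  | nil => simpa [pdl] using h₁ [] le_rfl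
  | cons β l ih =>
    have hB : 0 ≤ B := (abs_nonneg _).trans (h₀ [] (by simp))
    have := ih (f := pd β f) (B := 5 * B) (contDiff_pd β hf)
      (fun l' hl' => (h₀ (β :: l') (by simpa using hl')).trans (by linarith))
      (fun l' hl' => by
        rw [hZ.pdl_comm_eq l' β hf]
        refine (abs_add_le _ _).trans ?_
        have h2 := h₁ (β :: l') (by simpa using hl')
        have h3 := abs_sum_coeff_le hZ β (a := fun β' => pdl (β' :: l') f z) (B := B)
          (fun β' => h₀ (β' :: l') (by simpa using hl'))
        linarith)
    rw [List.length_cons, pow_succ, mul_assoc]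
    exact this

lemma IsField.abs_pdl_le₂ (hZ : IsField Z c) (l : List (Fin 4)) (hf : ContDiff ℝ ∞ f)
    {z : Spacetime} {B : ℝ}
    (h₀ : ∀ l' : List (Fin 4), l'.length ≤ l.length → |pdl l' f z| ≤ B)
    (h₁ : ∀ l' : List (Fin 4), l'.length ≤ l.length → |pdl l' (Z f) z| ≤ B)
    (h₂ : ∀ l' : List (Fin 4), l'.length ≤ l.length → |pdl l' (Z (Z f)) z| ≤ B) :
    |Z (Z (pdl l f)) z| ≤ 25 ^ l.length * B := by
  induction l generalizing f B with
  | nil => simpa [pdl] using h₂ [] le_rfl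
  | cons β l ih =>
    have hB : 0 ≤ B := (abs_nonneg _).trans (h₀ [] (by simp))
    have hZf := hZ.smooth hf
    have key : Z (Z (pd β f)) = fun z => Z (pd β (Z f)) z + ∑ β', c β β' * Z (pd β' f) z := by
      have hs : ∀ s : Finset (Fin 4), Z (fun z => ∑ β' ∈ s, c β β' * pd β' f z)
          = fun z => ∑ β' ∈ s, c β β' * Z (pd β' f) z := by
        intro s
        induction s using Finset.induction_on with
        | empty =>
          have := hZ.const_mul (u := f) 0 hf
          simpa using this
        | insert i s hi ih =>
          simp only [Finset.sum_insert hi]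
          rw [hZ.add (contDiff_const.mul (contDiff_pd i hf))
            (ContDiff.sum fun i _ => contDiff_const.mul (contDiff_pd i hf)), ih,
            hZ.const_mul _ (contDiff_pd i hf)]
      conv_lhs => rw [hZ.comm β hf]
      rw [hZ.add (contDiff_pd β hZf)
        (ContDiff.sum fun i _ => contDiff_const.mul (contDiff_pd i hf)), hs]
    have step : ∀ (β : Fin 4) (l' : List (Fin 4)), l'.length ≤ l.length →
        |pdl l' (Z (pd β f)) z| ≤ 5 * B := fun β l' hl' => by
      rw [hZ.pdl_comm_eq l' β hf]
      refine (abs_add_le _ _).trans ?_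
      have h2 := h₁ (β :: l') (by simpa using hl')
      have h3 := abs_sum_coeff_le hZ β (a := fun β' => pdl (β' :: l') f z) (B := B)
        (fun β' => h₀ (β' :: l') (by simpa using hl'))
      linarith
    -- 25 = 1 + 4 + 20: one term with Z²f, four with Zf from the inner commutator, and four terms of
    -- size 5B from the outer one.
    have := ih (f := pd β f) (B := 25 * B) (contDiff_pd β hf)
      (fun l' hl' => (h₀ (β :: l') (by simpa using hl')).trans (by linarith))
      (fun l' hl' => (step β l' hl').trans (by linarith))
      (fun l' hl' => by
        rw [key, pdl_add l' (hZ.smooth (contDiff_pd β hZf))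
          (ContDiff.sum fun i _ => contDiff_const.mul (hZ.smooth (contDiff_pd i hf))),
          pdl_sum l' _ (fun i _ => contDiff_const.mul (hZ.smooth (contDiff_pd i hf)))]
        simp only [pdl_const_mul l' _ (hZ.smooth (contDiff_pd _ hf))]
        rw [hZ.pdl_comm_eq l' β hZf]
        refine (abs_add_le _ _).trans ?_
        have h1 := abs_sum_coeff_le hZ β (a := fun β' => pdl l' (Z (pd β' f)) z) (B := 5 * B)
          (fun β' => step β' l' hl')
        have h2 := h₂ (β :: l') (by simpa using hl')
        have h3 := abs_sum_coeff_le hZ β (a := fun β' => pdl (β' :: l') (Z f) z) (B := B)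
          (fun β' => h₁ (β' :: l') (by simpa using hl'))
        have h4 := abs_add_le (pdl (β :: l') (Z (Z f)) z)
          (∑ β', c β β' * pdl (β' :: l') (Z f) z)
        linarith)
    rw [List.length_cons, pow_succ, mul_assoc]
    exact this

end Iterated

/-! ### The equation on a time slice -/

section Equation

variable {g : Spacetime → Matrix (Fin 4) (Fin 4) ℝ} {A : Fin 4 → Spacetime → ℝ}
  {V φ : Spacetime → ℝ}

/-- The difference between the metric and the Minkowski metric. -/
def metricDiff (g : Spacetime → Matrix (Fin 4) (Fin 4) ℝ) (α β : Fin 4) : Spacetime → ℝ :=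
  fun z => g z α β - mink α β

/-- The perturbative flux `∑ (g - m)^{μβ} ∂_β φ + A^μ φ`. -/
def flux (g : Spacetime → Matrix (Fin 4) (Fin 4) ℝ) (A : Fin 4 → Spacetime → ℝ)
    (φ : Spacetime → ℝ) (μ : Fin 4) : Spacetime → ℝ :=
  fun z => (∑ β, metricDiff g μ β z * pd β φ z) + A μ z * φ z

/-- Smoothness of all coefficients. -/
structure SmoothCoeffs (g : Spacetime → Matrix (Fin 4) (Fin 4) ℝ) (A : Fin 4 → Spacetime → ℝ)
    (V : Spacetime → ℝ) : Prop where
  metric : ∀ α β, ContDiff ℝ ∞ (metricDiff g α β)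
  first : ∀ μ, ContDiff ℝ ∞ (A μ)
  potential : ContDiff ℝ ∞ V

lemma contDiff_flux (hc : SmoothCoeffs g A V) (hφ : ContDiff ℝ ∞ φ) (μ : Fin 4) :
    ContDiff ℝ ∞ (flux g A φ μ) := by
  unfold flux
  exact (ContDiff.sum fun β _ => (hc.metric μ β).mul (contDiff_pd β hφ)).add ((hc.first μ).mul hφ)

lemma contDiff_lap (hφ : ContDiff ℝ ∞ φ) : ContDiff ℝ ∞ (lap φ) :=
  ContDiff.sum fun _ _ => contDiff_pd _ (contDiff_pd _ hφ)

lemma waveOp_eq (hc : SmoothCoeffs g A V) (hφ : ContDiff ℝ ∞ φ) (z : Spacetime) :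
    waveOp g A V φ z = -pd 0 (pd 0 φ) z + lap φ z + ∑ μ, pd μ (flux g A φ μ) z + V z * φ z := by
  have h1 : ∀ α β, pd α (fun y => g y α β * pd β φ y) z =
      pd α (fun y => metricDiff g α β y * pd β φ y) z + mink α β * pd α (pd β φ) z := by
    intro α β
    have : (fun y => g y α β * pd β φ y) =
        fun y => metricDiff g α β y * pd β φ y + mink α β * pd β φ y := by
      ext y; simp only [metricDiff]; ring
    rw [this, pd_add α ((hc.metric α β).mul (contDiff_pd β hφ))
      (contDiff_const.mul (contDiff_pd β hφ)), pd_const_mul α _ (contDiff_pd β hφ)]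
  have h2 : ∀ μ, pd μ (flux g A φ μ) z =
      (∑ β, pd μ (fun y => metricDiff g μ β y * pd β φ y) z) + pd μ (fun y => A μ y * φ y) z := by
    intro μ
    unfold flux
    rw [pd_add μ (ContDiff.sum fun β _ => (hc.metric μ β).mul (contDiff_pd β hφ))
      ((hc.first μ).mul hφ), pd_sum μ _ (fun β _ => (hc.metric μ β).mul (contDiff_pd β hφ))]
  have h3 : ∑ α, ∑ β, mink α β * pd α (pd β φ) z = -pd 0 (pd 0 φ) z + lap φ z := by
    simp only [mink, Matrix.diagonal_apply, ite_mul, zero_mul, Finset.sum_ite_eq, Finset.mem_univ,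
      if_true, lap]
    rw [Fin.sum_univ_succ]
    simp
  simp only [waveOp, h1, h2, Finset.sum_add_distrib]
  rw [← h3]
  ring

lemma pdl_eq_zero_of_eventuallyEq {f : Spacetime → ℝ} {z : Spacetime} (l : List (Fin 4))
    (hf : f =ᶠ[nhds z] fun _ => 0) : pdl l f z = 0 := by
  suffices h : pdl l f =ᶠ[nhds z] fun _ => 0 from h.self_of_nhds
  induction l generalizing f with
  | nil => exact hf
  | cons β l ih =>
    refine ih ?_
    filter_upwards [hf.fderiv (𝕜 := ℝ)] with y hy
    simp [pd, hy]

lemma lap_pdl (l : List (Fin 4)) (hφ : ContDiff ℝ ∞ φ) : lap (pdl l φ) = pdl l (lap φ) := by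
  have : lap φ = fun z => ∑ i : Fin 3, pd i.succ (pd i.succ φ) z := rfl
  rw [this, pdl_sum l _ (fun i _ => contDiff_pd _ (contDiff_pd _ hφ))]
  ext z
  refine Finset.sum_congr rfl fun i _ => ?_
  rw [pd_pdl _ l hφ]
  change pd _ (pdl l (pd _ φ)) z = _
  rw [pd_pdl _ l (contDiff_pd _ hφ)]
  rfl

/-- The differentiated equation. -/
lemma pdl_equation (hc : SmoothCoeffs g A V) (hφ : ContDiff ℝ ∞ φ)
    (heq : ∀ z : Spacetime, 0 < z.1 → waveOp g A V φ z = 0) (l : List (Fin 4)) {z : Spacetime}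
    (hz : 0 < z.1) :
    -pd 0 (pd 0 (pdl l φ)) z + lap (pdl l φ) z + ∑ μ, pd μ (pdl l (flux g A φ μ)) z
      + pdl l (fun y => V y * φ y) z = 0 := by
  have hW : waveOp g A V φ = fun z => ((-1) * pd 0 (pd 0 φ) z + lap φ z)
      + ((∑ μ, pd μ (flux g A φ μ) z) + V z * φ z) := by
    ext z; rw [waveOp_eq hc hφ]; ring
  -- The equation is available only for t > 0, but it holds in a whole neighbourhood of z, so it may
  -- be differentiated at z.
  have h0 : pdl l (waveOp g A V φ) z = 0 := by
    refine pdl_eq_zero_of_eventuallyEq l ?_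
    filter_upwards [(isOpen_lt continuous_const continuous_fst).mem_nhds hz] with y hy
    exact heq y hy
  have s1 : ContDiff ℝ ∞ (pd 0 (pd 0 φ)) := by fun_prop
  have s2 : ContDiff ℝ ∞ (lap φ) := contDiff_lap hφ
  have s3 : ∀ μ, ContDiff ℝ ∞ (pd μ (flux g A φ μ)) := fun μ => contDiff_pd _ (contDiff_flux hc hφ μ)
  have s4 : ContDiff ℝ ∞ (fun z => V z * φ z) := hc.potential.mul hφ
  rw [hW, pdl_add l ((contDiff_const.mul s1).add s2) ((ContDiff.sum fun μ _ => s3 μ).add s4),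
    pdl_add l (contDiff_const.mul s1) s2, pdl_add l (ContDiff.sum fun μ _ => s3 μ) s4,
    pdl_const_mul l _ s1, pdl_sum l _ (fun μ _ => s3 μ)] at h0
  have e1 : pd 0 (pd 0 (pdl l φ)) = pdl l (pd 0 (pd 0 φ)) := by
    rw [pd_pdl 0 l hφ]
    change pd 0 (pdl l (pd 0 φ)) = _
    rw [pd_pdl 0 l (contDiff_pd 0 hφ)]; rfl
  have e3 : ∀ μ, pd μ (pdl l (flux g A φ μ)) = pdl l (pd μ (flux g A φ μ)) := fun μ =>
    pd_pdl μ l (contDiff_flux hc hφ μ)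
  rw [e1, lap_pdl l hφ]
  simp only [e3]
  linarith

/-- The vector field in the divergence-form equation on the slice at time `t`. -/
def divField (g : Spacetime → Matrix (Fin 4) (Fin 4) ℝ) (A : Fin 4 → Spacetime → ℝ)
    (φ : Spacetime → ℝ) (l : List (Fin 4)) (t : ℝ) (i : Fin 3) : Spacetime → ℝ := fun y =>
  (-2 * t⁻¹ ^ 2) * (y.2 i * scal (pdl l φ) y) + (-1) * pdl l (flux g A φ i.succ) y
    + t⁻¹ * (y.2 i * pdl l (flux g A φ 0) y)

/-- The source in the divergence-form equation on the slice at time `t`. -/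
def srcField (g : Spacetime → Matrix (Fin 4) (Fin 4) ℝ) (A : Fin 4 → Spacetime → ℝ)
    (V φ : Spacetime → ℝ) (l : List (Fin 4)) (t : ℝ) : Spacetime → ℝ := fun y =>
  t⁻¹ ^ 2 * (scal (scal (pdl l φ)) y + 5 * scal (pdl l φ) y - ∑ a, rot a (rot a (pdl l φ)) y)
    - t⁻¹ * (scal (pdl l (flux g A φ 0)) y + 3 * pdl l (flux g A φ 0) y)
    - pdl l (fun y => V y * φ y) y

lemma contDiff_divField (hc : SmoothCoeffs g A V) (hφ : ContDiff ℝ ∞ φ) (l : List (Fin 4)) (t : ℝ)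
    (i : Fin 3) : ContDiff ℝ ∞ (divField g A φ l t i) := by
  have h0 := contDiff_flux hc hφ 0
  have h1 := contDiff_flux hc hφ i.succ
  unfold divField
  fun_prop

lemma contDiff_srcField (hc : SmoothCoeffs g A V) (hφ : ContDiff ℝ ∞ φ) (l : List (Fin 4)) (t : ℝ) :
    ContDiff ℝ ∞ (srcField g A V φ l t) := by
  have h0 := contDiff_flux hc hφ 0
  have h1 : ContDiff ℝ ∞ (fun y => V y * φ y) := hc.potential.mul hφ
  unfold srcField
  fun_prop

/-- The divergence-form equation on a time slice. -/
lemma slice_equation (hc : SmoothCoeffs g A V) (hφ : ContDiff ℝ ∞ φ)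
    (heq : ∀ z : Spacetime, 0 < z.1 → waveOp g A V φ z = 0) (l : List (Fin 4)) {z : Spacetime}
    (hz : 0 < z.1) :
    (1 - ‖z.2‖ ^ 2 / z.1 ^ 2) * lap (pdl l φ) z =
      (∑ i : Fin 3, pd i.succ (divField g A φ l z.1 i) z) + srcField g A V φ l z.1 z := by
  have h0 := pdl_equation hc hφ heq l hz
  have h1 := time_sq_mul_pd_pd (contDiff_pdl l hφ) z
  have hY := contDiff_pdl l (contDiff_flux hc hφ 0)
  -- Since div x = 3, the term -2t⁻²x·∇Sv equals div(-2t⁻²x Sv) + 6t⁻²Sv. With the -t⁻²Sv from the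
  -- identity for ∂_t² this gives the coefficient 5 in `srcField`.
  have h2 : ∀ i : Fin 3, pd i.succ (divField g A φ l z.1 i) z =
      (-2 * z.1⁻¹ ^ 2) * (scal (pdl l φ) z + z.2 i * pd i.succ (scal (pdl l φ)) z)
      + (-1) * pd i.succ (pdl l (flux g A φ i.succ)) z
      + z.1⁻¹ * (pdl l (flux g A φ 0) z + z.2 i * pd i.succ (pdl l (flux g A φ 0)) z) := by
    intro i
    have hX := contDiff_pdl l (contDiff_flux hc hφ i.succ)
    unfold divField
    rw [pd_add _ (by fun_prop) (by fun_prop), pd_add _ (by fun_prop) (by fun_prop),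
      pd_const_mul _ _ (by fun_prop), pd_const_mul _ _ (by fun_prop),
      pd_const_mul _ _ (by fun_prop), pd_coord_mul _ _ (by fun_prop), pd_coord_mul _ _ hY]
    simp
  -- The time derivative of the flux is also traded for t⁻¹(S - x·∇). Its x·∇ part joins the
  -- divergence, which leaves 3t⁻¹ times the flux in the source.
  have h3 : scal (pdl l (flux g A φ 0)) z = z.1 * pd 0 (pdl l (flux g A φ 0)) z
      + ∑ i : Fin 3, z.2 i * pd i.succ (pdl l (flux g A φ 0)) z := rfl
  have hz' : z.1 ≠ 0 := hz.ne'
  rw [Fin.sum_univ_succ] at h0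
  simp only [h2, srcField, h3]
  simp only [Finset.sum_add_distrib, ← Finset.mul_sum, Finset.sum_const, Finset.card_univ,
    Fintype.card_fin, nsmul_eq_mul]
  have h4 : pd 0 (pd 0 (pdl l φ)) z = z.1⁻¹ ^ 2 * (scal (scal (pdl l φ)) z - scal (pdl l φ) z
      - 2 * ∑ i : Fin 3, z.2 i * pd i.succ (scal (pdl l φ)) z
      + ‖z.2‖ ^ 2 * lap (pdl l φ) z - ∑ a, rot a (rot a (pdl l φ)) z) := by
    rw [← h1]; field_simp
  rw [h4] at h0
  have h5 : z.1⁻¹ * z.1 = 1 := inv_mul_cancel₀ hz'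
  have h6 : ‖z.2‖ ^ 2 / z.1 ^ 2 = z.1⁻¹ ^ 2 * ‖z.2‖ ^ 2 := by field_simp
  rw [h6]
  push_cast
  linear_combination h0 + pd 0 (pdl l (flux g A φ 0)) z * h5

/-- The space-derivative of a slice. -/
lemma fderiv_slice {u : Spacetime → ℝ} (hu : ContDiff ℝ ∞ u) (t : ℝ) (x : Space) (i : Fin 3) :
    fderiv ℝ (fun y : Space => u (t, y)) x (EuclideanSpace.single i 1) = pd i.succ u (t, x) := by
  have h := (differentiableAt_of_smooth hu (t, x)).hasFDerivAt.comp x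
    (hasFDerivAt_prodMk_right t x)
  have e : fderiv ℝ (fun y : Space => u (t, y)) x = _ := h.fderiv
  rw [e]
  simp [pd, coordVec]

lemma contDiff_slice {u : Spacetime → ℝ} (hu : ContDiff ℝ ∞ u) (t : ℝ) :
    ContDiff ℝ ∞ (fun y : Space => u (t, y)) :=
  hu.comp (contDiff_prodMk_right t)

end Equation

/-! ### Integration on time slices -/

section Slices

variable {u v W : Spacetime → ℝ} {t : ℝ}

/-- The slice of `u` at time `t` vanishes outside a ball. -/
def SliceCompact (t : ℝ) (u : Spacetime → ℝ) : Prop := ∃ ρ : ℝ, ∀ x : Space, ρ < ‖x‖ → u (t, x) = 0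

lemma SliceCompact.mul_left (h : SliceCompact t u) (v : Spacetime → ℝ) :
    SliceCompact t (fun z => u z * v z) := by
  obtain ⟨ρ, hρ⟩ := h
  exact ⟨ρ, fun x hx => by simp [hρ x hx]⟩

lemma SliceCompact.mul_right (h : SliceCompact t u) (v : Spacetime → ℝ) :
    SliceCompact t (fun z => v z * u z) := by
  obtain ⟨ρ, hρ⟩ := h
  exact ⟨ρ, fun x hx => by simp [hρ x hx]⟩

lemma SliceCompact.add (hu : SliceCompact t u) (hv : SliceCompact t v) :
    SliceCompact t (fun z => u z + v z) := by
  obtain ⟨ρ, hρ⟩ := hu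
  obtain ⟨ρ', hρ'⟩ := hv
  refine ⟨max ρ ρ', fun x hx => ?_⟩
  simp [hρ x ((le_max_left _ _).trans_lt hx), hρ' x ((le_max_right _ _).trans_lt hx)]

lemma SliceCompact.hasCompactSupport (h : SliceCompact t u) :
    HasCompactSupport (fun x : Space => u (t, x)) := by
  obtain ⟨ρ, hρ⟩ := h
  refine HasCompactSupport.of_support_subset_isCompact (isCompact_closedBall (0 : Space) ρ) ?_
  intro x hx
  by_contra hc
  exact hx (hρ x (by simpa using hc))

lemma SliceCompact.pd (hu : ContDiff ℝ ∞ u) (h : SliceCompact t u) (i : Fin 3) :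
    SliceCompact t (pd i.succ u) := by
  obtain ⟨ρ, hρ⟩ := h
  refine ⟨ρ, fun x hx => ?_⟩
  rw [← fderiv_slice hu]
  have : (fun y : Space => u (t, y)) =ᶠ[nhds x] fun _ => 0 := by
    filter_upwards [(isOpen_lt continuous_const continuous_norm).mem_nhds hx] with y hy
    exact hρ y hy
  rw [this.fderiv_eq]
  simp

lemma continuous_slice (hu : ContDiff ℝ ∞ u) (t : ℝ) : Continuous (fun x : Space => u (t, x)) :=
  (contDiff_slice hu t).continuous

lemma SliceCompact.integrable (hu : ContDiff ℝ ∞ u) (h : SliceCompact t u) :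
    Integrable (fun x : Space => u (t, x)) :=
  (continuous_slice hu t).integrable_of_hasCompactSupport h.hasCompactSupport

lemma integral_pd_eq_zero (hu : ContDiff ℝ ∞ u) (h : SliceCompact t u) (i : Fin 3) :
    ∫ x : Space, pd i.succ u (t, x) = 0 := by
  have hs := contDiff_slice hu t
  have h1 := integral_mul_fderiv_eq_neg_fderiv_mul_of_integrable (μ := (volume : Measure Space))
    (f := fun _ : Space => (1 : ℝ)) (g := fun y : Space => u (t, y))
    (v := EuclideanSpace.single i 1) (by simp)
    (by simpa [fderiv_slice hu] using (h.pd hu i).integrable (contDiff_pd _ hu))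
    (by simpa using h.integrable hu)
    (fun x _ => by fun_prop) (fun x _ => hs.differentiable (by simp) x)
  simpa [fderiv_slice hu] using h1

/-- The weighted energy identity for the Laplacian. -/
lemma integral_weight_grad_sq (hv : ContDiff ℝ ∞ v) (hW : ContDiff ℝ ∞ W) (hWc : SliceCompact t W) :
    ∫ x : Space, W (t, x) * ∑ i : Fin 3, pd i.succ v (t, x) ^ 2 =
      ∫ x : Space, (1 / 2 * v (t, x) ^ 2 * lap W (t, x) - W (t, x) * v (t, x) * lap v (t, x)) := by
  -- The field W v∇v - ½v²∇W. Its divergence is the difference of the two integrands.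
  set P : Fin 3 → Spacetime → ℝ := fun i z =>
    W z * (v z * pd i.succ v z) + (-1 / 2) * (v z * v z * pd i.succ W z) with hP
  have hPs : ∀ i, ContDiff ℝ ∞ (P i) := fun i => by
    simp only [hP]; fun_prop
  have hPc : ∀ i, SliceCompact t (P i) := fun i =>
    (hWc.mul_left _).add (((hWc.pd hW i).mul_right (fun z => v z * v z)).mul_right _)
  have hd : ∀ i z, pd i.succ (P i) z = W z * pd i.succ v z ^ 2
      - (1 / 2 * v z ^ 2 * pd i.succ (pd i.succ W) z - W z * v z * pd i.succ (pd i.succ v) z) := by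
    intro i z
    simp only [hP]
    rw [pd_add _ (by fun_prop) (by fun_prop), pd_const_mul _ _ (by fun_prop),
      pd_mul _ hW (by fun_prop), pd_mul _ hv (by fun_prop),
      pd_mul _ (hv.mul hv) (by fun_prop), pd_mul _ hv hv]
    ring
  have h0 : ∫ x : Space, ∑ i : Fin 3, pd i.succ (P i) (t, x) = 0 := by
    rw [integral_finsetSum _ fun i _ => ((hPc i).pd (hPs i) i).integrable (contDiff_pd _ (hPs i))]
    simp [integral_pd_eq_zero (hPs _) (hPc _)]
  have i1 : Integrable (fun x : Space => W (t, x) * ∑ i : Fin 3, pd i.succ v (t, x) ^ 2) :=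
    SliceCompact.integrable (u := fun z => W z * ∑ i : Fin 3, pd i.succ v z ^ 2)
      (by fun_prop) (hWc.mul_left _)
  have hWl : SliceCompact t (lap W) := by
    have : lap W = fun z => pd (Fin.succ 0) (pd (Fin.succ 0) W) z
      + pd (Fin.succ 1) (pd (Fin.succ 1) W) z + pd (Fin.succ 2) (pd (Fin.succ 2) W) z := by
      ext z; simp [lap, Fin.sum_univ_three]
    rw [this]
    have h (i : Fin 3) := (hWc.pd hW i).pd (contDiff_pd _ hW) i
    exact ((h 0).add (h 1)).add (h 2)
  have s1 := contDiff_lap hW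
  have s2 := contDiff_lap hv
  have i2 : Integrable (fun x : Space => 1 / 2 * v (t, x) ^ 2 * lap W (t, x)
      - W (t, x) * v (t, x) * lap v (t, x)) := by
    refine Integrable.sub (SliceCompact.integrable (u := fun z => 1 / 2 * v z ^ 2 * lap W z)
      (by fun_prop) (hWl.mul_right _)) (SliceCompact.integrable
        (u := fun z => W z * v z * lap v z) (by fun_prop) ((hWc.mul_left v).mul_left _))
  rw [← sub_eq_zero, ← integral_sub i1 i2, ← h0]
  refine integral_congr_ae (Filter.Eventually.of_forall fun x => ?_)
  simp only [hd, lap, Fin.sum_univ_three]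
  ring

/-- The energy identity for `b Δ v = ∑ ∂_i G_i + F`. -/
lemma energy_identity {b F : Spacetime → ℝ} {G : Fin 3 → Spacetime → ℝ} (hv : ContDiff ℝ ∞ v)
    (hW : ContDiff ℝ ∞ W) (hWc : SliceCompact t W) (hb : ContDiff ℝ ∞ b)
    (hG : ∀ i, ContDiff ℝ ∞ (G i))
    (heq : ∀ x : Space, b (t, x) * lap v (t, x) = (∑ i : Fin 3, pd i.succ (G i) (t, x)) + F (t, x)) :
    ∫ x : Space, b (t, x) * W (t, x) * ∑ i : Fin 3, pd i.succ v (t, x) ^ 2 =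
      ∫ x : Space, (1 / 2 * v (t, x) ^ 2 * lap (fun z => b z * W z) (t, x)
        + (∑ i : Fin 3, G i (t, x) * pd i.succ (fun z => W z * v z) (t, x))
        - F (t, x) * (W (t, x) * v (t, x))) := by
  -- The coefficient b is put into the weight, so that derivatives falling on b only meet v². The
  -- product b Δv is then replaced by the equation, and div G is integrated by parts against Wv.
  have hbW : SliceCompact t (fun z => b z * W z) := hWc.mul_right b
  rw [integral_weight_grad_sq hv (hb.mul hW) hbW]
  have s1 := contDiff_lap (hb.mul hW)
  have s2 := contDiff_lap hv
  have hWl : SliceCompact t (lap (fun z => b z * W z)) := by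
    have : lap (fun z => b z * W z) = fun z => pd (Fin.succ 0) (pd (Fin.succ 0) (fun z => b z * W z)) z
      + pd (Fin.succ 1) (pd (Fin.succ 1) (fun z => b z * W z)) z
      + pd (Fin.succ 2) (pd (Fin.succ 2) (fun z => b z * W z)) z := by
      ext z; simp [lap, Fin.sum_univ_three]
    rw [this]
    have h (i : Fin 3) := (hbW.pd (hb.mul hW) i).pd (contDiff_pd _ (hb.mul hW)) i
    exact ((h 0).add (h 1)).add (h 2)
  have hWv : SliceCompact t (fun z => W z * v z) := hWc.mul_left v
  have hQs : ∀ i, ContDiff ℝ ∞ (fun z => G i z * (W z * v z)) := fun i => by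
    have := hG i; fun_prop
  have hQc : ∀ i, SliceCompact t (fun z => G i z * (W z * v z)) := fun i => hWv.mul_right _
  have h0 : ∫ x : Space, ∑ i : Fin 3, pd i.succ (fun z => G i z * (W z * v z)) (t, x) = 0 := by
    rw [integral_finsetSum _ fun i _ => ((hQc i).pd (hQs i) i).integrable (contDiff_pd _ (hQs i))]
    simp [integral_pd_eq_zero (hQs _) (hQc _)]
  have i1 : Integrable (fun x : Space => 1 / 2 * v (t, x) ^ 2 * lap (fun z => b z * W z) (t, x)
      - b (t, x) * W (t, x) * v (t, x) * lap v (t, x)) := by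
    refine Integrable.sub (SliceCompact.integrable
      (u := fun z => 1 / 2 * v z ^ 2 * lap (fun z => b z * W z) z)
      (by fun_prop) (hWl.mul_right _)) (SliceCompact.integrable
        (u := fun z => b z * W z * v z * lap v z) (by fun_prop) ((hbW.mul_left v).mul_left _))
  have i2 : Integrable (fun x : Space =>
      ∑ i : Fin 3, pd i.succ (fun z => G i z * (W z * v z)) (t, x)) :=
    integrable_finsetSum _ fun i _ => ((hQc i).pd (hQs i) i).integrable (contDiff_pd _ (hQs i))
  rw [← add_zero (∫ x : Space, _), ← h0, ← integral_add i1 i2]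
  refine integral_congr_ae (Filter.Eventually.of_forall fun x => ?_)
  have e : ∀ i : Fin 3, pd i.succ (fun z => G i z * (W z * v z)) (t, x) =
      pd i.succ (G i) (t, x) * (W (t, x) * v (t, x))
        + G i (t, x) * pd i.succ (fun z => W z * v z) (t, x) := fun i => by
    rw [pd_mul _ (hG i) (hW.mul hv)]
  simp only [e, Finset.sum_add_distrib, ← Finset.sum_mul]
  linear_combination (-(W (t, x) * v (t, x))) * heq x

end Slices

/-! ### Scaled cutoffs -/

section Cutoffs

/-- The function `x ↦ ψ ((x - x₀) / ρ)` on spacetime. -/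
def spaceCut (ψ : Space → ℝ) (ρ : ℝ) (x₀ : Space) : Spacetime → ℝ :=
  fun z => ψ (ρ⁻¹ • (z.2 - x₀))

/-- Partial derivatives of functions of the space variable, indexed as on spacetime. -/
def psd (α : Fin 4) (ψ : Space → ℝ) : Space → ℝ := fun x => fderiv ℝ ψ x (coordVec α).2

/-- Iterated partial derivatives of functions of the space variable. -/
def psdl : List (Fin 4) → (Space → ℝ) → (Space → ℝ)
  | [], ψ => ψ
  | β :: l, ψ => psdl l (psd β ψ)

variable {ψ : Space → ℝ}

lemma contDiff_psd (α : Fin 4) (hψ : ContDiff ℝ ∞ ψ) : ContDiff ℝ ∞ (psd α ψ) :=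
  (hψ.fderiv_right (m := ∞) (by simp)).clm_apply contDiff_const

lemma contDiff_psdl (l : List (Fin 4)) (hψ : ContDiff ℝ ∞ ψ) : ContDiff ℝ ∞ (psdl l ψ) := by
  induction l generalizing ψ with
  | nil => exact hψ
  | cons β l ih => exact ih (contDiff_psd β hψ)

lemma hasCompactSupport_psd (α : Fin 4) (h : HasCompactSupport ψ) :
    HasCompactSupport (psd α ψ) := h.fderiv_apply (𝕜 := ℝ) _

lemma hasCompactSupport_psdl (l : List (Fin 4)) (h : HasCompactSupport ψ) :
    HasCompactSupport (psdl l ψ) := by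
  induction l generalizing ψ with
  | nil => exact h
  | cons β l ih => exact ih (hasCompactSupport_psd β h)

lemma contDiff_spaceCut (hψ : ContDiff ℝ ∞ ψ) (ρ : ℝ) (x₀ : Space) :
    ContDiff ℝ ∞ (spaceCut ψ ρ x₀) := by
  unfold spaceCut
  fun_prop

lemma pd_spaceCut (hψ : ContDiff ℝ ∞ ψ) (ρ : ℝ) (x₀ : Space) (α : Fin 4) :
    pd α (spaceCut ψ ρ x₀) = fun z => ρ⁻¹ * spaceCut (psd α ψ) ρ x₀ z := by
  ext z
  have h1 : HasFDerivAt (fun z : Spacetime => ρ⁻¹ • (z.2 - x₀))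
      (ρ⁻¹ • ContinuousLinearMap.snd ℝ ℝ Space) z :=
    ((hasFDerivAt_snd (𝕜 := ℝ)).sub_const x₀).const_smul ρ⁻¹
  have h2 := ((hψ.differentiable (by simp)) (ρ⁻¹ • (z.2 - x₀))).hasFDerivAt.comp z h1
  have e : fderiv ℝ (spaceCut ψ ρ x₀) z = _ := h2.fderiv
  simp [pd, e, spaceCut, psd]

lemma pdl_spaceCut (hψ : ContDiff ℝ ∞ ψ) (ρ : ℝ) (x₀ : Space) (l : List (Fin 4)) :
    pdl l (spaceCut ψ ρ x₀) = fun z => ρ⁻¹ ^ l.length * spaceCut (psdl l ψ) ρ x₀ z := by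
  induction l generalizing ψ with
  | nil => simp [pdl, psdl]
  | cons β l ih =>
    simp only [pdl, psdl]
    rw [pd_spaceCut hψ, pdl_const_mul l _ (contDiff_spaceCut (contDiff_psd β hψ) _ _),
      ih (contDiff_psd β hψ)]
    ext z
    rw [List.length_cons, pow_succ]
    ring

lemma exists_psdl_bound (hψ : ContDiff ℝ ∞ ψ) (hc : HasCompactSupport ψ) (l : List (Fin 4)) :
    ∃ C : ℝ, 0 ≤ C ∧ ∀ x, |psdl l ψ x| ≤ C := by
  obtain ⟨C, hC⟩ := (contDiff_psdl l hψ).continuous.bounded_above_of_compact_support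
    (hasCompactSupport_psdl l hc)
  exact ⟨C, (norm_nonneg _).trans (hC 0), fun x => hC x⟩

/-- Uniform bounds for all derivatives up to order `n`. -/
lemma exists_psdl_bound_le (hψ : ContDiff ℝ ∞ ψ) (hc : HasCompactSupport ψ) (n : ℕ) :
    ∃ C : ℝ, 0 ≤ C ∧ ∀ l : List (Fin 4), l.length ≤ n → ∀ x, |psdl l ψ x| ≤ C := by
  choose C hC0 hC using exists_psdl_bound hψ hc
  have hfin : {l : List (Fin 4) | l.length ≤ n}.Finite := List.finite_length_le _ _
  refine ⟨∑ l ∈ hfin.toFinset, C l, Finset.sum_nonneg fun l _ => hC0 l, fun l hl x => ?_⟩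
  exact (hC l x).trans (Finset.single_le_sum (f := C) (fun l _ => hC0 l)
    (hfin.mem_toFinset.2 hl))

/-- A fixed smooth bump: `1` on the unit ball, supported in the ball of radius `2`. -/
def bumpB : ContDiffBump (0 : Space) := ⟨1, 2, one_pos, one_lt_two⟩

lemma bumpB_contDiff : ContDiff ℝ ∞ (bumpB : Space → ℝ) := bumpB.contDiff

lemma bumpB_one {x : Space} (hx : ‖x‖ ≤ 1) : bumpB x = 1 :=
  bumpB.one_of_mem_closedBall (by simpa [bumpB] using hx)

lemma bumpB_zero {x : Space} (hx : 2 ≤ ‖x‖) : bumpB x = 0 :=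
  bumpB.zero_of_le_dist (by simpa [bumpB] using hx)

lemma psdl_bumpB_zero {l : List (Fin 4)} {x : Space} (hx : 2 < ‖x‖) :
    psdl l bumpB x = 0 := by
  suffices h : ∀ (ψ : Space → ℝ), (∀ y, 2 < ‖y‖ → ψ y = 0) → psdl l ψ x = 0 from
    h _ fun y hy => bumpB_zero hy.le
  induction l with
  | nil => exact fun ψ hψ => hψ x hx
  | cons β l ih =>
    intro ψ hψ
    refine ih _ fun y hy => ?_
    have : ψ =ᶠ[nhds y] fun _ => 0 := by
      filter_upwards [(isOpen_lt continuous_const continuous_norm).mem_nhds hy] with y' hy'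
      exact hψ y' hy'
    simp [psd, this.fderiv_eq]

lemma psdl_bumpB_zero_of_lt {l : List (Fin 4)} (hl : l ≠ []) {x : Space} (hx : ‖x‖ < 1) :
    psdl l bumpB x = 0 := by
  -- The induction needs an arbitrary constant value c: after the first derivative the function is
  -- constant with c = 0, and from then on an empty list is harmless too.
  suffices h : ∀ (l : List (Fin 4)) (ψ : Space → ℝ) (c : ℝ), (∀ y, ‖y‖ < 1 → ψ y = c) →
      (l ≠ [] ∨ c = 0) → psdl l ψ x = 0 from
    h l _ 1 (fun y hy => bumpB_one hy.le) (Or.inl hl)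
  intro l
  induction l with
  | nil =>
    intro ψ c hψ h
    rw [psdl, hψ x hx]
    simpa using h
  | cons β l ih =>
    intro ψ c hψ _
    refine ih _ 0 (fun y hy => ?_) (Or.inr rfl)
    have : ψ =ᶠ[nhds y] fun _ => c := by
      filter_upwards [(isOpen_lt continuous_norm continuous_const).mem_nhds hy] with y' hy'
      exact hψ y' hy'
    simp [psd, this.fderiv_eq]

end Cutoffs

/-! ### The Japanese bracket -/

section Bracket

lemma jb_pos (s : ℝ) : 0 < jb s := Real.sqrt_pos.2 (by positivity)

lemma one_le_jb (s : ℝ) : 1 ≤ jb s := by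
  rw [jb, Real.le_sqrt' one_pos]; nlinarith [sq_nonneg s]

lemma jb_sq (s : ℝ) : jb s ^ 2 = 1 + s ^ 2 := Real.sq_sqrt (by positivity)

lemma abs_le_jb (s : ℝ) : |s| ≤ jb s := by
  rw [jb]; exact Real.abs_le_sqrt (by linarith)

lemma le_jb (s : ℝ) : s ≤ jb s := (le_abs_self s).trans (abs_le_jb s)

lemma jb_le_one_add (s : ℝ) : jb s ≤ 1 + |s| := by
  rw [jb, Real.sqrt_le_left (by positivity)]
  nlinarith [abs_nonneg s, sq_abs s]

lemma jb_le_add_of_abs_le {a b c : ℝ} (h : |a| ≤ |b| + |c|) : jb a ≤ jb b + jb c := by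
  have hb := abs_le_jb b
  have hc := abs_le_jb c
  rw [jb, Real.sqrt_le_left (add_nonneg (jb_pos b).le (jb_pos c).le)]
  have h1 := jb_sq b
  have h2 := jb_sq c
  have h3 : |b| * |c| ≤ jb b * jb c :=
    mul_le_mul hb hc (abs_nonneg c) (jb_pos b).le
  have h4 : a ^ 2 ≤ (|b| + |c|) ^ 2 := by rw [← sq_abs a]; gcongr
  nlinarith [sq_abs b, sq_abs c]

lemma jb_mono {a b : ℝ} (h : |a| ≤ |b|) : jb a ≤ jb b := by
  rw [jb, jb]
  apply Real.sqrt_le_sqrt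
  have := sq_le_sq.2 h
  linarith

lemma jb_norm_le (x x₀ : Space) : jb ‖x₀‖ ≤ jb ‖x‖ + jb ‖x - x₀‖ := by
  apply jb_le_add_of_abs_le
  simp only [abs_norm]
  have : x₀ = x - (x - x₀) := by abel
  calc ‖x₀‖ = ‖x - (x - x₀)‖ := by rw [← this]
    _ ≤ _ := norm_sub_le _ _

@[fun_prop]
lemma continuous_jb : Continuous jb := by
  unfold jb; fun_prop

end Bracket

/-! ### Kernel integrals -/

section Kernels

lemma integrable_jb_rpow {p : ℝ} (hp : 3 < p) (x₀ : Space) :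
    Integrable (fun x : Space => jb ‖x - x₀‖ ^ (-p)) := by
  have h := integrable_rpow_neg_one_add_norm_sq (E := Space) (μ := volume) (r := p)
    (by simpa using hp)
  have h2 : Integrable (fun x : Space => jb ‖x‖ ^ (-p)) := by
    refine h.congr (Filter.Eventually.of_forall fun x => ?_)
    simp only [jb]
    rw [Real.sqrt_eq_rpow, ← Real.rpow_mul (by positivity)]
    congr 1; ring
  exact h2.comp_sub_right x₀

lemma integral_jb_rpow_translate (p : ℝ) (x₀ : Space) :
    ∫ x : Space, jb ‖x - x₀‖ ^ (-p) = ∫ x : Space, jb ‖x‖ ^ (-p) :=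
  integral_sub_right_eq_self (fun x : Space => jb ‖x‖ ^ (-p)) x₀

/-- The smaller of the two bases may carry both exponents. -/
lemma rpow_mul_rpow_le {a b p q : ℝ} (ha : 1 ≤ a) (hb : 1 ≤ b) (hp : 0 ≤ p) (hq : 0 ≤ q) :
    a ^ (-p) * b ^ (-q) ≤ a ^ (-(p + q)) + b ^ (-(p + q)) := by
  have ha0 : 0 < a := by linarith
  have hb0 : 0 < b := by linarith
  have h1 : 0 ≤ a ^ (-(p + q)) := by positivity
  have h2 : 0 ≤ b ^ (-(p + q)) := by positivity
  rcases le_total a b with h | h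
  · have : a ^ (-p) * b ^ (-q) ≤ a ^ (-p) * a ^ (-q) := by
      gcongr ?_ * ?_
      exact Real.rpow_le_rpow_of_nonpos ha0 h (by linarith)
    rw [← Real.rpow_add ha0] at this
    rw [show -(p + q) = -p + -q by ring] at h2 ⊢
    linarith
  · have : a ^ (-p) * b ^ (-q) ≤ b ^ (-p) * b ^ (-q) := by
      gcongr ?_ * ?_
      exact Real.rpow_le_rpow_of_nonpos hb0 h (by linarith)
    rw [← Real.rpow_add hb0] at this
    rw [show -(p + q) = -p + -q by ring] at h1 ⊢
    linarith

/-- Convolution of two powers whose total decay is `3 + s`. -/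
lemma kernel_pointwise {a b c p q s : ℝ} (ha : 1 ≤ a) (hb : 1 ≤ b) (hc : 1 ≤ c)
    (hcab : c ≤ a + b) (hs : 0 < s) (hp : s / 2 ≤ p) (hq : s / 2 ≤ q) (hpq : p + q = 3 + s) :
    a ^ (-p) * b ^ (-q) ≤
      2 ^ (s / 2) * c ^ (-(s / 2)) * (a ^ (-(3 + s / 2)) + b ^ (-(3 + s / 2))) := by
  have ha0 : 0 < a := by linarith
  have hb0 : 0 < b := by linarith
  have hc0 : 0 < c := by linarith
  have e : (2 : ℝ) ^ (s / 2) * c ^ (-(s / 2)) = (c / 2) ^ (-(s / 2)) := by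
    rw [Real.div_rpow hc0.le zero_le_two, Real.rpow_neg zero_le_two]
    field_simp
  rw [e]
  -- The larger of a and b is at least c/2. A power s/2 of it is traded for decay in c, and the
  -- remaining total exponent 3 + s/2 is still integrable in three dimensions.
  rcases le_total b a with h | h
  · have h1 : a ^ (-(s / 2)) ≤ (c / 2) ^ (-(s / 2)) :=
      Real.rpow_le_rpow_of_nonpos (by positivity) (by linarith) (by linarith)
    have h2 := rpow_mul_rpow_le ha hb (p := p - s / 2) (q := q) (by linarith) (by linarith)
    rw [show p - s / 2 + q = 3 + s / 2 by linarith] at h2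
    calc a ^ (-p) * b ^ (-q) = a ^ (-(s / 2)) * (a ^ (-(p - s / 2)) * b ^ (-q)) := by
          rw [← mul_assoc, ← Real.rpow_add ha0]; congr 2; ring
      _ ≤ _ := by gcongr
  · have h1 : b ^ (-(s / 2)) ≤ (c / 2) ^ (-(s / 2)) :=
      Real.rpow_le_rpow_of_nonpos (by positivity) (by linarith) (by linarith)
    have h2 := rpow_mul_rpow_le ha hb (p := p) (q := q - s / 2) (by linarith) (by linarith)
    rw [show p + (q - s / 2) = 3 + s / 2 by linarith] at h2
    calc a ^ (-p) * b ^ (-q) = b ^ (-(s / 2)) * (a ^ (-p) * b ^ (-(q - s / 2))) := by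
          rw [mul_left_comm, ← Real.rpow_add hb0]; congr 2; ring
      _ ≤ _ := by gcongr

lemma continuous_jb_rpow (p : ℝ) (x₀ : Space) :
    Continuous (fun x : Space => jb ‖x - x₀‖ ^ p) :=
  Continuous.rpow_const (by fun_prop) fun x => Or.inl (jb_pos _).ne'

lemma continuous_jb_rpow_zero (p : ℝ) : Continuous (fun x : Space => jb ‖x‖ ^ p) :=
  Continuous.rpow_const (by fun_prop) fun x => Or.inl (jb_pos _).ne'

/-- The pointwise splitting leaves powers of exponent 3 + s/2 centred at 0 and at x₀, whose
integrals are finite and independent of x₀. The gain ⟨x₀⟩^{-s/2} is what makes the perturbation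
absorbable far out. -/
lemma kernel_integral {p q s : ℝ} (hs : 0 < s) (hp : s / 2 ≤ p) (hq : s / 2 ≤ q)
    (hpq : p + q = 3 + s) :
    ∃ C : ℝ, 0 ≤ C ∧ ∀ x₀ : Space, Integrable (fun x : Space => jb ‖x‖ ^ (-p) * jb ‖x - x₀‖ ^ (-q)) ∧
      ∫ x : Space, jb ‖x‖ ^ (-p) * jb ‖x - x₀‖ ^ (-q) ≤ C * jb ‖x₀‖ ^ (-(s / 2)) := by
  set I := ∫ x : Space, jb ‖x‖ ^ (-(3 + s / 2)) with hI
  have hI0 : 0 ≤ I := integral_nonneg fun x => by have := jb_pos ‖x‖; positivity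
  refine ⟨2 ^ (s / 2) * (I + I), by positivity, fun x₀ => ?_⟩
  have hpt : ∀ x : Space, jb ‖x‖ ^ (-p) * jb ‖x - x₀‖ ^ (-q) ≤
      2 ^ (s / 2) * jb ‖x₀‖ ^ (-(s / 2)) *
        (jb ‖x‖ ^ (-(3 + s / 2)) + jb ‖x - x₀‖ ^ (-(3 + s / 2))) := fun x =>
    kernel_pointwise (one_le_jb _) (one_le_jb _) (one_le_jb _) (jb_norm_le x x₀) hs hp hq hpq
  have i0 : Integrable (fun x : Space => jb ‖x‖ ^ (-(3 + s / 2))) := by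
    simpa using integrable_jb_rpow (p := 3 + s / 2) (by linarith) 0
  have i1 := integrable_jb_rpow (p := 3 + s / 2) (by linarith) x₀
  have i2 := (i0.add i1).const_mul (2 ^ (s / 2) * jb ‖x₀‖ ^ (-(s / 2)))
  have i3 : Integrable (fun x : Space => jb ‖x‖ ^ (-p) * jb ‖x - x₀‖ ^ (-q)) := by
    refine i2.mono' ((continuous_jb_rpow_zero _).mul (continuous_jb_rpow _ _)).aestronglyMeasurable
      (Filter.Eventually.of_forall fun x => ?_)
    rw [Real.norm_of_nonneg (by have := jb_pos ‖x‖; have := jb_pos ‖x - x₀‖; positivity)]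
    exact hpt x
  refine ⟨i3, (integral_mono i3 i2 hpt).trans ?_⟩
  simp only [Pi.add_apply]
  rw [integral_const_mul, integral_add i0 i1, integral_jb_rpow_translate, ← hI]
  apply le_of_eq; ring

/-- The integral of `⟨x⟩⁻²` over a ball grows linearly. -/
lemma integral_ball_jb_neg_two : ∃ C : ℝ, 0 ≤ C ∧ ∀ R : ℝ, 0 ≤ R →
    ∫ x in Metric.closedBall (0 : Space) R, (jb ‖x‖ ^ 2)⁻¹ ≤ C * R := by
  refine ⟨3 * (volume : Measure Space).real (Metric.ball 0 1), by positivity, fun R hR => ?_⟩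
  -- In polar coordinates the Jacobian r² cancels ⟨r⟩⁻² up to a factor at most 1; three times the
  -- volume of the unit ball is the area of the unit sphere.
  have h := integral_fun_norm_addHaar (volume : Measure Space)
    (fun r : ℝ => Set.indicator (Set.Iic R) (fun r => (jb r ^ 2)⁻¹) r)
  have e1 : ∫ x in Metric.closedBall (0 : Space) R, (jb ‖x‖ ^ 2)⁻¹ =
      ∫ x : Space, Set.indicator (Set.Iic R) (fun r => (jb r ^ 2)⁻¹) ‖x‖ := by
    rw [← integral_indicator measurableSet_closedBall]
    refine integral_congr_ae (Filter.Eventually.of_forall fun x => ?_)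
    classical
    simp only [Set.indicator_apply, mem_closedBall_zero_iff, Set.mem_Iic]
  rw [e1, h]
  have e2 : ∫ y in Set.Ioi (0 : ℝ), y ^ (Module.finrank ℝ Space - 1) •
      Set.indicator (Set.Iic R) (fun r => (jb r ^ 2)⁻¹) y ≤ R := by
    have e3 : ∀ y : ℝ, y ^ (Module.finrank ℝ Space - 1) •
      Set.indicator (Set.Iic R) (fun r => (jb r ^ 2)⁻¹) y
        = Set.indicator (Set.Iic R) (fun r => r ^ 2 * (jb r ^ 2)⁻¹) y := fun y => by
      simp [Set.indicator_apply]
    simp_rw [e3]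
    rw [integral_indicator measurableSet_Iic, Measure.restrict_restrict measurableSet_Iic,
      Set.Iic_inter_Ioi]
    have : ∫ y in Set.Ioc 0 R, y ^ 2 * (jb y ^ 2)⁻¹ ≤ ∫ y in Set.Ioc 0 R, (1 : ℝ) := by
      refine setIntegral_mono_on ?_ (by simp) measurableSet_Ioc fun y _ => ?_
      · refine (ContinuousOn.integrableOn_Icc ?_).mono_set Set.Ioc_subset_Icc_self
        refine Continuous.continuousOn ?_
        exact (continuous_id.pow 2).mul
          ((continuous_jb.pow 2).inv₀ fun y => (pow_pos (jb_pos y) 2).ne')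
      · rw [jb_sq, ← div_eq_mul_inv, div_le_one (by positivity)]; linarith
    refine this.trans ?_
    simp [hR]
  have hv : 0 ≤ (volume : Measure Space).real (Metric.ball 0 1) := by positivity
  simp only [nsmul_eq_mul, smul_eq_mul, finrank_euclideanSpace, Fintype.card_fin] at e2 ⊢
  push_cast
  nlinarith [mul_le_mul_of_nonneg_left e2 hv]

/-- The ball of radius R about 0 lies in the ball of radius 2R about x₀, and translation reduces to
the centred case. -/
lemma integral_jb_neg_two_ball : ∃ C : ℝ, 0 ≤ C ∧ ∀ (R : ℝ) (x₀ : Space), 0 ≤ R → ‖x₀‖ ≤ R →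
    ∫ x in Metric.closedBall (0 : Space) R, (jb ‖x - x₀‖ ^ 2)⁻¹ ≤ C * R := by
  obtain ⟨C, hC, h⟩ := integral_ball_jb_neg_two
  have hcont : ∀ x₀ : Space, Continuous (fun x : Space => (jb ‖x - x₀‖ ^ 2)⁻¹) := fun x₀ =>
    Continuous.inv₀ (by fun_prop) fun x => (pow_pos (jb_pos _) 2).ne'
  refine ⟨2 * C, by positivity, fun R x₀ hR hx₀ => ?_⟩
  have h1 : ∫ x in Metric.closedBall (0 : Space) R, (jb ‖x - x₀‖ ^ 2)⁻¹ ≤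
      ∫ x in Metric.closedBall x₀ (2 * R), (jb ‖x - x₀‖ ^ 2)⁻¹ := by
    refine setIntegral_mono_set ((hcont x₀).continuousOn.integrableOn_compact
      (isCompact_closedBall _ _)) (Filter.Eventually.of_forall fun x => ?_) ?_
    · positivity
    · refine Filter.Eventually.of_forall fun x hx => ?_
      have hx' : ‖x‖ ≤ R := by simpa using mem_closedBall_zero_iff.1 hx
      have : ‖x - x₀‖ ≤ 2 * R := (norm_sub_le _ _).trans (by linarith)
      exact (mem_closedBall_iff_norm.2 this)
  have h2 : ∫ x in Metric.closedBall x₀ (2 * R), (jb ‖x - x₀‖ ^ 2)⁻¹ =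
      ∫ x in Metric.closedBall (0 : Space) (2 * R), (jb ‖x‖ ^ 2)⁻¹ := by
    rw [← integral_indicator measurableSet_closedBall, ← integral_indicator measurableSet_closedBall]
    rw [← integral_sub_right_eq_self
      ((Metric.closedBall (0 : Space) (2 * R)).indicator fun x => (jb ‖x‖ ^ 2)⁻¹) x₀]
    refine integral_congr_ae (Filter.Eventually.of_forall fun x => ?_)
    classical
    simp only [Set.indicator_apply, mem_closedBall_iff_norm, sub_zero]
  have := h (2 * R) (by positivity)
  rw [h2] at h1
  linarith

end Kernels

/-! ### The weight `⟨x - x₀⟩⁻¹` -/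

section Weight

/-- The regularized Newton kernel `⟨x - x₀⟩⁻¹`. -/
def newt (x₀ : Space) : Spacetime → ℝ := fun z => (jb ‖z.2 - x₀‖)⁻¹

lemma jb_norm_sub_eq (x x₀ : Space) :
    jb ‖x - x₀‖ = Real.sqrt (1 + ((x 0 - x₀ 0) ^ 2 + (x 1 - x₀ 1) ^ 2 + (x 2 - x₀ 2) ^ 2)) := by
  rw [jb, norm_sq_coord]; rfl

lemma contDiff_newt (x₀ : Space) : ContDiff ℝ ∞ (newt x₀) := by
  have : newt x₀ = fun z : Spacetime => (Real.sqrt (1 + ((z.2 0 - x₀ 0) ^ 2 + (z.2 1 - x₀ 1) ^ 2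
      + (z.2 2 - x₀ 2) ^ 2)))⁻¹ := by
    ext z; rw [newt, jb_norm_sub_eq]
  rw [this]
  refine ContDiff.inv (ContDiff.sqrt (by fun_prop) fun z => by positivity) fun z => ?_
  exact (Real.sqrt_pos.2 (by positivity)).ne'

lemma newt_pos (x₀ : Space) (z : Spacetime) : 0 < newt x₀ z := inv_pos.2 (jb_pos _)

lemma newt_le_one (x₀ : Space) (z : Spacetime) : newt x₀ z ≤ 1 := inv_le_one_of_one_le₀ (one_le_jb _)

/-- This polynomial relation stands in for the explicit square root: the gradient and the Laplacian
of the weight are found by differentiating and reusing it. -/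
lemma newt_sq_mul (x₀ : Space) (z : Spacetime) :
    newt x₀ z * newt x₀ z * (1 + ((z.2 0 - x₀ 0) * (z.2 0 - x₀ 0) + (z.2 1 - x₀ 1) * (z.2 1 - x₀ 1)
      + (z.2 2 - x₀ 2) * (z.2 2 - x₀ 2))) = 1 := by
  have h1 : jb ‖z.2 - x₀‖ ^ 2 = 1 + ((z.2 0 - x₀ 0) * (z.2 0 - x₀ 0)
      + (z.2 1 - x₀ 1) * (z.2 1 - x₀ 1) + (z.2 2 - x₀ 2) * (z.2 2 - x₀ 2)) := by
    rw [jb_sq, norm_sq_coord]; simp only [PiLp.sub_apply]; ring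
  rw [← h1, newt]
  have := (jb_pos ‖z.2 - x₀‖).ne'
  field_simp

lemma pd_coord_sub (α : Fin 4) (i : Fin 3) (c : ℝ) :
    pd α (fun z => z.2 i - c) = fun _ => if α = i.succ then 1 else 0 := by
  rw [pd_sub α (contDiff_coord i) contDiff_const, pd_coord, pd_const]
  simp

lemma pd_newt (x₀ : Space) (i : Fin 3) (z : Spacetime) :
    pd i.succ (newt x₀) z = -(z.2 i - x₀ i) * newt x₀ z ^ 3 := by
  have hw := contDiff_newt x₀
  have h0 : pd i.succ (fun z => newt x₀ z * newt x₀ z * (1 + ((z.2 0 - x₀ 0) * (z.2 0 - x₀ 0)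
    + (z.2 1 - x₀ 1) * (z.2 1 - x₀ 1) + (z.2 2 - x₀ 2) * (z.2 2 - x₀ 2)))) z = 0 := by
    rw [show (fun z => newt x₀ z * newt x₀ z * (1 + ((z.2 0 - x₀ 0) * (z.2 0 - x₀ 0)
      + (z.2 1 - x₀ 1) * (z.2 1 - x₀ 1) + (z.2 2 - x₀ 2) * (z.2 2 - x₀ 2)))) = fun _ => 1 from
      funext (newt_sq_mul x₀), pd_const]
  rw [pd_mul _ (by fun_prop) (by fun_prop), pd_mul _ hw hw, pd_add _ (by fun_prop) (by fun_prop),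
    pd_add _ (by fun_prop) (by fun_prop), pd_add _ (by fun_prop) (by fun_prop), pd_const,
    pd_mul _ (by fun_prop) (by fun_prop), pd_mul _ (by fun_prop) (by fun_prop),
    pd_mul _ (by fun_prop) (by fun_prop), pd_coord_sub, pd_coord_sub, pd_coord_sub] at h0
  have h1 := newt_sq_mul x₀ z
  have hp := (newt_pos x₀ z).ne'
  have key : pd i.succ (newt x₀) z = -(newt x₀ z ^ 2 * newt x₀ z) * (z.2 i - x₀ i) := by
    have : 2 * (newt x₀ z) * ((newt x₀ z * pd i.succ (newt x₀) z) * (1 +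
        ((z.2 0 - x₀ 0) * (z.2 0 - x₀ 0) + (z.2 1 - x₀ 1) * (z.2 1 - x₀ 1)
        + (z.2 2 - x₀ 2) * (z.2 2 - x₀ 2))) + newt x₀ z ^ 2 * (z.2 i - x₀ i)) = 0 := by
      fin_cases i <;> simp [Fin.ext_iff] at h0 ⊢ <;> right <;> linarith
    have h3 := (mul_eq_zero.1 this).resolve_left (by simpa using hp)
    have h4 := congrArg (fun y => newt x₀ z * y) h3
    simp only [mul_zero] at h4
    linear_combination h4 - (pd i.succ (newt x₀) z) * h1
  rw [key]; ring

/-- The weight w is strictly superharmonic, because w²|x-x₀|² = 1 - w². This sign puts a term w⁵v²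
on the good side of the energy inequality, which controls v near x₀. -/
lemma lap_newt (x₀ : Space) (z : Spacetime) : lap (newt x₀) z = -3 * newt x₀ z ^ 5 := by
  have hw := contDiff_newt x₀
  have h : ∀ i : Fin 3, pd i.succ (newt x₀) =
      fun z => (-1) * ((z.2 i - x₀ i) * (newt x₀ z * (newt x₀ z * newt x₀ z))) := fun i => by
    ext z; rw [pd_newt]; ring
  have h2 : ∀ i : Fin 3, pd i.succ (pd i.succ (newt x₀)) z =
      -newt x₀ z ^ 3 + 3 * (z.2 i - x₀ i) ^ 2 * newt x₀ z ^ 5 := fun i => by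
    conv_lhs => rw [h]
    rw [pd_const_mul _ _ (by fun_prop), pd_mul _ (by fun_prop) (by fun_prop), pd_coord_sub,
      pd_mul _ hw (by fun_prop), pd_mul _ hw hw]
    simp only [if_true, pd_newt]
    ring
  have h1 := newt_sq_mul x₀ z
  simp only [lap, h2, Fin.sum_univ_three]
  linear_combination (3 * newt x₀ z ^ 3) * h1

lemma abs_pd_newt_le (x₀ : Space) (i : Fin 3) (z : Spacetime) :
    |pd i.succ (newt x₀) z| ≤ newt x₀ z ^ 2 := by
  rw [pd_newt, abs_mul, abs_neg, abs_of_pos (pow_pos (newt_pos x₀ z) 3)]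
  have h1 : |z.2 i - x₀ i| ≤ jb ‖z.2 - x₀‖ := by
    have h2 : |(z.2 - x₀) i| ≤ ‖z.2 - x₀‖ := by
      simpa using PiLp.norm_apply_le (z.2 - x₀) i
    exact (by simpa using h2 : |z.2 i - x₀ i| ≤ ‖z.2 - x₀‖).trans (le_jb _)
  have h3 : |z.2 i - x₀ i| * newt x₀ z ≤ 1 := by
    rw [newt, ← div_eq_mul_inv, div_le_one (jb_pos _)]; exact h1
  have h4 := pow_pos (newt_pos x₀ z) 2
  calc |z.2 i - x₀ i| * newt x₀ z ^ 3 = (|z.2 i - x₀ i| * newt x₀ z) * newt x₀ z ^ 2 := by ring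
    _ ≤ 1 * newt x₀ z ^ 2 := by gcongr
    _ = _ := one_mul _

end Weight

/-! ### A Sobolev inequality on slices -/

section Sobolev

variable {f : Spacetime → ℝ} {t : ℝ}

lemma enorm_le_lintegral_pd (hf : ContDiff ℝ ∞ f) (hc : SliceCompact t f) (i : Fin 3)
    (y : Fin 3 → ℝ) :
    ‖f (t, WithLp.toLp 2 y)‖ₑ ≤
      ∫⁻ s : ℝ, ‖pd i.succ f (t, WithLp.toLp 2 (Function.update y i s))‖ₑ := by
  set c : ℝ → Space := fun s => WithLp.toLp 2 (Function.update y i s) with hcdef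
  have hc1 : ∀ s, c s = WithLp.toLp 2 (Function.update y i 0) + s • EuclideanSpace.single i 1 := by
    intro s
    ext j
    by_cases hj : j = i
    · subst hj; simp [hcdef]
    · simp [hcdef, hj]
  have hc2 : c = fun s => WithLp.toLp 2 (Function.update y i 0)
      + s • (EuclideanSpace.single i 1 : Space) := funext hc1
  have hcs : ContDiff ℝ ∞ c := by
    rw [hc2]; fun_prop
  set F : ℝ → ℝ := fun s => f (t, c s) with hF
  have hFs : ContDiff ℝ ∞ F := (contDiff_slice hf t).comp hcs
  have hFd : ∀ s, deriv F s = pd i.succ f (t, c s) := by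
    intro s
    have h1 : HasDerivAt c (EuclideanSpace.single i 1 : Space) s := by
      rw [hc2]
      simpa using ((hasDerivAt_id s).smul_const (EuclideanSpace.single i 1 : Space)).const_add
        (WithLp.toLp 2 (Function.update y i 0))
    have h2 := (((contDiff_slice hf t).differentiable (by simp)) (c s)).hasFDerivAt.comp_hasDerivAt s h1
    rw [← fderiv_slice hf]
    exact h2.deriv
  have hFc : HasCompactSupport F := by
    obtain ⟨ρ, hρ⟩ := hc
    refine HasCompactSupport.of_support_subset_isCompact (isCompact_Icc (a := -ρ) (b := ρ)) ?_
    intro s hs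
    by_contra hcon
    apply hs
    refine hρ _ ?_
    have h3 : |s| ≤ ‖c s‖ := by
      have := PiLp.norm_apply_le (c s) i
      simpa [hcdef] using this
    refine lt_of_lt_of_le ?_ h3
    by_contra h4
    exact hcon (abs_le.1 (not_lt.1 h4))
  have h4 := hFc.enorm_le_lintegral_Ici_deriv (hFs.of_le (by simp)) (y i)
  have e : F (y i) = f (t, WithLp.toLp 2 y) := by simp [hF, hcdef]
  rw [e] at h4
  refine h4.trans ((lintegral_mono' Measure.restrict_le_self le_rfl).trans ?_)
  simp only [hFd]
  exact le_rfl

/-- The fundamental theorem of calculus in each of the three coordinates in turn. Only the mixed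
derivative ∂₁∂₂∂₃ occurs, so that a later cutoff produces no derivatives other than those along
sublists of [1, 2, 3]. -/
lemma abs_le_integral_mixed (hf : ContDiff ℝ ∞ f) (hc : SliceCompact t f) (x : Space) :
    |f (t, x)| ≤ ∫ y : Space, |pdl [1, 2, 3] f (t, y)| := by
  have hm : ∀ u : Spacetime → ℝ, ContDiff ℝ ∞ u →
      Measurable (fun y : Fin 3 → ℝ => ‖u (t, WithLp.toLp 2 y)‖ₑ) := fun u hu =>
    ((continuous_slice hu t).comp (PiLp.continuous_toLp 2 _)).measurable.enorm
  have step : ∀ (u : Spacetime → ℝ) (_ : ContDiff ℝ ∞ u) (_ : SliceCompact t u) (i : Fin 3)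
      (y : Fin 3 → ℝ), ‖u (t, WithLp.toLp 2 y)‖ₑ ≤
        (lmarginal (fun _ : Fin 3 => (volume : Measure ℝ)) {i}
          (fun y => ‖pd i.succ u (t, WithLp.toLp 2 y)‖ₑ)) y := by
    intro u hu huc i y
    rw [lmarginal_singleton]
    exact enorm_le_lintegral_pd hu huc i y
  set y : Fin 3 → ℝ := WithLp.ofLp x with hy
  have hf1 : ContDiff ℝ ∞ (pd 1 f) := by fun_prop
  have hf2 : ContDiff ℝ ∞ (pd 2 (pd 1 f)) := by fun_prop
  have hf3 : ContDiff ℝ ∞ (pd 3 (pd 2 (pd 1 f))) := by fun_prop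
  have hc1 : SliceCompact t (pd 1 f) := hc.pd hf 0
  have hc2 : SliceCompact t (pd 2 (pd 1 f)) := hc1.pd hf1 1
  have hc3 : SliceCompact t (pd 3 (pd 2 (pd 1 f))) := hc2.pd hf2 2
  have h1 : ‖f (t, x)‖ₑ ≤ ∫⁻ y : Fin 3 → ℝ, ‖pd 3 (pd 2 (pd 1 f)) (t, WithLp.toLp 2 y)‖ₑ := by
    calc ‖f (t, x)‖ₑ ≤ _ := step f hf hc 0 y
      _ ≤ _ := lmarginal_mono (fun y => step (pd 1 f) hf1 hc1 1 y) y
      _ ≤ _ := lmarginal_mono (lmarginal_mono (fun y => step (pd 2 (pd 1 f)) hf2 hc2 2 y)) y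
      _ = _ := by
        rw [show (Fin.succ 2 : Fin 4) = 3 from rfl, ← lmarginal_union _ _ (hm _ hf3) (by decide),
          ← lmarginal_union _ _ (hm _ hf3)
          (by decide), show ({0} ∪ ({1} ∪ {2}) : Finset (Fin 3)) = Finset.univ from by decide,
          lmarginal_univ]
        rfl
  have h2 : ∫⁻ y : Fin 3 → ℝ, ‖pd 3 (pd 2 (pd 1 f)) (t, WithLp.toLp 2 y)‖ₑ =
      ∫⁻ y : Space, ‖pd 3 (pd 2 (pd 1 f)) (t, y)‖ₑ := by
    have := (PiLp.volume_preserving_toLp (Fin 3)).lintegral_comp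
      (f := fun y : Space => ‖pd 3 (pd 2 (pd 1 f)) (t, y)‖ₑ)
      (continuous_slice hf3 t).measurable.enorm
    simpa using this
  rw [h2] at h1
  have hi := hc3.integrable hf3
  have h3 : ∫ y : Space, |pdl [1, 2, 3] f (t, y)| =
      (∫⁻ y : Space, ‖pd 3 (pd 2 (pd 1 f)) (t, y)‖ₑ).toReal := by
    rw [← integral_norm_eq_lintegral_enorm hi.aestronglyMeasurable]
    rfl
  rw [h3, ← Real.norm_eq_abs, ← toReal_enorm]
  exact ENNReal.toReal_mono hi.hasFiniteIntegral.ne h1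

/-- Unit-scale Sobolev inequality. -/
lemma sobolev_unit : ∃ C : ℝ, 0 ≤ C ∧ ∀ (f : Spacetime → ℝ) (_ : ContDiff ℝ ∞ f) (t : ℝ) (x₀ : Space)
    (q : Space → ℝ) (_ : ContinuousOn q (Metric.closedBall x₀ 2))
    (_ : ∀ x ∈ Metric.closedBall x₀ 2, ∀ l, l.Sublist [1, 2, 3] → pdl l f (t, x) ^ 2 ≤ q x),
    f (t, x₀) ^ 2 ≤ C * ∫ x in Metric.closedBall x₀ 2, q x := by
  obtain ⟨Cb, hCb0, hCb⟩ := exists_psdl_bound_le bumpB_contDiff bumpB.hasCompactSupport 3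
  set vol := (volume : Measure Space).real (Metric.closedBall (0 : Space) 2) with hvol
  refine ⟨(8 * Cb) ^ 2 * vol, by positivity, fun f hf t x₀ q hq hl => ?_⟩
  set B := Metric.closedBall x₀ 2
  have hBc : IsCompact B := isCompact_closedBall _ _
  have hBm : MeasurableSet B := measurableSet_closedBall
  -- The cutoff equals 1 at x₀ and lives in the ball of radius 2. The Leibniz rule for the mixed
  -- third derivative gives 8 = 2³ terms.
  set h : Spacetime → ℝ := fun z => spaceCut bumpB 1 x₀ z * f z with hh
  have hcut := contDiff_spaceCut bumpB_contDiff 1 x₀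
  have hhs : ContDiff ℝ ∞ h := hcut.mul hf
  have hz : ∀ x : Space, x ∉ B → ∀ l : List (Fin 4), pdl l (spaceCut bumpB 1 x₀) (t, x) = 0 := by
    intro x hx l
    rw [pdl_spaceCut bumpB_contDiff]
    have : 2 < ‖x - x₀‖ := by
      by_contra hcon
      exact hx (mem_closedBall_iff_norm.2 (not_lt.1 hcon))
    simp [spaceCut, psdl_bumpB_zero this]
  have hhc : SliceCompact t h := by
    refine ⟨‖x₀‖ + 2, fun x hx => ?_⟩
    have : x ∉ B := fun hxB => by
      have h1 := mem_closedBall_iff_norm.1 hxB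
      have h2 : ‖x‖ ≤ ‖x - x₀‖ + ‖x₀‖ := by simpa using norm_add_le (x - x₀) x₀
      linarith
    have := hz x this []
    simp only [pdl] at this
    simp [hh, this]
  have h1 := abs_le_integral_mixed hhs hhc x₀
  have e0 : h (t, x₀) = f (t, x₀) := by
    simp [hh, spaceCut, bumpB_one]
  rw [e0] at h1
  have hb : ∀ x, |pdl [1, 2, 3] h (t, x)| ≤ B.indicator (fun x => 8 * Cb * Real.sqrt (q x)) x := by
    intro x
    by_cases hx : x ∈ B
    · rw [Set.indicator_of_mem hx]
      have := abs_pdl_mul_le [1, 2, 3] hcut hf (z := (t, x)) (a := Cb) (b := Real.sqrt (q x))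
        (fun l hl' => by
          rw [pdl_spaceCut bumpB_contDiff]
          simpa [spaceCut] using hCb l (by simpa using hl'.length_le) _)
        (fun l hl' => Real.abs_le_sqrt (hl x hx l hl'))
      refine this.trans (le_of_eq ?_)
      norm_num
      ring
    · rw [Set.indicator_of_notMem hx]
      have := abs_pdl_mul_le [1, 2, 3] hcut hf (z := (t, x)) (a := 0)
        (b := |pdl [] f (t, x)| + |pdl [1] f (t, x)| + |pdl [2] f (t, x)| + |pdl [3] f (t, x)|
          + |pdl [1, 2] f (t, x)| + |pdl [1, 3] f (t, x)| + |pdl [2, 3] f (t, x)|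
          + |pdl [1, 2, 3] f (t, x)|)
        (fun l _ => by rw [hz x hx l, abs_zero])
        (fun l hl' => by
          have a (l : List (Fin 4)) := abs_nonneg (pdl l f (t, x))
          have := a []; have := a [1]; have := a [2]; have := a [3]
          have := a [1, 2]; have := a [1, 3]; have := a [2, 3]; have := a [1, 2, 3]
          have hmem := List.mem_sublists.2 hl'
          simp [List.sublists, List.foldr] at hmem
          rcases hmem with h | h | h | h | h | h | h | h <;> subst h <;> linarith)
      simpa using this
  have hsq : ContinuousOn (fun x => 8 * Cb * Real.sqrt (q x)) B :=
    continuousOn_const.mul (Real.continuous_sqrt.comp_continuousOn hq)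
  have hI : |f (t, x₀)| ≤ ∫ x in B, 8 * Cb * Real.sqrt (q x) := by
    refine h1.trans ?_
    rw [← integral_indicator hBm]
    refine integral_mono_of_nonneg (Filter.Eventually.of_forall fun x => abs_nonneg _)
      ((hsq.integrableOn_compact hBc).integrable_indicator hBm) (Filter.Eventually.of_forall hb)
  rw [integral_const_mul] at hI
  have hq0 : ∀ x ∈ B, 0 ≤ q x := fun x hx => (sq_nonneg _).trans (hl x hx [] (by simp))
  have hvB : (volume : Measure Space).real B = vol := by
    simp only [B, hvol, Measure.real]
    rw [Measure.addHaar_closedBall_center]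
  have cs : (∫ x in B, Real.sqrt (q x)) ^ 2 ≤ vol * ∫ x in B, q x := by
    have hi1 : IntegrableOn (fun x => Real.sqrt (q x)) B :=
      (Real.continuous_sqrt.comp_continuousOn hq).integrableOn_compact hBc
    have hi2 : IntegrableOn q B := hq.integrableOn_compact hBc
    set m := ∫ x in B, Real.sqrt (q x) with hm
    by_cases hv0 : vol = 0
    · have : (volume : Measure Space) B = 0 := by
        have := hvB
        rw [hv0, Measure.real, ENNReal.toReal_eq_zero_iff] at this
        exact this.resolve_right hBc.measure_lt_top.ne
      rw [hm, setIntegral_measure_zero _ this]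
      simp [hv0]
    have hvp : 0 < vol := lt_of_le_of_ne (by positivity) (Ne.symm hv0)
    -- Cauchy–Schwarz by expanding (√q - m/vol)² ≥ 0, where m/vol is the mean of √q over the ball.
    have hpt : ∫ x in B, (2 * (m / vol) * Real.sqrt (q x) - (m / vol) ^ 2) ≤ ∫ x in B, q x := by
      refine setIntegral_mono_on ((hi1.const_mul _).sub (integrableOn_const (hBc.measure_lt_top.ne)))
        hi2 hBm fun x hx => ?_
      nlinarith [sq_nonneg (Real.sqrt (q x) - m / vol), Real.sq_sqrt (hq0 x hx)]
    rw [integral_sub (hi1.const_mul _) (integrableOn_const (hBc.measure_lt_top.ne)),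
      integral_const_mul, ← hm, setIntegral_const, hvB, smul_eq_mul] at hpt
    have e1 : 2 * (m / vol) * m - vol * (m / vol) ^ 2 = m ^ 2 / vol := by field_simp; ring
    rw [e1, div_le_iff₀ hvp] at hpt
    linarith
  have h0 : 0 ≤ ∫ x in B, Real.sqrt (q x) := integral_nonneg fun x => Real.sqrt_nonneg _
  calc f (t, x₀) ^ 2 = |f (t, x₀)| ^ 2 := (sq_abs _).symm
    _ ≤ (8 * Cb * ∫ x in B, Real.sqrt (q x)) ^ 2 := by gcongr
    _ = (8 * Cb) ^ 2 * (∫ x in B, Real.sqrt (q x)) ^ 2 := by ring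
    _ ≤ (8 * Cb) ^ 2 * (vol * ∫ x in B, q x) := by gcongr
    _ = _ := by ring

end Sobolev

/-! ### Weights for the energy estimates on slices -/

section EnergyWeights

variable {f h : Spacetime → ℝ}

lemma lap_mul (hf : ContDiff ℝ ∞ f) (hh : ContDiff ℝ ∞ h) (z : Spacetime) :
    lap (fun y => f y * h y) z = f z * lap h z + 2 * (∑ i : Fin 3, pd i.succ f z * pd i.succ h z)
      + lap f z * h z := by
  have : ∀ i : Fin 3, pd i.succ (pd i.succ (fun y => f y * h y)) z =
      pd i.succ (pd i.succ f) z * h z + 2 * (pd i.succ f z * pd i.succ h z)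
        + f z * pd i.succ (pd i.succ h) z := fun i => by
    rw [pd_mul _ hf hh, pd_add _ (by fun_prop) (by fun_prop), pd_mul _ (by fun_prop) hh,
      pd_mul _ hf (by fun_prop)]
    ring
  simp only [lap, this, Fin.sum_univ_three]
  ring

lemma lap_sub (hf : ContDiff ℝ ∞ f) (hh : ContDiff ℝ ∞ h) (z : Spacetime) :
    lap (fun y => f y - h y) z = lap f z - lap h z := by
  have : ∀ i : Fin 3, pd i.succ (pd i.succ (fun y => f y - h y)) z =
      pd i.succ (pd i.succ f) z - pd i.succ (pd i.succ h) z := fun i => by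
    rw [pd_sub _ hf hh, pd_sub _ (by fun_prop) (by fun_prop)]
  simp only [lap, this, Finset.sum_sub_distrib]

/-- The coefficient `1 - r² / T²` of the Laplacian. -/
def lapCoeff (T : ℝ) : Spacetime → ℝ := fun z => 1 - ‖z.2‖ ^ 2 / T ^ 2

lemma lapCoeff_eq (T : ℝ) : lapCoeff T = fun z => 1 - (T ^ 2)⁻¹ * (z.2 0 * z.2 0 +
    (z.2 1 * z.2 1 + z.2 2 * z.2 2)) := by
  ext z; rw [lapCoeff, norm_sq_coord]; ring

lemma contDiff_lapCoeff (T : ℝ) : ContDiff ℝ ∞ (lapCoeff T) := by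
  rw [lapCoeff_eq]; fun_prop

lemma pd_lapCoeff (T : ℝ) (i : Fin 3) :
    pd i.succ (lapCoeff T) = fun z => (-2 * (T ^ 2)⁻¹) * z.2 i := by
  ext z
  rw [lapCoeff_eq, pd_sub _ (by fun_prop) (by fun_prop), pd_const, pd_const_mul _ _ (by fun_prop),
    pd_add _ (by fun_prop) (by fun_prop), pd_add _ (by fun_prop) (by fun_prop),
    pd_mul _ (by fun_prop) (by fun_prop), pd_mul _ (by fun_prop) (by fun_prop),
    pd_mul _ (by fun_prop) (by fun_prop), pd_coord, pd_coord, pd_coord]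
  fin_cases i <;> simp [Fin.ext_iff] <;> ring

lemma lap_lapCoeff (T : ℝ) (z : Spacetime) : lap (lapCoeff T) z = -6 * (T ^ 2)⁻¹ := by
  have : ∀ i : Fin 3, pd i.succ (pd i.succ (lapCoeff T)) z = -2 * (T ^ 2)⁻¹ := fun i => by
    rw [pd_lapCoeff, pd_const_mul _ _ (by fun_prop), pd_coord]; simp
  simp only [lap, this, Fin.sum_univ_three]
  ring

lemma lapCoeff_le_one (T : ℝ) (z : Spacetime) : lapCoeff T z ≤ 1 := by
  have : 0 ≤ ‖z.2‖ ^ 2 / T ^ 2 := by positivity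
  rw [lapCoeff]; linarith

lemma le_lapCoeff {T : ℝ} (hT : 0 < T) {z : Spacetime} (hz : ‖z.2‖ ≤ T / 2) :
    3 / 4 ≤ lapCoeff T z := by
  have h1 : ‖z.2‖ ^ 2 ≤ (T / 2) ^ 2 := by gcongr
  have : ‖z.2‖ ^ 2 / T ^ 2 ≤ 1 / 4 := by
    rw [div_le_iff₀ (by positivity)]; nlinarith
  rw [lapCoeff]; linarith

lemma abs_pd_lapCoeff_le {T : ℝ} (z : Spacetime) (i : Fin 3) :
    |pd i.succ (lapCoeff T) z| ≤ 2 * (T ^ 2)⁻¹ * ‖z.2‖ := by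
  rw [pd_lapCoeff]
  have h1 : |z.2 i| ≤ ‖z.2‖ := by simpa using PiLp.norm_apply_le z.2 i
  rw [abs_mul, abs_mul, abs_neg, abs_two, abs_of_nonneg (by positivity : 0 ≤ (T ^ 2)⁻¹)]
  gcongr

/-- The cutoff to the region between `|x| = R` and `|x| = ρ`. -/
def shellCut (R ρ : ℝ) : Spacetime → ℝ :=
  fun z => (1 - spaceCut bumpB R 0 z) * spaceCut bumpB ρ 0 z

lemma contDiff_shellCut (R ρ : ℝ) : ContDiff ℝ ∞ (shellCut R ρ) := by
  have h1 := contDiff_spaceCut bumpB_contDiff R 0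
  have h2 := contDiff_spaceCut bumpB_contDiff ρ 0
  unfold shellCut
  fun_prop

lemma norm_inv_smul {R : ℝ} (hR : 0 < R) (x : Space) : ‖R⁻¹ • (x - 0)‖ = ‖x‖ / R := by
  rw [sub_zero, norm_smul, norm_inv, Real.norm_of_nonneg hR.le]; ring

lemma psdl_spaceCut_bounds {C R : ℝ} (hR : 0 < R) {l : List (Fin 4)} (hl : l ≠ [])
    (hC : ∀ x, |psdl l bumpB x| ≤ C) (z : Spacetime) :
    |pdl l (spaceCut bumpB R 0) z| ≤
      C * R⁻¹ ^ l.length * (Metric.closedBall (0 : Space) (2 * R) \ Metric.ball 0 R).indicator 1 z.2 := by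
  rw [pdl_spaceCut bumpB_contDiff]
  by_cases hz : z.2 ∈ Metric.closedBall (0 : Space) (2 * R) \ Metric.ball 0 R
  · rw [Set.indicator_of_mem hz, Pi.one_apply, mul_one, abs_mul,
      abs_of_nonneg (by positivity : 0 ≤ R⁻¹ ^ l.length), mul_comm]
    gcongr
    exact hC _
  · rw [Set.indicator_of_notMem hz, mul_zero]
    have : spaceCut (psdl l bumpB) R 0 z = 0 := by
      unfold spaceCut
      by_cases h1 : ‖z.2‖ < R
      · refine psdl_bumpB_zero_of_lt hl ?_
        rw [norm_inv_smul hR]; rwa [div_lt_one hR]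
      · refine psdl_bumpB_zero ?_
        rw [norm_inv_smul hR, lt_div_iff₀ hR]
        by_contra h2
        exact hz ⟨by simpa using h2, by simpa using h1⟩
    simp [this]

lemma spaceCut_eq_one {R : ℝ} (hR : 0 < R) {z : Spacetime} (hz : ‖z.2‖ ≤ R) :
    spaceCut bumpB R 0 z = 1 :=
  bumpB_one (by rw [norm_inv_smul hR]; rwa [div_le_one hR])

lemma spaceCut_eq_zero {R : ℝ} (hR : 0 < R) {z : Spacetime} (hz : 2 * R ≤ ‖z.2‖) :
    spaceCut bumpB R 0 z = 0 :=
  bumpB_zero (by rw [norm_inv_smul hR, le_div_iff₀ hR]; exact hz)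

lemma spaceCut_mem_Icc (R : ℝ) (z : Spacetime) : spaceCut bumpB R 0 z ∈ Set.Icc (0 : ℝ) 1 :=
  ⟨bumpB.nonneg, bumpB.le_one⟩

/-- The annulus `R ≤ |x| ≤ ρ`. -/
def annulus (R ρ : ℝ) : Set Space := {x | R ≤ ‖x‖ ∧ ‖x‖ ≤ ρ}

lemma isCompact_annulus (R ρ : ℝ) : IsCompact (annulus R ρ) := by
  have : annulus R ρ = Metric.closedBall (0 : Space) ρ ∩ {x | R ≤ ‖x‖} := by
    ext x; simp [annulus, and_comm]
  rw [this]
  exact (isCompact_closedBall _ _).inter_right (isClosed_le continuous_const continuous_norm)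

lemma measurableSet_annulus (R ρ : ℝ) : MeasurableSet (annulus R ρ) :=
  (isCompact_annulus R ρ).measurableSet

/-- Bounds for the shell cutoff and its derivatives. -/
lemma exists_shellCut_bounds : ∃ C : ℝ, 0 ≤ C ∧ ∀ R ρ : ℝ, 1 ≤ R → 1 ≤ ρ → ∀ z : Spacetime,
    (∀ i : Fin 3, |pd i.succ (shellCut R ρ) z| ≤ C * ((annulus R (2 * R)).indicator 1 z.2
      + ρ⁻¹ * (annulus ρ (2 * ρ)).indicator 1 z.2)) ∧
    |lap (shellCut R ρ) z| ≤ C * ((annulus R (2 * R)).indicator 1 z.2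
      + ρ⁻¹ ^ 2 * (annulus ρ (2 * ρ)).indicator 1 z.2) := by
  obtain ⟨C, hC0, hC⟩ := exists_psdl_bound_le bumpB_contDiff bumpB.hasCompactSupport 2
  refine ⟨6 * C + 6 * C * C, by positivity, fun R ρ hR hρ z => ?_⟩
  have hset : ∀ R : ℝ, Metric.closedBall (0 : Space) (2 * R) \ Metric.ball 0 R
      = annulus R (2 * R) := fun R => by
    ext x; simp [annulus, and_comm]
  have b1 : ∀ (R : ℝ), 1 ≤ R → ∀ i : Fin 3, |pd i.succ (spaceCut bumpB R 0) z| ≤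
      C * R⁻¹ * (annulus R (2 * R)).indicator 1 z.2 := fun R hR i => by
    have := psdl_spaceCut_bounds (C := C) (R := R) (by linarith) (l := [i.succ]) (by simp)
      (hC _ (by simp)) z
    rw [hset] at this
    simpa [pdl] using this
  have b2 : ∀ (R : ℝ), 1 ≤ R → ∀ i : Fin 3, |pd i.succ (pd i.succ (spaceCut bumpB R 0)) z| ≤
      C * R⁻¹ ^ 2 * (annulus R (2 * R)).indicator 1 z.2 := fun R hR i => by
    have := psdl_spaceCut_bounds (C := C) (R := R) (by linarith) (l := [i.succ, i.succ]) (by simp)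
      (hC _ (by simp)) z
    rw [hset] at this
    simpa [pdl] using this
  have b3 : ∀ (R : ℝ), 1 ≤ R → |lap (spaceCut bumpB R 0) z| ≤
      3 * C * R⁻¹ ^ 2 * (annulus R (2 * R)).indicator 1 z.2 := fun R hR => by
    refine (Finset.abs_sum_le_sum_abs _ _).trans ?_
    refine (Finset.sum_le_sum fun i _ => b2 R hR i).trans (le_of_eq ?_)
    simp; ring
  have s1 := contDiff_spaceCut bumpB_contDiff R 0
  have s2 := contDiff_spaceCut bumpB_contDiff ρ 0
  have hn1 := spaceCut_mem_Icc R z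
  have hn2 := spaceCut_mem_Icc ρ z
  set χ₁ : ℝ := (annulus R (2 * R)).indicator 1 z.2 with hχ₁
  set χ₂ : ℝ := (annulus ρ (2 * ρ)).indicator 1 z.2 with hχ₂
  have hχ₁0 : 0 ≤ χ₁ := Set.indicator_nonneg (fun _ _ => zero_le_one) _
  have hχ₂0 : 0 ≤ χ₂ := Set.indicator_nonneg (fun _ _ => zero_le_one) _
  have hχ₂1 : χ₂ ≤ 1 := Set.indicator_le_self' (fun _ _ => zero_le_one) _
  have hRi : R⁻¹ ≤ 1 := inv_le_one_of_one_le₀ hR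
  have hρi : ρ⁻¹ ≤ 1 := inv_le_one_of_one_le₀ hρ
  have hRi0 : 0 ≤ R⁻¹ := by positivity
  have hρi0 : 0 ≤ ρ⁻¹ := by positivity
  have p1 : ∀ i : Fin 3, pd i.succ (fun y => 1 - spaceCut bumpB R 0 y) z =
      -pd i.succ (spaceCut bumpB R 0) z := fun i => by
    rw [pd_sub _ contDiff_const s1, pd_const]; simp
  have pl : lap (fun y => 1 - spaceCut bumpB R 0 y) z = -lap (spaceCut bumpB R 0) z := by
    rw [lap_sub contDiff_const s1]
    simp [lap, pd_const]
  -- Powers of R⁻¹ at the inner edge are discarded. At the outer edge the powers of ρ⁻¹ are kept: in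
  -- the outer estimate ρ = t/4, and they supply factors t⁻¹.
  have c1 : ∀ i : Fin 3, |pd i.succ (spaceCut bumpB R 0) z| ≤ C * χ₁ := fun i =>
    (b1 R hR i).trans (by
      have : C * R⁻¹ ≤ C := by nlinarith
      exact mul_le_mul_of_nonneg_right this hχ₁0)
  have c2 : ∀ i : Fin 3, |pd i.succ (spaceCut bumpB ρ 0) z| ≤ C * ρ⁻¹ * χ₂ := fun i => b1 ρ hρ i
  have c2' : ∀ i : Fin 3, |pd i.succ (spaceCut bumpB ρ 0) z| ≤ C := fun i =>
    (c2 i).trans (by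
      have h1 : ρ⁻¹ * χ₂ ≤ 1 := by nlinarith
      nlinarith)
  have c3 : |lap (spaceCut bumpB R 0) z| ≤ 3 * C * χ₁ := (b3 R hR).trans (by
    have h1 : R⁻¹ ^ 2 ≤ 1 := by nlinarith
    have : 3 * C * R⁻¹ ^ 2 ≤ 3 * C := by nlinarith
    exact mul_le_mul_of_nonneg_right this hχ₁0)
  have c4 : |lap (spaceCut bumpB ρ 0) z| ≤ 3 * C * ρ⁻¹ ^ 2 * χ₂ := b3 ρ hρ
  have q1 : |1 - spaceCut bumpB R 0 z| ≤ 1 := by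
    rw [abs_le]; constructor <;> linarith [hn1.1, hn1.2]
  have q2 : |spaceCut bumpB ρ 0 z| ≤ 1 := by
    rw [abs_le]; constructor <;> linarith [hn2.1, hn2.2]
  have hCC : 0 ≤ C * C := by positivity
  constructor
  · intro i
    have e : pd i.succ (shellCut R ρ) z = -pd i.succ (spaceCut bumpB R 0) z * spaceCut bumpB ρ 0 z
        + (1 - spaceCut bumpB R 0 z) * pd i.succ (spaceCut bumpB ρ 0) z := by
      unfold shellCut
      rw [pd_mul _ (by fun_prop) s2]
      simp only [p1]
    rw [e]
    refine (abs_add_le _ _).trans ?_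
    rw [abs_mul, abs_mul, abs_neg]
    have t1 : |pd i.succ (spaceCut bumpB R 0) z| * |spaceCut bumpB ρ 0 z| ≤ C * χ₁ * 1 :=
      mul_le_mul (c1 i) q2 (abs_nonneg _) (by positivity)
    have t2 : |1 - spaceCut bumpB R 0 z| * |pd i.succ (spaceCut bumpB ρ 0) z| ≤ 1 * (C * ρ⁻¹ * χ₂) :=
      mul_le_mul q1 (c2 i) (abs_nonneg _) zero_le_one
    have t3 : 0 ≤ (5 * C + 6 * C * C) * (χ₁ + ρ⁻¹ * χ₂) := by positivity
    nlinarith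
  · have e : lap (shellCut R ρ) z = (1 - spaceCut bumpB R 0 z) * lap (spaceCut bumpB ρ 0) z
        + 2 * (∑ i : Fin 3, -pd i.succ (spaceCut bumpB R 0) z * pd i.succ (spaceCut bumpB ρ 0) z)
        + -lap (spaceCut bumpB R 0) z * spaceCut bumpB ρ 0 z := by
      unfold shellCut
      rw [lap_mul (by fun_prop) s2, pl]
      simp only [p1]
    have t2 : |∑ i : Fin 3, -pd i.succ (spaceCut bumpB R 0) z * pd i.succ (spaceCut bumpB ρ 0) z|
        ≤ 3 * (C * χ₁ * C) := by
      refine (Finset.abs_sum_le_sum_abs _ _).trans ?_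
      refine (Finset.sum_le_sum (g := fun _ => C * χ₁ * C) fun i _ => ?_).trans (le_of_eq (by simp))
      rw [abs_mul, abs_neg]
      exact mul_le_mul (c1 i) (c2' i) (abs_nonneg _) (by positivity)
    have t1 : |(1 - spaceCut bumpB R 0 z) * lap (spaceCut bumpB ρ 0) z| ≤
        1 * (3 * C * ρ⁻¹ ^ 2 * χ₂) := by
      rw [abs_mul]; exact mul_le_mul q1 c4 (abs_nonneg _) zero_le_one
    have t3 : |-lap (spaceCut bumpB R 0) z * spaceCut bumpB ρ 0 z| ≤ 3 * C * χ₁ * 1 := by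
      rw [abs_mul, abs_neg]; exact mul_le_mul c3 q2 (abs_nonneg _) (by positivity)
    rw [e]
    refine (abs_add_le _ _).trans ((add_le_add (abs_add_le _ _) le_rfl).trans ?_)
    rw [abs_mul 2, abs_two]
    have t4 : 0 ≤ (3 * C) * χ₁ := by positivity
    have t5 : 0 ≤ (3 * C + 6 * C * C) * (ρ⁻¹ ^ 2 * χ₂) := by positivity
    nlinarith

end EnergyWeights

/-! ### Elliptic systems on a slice -/

section System

variable {I : Type*} {ι : Finset I} {i₀ : I} {v : I → Spacetime → ℝ} {C₁ s D t : ℝ}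

/-- The sum of the squared space gradients of a family on a slice. -/
def gradSq (ι : Finset I) (v : I → Spacetime → ℝ) (t : ℝ) (x : Space) : ℝ :=
  ∑ l ∈ ι, ∑ i : Fin 3, pd i.succ (v l) (t, x) ^ 2

/-- The size of the flux that is known a priori. -/
def fluxSrc (s D t : ℝ) (x : Space) : ℝ := D * ((t ^ 2)⁻¹ + t⁻¹ * jb ‖x‖ ^ (-1 - s))

/-- The size of the source that is known a priori. -/
def bulkSrc (s D t : ℝ) (x : Space) : ℝ :=
  D * ((t ^ 2)⁻¹ * (jb ‖x‖)⁻¹ + t⁻¹ * jb ‖x‖ ^ (-2 - s))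

/-- A family of functions that solves a perturbation of `(1 - r²/t²) Δ v = 0` in divergence form on
the slice at time `t`. -/
structure SliceSystem (ι : Finset I) (i₀ : I) (v : I → Spacetime → ℝ) (C₁ s D t : ℝ) : Prop where
  mem : i₀ ∈ ι
  smooth : ∀ l ∈ ι, ContDiff ℝ ∞ (v l)
  eqn : ∀ l ∈ ι, ∃ (G : Fin 3 → Spacetime → ℝ) (F : Spacetime → ℝ), (∀ i, ContDiff ℝ ∞ (G i)) ∧
    ContDiff ℝ ∞ F ∧
    (∀ x : Space, lapCoeff t (t, x) * lap (v l) (t, x)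
      = (∑ i : Fin 3, pd i.succ (G i) (t, x)) + F (t, x)) ∧
    ∀ x : Space, ‖x‖ ≤ t / 2 →
      (∀ i, |G i (t, x)| ≤ C₁ * (jb ‖x‖ ^ (-1 - s) *
        (Real.sqrt (gradSq ι v t x) + |v i₀ (t, x)|) + fluxSrc s D t x)) ∧
      |F (t, x)| ≤ C₁ * (jb ‖x‖ ^ (-2 - s) *
        (Real.sqrt (gradSq ι v t x) + |v i₀ (t, x)|) + bulkSrc s D t x)
  dom : ∀ l ∈ ι, ∀ x : Space, |v l (t, x)| ≤ |v i₀ (t, x)| + Real.sqrt (gradSq ι v t x)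
  apriori : ∀ l ∈ ι, ∀ x : Space, ‖x‖ ≤ t / 2 → |v l (t, x)| ≤ D * (jb ‖x‖)⁻¹ ∧
    ∀ i : Fin 3, |pd i.succ (v l) (t, x)| ≤ D * (jb ‖x‖)⁻¹

lemma gradSq_nonneg (ι : Finset I) (v : I → Spacetime → ℝ) (t : ℝ) (x : Space) :
    0 ≤ gradSq ι v t x :=
  Finset.sum_nonneg fun _ _ => Finset.sum_nonneg fun _ _ => sq_nonneg _

lemma continuous_gradSq (hv : ∀ l ∈ ι, ContDiff ℝ ∞ (v l)) : Continuous (gradSq ι v t) := by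
  unfold gradSq
  refine continuous_finsetSum _ fun l hl => continuous_finsetSum _ fun i _ => ?_
  exact (continuous_slice (contDiff_pd _ (hv l hl)) t).pow 2

lemma abs_pd_le_sqrt_gradSq {l : I} (hl : l ∈ ι) (i : Fin 3) (x : Space) :
    |pd i.succ (v l) (t, x)| ≤ Real.sqrt (gradSq ι v t x) := by
  refine Real.abs_le_sqrt ?_
  refine le_trans ?_ (Finset.single_le_sum (f := fun l => ∑ i : Fin 3, pd i.succ (v l) (t, x) ^ 2)
    (fun l _ => Finset.sum_nonneg fun _ _ => sq_nonneg _) hl)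
  exact Finset.single_le_sum (f := fun i : Fin 3 => pd i.succ (v l) (t, x) ^ 2)
    (fun i _ => sq_nonneg _) (Finset.mem_univ i)

lemma pd_eq_zero_of_vanish {u : Spacetime → ℝ} (hu : ContDiff ℝ ∞ u) {ρ : ℝ}
    (h : ∀ x : Space, ρ < ‖x‖ → u (t, x) = 0) (i : Fin 3) {x : Space} (hx : ρ < ‖x‖) :
    pd i.succ u (t, x) = 0 := by
  rw [← fderiv_slice hu]
  have : (fun y : Space => u (t, y)) =ᶠ[nhds x] fun _ => 0 := by
    filter_upwards [(isOpen_lt continuous_const continuous_norm).mem_nhds hx] with y hy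
    exact h y hy
  rw [this.fderiv_eq]
  simp

lemma lap_eq_zero_of_vanish {u : Spacetime → ℝ} (hu : ContDiff ℝ ∞ u) {ρ : ℝ}
    (h : ∀ x : Space, ρ < ‖x‖ → u (t, x) = 0) {x : Space} (hx : ρ < ‖x‖) : lap u (t, x) = 0 :=
  Finset.sum_eq_zero fun i _ => pd_eq_zero_of_vanish (contDiff_pd _ hu)
    (fun _ hy => pd_eq_zero_of_vanish hu h i hy) i hx

/-- The weighted energy inequality for a slice system. -/
lemma SliceSystem.weighted_energy (S : SliceSystem ι i₀ v C₁ s D t) {W : Spacetime → ℝ}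
    (hW : ContDiff ℝ ∞ W) (hW0 : ∀ x, 0 ≤ W (t, x)) (hWs : ∀ x : Space, t / 2 < ‖x‖ → W (t, x) = 0)
    {om : Space → ℝ} (hom : ∀ (x : Space) (i : Fin 3), ‖x‖ ≤ t / 2 → |pd i.succ W (t, x)| ≤ om x)
    {B : Space → ℝ} (hB : ∀ l ∈ ι, ∀ x : Space, |v l (t, x)| ≤ B x)
    {R : Space → ℝ} (hRi : Integrable R) (hR0 : ∀ x : Space, t / 2 < ‖x‖ → 0 ≤ R x)
    (hR : ∀ x : Space, ‖x‖ ≤ t / 2 →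
      (∑ l ∈ ι, 1 / 2 * v l (t, x) ^ 2 * lap (fun z => lapCoeff t z * W z) (t, x))
      + ι.card * (3 * (C₁ * (jb ‖x‖ ^ (-1 - s) * (Real.sqrt (gradSq ι v t x) + |v i₀ (t, x)|)
          + fluxSrc s D t x)) * (om x * B x
            + W (t, x) * Real.sqrt (gradSq ι v t x))
        + (C₁ * (jb ‖x‖ ^ (-2 - s) * (Real.sqrt (gradSq ι v t x) + |v i₀ (t, x)|)
          + bulkSrc s D t x)) * (W (t, x) * B x)) ≤ R x) :
    ∫ x : Space, lapCoeff t (t, x) * W (t, x) * gradSq ι v t x ≤ ∫ x, R x := by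
  have hb := contDiff_lapCoeff t
  have hWc : SliceCompact t W := ⟨t / 2, hWs⟩
  choose! G F hG hF heq hbd using S.eqn
  set E : I → Space → ℝ := fun l x =>
    1 / 2 * v l (t, x) ^ 2 * lap (fun z => lapCoeff t z * W z) (t, x)
      + (∑ i : Fin 3, G l i (t, x) * pd i.succ (fun z => W z * v l z) (t, x))
      - F l (t, x) * (W (t, x) * v l (t, x)) with hE
  have hbWs : ∀ x : Space, t / 2 < ‖x‖ → (fun z => lapCoeff t z * W z) (t, x) = 0 := fun x hx => by
    simp [hWs x hx]
  have hEc : ∀ l ∈ ι, Continuous (E l) := by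
    intro l hl
    have h1 := continuous_slice (S.smooth l hl) t
    have h2 := continuous_slice (contDiff_lap (hb.mul hW)) t
    have h3 : ∀ i, Continuous (fun x : Space => G l i (t, x)) := fun i => continuous_slice (hG l hl i) t
    have h4 : ∀ i : Fin 3, Continuous (fun x : Space => pd i.succ (fun z => W z * v l z) (t, x)) :=
      fun i => continuous_slice (contDiff_pd _ (hW.mul (S.smooth l hl))) t
    have h5 := continuous_slice hW t
    have h6 := continuous_slice (hF l hl) t
    simp only [hE]
    exact (((continuous_const.mul (h1.pow 2)).mul h2).add
      (continuous_finsetSum _ fun i _ => (h3 i).mul (h4 i))).sub (h6.mul (h5.mul h1))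
  have hE0 : ∀ l ∈ ι, ∀ x : Space, t / 2 < ‖x‖ → E l x = 0 := by
    intro l hl x hx
    have h1 := lap_eq_zero_of_vanish (t := t) (hb.mul hW) hbWs hx
    have h2 : ∀ i : Fin 3, pd i.succ (fun z => W z * v l z) (t, x) = 0 := fun i =>
      pd_eq_zero_of_vanish (hW.mul (S.smooth l hl)) (ρ := t / 2)
        (fun y hy => by simp [hWs y hy]) i hx
    simp only [hE, h1, h2, hWs x hx]
    simp
  have hEi : ∀ l ∈ ι, Integrable (E l) := fun l hl => by
    refine (hEc l hl).integrable_of_hasCompactSupport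
      (HasCompactSupport.of_support_subset_isCompact (isCompact_closedBall (0 : Space) (t / 2)) ?_)
    intro x hx
    by_contra hcon
    exact hx (hE0 l hl x (by simpa using hcon))
  have hid : ∫ x : Space, lapCoeff t (t, x) * W (t, x) * gradSq ι v t x = ∫ x, ∑ l ∈ ι, E l x := by
    rw [integral_finsetSum _ hEi]
    have : ∀ x : Space, lapCoeff t (t, x) * W (t, x) * gradSq ι v t x =
        ∑ l ∈ ι, lapCoeff t (t, x) * W (t, x) * ∑ i : Fin 3, pd i.succ (v l) (t, x) ^ 2 := fun x => by
      rw [gradSq, Finset.mul_sum]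
    simp_rw [this]
    rw [integral_finsetSum]
    · refine Finset.sum_congr rfl fun l hl => ?_
      exact energy_identity (S.smooth l hl) hW hWc hb (hG l hl) (heq l hl)
    · intro l hl
      have := S.smooth l hl
      exact SliceCompact.integrable (t := t)
        (u := fun z => lapCoeff t z * W z * ∑ i : Fin 3, pd i.succ (v l) z ^ 2) (by fun_prop)
        ((hWc.mul_right (lapCoeff t)).mul_left _)
  rw [hid]
  refine integral_mono (integrable_finsetSum _ hEi) hRi fun x => ?_
  rcases lt_or_ge (t / 2) ‖x‖ with hx | hx
  · change ∑ l ∈ ι, E l x ≤ R x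
    rw [Finset.sum_eq_zero fun l hl => hE0 l hl x hx]
    exact hR0 x hx
  · refine le_trans ?_ (hR x hx)
    rw [← nsmul_eq_mul, ← Finset.sum_const, ← Finset.sum_add_distrib]
    refine Finset.sum_le_sum fun l hl => ?_
    set q := Real.sqrt (gradSq ι v t x)
    set φ := |v i₀ (t, x)|
    obtain ⟨hGb, hFb⟩ := hbd l hl x hx
    set Γ := C₁ * (jb ‖x‖ ^ (-1 - s) * (q + φ) + fluxSrc s D t x)
    set Φ := C₁ * (jb ‖x‖ ^ (-2 - s) * (q + φ) + bulkSrc s D t x)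
    have hvl := hB l hl x
    have hom0 : 0 ≤ om x := (abs_nonneg _).trans (hom x 0 hx)
    have hΓ0 : 0 ≤ Γ := (abs_nonneg _).trans (hGb 0)
    have hΦ0 : 0 ≤ Φ := (abs_nonneg _).trans hFb
    have hq0 : 0 ≤ q := Real.sqrt_nonneg _
    have hφ0 : 0 ≤ φ := abs_nonneg _
    -- The test function Wv differs from member to member, but |∇W| ≤ om, |v_l| ≤ B and |∇v_l| ≤ q
    -- hold for the whole family, so the sum over it only costs its cardinality.
    have hpd : ∀ i : Fin 3, |pd i.succ (fun z => W z * v l z) (t, x)| ≤ om x * B x + W (t, x) * q := by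
      intro i
      rw [pd_mul _ hW (S.smooth l hl)]
      refine (abs_add_le _ _).trans ?_
      rw [abs_mul, abs_mul, abs_of_nonneg (hW0 x)]
      exact add_le_add (mul_le_mul (hom x i hx) hvl (abs_nonneg _) hom0)
        (mul_le_mul_of_nonneg_left (abs_pd_le_sqrt_gradSq hl i x) (hW0 x))
    have h1 : ∑ i : Fin 3, G l i (t, x) * pd i.succ (fun z => W z * v l z) (t, x) ≤
        3 * Γ * (om x * B x + W (t, x) * q) := by
      refine (le_abs_self _).trans ((Finset.abs_sum_le_sum_abs _ _).trans ?_)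
      refine (Finset.sum_le_sum (g := fun _ => Γ * (om x * B x + W (t, x) * q)) fun i _ => ?_).trans
        (le_of_eq (by simp; ring))
      rw [abs_mul]
      exact mul_le_mul (hGb i) (hpd i) (abs_nonneg _) hΓ0
    have h2 : -(F l (t, x) * (W (t, x) * v l (t, x))) ≤ Φ * (W (t, x) * B x) := by
      refine (neg_le_abs _).trans ?_
      rw [abs_mul, abs_mul, abs_of_nonneg (hW0 x)]
      exact mul_le_mul hFb (mul_le_mul_of_nonneg_left hvl (hW0 x))
        (mul_nonneg (hW0 x) (abs_nonneg _)) hΦ0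
    simp only [hE]
    linarith

end System

/-! ### Absorbing the perturbation -/

section Absorb

lemma mul_le_amgm {x y δ : ℝ} (hδ : 0 < δ) : x * y ≤ δ * x ^ 2 + (4 * δ)⁻¹ * y ^ 2 := by
  have h : δ * x ^ 2 + (4 * δ)⁻¹ * y ^ 2 - x * y = δ * (x - (2 * δ)⁻¹ * y) ^ 2 := by
    field_simp; ring
  nlinarith [mul_nonneg hδ.le (sq_nonneg (x - (2 * δ)⁻¹ * y))]

/-- For A₁ small the terms quadratic in q go into the energy: they add up to 21kδ ≤ 1/8 with δ =
(200(k+1))⁻¹. The cross terms A₁wqφ cost A₁²wφ², and A₁² ≤ A₂ turns this into A₂wφ². Thus φ² only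
meets A₁w² + A₂w, a kernel of total decay 3 + s when A₁ = ⟨r⟩^{-1-s}, A₂ = ⟨r⟩^{-2-s} and w =
⟨x-x₀⟩⁻¹. -/
lemma quad_absorb {k w A₁ A₂ q φ s₁ s₂ : ℝ} (hk : 0 ≤ k) (hw : 0 ≤ w) (hw1 : w ≤ 1)
    (hA₁ : 0 ≤ A₁) (hA₂ : 0 ≤ A₂) (hA21 : A₂ ≤ A₁) (hA12 : A₁ ^ 2 ≤ A₂) (hq : 0 ≤ q) (hφ : 0 ≤ φ)
    (hs₁ : 0 ≤ s₁) (hs₂ : 0 ≤ s₂) (hs : s₂ ≤ s₁) (hA : A₁ ≤ (200 * (k + 1))⁻¹) :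
    3 * k * ((A₁ * (q + φ) + s₁) * (w ^ 2 * (φ + q) + w * q))
      + k * ((A₂ * (q + φ) + s₂) * (w * (φ + q))) ≤
    1 / 8 * (w * q ^ 2) + 1000 * (k + 1) ^ 2 *
      ((A₁ * w ^ 2 + A₂ * w) * φ ^ 2 + (s₁ * w ^ 2 + s₂ * w) * φ + w * s₁ ^ 2) := by
  have k1 : k ≤ (k + 1) ^ 2 := by nlinarith
  have k2 : k * (k + 1) ≤ (k + 1) ^ 2 := by nlinarith
  have k0 : 0 ≤ (k + 1) ^ 2 := sq_nonneg _
  have hkδ : k * (21 * (200 * (k + 1))⁻¹) ≤ 1 / 8 := by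
    rw [show k * (21 * (200 * (k + 1))⁻¹) = 21 * k / (200 * (k + 1)) by field_simp,
      div_le_iff₀ (by positivity)]
    linarith
  have c1 : k * 6 ≤ 1000 * (k + 1) ^ 2 := by linarith
  have c2 : k * (150 * (k + 1) + 2) ≤ 1000 * (k + 1) ^ 2 := by linarith
  have c3 : k * 3 ≤ 1000 * (k + 1) ^ 2 := by linarith
  have c4 : k * 1 ≤ 1000 * (k + 1) ^ 2 := by linarith
  have c5 : k * (350 * (k + 1)) ≤ 1000 * (k + 1) ^ 2 := by linarith
  set δ : ℝ := (200 * (k + 1))⁻¹ with hδ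
  have hδ0 : 0 < δ := by positivity
  have hδi : (4 * δ)⁻¹ = 50 * (k + 1) := by rw [hδ]; field_simp; norm_num
  have hw2 : w ^ 2 ≤ w := by nlinarith
  have hw20 : 0 ≤ w ^ 2 := sq_nonneg w
  have hq2 : 0 ≤ q ^ 2 := sq_nonneg q
  have hφ2 : 0 ≤ φ ^ 2 := sq_nonneg φ
  have hsq : (q + φ) ^ 2 ≤ 2 * q ^ 2 + 2 * φ ^ 2 := by nlinarith [sq_nonneg (q - φ)]
  have hwq : 0 ≤ w * q ^ 2 := by positivity
  have B := mul_le_amgm (x := q) (y := A₁ * φ) hδ0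
  have Bs := mul_le_amgm (x := q) (y := s₁) hδ0
  rw [hδi] at B Bs
  have t1 : A₁ * w ^ 2 * (q + φ) ^ 2 ≤ 2 * δ * (w * q ^ 2) + 2 * (A₁ * w ^ 2 * φ ^ 2) := by
    have h1 : A₁ * w ^ 2 * (q + φ) ^ 2 ≤ A₁ * w ^ 2 * (2 * q ^ 2 + 2 * φ ^ 2) := by gcongr
    have h2 : A₁ * w ^ 2 * q ^ 2 ≤ δ * w * q ^ 2 := by gcongr
    linarith
  have t2 : A₁ * (w * (q * (q + φ))) ≤ 2 * δ * (w * q ^ 2) + 50 * (k + 1) * (A₂ * w * φ ^ 2) := by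
    have h1 : A₁ * (w * q ^ 2) ≤ δ * (w * q ^ 2) := by gcongr
    have h2 : w * (q * (A₁ * φ)) ≤ w * (δ * q ^ 2 + 50 * (k + 1) * (A₁ * φ) ^ 2) := by gcongr
    have h3 : (A₁ * φ) ^ 2 ≤ A₂ * φ ^ 2 := by rw [mul_pow]; gcongr
    have h4 : 50 * (k + 1) * (w * (A₁ * φ) ^ 2) ≤ 50 * (k + 1) * (w * (A₂ * φ ^ 2)) := by gcongr
    linarith
  have t3 : s₁ * (w * q) ≤ δ * (w * q ^ 2) + 50 * (k + 1) * (w * s₁ ^ 2) := by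
    have h2 : w * (q * s₁) ≤ w * (δ * q ^ 2 + 50 * (k + 1) * s₁ ^ 2) := by gcongr
    linarith
  have t4 : s₁ * (w ^ 2 * (φ + q)) ≤ s₁ * w ^ 2 * φ + s₁ * (w * q) := by
    have : s₁ * (w ^ 2 * q) ≤ s₁ * (w * q) := by gcongr
    linarith
  have t5 : A₂ * (w * (q + φ) ^ 2) ≤ 2 * δ * (w * q ^ 2) + 2 * (A₂ * w * φ ^ 2) := by
    have h1 : A₂ * (w * (q + φ) ^ 2) ≤ A₂ * (w * (2 * q ^ 2 + 2 * φ ^ 2)) := by gcongr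
    have h2 : A₂ * (w * q ^ 2) ≤ δ * (w * q ^ 2) := by gcongr; linarith
    linarith
  have t6 : s₂ * (w * (φ + q)) ≤ s₂ * w * φ + s₁ * (w * q) := by
    have : s₂ * (w * q) ≤ s₁ * (w * q) := by gcongr
    linarith
  have hsum : 3 * ((A₁ * (q + φ) + s₁) * (w ^ 2 * (φ + q) + w * q))
      + ((A₂ * (q + φ) + s₂) * (w * (φ + q))) ≤
      21 * δ * (w * q ^ 2) + (6 * (A₁ * w ^ 2 * φ ^ 2) + (150 * (k + 1) + 2) * (A₂ * w * φ ^ 2)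
        + 3 * (s₁ * w ^ 2 * φ) + s₂ * w * φ + 350 * (k + 1) * (w * s₁ ^ 2)) := by
    have e : 3 * ((A₁ * (q + φ) + s₁) * (w ^ 2 * (φ + q) + w * q))
        + ((A₂ * (q + φ) + s₂) * (w * (φ + q))) =
        3 * (A₁ * w ^ 2 * (q + φ) ^ 2) + 3 * (A₁ * (w * (q * (q + φ)))) + 3 * (s₁ * (w ^ 2 * (φ + q)))
        + 3 * (s₁ * (w * q)) + A₂ * (w * (q + φ) ^ 2) + s₂ * (w * (φ + q)) := by ring
    rw [e]
    linarith
  have hfin := mul_le_mul_of_nonneg_left hsum hk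
  have a1 : 0 ≤ A₁ * w ^ 2 * φ ^ 2 := by positivity
  have a2 : 0 ≤ A₂ * w * φ ^ 2 := by positivity
  have a3 : 0 ≤ s₁ * w ^ 2 * φ := by positivity
  have a4 : 0 ≤ s₂ * w * φ := by positivity
  have a5 : 0 ≤ w * s₁ ^ 2 := by positivity
  have d0 := mul_le_mul_of_nonneg_right hkδ hwq
  have d1 := mul_le_mul_of_nonneg_right c1 a1
  have d2 := mul_le_mul_of_nonneg_right c2 a2
  have d3 := mul_le_mul_of_nonneg_right c3 a3
  have d4 := mul_le_mul_of_nonneg_right c4 a4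
  have d5 := mul_le_mul_of_nonneg_right c5 a5
  linarith

end Absorb

/-! ### The weight of the outer estimate -/

section Shell

lemma indicator_one_mem_Icc (s : Set Space) (x : Space) :
    s.indicator (1 : Space → ℝ) x ∈ Set.Icc (0 : ℝ) 1 := by
  by_cases h : x ∈ s <;> simp [h]

lemma shellCut_mem_Icc (R ρ : ℝ) (z : Spacetime) : shellCut R ρ z ∈ Set.Icc (0 : ℝ) 1 := by
  obtain ⟨h1, h2⟩ := spaceCut_mem_Icc R z
  obtain ⟨h3, h4⟩ := spaceCut_mem_Icc ρ z
  constructor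
  · exact mul_nonneg (by linarith) h3
  · exact mul_le_one₀ (by linarith) h3 h4

lemma abs_sum_mul_le {a b : Fin 3 → ℝ} {A B : ℝ} (ha : ∀ i, |a i| ≤ A) (hb : ∀ i, |b i| ≤ B) :
    |∑ i, a i * b i| ≤ 3 * (A * B) := by
  have hA : 0 ≤ A := (abs_nonneg _).trans (ha 0)
  refine (Finset.abs_sum_le_sum_abs _ _).trans ?_
  refine (Finset.sum_le_sum (g := fun _ => A * B) fun i _ => ?_).trans (le_of_eq (by simp))
  rw [abs_mul]
  exact mul_le_mul (ha i) (hb i) (abs_nonneg _) hA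

/-- The good term has coefficient 9/4 = 3·(3/4), from Δw = -3w⁵ and 1 - r²/t² ≥ 3/4 in r ≤ t/2. The
gradient of 1 - r²/t², of size 2t⁻²r, against ηw² gives the factor 12 = 2·3·2. The Laplacian of 1 -
r²/t² has a favourable sign and is dropped. All other terms come from derivatives of the cutoff. -/
lemma exists_shell_weight_bounds : ∃ C : ℝ, 0 ≤ C ∧ ∀ R t : ℝ, 1 ≤ R → 4 ≤ t → ∀ x₀ x : Space,
    ‖x‖ ≤ t / 2 →
    (∀ i : Fin 3, |pd i.succ (fun z => shellCut R (t / 4) z * newt x₀ z) (t, x)| ≤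
      shellCut R (t / 4) (t, x) * newt x₀ (t, x) ^ 2 + C * ((annulus R (2 * R)).indicator 1 x
        + t⁻¹ * (annulus (t / 4) (t / 2)).indicator 1 x) * newt x₀ (t, x)) ∧
    lap (fun z => lapCoeff t z * (shellCut R (t / 4) z * newt x₀ z)) (t, x) ≤
      -(9 / 4) * (shellCut R (t / 4) (t, x) * newt x₀ (t, x) ^ 5)
      + 12 * (shellCut R (t / 4) (t, x) * (t⁻¹ ^ 2 * ‖x‖ * newt x₀ (t, x) ^ 2))
      + C * ((annulus R (2 * R)).indicator 1 x * newt x₀ (t, x)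
        + (annulus (t / 4) (t / 2)).indicator 1 x *
          (t⁻¹ * newt x₀ (t, x) ^ 2 + t⁻¹ ^ 2 * newt x₀ (t, x))) := by
  obtain ⟨C, hC0, hC⟩ := exists_shellCut_bounds
  refine ⟨40 * C, by positivity, fun R t hR ht x₀ x hx => ?_⟩
  have ht0 : 0 < t := by linarith
  obtain ⟨h1, h2⟩ := hC R (t / 4) hR (by linarith) (t, x)
  simp only at h1 h2
  have e2 : 2 * (t / 4) = t / 2 := by ring
  have e3 : (t / 4)⁻¹ = 4 * t⁻¹ := by field_simp
  rw [e2, e3] at h1 h2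
  have hηs := contDiff_shellCut R (t / 4)
  have hws := contDiff_newt x₀
  have hbs := contDiff_lapCoeff t
  obtain ⟨hη0, hη1⟩ := shellCut_mem_Icc R (t / 4) (t, x)
  have hw0 := newt_pos x₀ (t, x)
  have hw1 := newt_le_one x₀ (t, x)
  obtain ⟨hP0, hP1⟩ := indicator_one_mem_Icc (annulus R (2 * R)) x
  obtain ⟨hQ0, hQ1⟩ := indicator_one_mem_Icc (annulus (t / 4) (t / 2)) x
  have hdw := fun i => abs_pd_newt_le x₀ i (t, x)
  have hlw := lap_newt x₀ (t, x)
  have hdb := fun i => abs_pd_lapCoeff_le (T := t) (t, x) i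
  have hlb := lap_lapCoeff t (t, x)
  have hb1 := lapCoeff_le_one t (t, x)
  have hb0 := le_lapCoeff ht0 (z := (t, x)) hx
  have hpd : ∀ i : Fin 3, pd i.succ (fun z => shellCut R (t / 4) z * newt x₀ z) (t, x) =
      pd i.succ (shellCut R (t / 4)) (t, x) * newt x₀ (t, x)
        + shellCut R (t / 4) (t, x) * pd i.succ (newt x₀) (t, x) := fun i => by
    rw [pd_mul _ hηs hws]
  have hτ : 0 < t⁻¹ := by positivity
  have hτ1 : t⁻¹ ≤ 1 := inv_le_one_of_one_le₀ (by linarith)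
  have hrt : t⁻¹ ^ 2 * ‖x‖ ≤ 1 / 2 * t⁻¹ := by
    calc t⁻¹ ^ 2 * ‖x‖ ≤ t⁻¹ ^ 2 * (t / 2) := by gcongr
      _ = 1 / 2 * t⁻¹ := by field_simp
  have hr0 : 0 ≤ t⁻¹ ^ 2 * ‖x‖ := by positivity
  have et : (t ^ 2)⁻¹ = t⁻¹ ^ 2 := by rw [inv_pow]
  simp only at hdb
  rw [et] at hdb hlb
  generalize annulus R (2 * R) = S₁ at *
  generalize annulus (t / 4) (t / 2) = S₂ at *
  set P : ℝ := S₁.indicator 1 x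
  set Q : ℝ := S₂.indicator 1 x
  set τ := t⁻¹
  set w := newt x₀ (t, x)
  set η := shellCut R (t / 4) (t, x)
  set d := C * (P + 4 * τ * Q) with hd
  have hd0 : 0 ≤ d := by positivity
  have hpd' : ∀ i : Fin 3, |pd i.succ (fun z => shellCut R (t / 4) z * newt x₀ z) (t, x)| ≤
      d * w + η * w ^ 2 := fun i => by
    rw [hpd]
    refine (abs_add_le _ _).trans ?_
    rw [abs_mul, abs_mul, abs_of_pos hw0, abs_of_nonneg hη0]
    exact add_le_add (mul_le_mul_of_nonneg_right (h1 i) hw0.le)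
      (mul_le_mul_of_nonneg_left (hdw i) hη0)
  have hPw : 0 ≤ C * (P * w) := by positivity
  have hQw : 0 ≤ C * (τ * (Q * w)) := by positivity
  have hQw2 : 0 ≤ C * (τ ^ 2 * (Q * w)) := by positivity
  have hQw3 : 0 ≤ C * (τ * (Q * w ^ 2)) := by positivity
  refine ⟨fun i => (hpd' i).trans ?_, ?_⟩
  · rw [hd]; linarith
  · rw [lap_mul hbs (hηs.mul hws), lap_mul hηs hws, hlw, hlb]
    have s1 := (le_abs_self _).trans (abs_sum_mul_le h1 hdw)
    have s2 := (le_abs_self _).trans (abs_sum_mul_le hdb hpd')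
    have s3 : lap (shellCut R (t / 4)) (t, x) * w ≤ C * (P + (4 * τ) ^ 2 * Q) * w :=
      mul_le_mul_of_nonneg_right ((le_abs_self _).trans h2) hw0.le
    have n3 : 0 ≤ C * (P + (4 * τ) ^ 2 * Q) * w := by positivity
    have n1 : 0 ≤ 3 * (d * w ^ 2) := by positivity
    have b1 : lapCoeff t (t, x) * (2 * (3 * (d * w ^ 2)) + C * (P + (4 * τ) ^ 2 * Q) * w) ≤
        2 * (3 * (d * w ^ 2)) + C * (P + (4 * τ) ^ 2 * Q) * w :=
      mul_le_of_le_one_left (by linarith) hb1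
    have b2 : 3 / 4 * (3 * (η * w ^ 5)) ≤ lapCoeff t (t, x) * (3 * (η * w ^ 5)) :=
      mul_le_mul_of_nonneg_right hb0 (by positivity)
    have b3 := mul_le_mul_of_nonneg_left (add_le_add (mul_le_mul_of_nonneg_left s1 zero_le_two) s3)
      (by linarith : 0 ≤ lapCoeff t (t, x))
    have b4 : d * w * (τ ^ 2 * ‖x‖) ≤ d * w * (1 / 2 * τ) :=
      mul_le_mul_of_nonneg_left hrt (by positivity)
    have b5 : d * w ^ 2 ≤ C * (P * w) + 4 * (C * (τ * (Q * w ^ 2))) := by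
      have : w ^ 2 ≤ w := by nlinarith
      have : C * P * w ^ 2 ≤ C * P * w := by gcongr
      rw [hd]; linarith
    have b6 : d * w * τ ≤ C * (P * w) + 4 * (C * (τ ^ 2 * (Q * w))) := by
      have : C * P * w * τ ≤ C * P * w := mul_le_of_le_one_right (by positivity) hτ1
      rw [hd]; linarith
    have b7 : 0 ≤ τ ^ 2 * (η * w) := by positivity
    change lapCoeff t (t, x) * (η * (-3 * w ^ 5) + 2 * _ + _ * w) + 2 * _ + -6 * τ ^ 2 * (η * w) ≤ _
    linarith
  
lemma add_mul_le_sq (q φ s : ℝ) : (q + φ + s) * (φ + q) ≤ 4 * (φ ^ 2 + q ^ 2) + s ^ 2 := by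
  nlinarith [sq_nonneg (s - (φ + q)), sq_nonneg (φ - q), sq_nonneg (φ + q), sq_nonneg s]

set_option maxHeartbeats 1000000 in
/-- The pointwise estimate behind the outer estimate. -/
lemma shell_pointwise {N k C w η q φ A₁ A₂ s₁ s₂ P Q X τ r D V₂ L om : ℝ} (hN : 1 ≤ N) (hk : 0 ≤ k)
    (hC : 0 ≤ C) (hw : 0 ≤ w) (hw1 : w ≤ 1) (hη : 0 ≤ η) (hηX : η ≤ X) (hq : 0 ≤ q) (hφ : 0 ≤ φ)
    (hA₁ : 0 ≤ A₁) (hA₂ : 0 ≤ A₂) (hA21 : A₂ ≤ A₁) (hA12 : A₁ ^ 2 ≤ A₂) (hA1 : A₁ ≤ 1)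
    (hs₁ : 0 ≤ s₁) (hs₂ : 0 ≤ s₂) (hs : s₂ ≤ s₁) (hP : 0 ≤ P) (hPX : P ≤ X) (hQ : 0 ≤ Q)
    (hQX : Q ≤ X) (hτ : 0 ≤ τ) (hτN : τ * (48 * N) ≤ 1) (hr : 0 ≤ r) (hrτ : τ * r ≤ 1 / 2)
    (hD : 0 ≤ D) (hA : η = 0 ∨ A₁ ≤ (200 * (k + 1))⁻¹) (hrφ : r * φ ≤ D)
    (h1 : φ ^ 2 ≤ V₂) (h2 : V₂ ≤ 2 * N * (φ ^ 2 + q ^ 2))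
    (hout : Q = 0 ∨ (V₂ ≤ 16 * N * (D * τ) ^ 2 ∧ φ + q ≤ 11 * N * (D * τ) ∧ A₁ ≤ 4 * τ ∧
      s₁ ≤ 5 * (D * τ ^ 2)))
    (hL : L ≤ -(9 / 4) * (η * w ^ 5) + 12 * (η * (τ ^ 2 * r * w ^ 2))
      + C * (P * w + Q * (τ * w ^ 2 + τ ^ 2 * w)))
    (hom : om = η * w ^ 2 + C * (P + τ * Q) * w) :
    1 / 2 * V₂ * L + 3 * k * ((A₁ * (q + φ) + s₁) * (om * (φ + q) + η * w * q))
      + k * ((A₂ * (q + φ) + s₂) * (η * w * (φ + q))) ≤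
    -(9 / 8) * (η * w ^ 5 * φ ^ 2) + 1 / 4 * (η * w * q ^ 2)
      + (1000 * (k + 1) ^ 2 + 12 * N + 12 * (k * C) + C * N + 1617 * (k * C * N ^ 2) + 8 * (C * N)) *
        (X * ((A₁ * w ^ 2 + A₂ * w) * φ ^ 2 + (s₁ * w ^ 2 + s₂ * w) * φ + w * s₁ ^ 2)
          + X * (D * τ ^ 2 * w ^ 2 * φ) + P * w * (φ ^ 2 + q ^ 2)
          + X * (D ^ 2 * (τ ^ 3 * w ^ 2 + τ ^ 4 * w))) := by
  have hX : 0 ≤ X := hη.trans hηX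
  have hV : 0 ≤ V₂ := (sq_nonneg φ).trans h1
  set T₁ := (A₁ * w ^ 2 + A₂ * w) * φ ^ 2 + (s₁ * w ^ 2 + s₂ * w) * φ + w * s₁ ^ 2 with hT₁
  have hT₁0 : 0 ≤ T₁ := by positivity
  have n1 : 0 ≤ X * T₁ := by positivity
  have n2 : 0 ≤ X * (D * τ ^ 2 * w ^ 2 * φ) := by positivity
  have n3 : 0 ≤ P * w * (φ ^ 2 + q ^ 2) := by positivity
  have n4 : 0 ≤ X * (D ^ 2 * (τ ^ 3 * w ^ 2 + τ ^ 4 * w)) := by positivity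
  -- Interior of the cutoff region: either the cutoff vanishes or r is so large that the
  -- perturbation is small enough to be absorbed.
  have I1 : η * (3 * k * ((A₁ * (q + φ) + s₁) * (w ^ 2 * (φ + q) + w * q))
      + k * ((A₂ * (q + φ) + s₂) * (w * (φ + q)))) ≤
      1 / 8 * (η * w * q ^ 2) + 1000 * (k + 1) ^ 2 * (X * T₁) := by
    rcases hA with h0 | hA
    · rw [h0]; simp; positivity
    · have h := mul_le_mul_of_nonneg_left
        (quad_absorb hk hw hw1 hA₁ hA₂ hA21 hA12 hq hφ hs₁ hs₂ hs hA) hη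
      rw [← hT₁] at h
      have h' : η * (1000 * (k + 1) ^ 2 * T₁) ≤ X * (1000 * (k + 1) ^ 2 * T₁) :=
        mul_le_mul_of_nonneg_right hηX (by positivity)
      linarith
  have hXT : P * (w * s₁ ^ 2) ≤ X * T₁ := by
    refine mul_le_mul hPX ?_ (by positivity) hX
    rw [hT₁]
    have : 0 ≤ (A₁ * w ^ 2 + A₂ * w) * φ ^ 2 + (s₁ * w ^ 2 + s₂ * w) * φ := by positivity
    linarith
  have II1 : 3 * k * ((A₁ * (q + φ) + s₁) * (C * P * w * (φ + q))) ≤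
      12 * (k * C) * (P * w * (φ ^ 2 + q ^ 2)) + 3 * (k * C) * (X * T₁) := by
    have a1 : (A₁ * (q + φ) + s₁) * (φ + q) ≤ 4 * (φ ^ 2 + q ^ 2) + s₁ ^ 2 := by
      have b1 : A₁ * (q + φ) ≤ q + φ := mul_le_of_le_one_left (by positivity) hA1
      have b2 : (A₁ * (q + φ) + s₁) * (φ + q) ≤ (q + φ + s₁) * (φ + q) := by gcongr
      exact b2.trans (add_mul_le_sq q φ s₁)
    have a2 := mul_le_mul_of_nonneg_left a1 (by positivity : 0 ≤ 3 * (k * C) * (P * w))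
    have a3 := mul_le_mul_of_nonneg_left hXT (by positivity : 0 ≤ 3 * (k * C))
    linarith
  -- At the outer edge r ~ t nothing has to be absorbed, because v and its gradient are O(D/t) there
  -- by hypothesis.
  have II2 : 3 * k * ((A₁ * (q + φ) + s₁) * (C * (τ * Q) * w * (φ + q))) ≤
      1617 * (k * C * N ^ 2) * (X * (D ^ 2 * (τ ^ 3 * w ^ 2 + τ ^ 4 * w))) := by
    rcases hout with h0 | ⟨_, ha, hA4, hs5⟩
    · rw [h0]; simp; positivity
    · have a1 : A₁ * (q + φ) + s₁ ≤ 49 * N * (D * τ ^ 2) := by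
        have b1 : A₁ * (q + φ) ≤ 4 * τ * (11 * N * (D * τ)) :=
          mul_le_mul hA4 (by linarith) (by positivity) (by positivity)
        have b2 : 1 * (D * τ ^ 2) ≤ N * (D * τ ^ 2) := by gcongr
        linarith
      have a2 : (A₁ * (q + φ) + s₁) * (φ + q) ≤ 49 * N * (D * τ ^ 2) * (11 * N * (D * τ)) :=
        mul_le_mul a1 ha (by positivity) (by positivity)
      have a3 := mul_le_mul_of_nonneg_left a2 (by positivity : 0 ≤ 3 * (k * C) * (τ * Q * w))
      have a4 : Q * (D ^ 2 * (τ ^ 4 * w)) ≤ X * (D ^ 2 * (τ ^ 3 * w ^ 2 + τ ^ 4 * w)) := by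
        refine mul_le_mul hQX ?_ (by positivity) hX
        have : 0 ≤ D ^ 2 * (τ ^ 3 * w ^ 2) := by positivity
        linarith
      have a5 := mul_le_mul_of_nonneg_left a4 (by positivity : 0 ≤ 1617 * (k * C * N ^ 2))
      linarith
  have III1 : η * w ^ 5 * φ ^ 2 ≤ η * w ^ 5 * V₂ := by gcongr
  -- The term from the gradient of 1 - r²/t². Its q² part is small because t ≥ 48N and r ≤ t/2, and
  -- in its φ² part one factor rφ is replaced by the a priori bound D. Times 12/2 the q² part is
  -- 1/8, which with the 1/8 of I1 gives the coefficient 1/4 in the conclusion.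
  have III2 : η * (τ ^ 2 * r * w ^ 2) * V₂ ≤ 1 / 48 * (η * w * q ^ 2)
      + 2 * N * (X * (D * τ ^ 2 * w ^ 2 * φ)) := by
    have a1 : η * (τ ^ 2 * r * w ^ 2) * V₂ ≤
        η * (τ ^ 2 * r * w ^ 2) * (2 * N * (φ ^ 2 + q ^ 2)) := by gcongr
    have a2 : η * w * q ^ 2 * (τ * N * (τ * r) * w) ≤ η * w * q ^ 2 * (1 / 96) := by
      refine mul_le_mul_of_nonneg_left ?_ (by positivity)
      have b1 : τ * N ≤ 1 / 48 := by linarith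
      calc τ * N * (τ * r) * w ≤ 1 / 48 * (1 / 2) * 1 := by gcongr
        _ = 1 / 96 := by norm_num
    have a3 : η * (r * φ * (τ ^ 2 * w ^ 2 * φ)) ≤ X * (D * (τ ^ 2 * w ^ 2 * φ)) := by
      refine mul_le_mul hηX ?_ (by positivity) hX
      exact mul_le_mul_of_nonneg_right hrφ (by positivity)
    have a4 := mul_le_mul_of_nonneg_left a3 (by positivity : 0 ≤ 2 * N)
    linarith
  have III3 : C * (P * w) * V₂ ≤ 2 * (C * N) * (P * w * (φ ^ 2 + q ^ 2)) := by
    have := mul_le_mul_of_nonneg_left h2 (by positivity : 0 ≤ C * (P * w))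
    linarith
  have III4 : C * (Q * (τ * w ^ 2 + τ ^ 2 * w)) * V₂ ≤
      16 * (C * N) * (X * (D ^ 2 * (τ ^ 3 * w ^ 2 + τ ^ 4 * w))) := by
    rcases hout with h0 | ⟨hV2, _⟩
    · rw [h0]; simp; positivity
    · have a1 := mul_le_mul_of_nonneg_left hV2
        (by positivity : 0 ≤ C * (Q * (τ * w ^ 2 + τ ^ 2 * w)))
      have a2 := mul_le_mul_of_nonneg_right hQX
        (by positivity : 0 ≤ 16 * (C * N) * (D ^ 2 * (τ ^ 3 * w ^ 2 + τ ^ 4 * w)))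
      linarith
  have hL' := mul_le_mul_of_nonneg_left hL (by positivity : 0 ≤ 1 / 2 * V₂)
  have p1 : 0 ≤ k * C := by positivity
  have p2 : 0 ≤ C * N := by positivity
  have p3 : 0 ≤ k * C * N ^ 2 := by positivity
  have p4 : 0 ≤ (k + 1) ^ 2 := by positivity
  set K := 1000 * (k + 1) ^ 2 + 12 * N + 12 * (k * C) + C * N + 1617 * (k * C * N ^ 2) + 8 * (C * N)
    with hK
  have f1 : (1000 * (k + 1) ^ 2 + 3 * (k * C)) * (X * T₁) ≤ K * (X * T₁) := by
    refine mul_le_mul_of_nonneg_right ?_ n1; rw [hK]; linarith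
  have f2 : 12 * N * (X * (D * τ ^ 2 * w ^ 2 * φ)) ≤ K * (X * (D * τ ^ 2 * w ^ 2 * φ)) := by
    refine mul_le_mul_of_nonneg_right ?_ n2; rw [hK]; linarith
  have f3 : (12 * (k * C) + C * N) * (P * w * (φ ^ 2 + q ^ 2)) ≤ K * (P * w * (φ ^ 2 + q ^ 2)) := by
    refine mul_le_mul_of_nonneg_right ?_ n3; rw [hK]; linarith
  have f4 : (1617 * (k * C * N ^ 2) + 8 * (C * N)) * (X * (D ^ 2 * (τ ^ 3 * w ^ 2 + τ ^ 4 * w))) ≤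
      K * (X * (D ^ 2 * (τ ^ 3 * w ^ 2 + τ ^ 4 * w))) := by
    refine mul_le_mul_of_nonneg_right ?_ n4; rw [hK]; linarith
  clear_value K T₁
  subst hom
  linarith

/-- The source terms of the outer estimate in terms of two kernels. -/
lemma shell_sources {X w A₁ A₂ φ m τ D u : ℝ} (hX : 0 ≤ X) (hw : 0 ≤ w) (hA₁ : 0 ≤ A₁) (hA₂ : 0 ≤ A₂)
    (hA12 : A₁ ^ 2 ≤ A₂) (hφ : 0 ≤ φ) (hXm : X = 0 ∨ φ ≤ m) (hτ : 0 ≤ τ) (hτw : τ * w ≤ 2 * w ^ 2)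
    (hD : 0 ≤ D) (hm : 0 ≤ m) :
    X * ((A₁ * w ^ 2 + A₂ * w) * φ ^ 2 + (D * (τ ^ 2 + τ * A₁) * w ^ 2
        + D * (τ ^ 2 * u + τ * A₂) * w) * φ + w * (D * (τ ^ 2 + τ * A₁)) ^ 2)
      + X * (D * τ ^ 2 * w ^ 2 * φ) + X * (D ^ 2 * (τ ^ 3 * w ^ 2 + τ ^ 4 * w)) ≤
    8 * (X * ((A₁ * w ^ 2 + A₂ * w) * (m ^ 2 + D * τ * m + (D * τ) ^ 2)
      + (w ^ 2 + u ^ 2) * (D * τ ^ 2 * m + D ^ 2 * τ ^ 3))) := by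
  rcases hXm with h0 | hφm
  · simp [h0]
  have k1 : 0 ≤ A₁ * w ^ 2 + A₂ * w := by positivity
  have e1 : (A₁ * w ^ 2 + A₂ * w) * φ ^ 2 ≤ (A₁ * w ^ 2 + A₂ * w) * m ^ 2 := by gcongr
  -- The mixed product ⟨x⟩⁻¹⟨x-x₀⟩⁻¹ is reduced to the two squares. All sources are then multiples
  -- of two kernels only, `kerA` and `kerB`.
  have huw : u * w ≤ w ^ 2 + u ^ 2 := by nlinarith [sq_nonneg (u - w), sq_nonneg (u + w)]
  have e2 : (D * (τ ^ 2 + τ * A₁) * w ^ 2 + D * (τ ^ 2 * u + τ * A₂) * w) * φ ≤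
      (2 * (D * τ ^ 2 * (w ^ 2 + u ^ 2)) + D * τ * (A₁ * w ^ 2 + A₂ * w)) * m := by
    have h : D * (τ ^ 2 + τ * A₁) * w ^ 2 + D * (τ ^ 2 * u + τ * A₂) * w ≤
        2 * (D * τ ^ 2 * (w ^ 2 + u ^ 2)) + D * τ * (A₁ * w ^ 2 + A₂ * w) := by
      have h1 := mul_le_mul_of_nonneg_left huw (by positivity : 0 ≤ D * τ ^ 2)
      have h2 : 0 ≤ D * τ ^ 2 * u ^ 2 := by positivity
      linarith
    exact mul_le_mul h hφm hφ (by positivity)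
  have hτ4 : D ^ 2 * τ ^ 3 * (τ * w) ≤ D ^ 2 * τ ^ 3 * (2 * w ^ 2) := by gcongr
  have hu : 0 ≤ D ^ 2 * τ ^ 3 * u ^ 2 := by positivity
  have hu1 : 0 ≤ D * τ ^ 2 * m * u ^ 2 := by positivity
  have e3 : w * (D * (τ ^ 2 + τ * A₁)) ^ 2 ≤ 4 * (D ^ 2 * τ ^ 3 * w ^ 2)
      + 2 * ((D * τ) ^ 2 * (A₁ * w ^ 2 + A₂ * w)) := by
    have h1 : (τ ^ 2 + τ * A₁) ^ 2 ≤ 2 * τ ^ 4 + 2 * (τ ^ 2 * A₁ ^ 2) := by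
      nlinarith [sq_nonneg (τ ^ 2 - τ * A₁)]
    have h2 : τ ^ 2 * A₁ ^ 2 ≤ τ ^ 2 * A₂ := by gcongr
    have h3 := mul_le_mul_of_nonneg_left (h1.trans (by linarith :
      2 * τ ^ 4 + 2 * (τ ^ 2 * A₁ ^ 2) ≤ 2 * τ ^ 4 + 2 * (τ ^ 2 * A₂)))
      (by positivity : 0 ≤ w * D ^ 2)
    have h4 : 0 ≤ (D * τ) ^ 2 * (A₁ * w ^ 2) := by positivity
    linarith
  have e4 : D * τ ^ 2 * w ^ 2 * φ ≤ D * τ ^ 2 * w ^ 2 * m := by gcongr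
  have z1 : 0 ≤ (A₁ * w ^ 2 + A₂ * w) * m ^ 2 := by positivity
  have z2 : 0 ≤ (A₁ * w ^ 2 + A₂ * w) * (D * τ * m) := by positivity
  have z3 : 0 ≤ (A₁ * w ^ 2 + A₂ * w) * (D * τ) ^ 2 := by positivity
  have z4 : 0 ≤ w ^ 2 * (D * τ ^ 2 * m) := by positivity
  have z5 : 0 ≤ w ^ 2 * (D ^ 2 * τ ^ 3) := by positivity
  have key : ((A₁ * w ^ 2 + A₂ * w) * φ ^ 2 + (D * (τ ^ 2 + τ * A₁) * w ^ 2
        + D * (τ ^ 2 * u + τ * A₂) * w) * φ + w * (D * (τ ^ 2 + τ * A₁)) ^ 2)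
      + (D * τ ^ 2 * w ^ 2 * φ) + (D ^ 2 * (τ ^ 3 * w ^ 2 + τ ^ 4 * w)) ≤
      8 * ((A₁ * w ^ 2 + A₂ * w) * (m ^ 2 + D * τ * m + (D * τ) ^ 2)
      + (w ^ 2 + u ^ 2) * (D * τ ^ 2 * m + D ^ 2 * τ ^ 3)) := by
    linarith
  have := mul_le_mul_of_nonneg_left key hX
  linarith

end Shell

/-! ### The outer estimate -/

section Outer

variable {I : Type*} {ι : Finset I} {i₀ : I} {v : I → Spacetime → ℝ} {C₁ s D t : ℝ}

lemma rpow_neg_le_inv {a b s : ℝ} (hb : 0 < b) (hba : b ≤ a) (ha : 1 ≤ a) (hs : 0 ≤ s) :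
    a ^ (-1 - s) ≤ b⁻¹ := by
  calc a ^ (-1 - s) ≤ a ^ (-1 : ℝ) := Real.rpow_le_rpow_of_exponent_le ha (by linarith)
    _ = a⁻¹ := Real.rpow_neg_one a
    _ ≤ b⁻¹ := inv_anti₀ hb hba

lemma shellCut_eq_zero_of_le {R ρ : ℝ} (hR : 0 < R) {z : Spacetime} (hz : ‖z.2‖ ≤ R) :
    shellCut R ρ z = 0 := by
  rw [shellCut, spaceCut_eq_one hR hz]; simp

lemma shellCut_eq_zero_of_ge {R ρ : ℝ} (hρ : 0 < ρ) {z : Spacetime} (hz : 2 * ρ ≤ ‖z.2‖) :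
    shellCut R ρ z = 0 := by
  rw [shellCut, spaceCut_eq_zero hρ hz]; simp

lemma shellCut_eq_one {R ρ : ℝ} (hR : 0 < R) (hρ : 0 < ρ) {z : Spacetime} (hz : 2 * R ≤ ‖z.2‖)
    (hz' : ‖z.2‖ ≤ ρ) : shellCut R ρ z = 1 := by
  rw [shellCut, spaceCut_eq_zero hR hz, spaceCut_eq_one hρ hz']; simp

lemma indicator_one_mul_eq (A : Set Space) (f : Space → ℝ) (x : Space) :
    A.indicator (1 : Space → ℝ) x * f x = A.indicator f x := by
  by_cases h : x ∈ A <;> simp [h]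

lemma integrable_indicator_annulus {f : Space → ℝ} (hf : Continuous f) (R ρ : ℝ) :
    Integrable ((annulus R ρ).indicator f) :=
  (integrable_indicator_iff (measurableSet_annulus R ρ)).2
    (hf.continuousOn.integrableOn_compact (isCompact_annulus R ρ))

lemma integrable_shellCut_mul {f : Space → ℝ} (hf : Continuous f) (R : ℝ) {ρ : ℝ} (hρ : 0 < ρ) :
    Integrable (fun x => shellCut R ρ (t, x) * f x) := by
  refine ((continuous_slice (contDiff_shellCut R ρ) t).mul hf).integrable_of_hasCompactSupport
    (HasCompactSupport.of_support_subset_isCompact (isCompact_closedBall (0 : Space) (2 * ρ)) ?_)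
  intro x hx
  by_contra hcon
  refine hx ?_
  simp only [Metric.mem_closedBall, dist_zero_right, not_le] at hcon
  simp [shellCut_eq_zero_of_ge hρ (z := (t, x)) hcon.le]

lemma SliceSystem.sum_sq_le (S : SliceSystem ι i₀ v C₁ s D t) (x : Space) :
    ∑ l ∈ ι, v l (t, x) ^ 2 ≤ 2 * ι.card * (|v i₀ (t, x)| ^ 2 + Real.sqrt (gradSq ι v t x) ^ 2) := by
  have : ∀ l ∈ ι, v l (t, x) ^ 2 ≤ 2 * (|v i₀ (t, x)| ^ 2 + Real.sqrt (gradSq ι v t x) ^ 2) := by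
    intro l hl
    have h := S.dom l hl x
    calc v l (t, x) ^ 2 = |v l (t, x)| ^ 2 := (sq_abs _).symm
      _ ≤ (|v i₀ (t, x)| + Real.sqrt (gradSq ι v t x)) ^ 2 := by gcongr
      _ ≤ _ := by nlinarith [sq_nonneg (|v i₀ (t, x)| - Real.sqrt (gradSq ι v t x))]
  refine (Finset.sum_le_sum this).trans (le_of_eq ?_)
  rw [Finset.sum_const, nsmul_eq_mul]; ring

lemma SliceSystem.gradSq_le (S : SliceSystem ι i₀ v C₁ s D t) {x : Space} (hx : ‖x‖ ≤ t / 2) :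
    gradSq ι v t x ≤ 3 * ι.card * (D * (jb ‖x‖)⁻¹) ^ 2 := by
  have : ∀ l ∈ ι, ∑ i : Fin 3, pd i.succ (v l) (t, x) ^ 2 ≤ 3 * (D * (jb ‖x‖)⁻¹) ^ 2 := by
    intro l hl
    refine (Finset.sum_le_sum (g := fun _ => (D * (jb ‖x‖)⁻¹) ^ 2) fun i _ => ?_).trans
      (le_of_eq (by simp))
    exact sq_le_sq' (neg_le_of_abs_le ((S.apriori l hl x hx).2 i))
      (le_of_abs_le ((S.apriori l hl x hx).2 i))
  refine (Finset.sum_le_sum this).trans (le_of_eq ?_)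
  rw [Finset.sum_const, nsmul_eq_mul]; ring

lemma SliceSystem.sum_sq_le_apriori (S : SliceSystem ι i₀ v C₁ s D t) {x : Space}
    (hx : ‖x‖ ≤ t / 2) : ∑ l ∈ ι, v l (t, x) ^ 2 ≤ ι.card * (D * (jb ‖x‖)⁻¹) ^ 2 := by
  refine (Finset.sum_le_sum (g := fun _ => (D * (jb ‖x‖)⁻¹) ^ 2) fun l hl => ?_).trans
    (le_of_eq (by simp))
  exact sq_le_sq' (neg_le_of_abs_le (S.apriori l hl x hx).1) (le_of_abs_le (S.apriori l hl x hx).1)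

/-- The first kernel of the outer estimate. -/
def kerA (s : ℝ) (x₀ x : Space) : ℝ :=
  jb ‖x‖ ^ (-1 - s) * (jb ‖x - x₀‖)⁻¹ ^ 2 + jb ‖x‖ ^ (-2 - s) * (jb ‖x - x₀‖)⁻¹

/-- The second kernel of the outer estimate. -/
def kerB (x₀ x : Space) : ℝ := (jb ‖x - x₀‖)⁻¹ ^ 2 + (jb ‖x‖)⁻¹ ^ 2

lemma continuous_inv_jb (x₀ : Space) : Continuous fun x : Space => (jb ‖x - x₀‖)⁻¹ :=
  Continuous.inv₀ (by fun_prop) fun _ => (jb_pos _).ne'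

lemma continuous_inv_jb_zero : Continuous fun x : Space => (jb ‖x‖)⁻¹ :=
  Continuous.inv₀ (by fun_prop) fun _ => (jb_pos _).ne'

lemma continuous_kerA (s : ℝ) (x₀ : Space) : Continuous (kerA s x₀) :=
  ((continuous_jb_rpow_zero _).mul ((continuous_inv_jb x₀).pow 2)).add
    ((continuous_jb_rpow_zero _).mul (continuous_inv_jb x₀))

lemma continuous_kerB (x₀ : Space) : Continuous (kerB x₀) :=
  ((continuous_inv_jb x₀).pow 2).add (continuous_inv_jb_zero.pow 2)

lemma kerA_nonneg (s : ℝ) (x₀ x : Space) : 0 ≤ kerA s x₀ x := by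
  have := jb_pos ‖x‖
  have := jb_pos ‖x - x₀‖
  unfold kerA; positivity

lemma kerB_nonneg (x₀ x : Space) : 0 ≤ kerB x₀ x := by
  unfold kerB; positivity

lemma integral_kerA {s : ℝ} (hs : 0 < s) (hs1 : s ≤ 1) : ∃ C : ℝ, 0 ≤ C ∧ ∀ (A : Set Space)
    (x₀ : Space), MeasurableSet A → ∫ x, A.indicator (kerA s x₀) x ≤ C * jb ‖x₀‖ ^ (-(s / 2)) := by
  obtain ⟨C, hC, h1⟩ := kernel_integral (p := 1 + s) (q := 2) hs (by linarith) (by linarith) (by ring)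
  obtain ⟨C', hC', h2⟩ := kernel_integral (p := 2 + s) (q := 1) hs (by linarith) (by linarith)
    (by ring)
  refine ⟨C + C', by positivity, fun A x₀ hA => ?_⟩
  obtain ⟨i1, b1⟩ := h1 x₀
  obtain ⟨i2, b2⟩ := h2 x₀
  have e : kerA s x₀ = fun x => jb ‖x‖ ^ (-(1 + s)) * jb ‖x - x₀‖ ^ (-2 : ℝ)
      + jb ‖x‖ ^ (-(2 + s)) * jb ‖x - x₀‖ ^ (-1 : ℝ) := by
    ext x
    rw [kerA, Real.rpow_neg_one, Real.rpow_neg (jb_pos ‖x - x₀‖).le, Real.rpow_two, inv_pow]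
    congr 3 <;> ring
  have hi : Integrable (kerA s x₀) := by rw [e]; exact i1.add i2
  rw [integral_indicator hA]
  refine (setIntegral_le_integral hi (Filter.Eventually.of_forall fun x => kerA_nonneg s x₀ x)).trans ?_
  rw [e, integral_add i1 i2]
  linarith

lemma integral_kerB : ∃ C : ℝ, 0 ≤ C ∧ ∀ (t R : ℝ) (x₀ : Space), 0 ≤ t → ‖x₀‖ ≤ t / 2 →
    ∫ x, (annulus R (t / 2)).indicator (kerB x₀) x ≤ C * t := by
  obtain ⟨C, hC, h⟩ := integral_jb_neg_two_ball
  refine ⟨C, hC, fun t R x₀ ht hx₀ => ?_⟩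
  have h1 := h (t / 2) x₀ (by linarith) hx₀
  have h2 := h (t / 2) 0 (by linarith) (by simpa using by linarith)
  rw [integral_indicator (measurableSet_annulus _ _)]
  have hsub : annulus R (t / 2) ⊆ Metric.closedBall (0 : Space) (t / 2) := fun x hx => by
    simpa using hx.2
  have hK := isCompact_closedBall (0 : Space) (t / 2)
  have i1 := ((continuous_inv_jb x₀).pow 2).continuousOn.integrableOn_compact (μ := volume) hK
  have i2 := (continuous_inv_jb_zero.pow 2).continuousOn.integrableOn_compact (μ := volume) hK
  refine (setIntegral_mono_set ((continuous_kerB x₀).continuousOn.integrableOn_compact hK)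
    (Filter.Eventually.of_forall fun x => kerB_nonneg x₀ x) hsub.eventuallyLE).trans ?_
  have e : ∫ x in Metric.closedBall (0 : Space) (t / 2), kerB x₀ x =
      (∫ x in Metric.closedBall (0 : Space) (t / 2), (jb ‖x - x₀‖)⁻¹ ^ 2)
      + ∫ x in Metric.closedBall (0 : Space) (t / 2), (jb ‖x‖)⁻¹ ^ 2 := integral_add i1 i2
  rw [e]
  simp only [sub_zero] at h2
  simp only [inv_pow]
  linarith

end Outer

section OuterEstimate

variable {I : Type*}

set_option maxHeartbeats 1000000 in
/-- The outer estimate: away from a fixed ball, the weighted energy around a point `x₀` is small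
relative to the size of the solution, up to the a-priori terms and an inner boundary term. -/
theorem SliceSystem.outer_estimate (ι : Finset I) {C₁ s : ℝ} (hC₁ : 0 ≤ C₁) (hs : 0 < s)
    (hs1 : s ≤ 1) : ∃ C R₁ T₁ : ℝ, 0 ≤ C ∧ 1 ≤ R₁ ∧ 4 ≤ T₁ ∧
    ∀ (i₀ : I) (v : I → Spacetime → ℝ) (D t R m : ℝ) (x₀ : Space), SliceSystem ι i₀ v C₁ s D t →
      0 ≤ D → R₁ ≤ R → T₁ ≤ t → 4 * R ≤ ‖x₀‖ → ‖x₀‖ ≤ t / 8 →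
      (∀ x ∈ annulus R (t / 2), |v i₀ (t, x)| ≤ m) →
      ∫ x : Space, shellCut R (t / 4) (t, x) * (newt x₀ (t, x) * gradSq ι v t x
          + newt x₀ (t, x) ^ 5 * v i₀ (t, x) ^ 2) ≤
        C * (jb ‖x₀‖ ^ (-(s / 2)) * m ^ 2 + m * (D * t⁻¹) + (D * t⁻¹) ^ 2
          + (jb ‖x₀‖)⁻¹ * ∫ x in annulus R (2 * R), (v i₀ (t, x) ^ 2 + gradSq ι v t x)) := by
  obtain ⟨Cw, hCw, hwb⟩ := exists_shell_weight_bounds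
  obtain ⟨CA, hCA, hkA⟩ := integral_kerA hs hs1
  obtain ⟨CB, hCB, hkB⟩ := integral_kerB
  set N : ℝ := (ι.card : ℝ) with hN
  have hN0 : 0 ≤ N := by positivity
  set k : ℝ := N * C₁ with hk
  have hk0 : 0 ≤ k := by positivity
  set K : ℝ := 1000 * (k + 1) ^ 2 + 12 * N + 12 * (k * Cw) + Cw * N + 1617 * (k * Cw * N ^ 2)
    + 8 * (Cw * N) with hK
  have hK0 : 0 ≤ K := by positivity
  -- The radius 200(k+1) makes ⟨r⟩^{-1-s} at most (200(k+1))⁻¹ for r ≥ R, as the absorption demands.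
  -- The time 48N makes the gradient of 1 - r²/t² harmless.
  refine ⟨2 * (K * (8 * (2 * CA + CB) + 2)), 200 * (k + 1), max 4 (48 * N), by positivity,
    by linarith, le_max_left _ _, ?_⟩
  intro i₀ v D t R m x₀ S hD hR ht hx₀ hx₀t hm
  have ht4 : 4 ≤ t := (le_max_left _ _).trans ht
  have htN : 48 * N ≤ t := (le_max_right _ _).trans ht
  have ht0 : 0 < t := by linarith
  have hR1 : 1 ≤ R := by linarith
  have hR0 : 0 < R := by linarith
  have hN1 : 1 ≤ N := by
    rw [hN]; exact_mod_cast Finset.card_pos.2 ⟨i₀, S.mem⟩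
  have hm0 : 0 ≤ m := (abs_nonneg _).trans (hm x₀ ⟨by linarith, by linarith⟩)
  set τ := t⁻¹ with hτ
  have hτ0 : 0 < τ := by positivity
  have hτt : τ * t = 1 := by rw [hτ]; field_simp
  set Ω := annulus R (t / 2) with hΩ
  set Ωi := annulus R (2 * R) with hΩi
  set Ωo := annulus (t / 4) (t / 2) with hΩo
  set η : Space → ℝ := fun x => shellCut R (t / 4) (t, x) with hη
  set w : Space → ℝ := fun x => newt x₀ (t, x) with hw
  have hwe : ∀ x, w x = (jb ‖x - x₀‖)⁻¹ := fun x => rfl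
  set φ : Space → ℝ := fun x => |v i₀ (t, x)| with hφ
  set q : Space → ℝ := fun x => Real.sqrt (gradSq ι v t x) with hq
  have hq2 : ∀ x, q x ^ 2 = gradSq ι v t x := fun x => Real.sq_sqrt (gradSq_nonneg _ _ _ _)
  have hφ2 : ∀ x, φ x ^ 2 = v i₀ (t, x) ^ 2 := fun x => sq_abs _
  have hwc : Continuous w := continuous_slice (contDiff_newt x₀) t
  have hφc : Continuous fun x => v i₀ (t, x) ^ 2 := (continuous_slice (S.smooth i₀ S.mem) t).pow 2
  have hqc : Continuous fun x => gradSq ι v t x := continuous_gradSq S.smooth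
  set M₁ := m ^ 2 + D * τ * m + (D * τ) ^ 2 with hM₁
  set M₂ := D * τ ^ 2 * m + D ^ 2 * τ ^ 3 with hM₂
  set f₁ : Space → ℝ := fun x => η x * (w x ^ 5 * v i₀ (t, x) ^ 2) with hf₁
  set f₂ : Space → ℝ := fun x => η x * (w x * gradSq ι v t x) with hf₂
  set f₃ : Space → ℝ := Ω.indicator (kerA s x₀) with hf₃
  set f₄ : Space → ℝ := Ω.indicator (kerB x₀) with hf₄
  set f₅ : Space → ℝ := Ωi.indicator fun x => w x * (v i₀ (t, x) ^ 2 + gradSq ι v t x) with hf₅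
  have ht4' : 0 < t / 4 := by linarith
  have i₁ : Integrable f₁ := integrable_shellCut_mul ((hwc.pow 5).mul hφc) R ht4'
  have i₂ : Integrable f₂ := integrable_shellCut_mul (hwc.mul hqc) R ht4'
  have i₃ : Integrable f₃ := integrable_indicator_annulus (continuous_kerA s x₀) _ _
  have i₄ : Integrable f₄ := integrable_indicator_annulus (continuous_kerB x₀) _ _
  have i₅ : Integrable f₅ := integrable_indicator_annulus (hwc.mul (hφc.add hqc)) _ _
  have hηge : ∀ x : Space, t / 2 < ‖x‖ → η x = 0 := fun x hx =>
    shellCut_eq_zero_of_ge ht4' (z := (t, x)) (by simp only; linarith)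
  -- The integrable majorant: f₁ is the good term, f₂ the gradient energy to be absorbed, f₃ and f₄
  -- the two kernels, f₅ the contribution of the inner edge.
  set Rf : Space → ℝ := fun x => -(9 / 8) * f₁ x + 1 / 4 * f₂ x
    + K * (8 * (M₁ * f₃ x + M₂ * f₄ x) + f₅ x) with hRf
  have i₃₄ : Integrable fun x => M₁ * f₃ x + M₂ * f₄ x := (i₃.const_mul _).add (i₄.const_mul _)
  have hRi : Integrable Rf := ((i₁.const_mul _).add (i₂.const_mul _)).add
    (((i₃₄.const_mul _).add i₅).const_mul _)
  have hW : ContDiff ℝ ∞ fun z => shellCut R (t / 4) z * newt x₀ z :=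
    (contDiff_shellCut R (t / 4)).mul (contDiff_newt x₀)
  have main := S.weighted_energy hW
    (fun x => mul_nonneg (shellCut_mem_Icc _ _ _).1 (newt_pos _ _).le)
    (fun x hx => by
      have := hηge x hx
      simp only [hη] at this
      simp [this])
    (om := fun x => η x * w x ^ 2 + Cw * (Ωi.indicator 1 x + τ * Ωo.indicator 1 x) * w x)
    (fun x i hx => (hwb R t hR1 ht4 x₀ x hx).1 i)
    (B := fun x => φ x + q x) S.dom hRi
    (fun x hx => by
      have h1 : x ∉ Ω := fun h => by have := h.2; linarith
      have h2 : x ∉ Ωi := fun h => by have := h.2; linarith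
      simp [hRf, hf₁, hf₂, hf₃, hf₄, hf₅, h1, h2, hηge x hx])
    (fun x hx => by
      obtain ⟨hη0, hη1⟩ := shellCut_mem_Icc R (t / 4) (t, x)
      obtain ⟨hX0, hX1⟩ := indicator_one_mem_Icc Ω x
      obtain ⟨hP0, hP1⟩ := indicator_one_mem_Icc Ωi x
      obtain ⟨hQ0, hQ1⟩ := indicator_one_mem_Icc Ωo x
      have hj1 := one_le_jb ‖x‖
      have hj0 := jb_pos ‖x‖
      have hrj := le_jb ‖x‖
      have hA₂₁ : jb ‖x‖ ^ (-2 - s) ≤ jb ‖x‖ ^ (-1 - s) :=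
        Real.rpow_le_rpow_of_exponent_le hj1 (by linarith)
      have hA₁₂ : (jb ‖x‖ ^ (-1 - s)) ^ 2 ≤ jb ‖x‖ ^ (-2 - s) := by
        rw [← Real.rpow_natCast, ← Real.rpow_mul hj0.le]
        refine Real.rpow_le_rpow_of_exponent_le hj1 ?_
        push_cast; linarith
      have hA₁1 : jb ‖x‖ ^ (-1 - s) ≤ 1 := by
        simpa using rpow_neg_le_inv one_pos hj1 hj1 hs.le
      have hA₁0 : 0 ≤ jb ‖x‖ ^ (-1 - s) := by positivity
      have hA₂0 : 0 ≤ jb ‖x‖ ^ (-2 - s) := by positivity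
      have hji : (jb ‖x‖)⁻¹ ≤ 1 := inv_le_one_of_one_le₀ hj1
      have hji0 : 0 ≤ (jb ‖x‖)⁻¹ := by positivity
      have hs1e : fluxSrc s D t x = D * (τ ^ 2 + τ * jb ‖x‖ ^ (-1 - s)) := by
        rw [fluxSrc, hτ, inv_pow]
      have hs2e : bulkSrc s D t x = D * (τ ^ 2 * (jb ‖x‖)⁻¹ + τ * jb ‖x‖ ^ (-2 - s)) := by
        rw [bulkSrc, hτ, inv_pow]
      have hinΩ : R ≤ ‖x‖ → Ω.indicator (1 : Space → ℝ) x = 1 := fun h => by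
        rw [Set.indicator_of_mem (show x ∈ Ω from ⟨h, hx⟩)]; rfl
      have hηX : η x ≤ Ω.indicator 1 x := by
        rcases le_or_gt ‖x‖ R with h | h
        · rw [show η x = 0 from shellCut_eq_zero_of_le hR0 (z := (t, x)) h]; exact hX0
        · rw [hinΩ h.le]; exact hη1
      have hPX : Ωi.indicator (1 : Space → ℝ) x ≤ Ω.indicator 1 x := by
        by_cases h : x ∈ Ωi
        · rw [hinΩ h.1]; exact hP1
        · rw [Set.indicator_of_notMem h]; exact hX0
      have hQX : Ωo.indicator (1 : Space → ℝ) x ≤ Ω.indicator 1 x := by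
        by_cases h : x ∈ Ωo
        · rw [hinΩ (by linarith [h.1])]; exact hQ1
        · rw [Set.indicator_of_notMem h]; exact hX0
      have hap := (S.apriori i₀ S.mem x hx).1
      have hrτ : τ * ‖x‖ ≤ 1 / 2 := by
        calc τ * ‖x‖ ≤ τ * (t / 2) := by gcongr
          _ = 1 / 2 := by linarith
      -- In t/4 ≤ r ≤ t/2 the hypothesis D/⟨r⟩ is already of size D/t, for the functions and for
      -- their gradients.
      have hout : Ωo.indicator (1 : Space → ℝ) x = 0 ∨
          (∑ l ∈ ι, v l (t, x) ^ 2 ≤ 16 * N * (D * τ) ^ 2 ∧ φ x + q x ≤ 11 * N * (D * τ) ∧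
            jb ‖x‖ ^ (-1 - s) ≤ 4 * τ ∧ fluxSrc s D t x ≤ 5 * (D * τ ^ 2)) := by
        by_cases h : x ∈ Ωo
        · right
          have hjt : t / 4 ≤ jb ‖x‖ := h.1.trans hrj
          have hjτ : (jb ‖x‖)⁻¹ ≤ 4 * τ := by
            calc (jb ‖x‖)⁻¹ ≤ (t / 4)⁻¹ := inv_anti₀ ht4' hjt
              _ = 4 * τ := by rw [hτ]; field_simp
          have hA4 : jb ‖x‖ ^ (-1 - s) ≤ 4 * τ := by
            calc jb ‖x‖ ^ (-1 - s) ≤ (t / 4)⁻¹ := rpow_neg_le_inv ht4' hjt hj1 hs.le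
              _ = 4 * τ := by rw [hτ]; field_simp
          have hDj : D * (jb ‖x‖)⁻¹ ≤ 4 * (D * τ) := by
            calc D * (jb ‖x‖)⁻¹ ≤ D * (4 * τ) := by gcongr
              _ = _ := by ring
          have hDτ : 0 ≤ D * τ := by positivity
          refine ⟨?_, ?_, hA4, ?_⟩
          · calc _ ≤ N * (D * (jb ‖x‖)⁻¹) ^ 2 := S.sum_sq_le_apriori hx
              _ ≤ N * (4 * (D * τ)) ^ 2 := by gcongr
              _ = _ := by ring
          · have h1 : φ x ≤ 4 * (D * τ) := hap.trans hDj
            have h2 : q x ≤ 7 * N * (D * τ) := by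
              refine Real.sqrt_le_iff.2 ⟨by positivity, ?_⟩
              calc gradSq ι v t x ≤ 3 * N * (D * (jb ‖x‖)⁻¹) ^ 2 := S.gradSq_le hx
                _ ≤ 3 * N * (4 * (D * τ)) ^ 2 := by gcongr
                _ = 48 * N * 1 * (D * τ) ^ 2 := by ring
                _ ≤ 49 * N * N * (D * τ) ^ 2 := by gcongr; norm_num
                _ = _ := by ring
            have h3 : 1 * (D * τ) ≤ N * (D * τ) := by gcongr
            linarith
          · rw [hs1e]
            have := mul_le_mul_of_nonneg_left hA4 hDτ
            linarith
        · left; rw [Set.indicator_of_notMem h]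
      have P1 := shell_pointwise (N := N) (k := k) (C := Cw) (w := w x) (η := η x) (q := q x)
        (φ := φ x) (A₁ := jb ‖x‖ ^ (-1 - s)) (A₂ := jb ‖x‖ ^ (-2 - s)) (s₁ := fluxSrc s D t x)
        (s₂ := bulkSrc s D t x) (P := Ωi.indicator 1 x) (Q := Ωo.indicator 1 x)
        (X := Ω.indicator 1 x) (τ := τ) (r := ‖x‖) (D := D) (V₂ := ∑ l ∈ ι, v l (t, x) ^ 2)
        (L := lap (fun z => lapCoeff t z * (shellCut R (t / 4) z * newt x₀ z)) (t, x))
        (om := η x * w x ^ 2 + Cw * (Ωi.indicator 1 x + τ * Ωo.indicator 1 x) * w x)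
        hN1 hk0 hCw (newt_pos _ _).le (newt_le_one _ _) hη0 hηX (Real.sqrt_nonneg _) (abs_nonneg _)
        hA₁0 hA₂0 hA₂₁ hA₁₂ hA₁1 (by rw [hs1e]; positivity) (by rw [hs2e]; positivity)
        (by
          rw [hs1e, hs2e]
          gcongr
          exact mul_le_of_le_one_right (by positivity) hji) hP0 hPX hQ0 hQX hτ0.le
        (by
          calc τ * (48 * N) ≤ τ * t := by gcongr
            _ = 1 := hτt) (norm_nonneg x) hrτ hD
        (by
          rcases le_or_gt ‖x‖ R with h | h
          · left; exact shellCut_eq_zero_of_le hR0 (z := (t, x)) h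
          · right
            exact rpow_neg_le_inv (by positivity) (by linarith) hj1 hs.le)
        (by
          calc ‖x‖ * φ x ≤ jb ‖x‖ * (D * (jb ‖x‖)⁻¹) := by
                exact mul_le_mul hrj hap (abs_nonneg _) hj0.le
            _ = D := by field_simp)
        (by
          rw [hφ2]
          exact Finset.single_le_sum (f := fun l => v l (t, x) ^ 2) (fun l _ => sq_nonneg _) S.mem)
        (S.sum_sq_le x) hout (hwb R t hR1 ht4 x₀ x hx).2 rfl
      have P2 := shell_sources (X := Ω.indicator 1 x) (w := w x) (A₁ := jb ‖x‖ ^ (-1 - s))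
        (A₂ := jb ‖x‖ ^ (-2 - s)) (φ := φ x) (m := m) (τ := τ) (D := D) (u := (jb ‖x‖)⁻¹)
        hX0 (newt_pos _ _).le hA₁0 hA₂0 hA₁₂ (abs_nonneg _)
        (by
          by_cases h : x ∈ Ω
          · right; exact hm x h
          · left; rw [Set.indicator_of_notMem h]) hτ0.le
        (by
          have h1 : jb ‖x - x₀‖ ≤ 2 * t := by
            have h2 := norm_sub_le x x₀
            have h3 := jb_le_one_add ‖x - x₀‖
            rw [abs_norm] at h3
            linarith
          have h4 : 1 ≤ 2 * t * w x := by
            rw [hwe, ← div_eq_mul_inv, one_le_div (jb_pos _)]; exact h1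
          have hw0 : 0 < w x := newt_pos _ _
          calc τ * w x = τ * w x * 1 := by ring
            _ ≤ τ * w x * (2 * t * w x) := by gcongr
            _ = (τ * t) * (2 * w x ^ 2) := by ring
            _ = _ := by rw [hτt]; ring) hD hm0
      have e3 : f₃ x = Ω.indicator 1 x * (jb ‖x‖ ^ (-1 - s) * w x ^ 2 + jb ‖x‖ ^ (-2 - s) * w x) :=
        (indicator_one_mul_eq Ω (kerA s x₀) x).symm
      have e4 : f₄ x = Ω.indicator 1 x * (w x ^ 2 + (jb ‖x‖)⁻¹ ^ 2) :=
        (indicator_one_mul_eq Ω (kerB x₀) x).symm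
      have e5 : f₅ x = Ωi.indicator 1 x * (w x * (v i₀ (t, x) ^ 2 + gradSq ι v t x)) :=
        (indicator_one_mul_eq Ωi _ x).symm
      rw [← hs1e, ← hs2e] at P2
      have P2' := mul_le_mul_of_nonneg_left P2 hK0
      simp only [hq2, hφ2] at P1 P2'
      rw [← hK] at P1
      simp only [hRf, e3, e4, e5, hf₁, hf₂]
      have e0 : ∑ l ∈ ι, 1 / 2 * v l (t, x) ^ 2 *
            lap (fun z => lapCoeff t z * (shellCut R (t / 4) z * newt x₀ z)) (t, x) =
          1 / 2 * (∑ l ∈ ι, v l (t, x) ^ 2) *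
            lap (fun z => lapCoeff t z * (shellCut R (t / 4) z * newt x₀ z)) (t, x) := by
        rw [Finset.mul_sum, Finset.sum_mul]
      rw [e0]
      refine le_trans (le_of_eq ?_) (P1.trans (le_trans (le_of_eq ?_)
        ((add_le_add_right P2' (-(9 / 8) * (η x * w x ^ 5 * v i₀ (t, x) ^ 2)
        + 1 / 4 * (η x * w x * gradSq ι v t x) + K * (Ωi.indicator 1 x * w x *
          (v i₀ (t, x) ^ 2 + gradSq ι v t x)))).trans (le_of_eq ?_))))
      · rw [hk]; ring
      · ring
      · rw [hM₁, hM₂]; ring)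
  -- The 3/4 from the coefficient of the Laplacian beats the 1/4 in the majorant, so half of the
  -- gradient energy is left on the good side.
  have hlow : 3 / 4 * ∫ x, f₂ x ≤
      ∫ x : Space, lapCoeff t (t, x) * (shellCut R (t / 4) (t, x) * newt x₀ (t, x)) * gradSq ι v t x := by
    rw [← integral_const_mul]
    refine integral_mono (i₂.const_mul _) ?_ fun x => ?_
    · have hb := continuous_slice (contDiff_lapCoeff t) t
      refine (integrable_shellCut_mul (t := t) ((hb.mul hwc).mul hqc) R ht4').congr
        (Filter.Eventually.of_forall fun x => ?_)
      simp only [hw, Pi.mul_apply]; ring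
    · have hf : 0 ≤ f₂ x := mul_nonneg (shellCut_mem_Icc _ _ _).1
        (mul_nonneg (newt_pos _ _).le (gradSq_nonneg _ _ _ _))
      rcases le_or_gt ‖x‖ (t / 2) with h | h
      · have := mul_le_mul_of_nonneg_right (le_lapCoeff ht0 (z := (t, x)) h) hf
        refine this.trans (le_of_eq ?_)
        simp only [hf₂, hη, hw]; ring
      · have := hηge x h
        simp only [hη] at this
        simp [hf₂, hη, this]
  have hsum : ∫ x, Rf x = -(9 / 8) * (∫ x, f₁ x) + 1 / 4 * (∫ x, f₂ x)
      + K * (8 * (M₁ * (∫ x, f₃ x) + M₂ * ∫ x, f₄ x) + ∫ x, f₅ x) := by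
    have j₁ : Integrable fun x => -(9 / 8) * f₁ x + 1 / 4 * f₂ x :=
      (i₁.const_mul _).add (i₂.const_mul _)
    have j₂ : Integrable fun x => 8 * (M₁ * f₃ x + M₂ * f₄ x) + f₅ x := (i₃₄.const_mul _).add i₅
    simp only [hRf]
    rw [integral_add j₁ (j₂.const_mul _), integral_add (i₁.const_mul _) (i₂.const_mul _),
      integral_const_mul, integral_const_mul, integral_const_mul, integral_add (i₃₄.const_mul _) i₅,
      integral_const_mul, integral_add (i₃.const_mul _) (i₄.const_mul _), integral_const_mul,
      integral_const_mul]
  have hlhs : ∫ x : Space, shellCut R (t / 4) (t, x) * (newt x₀ (t, x) * gradSq ι v t x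
          + newt x₀ (t, x) ^ 5 * v i₀ (t, x) ^ 2) = (∫ x, f₂ x) + ∫ x, f₁ x := by
    rw [← integral_add i₂ i₁]
    refine integral_congr_ae (Filter.Eventually.of_forall fun x => ?_)
    simp only [hf₁, hf₂, hη, hw]; ring
  have hf₁0 : 0 ≤ ∫ x, f₁ x := integral_nonneg fun x => mul_nonneg (shellCut_mem_Icc _ _ _).1
    (mul_nonneg (pow_nonneg (newt_pos _ _).le _) (sq_nonneg _))
  have hf₂0 : 0 ≤ ∫ x, f₂ x := integral_nonneg fun x => mul_nonneg (shellCut_mem_Icc _ _ _).1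
    (mul_nonneg (newt_pos _ _).le (gradSq_nonneg _ _ _ _))
  have h3 : ∫ x, f₃ x ≤ CA * jb ‖x₀‖ ^ (-(s / 2)) := hkA Ω x₀ (measurableSet_annulus _ _)
  have h4 : ∫ x, f₄ x ≤ CB * t := hkB t R x₀ ht0.le (by linarith)
  -- On the inner annulus |x| ≤ 2R ≤ |x₀|/2, so the weight ⟨x-x₀⟩⁻¹ is at most 2/⟨x₀⟩.
  have h5 : ∫ x, f₅ x ≤ 2 * (jb ‖x₀‖)⁻¹ *
      ∫ x in annulus R (2 * R), (v i₀ (t, x) ^ 2 + gradSq ι v t x) := by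
    rw [hf₅, integral_indicator (measurableSet_annulus _ _), ← integral_const_mul]
    have hc := isCompact_annulus R (2 * R)
    refine setIntegral_mono_on ((hwc.mul (hφc.add hqc)).continuousOn.integrableOn_compact hc)
      ((continuous_const.mul (hφc.add hqc)).continuousOn.integrableOn_compact hc)
      (measurableSet_annulus _ _) fun x hx => ?_
    have h6 : 0 ≤ v i₀ (t, x) ^ 2 + gradSq ι v t x := add_nonneg (sq_nonneg _) (gradSq_nonneg _ _ _ _)
    refine mul_le_mul_of_nonneg_right ?_ h6
    have h7 : ‖x‖ ≤ ‖x₀‖ / 2 := by have := hx.2; linarith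
    have h8 : ‖x₀‖ ≤ 2 * ‖x - x₀‖ := by
      have := norm_sub_norm_le x₀ x
      rw [norm_sub_rev] at this
      linarith
    have h9 : jb ‖x₀‖ ≤ 2 * jb ‖x - x₀‖ := by
      rw [two_mul]
      refine jb_le_add_of_abs_le ?_
      simp only [abs_norm]; linarith
    rw [hwe, ← div_eq_mul_inv, inv_eq_one_div, div_le_div_iff₀ (jb_pos _) (jb_pos _)]
    linarith
  have hJ1 : jb ‖x₀‖ ^ (-(s / 2)) ≤ 1 := by
    rw [← Real.rpow_zero (jb ‖x₀‖)]
    exact Real.rpow_le_rpow_of_exponent_le (one_le_jb _) (by linarith)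
  have hM₁0 : 0 ≤ M₁ := by positivity
  have hM₂0 : 0 ≤ M₂ := by positivity
  have hA := mul_le_mul_of_nonneg_left h3 hM₁0
  have hB := mul_le_mul_of_nonneg_left h4 hM₂0
  -- The integral of the second kernel grows like t. The extra factor t⁻¹ in M₂ compensates exactly.
  have hB' : M₂ * (CB * t) = CB * (m * (D * τ) + (D * τ) ^ 2) := by
    calc M₂ * (CB * t) = CB * ((τ * t) * (m * (D * τ) + (D * τ) ^ 2)) := by rw [hM₂]; ring
      _ = _ := by rw [hτt]; ring
  set J := jb ‖x₀‖ ^ (-(s / 2))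
  set a2 := ∫ x in annulus R (2 * R), (v i₀ (t, x) ^ 2 + gradSq ι v t x)
  have ha2 : 0 ≤ (jb ‖x₀‖)⁻¹ * a2 := mul_nonneg (inv_nonneg.2 (jb_pos _).le)
    (integral_nonneg fun x => add_nonneg (sq_nonneg _) (gradSq_nonneg _ _ _ _))
  have hJ0 : 0 ≤ J := Real.rpow_nonneg (jb_pos _).le _
  have hmD : 0 ≤ m * (D * τ) := by positivity
  have hDD : 0 ≤ (D * τ) ^ 2 := by positivity
  have hA' : M₁ * (CA * J) ≤ CA * (J * m ^ 2 + m * (D * τ) + (D * τ) ^ 2) := by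
    have h := mul_le_mul_of_nonneg_left hJ1 (add_nonneg hmD hDD)
    have h' := mul_le_mul_of_nonneg_left h hCA
    rw [hM₁]; linarith
  have hmJ : 0 ≤ J * m ^ 2 := by positivity
  rw [hlhs]
  rw [hsum] at main
  have hin : 8 * (M₁ * (∫ x, f₃ x) + M₂ * ∫ x, f₄ x) + ∫ x, f₅ x ≤
      (8 * (2 * CA + CB) + 2) * (J * m ^ 2 + m * (D * τ) + (D * τ) ^ 2 + (jb ‖x₀‖)⁻¹ * a2) := by
    have z1 : 0 ≤ CA * (J * m ^ 2) := by positivity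
    have z2 : 0 ≤ CA * (m * (D * τ)) := by positivity
    have z3 : 0 ≤ CA * (D * τ) ^ 2 := by positivity
    have z4 : 0 ≤ CB * (J * m ^ 2) := by positivity
    have z5 : 0 ≤ CA * ((jb ‖x₀‖)⁻¹ * a2) := mul_nonneg hCA ha2
    have z6 : 0 ≤ CB * ((jb ‖x₀‖)⁻¹ * a2) := mul_nonneg hCB ha2
    linarith
  have hfin := mul_le_mul_of_nonneg_left hin hK0
  have := hlow.trans main
  linarith

end OuterEstimate

/-! ### Interior regularity on annuli -/

section Caccioppoli

variable {I : Type*}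

/-- The algebra of Caccioppoli's inequality, with e the cut-off gradient and b the cut-off size of
the functions: kA ≤ 1/200 handles the terms quadratic in e, and Young's inequality the mixed ones.
-/
lemma quad_absorb_inner {k C A e b σ : ℝ} (hk : 0 ≤ k) (hC : 0 ≤ C) (he : 0 ≤ e)
    (hb : 0 ≤ b) (hkA : k * A ≤ 1 / 200) :
    3 * k * ((A * (e + b) + σ) * (2 * C * b + e)) + k * ((A * (e + b) + σ) * b) ≤
      1 / 4 * e ^ 2 + ((2 * C + 1) ^ 2 + C + 3 * (k * C) + 36 * k ^ 2 + 1 + k) * (b ^ 2 + σ ^ 2) := by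
  have h1 : k * A * ((e + b) * (2 * C * b + e)) ≤ 1 / 200 * ((e + b) * (2 * C * b + e)) :=
    mul_le_mul_of_nonneg_right hkA (by positivity)
  have h2 : k * A * ((e + b) * b) ≤ 1 / 200 * ((e + b) * b) :=
    mul_le_mul_of_nonneg_right hkA (by positivity)
  have h3 : e * ((2 * C + 1) * b) ≤ 1 * e ^ 2 + (4 * 1)⁻¹ * ((2 * C + 1) * b) ^ 2 :=
    mul_le_amgm one_pos
  have h4 : e * (k * σ) ≤ 1 / 48 * e ^ 2 + (4 * (1 / 48))⁻¹ * (k * σ) ^ 2 := mul_le_amgm (by norm_num)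
  have h5 : e * b ≤ 1 * e ^ 2 + (4 * 1)⁻¹ * b ^ 2 := mul_le_amgm one_pos
  have h6 : k * C * (2 * (σ * b)) ≤ k * C * (σ ^ 2 + b ^ 2) := by
    gcongr; nlinarith [sq_nonneg (σ - b)]
  have h7 : k * (2 * (σ * b)) ≤ k * (σ ^ 2 + b ^ 2) := by
    gcongr; nlinarith [sq_nonneg (σ - b)]
  have h8 : 0 ≤ C * b ^ 2 := by positivity
  have h9 : 0 ≤ C * σ ^ 2 := by positivity
  have h10 : 0 ≤ k * b ^ 2 := by positivity
  have h11 : 0 ≤ k * σ ^ 2 := by positivity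
  have h12 : 0 ≤ k ^ 2 * b ^ 2 := by positivity
  have h13 : 0 ≤ k ^ 2 * σ ^ 2 := by positivity
  have h14 : 0 ≤ C ^ 2 * b ^ 2 := by positivity
  have h15 : 0 ≤ C ^ 2 * σ ^ 2 := by positivity
  have h16 : 0 ≤ b ^ 2 := by positivity
  have h17 : 0 ≤ σ ^ 2 := by positivity
  have h18 : 0 ≤ e ^ 2 := by positivity
  norm_num at h3 h4 h5
  linarith

/-- The weight is the square of a cutoff η, so that its gradient keeps one factor η to be paired
with the gradient of the solution. -/
lemma exists_shellCut_sq_bounds : ∃ C : ℝ, 0 ≤ C ∧ ∀ R ρ t : ℝ, 1 ≤ R → 1 ≤ ρ → 1 ≤ t → 2 * R ≤ 2 * ρ →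
    ∀ x : Space, ‖x‖ ≤ t / 2 →
    (∀ i : Fin 3, |pd i.succ (fun z => shellCut R ρ z * shellCut R ρ z) (t, x)| ≤
      2 * C * (annulus R (2 * ρ)).indicator 1 x * shellCut R ρ (t, x)) ∧
    lap (fun z => lapCoeff t z * (shellCut R ρ z * shellCut R ρ z)) (t, x) ≤
      C * (annulus R (2 * ρ)).indicator 1 x := by
  obtain ⟨C, hC0, hC⟩ := exists_shellCut_bounds
  refine ⟨28 * C + 24 * C ^ 2, by positivity, fun R ρ t hR hρ ht hRρ x hx => ?_⟩
  have ht0 : 0 < t := by linarith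
  obtain ⟨h1, h2⟩ := hC R ρ hR hρ (t, x)
  obtain ⟨hη0, hη1⟩ := shellCut_mem_Icc R ρ (t, x)
  obtain ⟨hX0, hX1⟩ := indicator_one_mem_Icc (annulus R (2 * ρ)) x
  have hηs := contDiff_shellCut R ρ
  have hPX : (annulus R (2 * R)).indicator (1 : Space → ℝ) x ≤ (annulus R (2 * ρ)).indicator 1 x :=
    Set.indicator_le_indicator_of_subset
      (show annulus R (2 * R) ⊆ annulus R (2 * ρ) from fun y hy => ⟨hy.1, by linarith [hy.2]⟩)
      (fun _ => zero_le_one) x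
  have hQX : (annulus ρ (2 * ρ)).indicator (1 : Space → ℝ) x ≤ (annulus R (2 * ρ)).indicator 1 x :=
    Set.indicator_le_indicator_of_subset
      (show annulus ρ (2 * ρ) ⊆ annulus R (2 * ρ) from fun y hy => ⟨by linarith [hy.1], hy.2⟩)
      (fun _ => zero_le_one) x
  have hρi : ρ⁻¹ ≤ 1 := inv_le_one_of_one_le₀ hρ
  have hρi0 : 0 ≤ ρ⁻¹ := by positivity
  set X : ℝ := (annulus R (2 * ρ)).indicator 1 x
  set η := shellCut R ρ (t, x)
  have hQ0 := (indicator_one_mem_Icc (annulus ρ (2 * ρ)) x).1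
  have g1 : ∀ i : Fin 3, |pd i.succ (shellCut R ρ) (t, x)| ≤ 2 * C * X := fun i => by
    refine (h1 i).trans ?_
    have : ρ⁻¹ * (annulus ρ (2 * ρ)).indicator (1 : Space → ℝ) x ≤ 1 * X :=
      mul_le_mul hρi hQX hQ0 zero_le_one
    have := mul_le_mul_of_nonneg_left (add_le_add hPX this) hC0
    simp only at this ⊢
    linarith
  have g2 : |lap (shellCut R ρ) (t, x)| ≤ 2 * C * X := by
    refine h2.trans ?_
    have : ρ⁻¹ ^ 2 * (annulus ρ (2 * ρ)).indicator (1 : Space → ℝ) x ≤ 1 * X :=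
      mul_le_mul (pow_le_one₀ hρi0 hρi) hQX hQ0 zero_le_one
    have := mul_le_mul_of_nonneg_left (add_le_add hPX this) hC0
    simp only at this ⊢
    linarith
  have g3 : ∀ i : Fin 3, |pd i.succ (fun z => shellCut R ρ z * shellCut R ρ z) (t, x)| ≤
      4 * C * X * η := fun i => by
    rw [pd_mul _ hηs hηs]
    refine (abs_add_le _ _).trans ?_
    rw [abs_mul, abs_mul, abs_of_nonneg hη0]
    have := mul_le_mul_of_nonneg_right (g1 i) hη0
    linarith
  have z0 : 0 ≤ C * X := by positivity
  have z1 : 0 ≤ C * X * η := by positivity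
  have z2 : 0 ≤ C ^ 2 * X * η := by positivity
  refine ⟨fun i => (g3 i).trans (by linarith), ?_⟩
  rw [lap_mul (contDiff_lapCoeff t) (hηs.mul hηs), lap_mul hηs hηs, lap_lapCoeff]
  have hb1 := lapCoeff_le_one t (t, x)
  have hb0 := le_lapCoeff ht0 (z := (t, x)) hx
  have s1 := (le_abs_self _).trans (abs_sum_mul_le g1 g1)
  have hdb : ∀ i : Fin 3, |pd i.succ (lapCoeff t) (t, x)| ≤ 1 := fun i => by
    refine (abs_pd_lapCoeff_le (T := t) (t, x) i).trans ?_
    calc 2 * (t ^ 2)⁻¹ * ‖x‖ ≤ 2 * (t ^ 2)⁻¹ * (t / 2) := by gcongr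
      _ = t⁻¹ := by field_simp
      _ ≤ 1 := inv_le_one_of_one_le₀ ht
  have s2 := (le_abs_self _).trans (abs_sum_mul_le hdb g3)
  have s3 : η * lap (shellCut R ρ) (t, x) ≤ η * (2 * C * X) :=
    mul_le_mul_of_nonneg_left ((le_abs_self _).trans g2) hη0
  have s4 : C * X * η ≤ C * X := mul_le_of_le_one_right z0 hη1
  have s5 : 2 * C * X * (2 * C * X) ≤ 4 * C ^ 2 * X := by
    have : 4 * C ^ 2 * X * X ≤ 4 * C ^ 2 * X := mul_le_of_le_one_right (by positivity) hX1
    linarith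
  have s6 : 0 ≤ (t ^ 2)⁻¹ * (η * η) := by positivity
  have s7 : lapCoeff t (t, x) * (η * lap (shellCut R ρ) (t, x) + 2 * ∑ i : Fin 3,
      pd i.succ (shellCut R ρ) (t, x) * pd i.succ (shellCut R ρ) (t, x)
      + lap (shellCut R ρ) (t, x) * η) ≤ 4 * C * X + 24 * C ^ 2 * X := by
    refine (mul_le_mul_of_nonneg_left (show _ ≤ 4 * C * X + 24 * C ^ 2 * X by linarith)
      (by linarith)).trans (mul_le_of_le_one_left (by positivity) hb1)
  linarith

set_option maxHeartbeats 1000000 in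
/-- Caccioppoli's inequality for slice systems, on annuli far from the origin. -/
theorem SliceSystem.caccioppoli (ι : Finset I) {C₁ s : ℝ} (hC₁ : 0 ≤ C₁) (hs : 0 < s) :
    ∃ C R₁ : ℝ, 0 ≤ C ∧ 1 ≤ R₁ ∧ ∀ (i₀ : I) (v : I → Spacetime → ℝ) (D t R ρ : ℝ),
      SliceSystem ι i₀ v C₁ s D t → 0 ≤ D → R₁ ≤ R → R ≤ ρ → 4 * ρ ≤ t →
      ∫ x in annulus (2 * R) ρ, gradSq ι v t x ≤
        C * ∫ x in annulus R (2 * ρ), ((∑ l ∈ ι, v l (t, x) ^ 2) + (D * t⁻¹) ^ 2) := by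
  obtain ⟨Cw, hCw, hwb⟩ := exists_shellCut_sq_bounds
  set N : ℝ := (ι.card : ℝ) with hN
  set k : ℝ := N * C₁ with hk
  have hk0 : 0 ≤ k := by positivity
  set K : ℝ := (2 * Cw + 1) ^ 2 + Cw + 3 * (k * Cw) + 36 * k ^ 2 + 1 + k with hK
  have hK0 : 0 ≤ K := by positivity
  refine ⟨2 * (Cw + 4 * K), 200 * (k + 1), by positivity, by linarith, ?_⟩
  intro i₀ v D t R ρ S hD hR hRρ hρt
  have hR1 : 1 ≤ R := by linarith
  have hR0 : 0 < R := by linarith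
  have hρ0 : 0 < ρ := by linarith
  have ht1 : 1 ≤ t := by linarith
  have ht0 : 0 < t := by linarith
  set τ := t⁻¹ with hτ
  have hτ0 : 0 < τ := by positivity
  have hτ1 : τ ≤ 1 := inv_le_one_of_one_le₀ ht1
  set Ω := annulus R (2 * ρ) with hΩ
  have hvc : Continuous fun x => ∑ l ∈ ι, v l (t, x) ^ 2 :=
    continuous_finsetSum _ fun l hl => (continuous_slice (S.smooth l hl) t).pow 2
  have hqc : Continuous fun x => gradSq ι v t x := continuous_gradSq S.smooth
  have hηc := continuous_slice (contDiff_shellCut R ρ) t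
  set f₁ : Space → ℝ := fun x => shellCut R ρ (t, x) * (shellCut R ρ (t, x) * gradSq ι v t x) with hf₁
  set f₂ : Space → ℝ := Ω.indicator fun x => (∑ l ∈ ι, v l (t, x) ^ 2) + (D * τ) ^ 2 with hf₂
  have i₁ : Integrable f₁ := integrable_shellCut_mul (hηc.mul hqc) R hρ0
  have i₂ : Integrable f₂ := integrable_indicator_annulus (hvc.add continuous_const) _ _
  have hηge : ∀ x : Space, 2 * ρ < ‖x‖ → shellCut R ρ (t, x) = 0 := fun x hx =>
    shellCut_eq_zero_of_ge hρ0 (z := (t, x)) hx.le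
  set Rf : Space → ℝ := fun x => 1 / 4 * f₁ x + (Cw + 4 * K) * f₂ x with hRf
  have hRi : Integrable Rf := (i₁.const_mul _).add (i₂.const_mul _)
  have main := S.weighted_energy (W := fun z => shellCut R ρ z * shellCut R ρ z)
    ((contDiff_shellCut R ρ).mul (contDiff_shellCut R ρ))
    (fun x => mul_self_nonneg _)
    (fun x hx => by simp [hηge x (by linarith)])
    (om := fun x => 2 * Cw * Ω.indicator 1 x * shellCut R ρ (t, x))
    (fun x i hx => (hwb R ρ t hR1 (by linarith) ht1 (by linarith) x hx).1 i)
    (B := fun x => Real.sqrt (∑ l ∈ ι, v l (t, x) ^ 2))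
    (fun l hl x => Real.abs_le_sqrt (Finset.single_le_sum (f := fun l => v l (t, x) ^ 2)
      (fun l _ => sq_nonneg _) hl)) hRi
    (fun x hx => by
      have h1 : x ∉ Ω := fun h => by have := h.2; linarith
      simp [hRf, hf₁, hf₂, h1, hηge x (by linarith)])
    (fun x hx => by
      obtain ⟨hη0, hη1⟩ := shellCut_mem_Icc R ρ (t, x)
      obtain ⟨hX0, hX1⟩ := indicator_one_mem_Icc Ω x
      have hj1 := one_le_jb ‖x‖
      have hj0 := jb_pos ‖x‖
      have hA₂₁ : jb ‖x‖ ^ (-2 - s) ≤ jb ‖x‖ ^ (-1 - s) :=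
        Real.rpow_le_rpow_of_exponent_le hj1 (by linarith)
      have hA₁1 : jb ‖x‖ ^ (-1 - s) ≤ 1 := by
        simpa using rpow_neg_le_inv one_pos hj1 hj1 hs.le
      have hA₁0 : 0 ≤ jb ‖x‖ ^ (-1 - s) := by positivity
      have hA₂0 : 0 ≤ jb ‖x‖ ^ (-2 - s) := by positivity
      have hji : (jb ‖x‖)⁻¹ ≤ 1 := inv_le_one_of_one_le₀ hj1
      have hDτ : 0 ≤ D * τ := by positivity
      have hττ : τ ^ 2 ≤ τ := by nlinarith
      have hs1 : fluxSrc s D t x ≤ 2 * (D * τ) := by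
        rw [fluxSrc, ← inv_pow, ← hτ]
        have h1 : D * (τ ^ 2 + τ * jb ‖x‖ ^ (-1 - s)) ≤ D * (τ + τ * 1) := by gcongr
        linarith
      have hs2 : bulkSrc s D t x ≤ 2 * (D * τ) := by
        rw [bulkSrc, ← inv_pow, ← hτ]
        have h1 : D * (τ ^ 2 * (jb ‖x‖)⁻¹ + τ * jb ‖x‖ ^ (-2 - s)) ≤ D * (τ * 1 + τ * 1) := by
          gcongr; linarith
        linarith
      have hs10 : 0 ≤ fluxSrc s D t x := by unfold fluxSrc; positivity
      have hs20 : 0 ≤ bulkSrc s D t x := by unfold bulkSrc; positivity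
      have hL := (hwb R ρ t hR1 (by linarith) ht1 (by linarith) x hx).2
      set V₂ := ∑ l ∈ ι, v l (t, x) ^ 2 with hV₂
      have hV0 : 0 ≤ V₂ := Finset.sum_nonneg fun _ _ => sq_nonneg _
      have e0 : ∑ l ∈ ι, 1 / 2 * v l (t, x) ^ 2 *
            lap (fun z => lapCoeff t z * (shellCut R ρ z * shellCut R ρ z)) (t, x) =
          1 / 2 * V₂ * lap (fun z => lapCoeff t z * (shellCut R ρ z * shellCut R ρ z)) (t, x) := by
        rw [hV₂, Finset.mul_sum, Finset.sum_mul]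
      have e2 : f₂ x = Ω.indicator 1 x * (V₂ + (D * τ) ^ 2) := (indicator_one_mul_eq Ω _ x).symm
      rw [e0]
      have hL' := mul_le_mul_of_nonneg_left hL (by positivity : 0 ≤ 1 / 2 * V₂)
      set X : ℝ := Ω.indicator 1 x
      set η := shellCut R ρ (t, x)
      set q := Real.sqrt (gradSq ι v t x)
      set β := Real.sqrt V₂
      have hβ2 : β ^ 2 = V₂ := Real.sq_sqrt hV0
      have hβ0 : 0 ≤ β := Real.sqrt_nonneg _
      have hq0 : 0 ≤ q := Real.sqrt_nonneg _
      have hq2 : q ^ 2 = gradSq ι v t x := Real.sq_sqrt (gradSq_nonneg _ _ _ _)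
      have hφβ : |v i₀ (t, x)| ≤ β := Real.abs_le_sqrt (Finset.single_le_sum
        (f := fun l => v l (t, x) ^ 2) (fun l _ => sq_nonneg _) S.mem)
      have hf1 : f₁ x = (η * q) ^ 2 := by rw [mul_pow, hq2]; simp only [hf₁]; ring
      have hz : 0 ≤ X * V₂ := by positivity
      have hXi : X ^ 2 ≤ X := by nlinarith
      -- One factor η of each product goes to the perturbation and one to the test function. Only ηq
      -- appears then, and its square is absorbed. This needs r > R, which makes ⟨r⟩^{-1-s} small;
      -- for r ≤ R the cutoff vanishes.
      have hfin : k * (3 * ((jb ‖x‖ ^ (-1 - s) * (q + |v i₀ (t, x)|) + fluxSrc s D t x) *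
            (2 * Cw * X * η * β + η * η * q)) + (jb ‖x‖ ^ (-2 - s) * (q + |v i₀ (t, x)|)
            + bulkSrc s D t x) * (η * η * β)) ≤ 1 / 4 * (η * q) ^ 2 + 4 * K * (X * (V₂ + (D * τ) ^ 2)) := by
        rcases le_or_gt ‖x‖ R with h | h
        · have : η = 0 := shellCut_eq_zero_of_le hR0 (z := (t, x)) h
          rw [this]; simp; positivity
        · have hA : k * jb ‖x‖ ^ (-1 - s) ≤ 1 / 200 := by
            have h1 : jb ‖x‖ ^ (-1 - s) ≤ (200 * (k + 1))⁻¹ :=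
              rpow_neg_le_inv (by positivity) (by linarith [le_jb ‖x‖]) hj1 hs.le
            calc k * jb ‖x‖ ^ (-1 - s) ≤ k * (200 * (k + 1))⁻¹ := by gcongr
              _ = k / (200 * (k + 1)) := by rw [div_eq_mul_inv]
              _ ≤ 1 / 200 := by rw [div_le_div_iff₀ (by positivity) (by positivity)]; linarith
          have hηX : η ≤ X := by
            rcases le_or_gt ‖x‖ (2 * ρ) with h' | h'
            · have : X = 1 := by
                simp only [X]
                rw [Set.indicator_of_mem (show x ∈ Ω from ⟨h.le, h'⟩)]; rfl
              rw [this]; exact hη1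
            · rw [show η = 0 from hηge x h']; exact hX0
          have Q := quad_absorb_inner (k := k) (C := Cw) (A := jb ‖x‖ ^ (-1 - s)) (e := η * q)
            (b := X * β) (σ := X * (2 * (D * τ))) hk0 hCw (by positivity) (by positivity)
            hA
          have hb : η * |v i₀ (t, x)| ≤ X * β := mul_le_mul hηX hφβ (abs_nonneg _) hX0
          have hc : η * β ≤ X * β := by gcongr
          have hσ1 : η * fluxSrc s D t x ≤ X * (2 * (D * τ)) := mul_le_mul hηX hs1 hs10 hX0
          have hσ2 : η * bulkSrc s D t x ≤ X * (2 * (D * τ)) := mul_le_mul hηX hs2 hs20 hX0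
          have u1 : η * (jb ‖x‖ ^ (-1 - s) * (q + |v i₀ (t, x)|) + fluxSrc s D t x) ≤
              jb ‖x‖ ^ (-1 - s) * (η * q + X * β) + X * (2 * (D * τ)) := by
            have := mul_le_mul_of_nonneg_left hb hA₁0
            linarith
          have u2 : η * (jb ‖x‖ ^ (-2 - s) * (q + |v i₀ (t, x)|) + bulkSrc s D t x) ≤
              jb ‖x‖ ^ (-1 - s) * (η * q + X * β) + X * (2 * (D * τ)) := by
            have h1 := mul_le_mul_of_nonneg_left hb hA₂0
            have h2 := mul_le_mul_of_nonneg_right hA₂₁ (by positivity : 0 ≤ η * q + X * β)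
            linarith
          have w1 := mul_le_mul_of_nonneg_right u1 (by positivity : 0 ≤ 2 * Cw * (X * β) + η * q)
          have w2 : η * (jb ‖x‖ ^ (-2 - s) * (q + |v i₀ (t, x)|) + bulkSrc s D t x) * (η * β) ≤
              (jb ‖x‖ ^ (-1 - s) * (η * q + X * β) + X * (2 * (D * τ))) * (X * β) :=
            mul_le_mul u2 hc (by positivity) (by positivity)
          have w3 := mul_le_mul_of_nonneg_left (add_le_add
            (mul_le_mul_of_nonneg_left w1 (by norm_num : (0 : ℝ) ≤ 3)) w2) hk0
          rw [← hK] at Q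
          have w4 : (X * β) ^ 2 + (X * (2 * (D * τ))) ^ 2 ≤ 4 * (X * (V₂ + (D * τ) ^ 2)) := by
            have h1 : X ^ 2 * (V₂ + 4 * (D * τ) ^ 2) ≤ X * (V₂ + 4 * (D * τ) ^ 2) := by gcongr
            have h2 : (X * β) ^ 2 = X ^ 2 * V₂ := by rw [mul_pow, hβ2]
            linarith
          have w5 := mul_le_mul_of_nonneg_left w4 hK0
          linarith
      simp only [hRf, e2, hf1]
      have hzz : 0 ≤ Cw * (X * (D * τ) ^ 2) := by positivity
      have hz2 : 0 ≤ Cw * (X * V₂) := by positivity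
      refine le_trans (le_of_eq ?_) ((add_le_add hL' hfin).trans ?_)
      · rw [hk]; ring
      · linarith)
  have hlow : 3 / 4 * ∫ x, f₁ x ≤
      ∫ x : Space, lapCoeff t (t, x) * (shellCut R ρ (t, x) * shellCut R ρ (t, x)) * gradSq ι v t x := by
    rw [← integral_const_mul]
    refine integral_mono (i₁.const_mul _) ?_ fun x => ?_
    · have hb := continuous_slice (contDiff_lapCoeff t) t
      refine (integrable_shellCut_mul (t := t) ((hb.mul hηc).mul hqc) R hρ0).congr
        (Filter.Eventually.of_forall fun x => ?_)
      simp only [Pi.mul_apply]; ring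
    · have hf : 0 ≤ f₁ x := by
        have := gradSq_nonneg ι v t x
        have := mul_self_nonneg (shellCut R ρ (t, x))
        simp only [hf₁, ← mul_assoc]; positivity
      rcases le_or_gt ‖x‖ (t / 2) with h | h
      · have := mul_le_mul_of_nonneg_right (le_lapCoeff ht0 (z := (t, x)) h) hf
        refine this.trans (le_of_eq ?_)
        simp only [hf₁]; ring
      · simp [hf₁, hηge x (by linarith)]
  have hsum : ∫ x, Rf x = 1 / 4 * (∫ x, f₁ x) + (Cw + 4 * K) * ∫ x, f₂ x := by
    simp only [hRf]
    rw [integral_add (i₁.const_mul _) (i₂.const_mul _), integral_const_mul, integral_const_mul]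
  have hfirst : ∫ x in annulus (2 * R) ρ, gradSq ι v t x ≤ ∫ x, f₁ x := by
    rw [← integral_indicator (measurableSet_annulus _ _)]
    refine integral_mono (integrable_indicator_annulus hqc _ _) i₁ fun x => ?_
    by_cases h : x ∈ annulus (2 * R) ρ
    · rw [Set.indicator_of_mem h]
      simp only [hf₁, shellCut_eq_one hR0 hρ0 (z := (t, x)) h.1 h.2]; simp
    · rw [Set.indicator_of_notMem h]
      have := gradSq_nonneg ι v t x
      have := mul_self_nonneg (shellCut R ρ (t, x))
      simp only [hf₁, ← mul_assoc]; positivity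
  rw [hsum] at main
  have hf2 : ∫ x, f₂ x = ∫ x in annulus R (2 * ρ), ((∑ l ∈ ι, v l (t, x) ^ 2) + (D * τ) ^ 2) :=
    integral_indicator (measurableSet_annulus _ _)
  rw [← hf2]
  linarith

end Caccioppoli

/-! ### Pointwise and shell bounds in the exterior of a large ball -/

section Exterior

variable {I : Type*}

/-- The energy of the outer estimate. -/
def shellEnergy (ι : Finset I) (i₀ : I) (v : I → Spacetime → ℝ) (t R : ℝ) (x₀ : Space) : ℝ :=
  ∫ x : Space, shellCut R (t / 4) (t, x) * (newt x₀ (t, x) * gradSq ι v t x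
    + newt x₀ (t, x) ^ 5 * v i₀ (t, x) ^ 2)

/-- The energy density of a family controls the derivatives of its base function that enter the
Sobolev inequality. -/
def SobolevDominated (ι : Finset I) (i₀ : I) (v : I → Spacetime → ℝ) (t : ℝ) : Prop :=
  ∀ l : List (Fin 4), l.Sublist [1, 2, 3] → ∀ x : Space,
    pdl l (v i₀) (t, x) ^ 2 ≤ v i₀ (t, x) ^ 2 + gradSq ι v t x

lemma shellEnergy_integrable {ι : Finset I} {i₀ : I} {v : I → Spacetime → ℝ}
    (hv : ∀ l ∈ ι, ContDiff ℝ ∞ (v l)) (h0 : i₀ ∈ ι) {t R : ℝ} (ht : 0 < t) (x₀ : Space) :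
    Integrable fun x : Space => shellCut R (t / 4) (t, x) * (newt x₀ (t, x) * gradSq ι v t x
      + newt x₀ (t, x) ^ 5 * v i₀ (t, x) ^ 2) := by
  have hwc := continuous_slice (contDiff_newt x₀) t
  exact integrable_shellCut_mul ((hwc.mul (continuous_gradSq hv)).add
    ((hwc.pow 5).mul ((continuous_slice (hv i₀ h0) t).pow 2))) R (by linarith)

lemma shellEnergy_density_nonneg {ι : Finset I} {i₀ : I} {v : I → Spacetime → ℝ} {t R : ℝ}
    (x₀ x : Space) : 0 ≤ shellCut R (t / 4) (t, x) * (newt x₀ (t, x) * gradSq ι v t x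
      + newt x₀ (t, x) ^ 5 * v i₀ (t, x) ^ 2) := by
  have h1 := (shellCut_mem_Icc R (t / 4) (t, x)).1
  have h2 := newt_pos x₀ (t, x)
  have h3 := gradSq_nonneg ι v t x
  positivity

/-- In the ball of radius 2 about x₀ the cutoff equals 1 and the weight is at least 1/3. The energy
density thus dominates 3⁻⁵ = 1/243 times the quadratic form in the Sobolev inequality. -/
lemma sq_le_shellEnergy : ∃ C : ℝ, 0 ≤ C ∧ ∀ (ι : Finset I) (i₀ : I) (v : I → Spacetime → ℝ)
    (t R : ℝ) (x₀ : Space), (∀ l ∈ ι, ContDiff ℝ ∞ (v l)) → i₀ ∈ ι → SobolevDominated ι i₀ v t →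
      1 ≤ R → 16 ≤ t → 4 * R ≤ ‖x₀‖ → ‖x₀‖ ≤ t / 8 →
      v i₀ (t, x₀) ^ 2 ≤ C * shellEnergy ι i₀ v t R x₀ := by
  obtain ⟨C, hC, h⟩ := sobolev_unit
  refine ⟨C * 243, by positivity, fun ι i₀ v t R x₀ hv h0 hs hR ht hx hxt => ?_⟩
  have hc : Continuous fun x => v i₀ (t, x) ^ 2 + gradSq ι v t x :=
    ((continuous_slice (hv i₀ h0) t).pow 2).add (continuous_gradSq hv)
  refine (h (v i₀) (hv i₀ h0) t x₀ _ hc.continuousOn fun x _ l hl => hs l hl x).trans ?_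
  rw [mul_assoc]
  refine mul_le_mul_of_nonneg_left ?_ hC
  have hi := shellEnergy_integrable (R := R) hv h0 (by linarith : 0 < t) x₀
  rw [shellEnergy, ← integral_const_mul]
  refine le_trans ?_ (setIntegral_le_integral (s := Metric.closedBall x₀ 2) (hi.const_mul 243)
    (Filter.Eventually.of_forall fun x =>
      mul_nonneg (by norm_num) (shellEnergy_density_nonneg x₀ x)))
  refine setIntegral_mono_on (hc.continuousOn.integrableOn_compact (isCompact_closedBall _ _))
    (hi.const_mul 243).integrableOn measurableSet_closedBall fun x hx' => ?_
  rw [Metric.mem_closedBall, dist_eq_norm] at hx'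
  have h1 : ‖x₀‖ ≤ ‖x‖ + 2 := by
    have := norm_sub_norm_le x₀ x
    rw [norm_sub_rev] at this; linarith
  have h2 : ‖x‖ ≤ ‖x₀‖ + 2 := by
    have := norm_sub_norm_le x x₀; linarith
  rw [shellCut_eq_one (by linarith) (by linarith) (z := (t, x)) (by simp only; linarith)
    (by simp only; linarith)]
  have h3 : jb ‖x - x₀‖ ≤ 3 := by
    have := jb_le_one_add ‖x - x₀‖
    rw [abs_norm] at this; linarith
  have h4 : (3 : ℝ)⁻¹ ≤ newt x₀ (t, x) := inv_anti₀ (jb_pos _) h3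
  have h5 : (3 : ℝ)⁻¹ ^ 5 ≤ newt x₀ (t, x) ^ 5 := by gcongr
  have g := mul_le_mul_of_nonneg_right h4 (gradSq_nonneg ι v t x)
  have g' := mul_le_mul_of_nonneg_right h5 (sq_nonneg (v i₀ (t, x)))
  have := gradSq_nonneg ι v t x
  norm_num at g g'
  linarith

lemma sq_le_of_absorb {m C P Q J : ℝ} (hJ : C * J ≤ 1 / 4)
    (h : m ^ 2 ≤ C * (J * m ^ 2 + m * P + P ^ 2 + Q)) (hQ : 0 ≤ Q) :
    m ^ 2 ≤ 2 * (C ^ 2 + C) * (P ^ 2 + Q) := by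
  have h1 : C * J * m ^ 2 ≤ 1 / 4 * m ^ 2 := mul_le_mul_of_nonneg_right hJ (sq_nonneg m)
  have h2 : m * (C * P) ≤ 1 / 4 * m ^ 2 + (4 * (1 / 4))⁻¹ * (C * P) ^ 2 := mul_le_amgm (by norm_num)
  have h3 : 0 ≤ C ^ 2 * Q := by positivity
  norm_num at h2
  nlinarith

lemma rpow_neg_le_of_ge {C s R : ℝ} (hC : 0 ≤ C) (hs : 0 < s)
    (hR : (4 * C + 1) ^ (2 / s) ≤ R) : C * R ^ (-(s / 2)) ≤ 1 / 4 := by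
  have h0 : 0 < 4 * C + 1 := by linarith
  have h1 : 0 < (4 * C + 1) ^ (2 / s) := by positivity
  have h2 : R ^ (-(s / 2)) ≤ ((4 * C + 1) ^ (2 / s)) ^ (-(s / 2)) :=
    Real.rpow_le_rpow_of_nonpos h1 hR (by linarith)
  rw [← Real.rpow_mul h0.le, show 2 / s * (-(s / 2)) = -1 by field_simp, Real.rpow_neg_one] at h2
  calc C * R ^ (-(s / 2)) ≤ C * (4 * C + 1)⁻¹ := by gcongr
    _ = C / (4 * C + 1) := by rw [div_eq_mul_inv]
    _ ≤ 1 / 4 := by rw [div_le_div_iff₀ h0 (by norm_num)]; linarith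

lemma setIntegral_annulus_const_le (R ρ c : ℝ) (hρ : 0 ≤ ρ) (hc : 0 ≤ c) :
    ∫ _ in annulus R ρ, c ≤ (volume : Measure Space).real (Metric.ball 0 1) * ρ ^ 3 * c := by
  rw [setIntegral_const, smul_eq_mul]
  refine mul_le_mul_of_nonneg_right ?_ hc
  have h1 : (volume : Measure Space).real (annulus R ρ) ≤
      (volume : Measure Space).real (Metric.closedBall 0 ρ) :=
    measureReal_mono (fun x hx => by simpa using hx.2) (isCompact_closedBall _ _).measure_ne_top
  refine h1.trans (le_of_eq ?_)
  rw [Measure.addHaar_real_closedBall _ _ hρ]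
  simp [mul_comm]

set_option maxHeartbeats 1000000 in
/-- Bounds for a slice system in the exterior of a large ball, in terms of its size near the
boundary of that ball. -/
theorem SliceSystem.exterior_bounds (ι : Finset I) {C₁ s : ℝ} (hC₁ : 0 ≤ C₁) (hs : 0 < s)
    (hs1 : s ≤ 1) : ∃ C R₁ T₁ : ℝ, 0 ≤ C ∧ 1 ≤ R₁ ∧ 16 ≤ T₁ ∧
    ∀ (i₀ : I) (v : I → Spacetime → ℝ) (D t R b : ℝ), SliceSystem ι i₀ v C₁ s D t →
      SobolevDominated ι i₀ v t → 0 ≤ D → R₁ ≤ R → T₁ ≤ t → 0 ≤ b →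
      (∀ x ∈ annulus R (4 * R), v i₀ (t, x) ^ 2 ≤ b) →
      (∀ x ∈ annulus R (t / 2), v i₀ (t, x) ^ 2 ≤ C * ((D * t⁻¹) ^ 2
        + ((∫ x in annulus R (2 * R), (v i₀ (t, x) ^ 2 + gradSq ι v t x)) + b))) ∧
      ∀ ρ : ℝ, 4 * R ≤ ρ → 16 * ρ ≤ t →
        ∫ x in annulus ρ (2 * ρ), (ρ⁻¹ * gradSq ι v t x + ρ⁻¹ ^ 3 * v i₀ (t, x) ^ 2) ≤
          C * (ρ ^ (-(s / 2)) * ((∫ x in annulus R (2 * R), (v i₀ (t, x) ^ 2 + gradSq ι v t x)) + b)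
            + ρ ^ (s / 2) * (D * t⁻¹) ^ 2) := by
  obtain ⟨Co, R₀, T₀, hCo, hR₀, hT₀, houter⟩ := SliceSystem.outer_estimate ι hC₁ hs hs1
  obtain ⟨Cs, hCs, hsob⟩ := sq_le_shellEnergy (I := I)
  set C' := Cs * Co with hC'
  have hC'0 : 0 ≤ C' := by positivity
  set C₂ := 2 * (C' ^ 2 + C') + 65 with hC₂
  have hC₂0 : 0 ≤ C₂ := by positivity
  set vol := (volume : Measure Space).real (Metric.ball 0 1) with hvol
  have hvol0 : 0 ≤ vol := measureReal_nonneg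
  set C₃ := Co * (2 * C₂ + 2) with hC₃
  have hC₃0 : 0 ≤ C₃ := by positivity
  refine ⟨C₂ + (4 * C₃ + vol * 8 * (Cs * C₃)), max R₀ ((4 * C' + 1) ^ (2 / s)), max T₀ 16,
    by positivity, hR₀.trans (le_max_left _ _), le_max_right _ _, ?_⟩
  intro i₀ v D t R b S hdom hD hR ht hb hbd
  have hRR₀ : R₀ ≤ R := (le_max_left _ _).trans hR
  have hRs : (4 * C' + 1) ^ (2 / s) ≤ R := (le_max_right _ _).trans hR
  have htT : T₀ ≤ t := (le_max_left _ _).trans ht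
  have ht16 : 16 ≤ t := (le_max_right _ _).trans ht
  have hR1 : 1 ≤ R := hR₀.trans hRR₀
  have ht0 : 0 < t := by linarith
  have hφc : Continuous fun x => v i₀ (t, x) := continuous_slice (S.smooth i₀ S.mem) t
  have hqc : Continuous fun x => gradSq ι v t x := continuous_gradSq S.smooth
  set a2 := ∫ x in annulus R (2 * R), (v i₀ (t, x) ^ 2 + gradSq ι v t x) with ha2
  have ha20 : 0 ≤ a2 := integral_nonneg fun x => add_nonneg (sq_nonneg _) (gradSq_nonneg _ _ _ _)
  set P := D * t⁻¹ with hP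
  have hP0 : 0 ≤ P := by positivity
  have hsup : ∀ x ∈ annulus R (t / 2), v i₀ (t, x) ^ 2 ≤ C₂ * (P ^ 2 + (a2 + b)) := by
    intro x hx
    -- It suffices to bound |v| at a maximum point y. Near the inner edge b bounds it, for |y| ≥ t/8
    -- the a priori bound does. In between, the outer estimate at x₀ = y returns m² with the factor
    -- ⟨y⟩^{-s/2}, which is small because |y| ≥ R, so m² is absorbed.
    obtain ⟨y, hy, hmax⟩ := (isCompact_annulus R (t / 2)).exists_isMaxOn ⟨x, hx⟩
      hφc.abs.continuousOn
    have hm : ∀ z ∈ annulus R (t / 2), |v i₀ (t, z)| ≤ |v i₀ (t, y)| := fun z hz => hmax hz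
    have hxy : v i₀ (t, x) ^ 2 ≤ |v i₀ (t, y)| ^ 2 := by
      rw [← sq_abs (v i₀ (t, x))]
      exact pow_le_pow_left₀ (abs_nonneg _) (hm x hx) 2
    refine hxy.trans ?_
    set m := |v i₀ (t, y)| with hmdef
    have z1 : 0 ≤ (C' ^ 2 + C') * (P ^ 2 + (a2 + b)) := by positivity
    have z2 : 0 ≤ P ^ 2 := sq_nonneg P
    rcases le_or_gt ‖y‖ (4 * R) with h4 | h4
    · have : m ^ 2 ≤ b := by rw [hmdef, sq_abs]; exact hbd y ⟨hy.1, h4⟩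
      rw [hC₂]; linarith
    rcases le_or_gt (t / 8) ‖y‖ with h8 | h8
    · have h1 : m ≤ 8 * P := by
        refine ((S.apriori i₀ S.mem y hy.2).1).trans ?_
        have : (jb ‖y‖)⁻¹ ≤ (t / 8)⁻¹ := inv_anti₀ (by positivity) (h8.trans (le_jb _))
        calc D * (jb ‖y‖)⁻¹ ≤ D * (t / 8)⁻¹ := by gcongr
          _ = 8 * P := by rw [hP]; field_simp
      have h2 : m ^ 2 ≤ (8 * P) ^ 2 := pow_le_pow_left₀ (abs_nonneg _) h1 2
      rw [hC₂]; linarith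
    · have ho := houter i₀ v D t R m y S hD hRR₀ htT h4.le h8.le hm
      have hq := hsob ι i₀ v t R y S.smooth S.mem hdom hR1 ht16 h4.le h8.le
      have h1 : m ^ 2 ≤ C' * (jb ‖y‖ ^ (-(s / 2)) * m ^ 2 + m * P + P ^ 2 + (jb ‖y‖)⁻¹ * a2) := by
        refine (le_of_eq (sq_abs _)).trans (hq.trans ?_)
        rw [hC', mul_assoc]
        exact mul_le_mul_of_nonneg_left ho hCs
      have hRj : R ≤ jb ‖y‖ := hy.1.trans (le_jb _)
      have h2 : C' * jb ‖y‖ ^ (-(s / 2)) ≤ 1 / 4 := rpow_neg_le_of_ge hC'0 hs (hRs.trans hRj)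
      have h3 := sq_le_of_absorb h2 h1 (mul_nonneg (inv_nonneg.2 (jb_pos _).le) ha20)
      have h4 : (jb ‖y‖)⁻¹ * a2 ≤ a2 :=
        mul_le_of_le_one_left ha20 (inv_le_one_of_one_le₀ (one_le_jb _))
      have h5 := mul_le_mul_of_nonneg_left h4 (by positivity : 0 ≤ 2 * (C' ^ 2 + C'))
      have h6 : 0 ≤ (C' ^ 2 + C') * b := by positivity
      rw [hC₂]; linarith
  have z3 : 0 ≤ (4 * C₃ + vol * 8 * (Cs * C₃)) * (P ^ 2 + (a2 + b)) := by positivity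
  refine ⟨fun x hx => (hsup x hx).trans (by linarith), fun ρ hρ hρt => ?_⟩
  have hρ1 : 1 ≤ ρ := by linarith
  have hρ0 : 0 < ρ := by linarith
  set m := Real.sqrt (C₂ * (P ^ 2 + (a2 + b))) with hm
  have hm2 : m ^ 2 = C₂ * (P ^ 2 + (a2 + b)) := Real.sq_sqrt (by positivity)
  have hmb : ∀ x ∈ annulus R (t / 2), |v i₀ (t, x)| ≤ m := fun x hx => Real.abs_le_sqrt (hsup x hx)
  set α := ρ ^ (-(s / 2)) with hα
  set β := ρ ^ (s / 2) with hβ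
  have hα0 : 0 ≤ α := by positivity
  have hβ1 : 1 ≤ β := Real.one_le_rpow hρ1 (by linarith)
  have hα1 : α ≤ 1 := by
    rw [hα, ← Real.rpow_zero ρ]; exact Real.rpow_le_rpow_of_exponent_le hρ1 (by linarith)
  have hαβ : α * β = 1 := by
    rw [hα, hβ, ← Real.rpow_add hρ0]; simp
  have henergy : ∀ x₀ ∈ annulus ρ (2 * ρ),
      shellEnergy ι i₀ v t R x₀ ≤ C₃ * (α * (a2 + b) + β * P ^ 2) := by
    intro x₀ hx₀
    have ho := houter i₀ v D t R m x₀ S hD hRR₀ htT (by linarith [hx₀.1]) (by linarith [hx₀.2]) hmb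
    have hρj : ρ ≤ jb ‖x₀‖ := hx₀.1.trans (le_jb _)
    have h1 : jb ‖x₀‖ ^ (-(s / 2)) ≤ α := Real.rpow_le_rpow_of_nonpos hρ0 hρj (by linarith)
    have h2 : (jb ‖x₀‖)⁻¹ ≤ α := by
      calc (jb ‖x₀‖)⁻¹ ≤ ρ⁻¹ := inv_anti₀ hρ0 hρj
        _ = ρ ^ (-1 : ℝ) := (Real.rpow_neg_one ρ).symm
        _ ≤ α := Real.rpow_le_rpow_of_exponent_le hρ1 (by linarith)
    refine ho.trans ?_
    rw [hC₃, mul_assoc]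
    refine mul_le_mul_of_nonneg_left ?_ hCo
    have g1 := mul_le_mul_of_nonneg_right h1 (sq_nonneg m)
    have g2 := mul_le_mul_of_nonneg_right h2 ha20
    -- The mixed term is split with weight α = ρ^{-s/2}, so that m² keeps the small factor. The
    -- price is the growing factor β = ρ^{s/2} in front of (D/t)².
    have g3 : m * P ≤ α * m ^ 2 + (4 * α)⁻¹ * P ^ 2 := mul_le_amgm (by positivity)
    have g4 : (4 * α)⁻¹ = 1 / 4 * β := by
      rw [mul_inv, show α⁻¹ = β from inv_eq_of_mul_eq_one_right hαβ]; norm_num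
    have g5 : α * m ^ 2 ≤ C₂ * (α * (a2 + b) + β * P ^ 2) := by
      rw [hm2]
      have : C₂ * (α * P ^ 2) ≤ C₂ * (β * P ^ 2) := by gcongr; linarith
      linarith
    have g6 : 1 * P ^ 2 ≤ β * P ^ 2 := by gcongr
    have g7 : 0 ≤ α * b := by positivity
    have g8 : 0 ≤ α * a2 := by positivity
    have g9 : 0 ≤ β * P ^ 2 := by positivity
    rw [g4] at g3
    linarith
  set E := C₃ * (α * (a2 + b) + β * P ^ 2) with hE
  have hE0 : 0 ≤ E := by positivity
  have hpt : ∀ x ∈ annulus ρ (2 * ρ), v i₀ (t, x) ^ 2 ≤ Cs * E := fun x hx =>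
    (hsob ι i₀ v t R x S.smooth S.mem hdom hR1 ht16 (by linarith [hx.1]) (by linarith [hx.2])).trans
      (mul_le_mul_of_nonneg_left (henergy x hx) hCs)
  have hc := isCompact_annulus ρ (2 * ρ)
  have hmeas := measurableSet_annulus ρ (2 * ρ)
  have j1 : IntegrableOn (fun x => ρ⁻¹ * gradSq ι v t x) (annulus ρ (2 * ρ)) :=
    (continuous_const.mul hqc).continuousOn.integrableOn_compact hc
  have j2 : IntegrableOn (fun x => ρ⁻¹ ^ 3 * v i₀ (t, x) ^ 2) (annulus ρ (2 * ρ)) :=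
    (continuous_const.mul (hφc.pow 2)).continuousOn.integrableOn_compact hc
  rw [integral_add j1 j2]
  -- One centre x₀ with |x₀| = ρ serves the whole shell, since ⟨x-x₀⟩ ≤ 4ρ on it.
  have k1 : ∫ x in annulus ρ (2 * ρ), ρ⁻¹ * gradSq ι v t x ≤ 4 * E := by
    set x₀ : Space := EuclideanSpace.single 0 ρ with hx₀
    have hx₀n : ‖x₀‖ = ρ := by simp [hx₀, abs_of_pos hρ0]
    have he := henergy x₀ ⟨hx₀n.ge, by linarith⟩
    have hi := shellEnergy_integrable (R := R) S.smooth S.mem ht0 x₀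
    refine le_trans ?_ (mul_le_mul_of_nonneg_left he (by norm_num : (0 : ℝ) ≤ 4))
    rw [shellEnergy, ← integral_const_mul]
    refine le_trans ?_ (setIntegral_le_integral (s := annulus ρ (2 * ρ)) (hi.const_mul 4)
      (Filter.Eventually.of_forall fun x =>
        mul_nonneg (by norm_num) (shellEnergy_density_nonneg x₀ x)))
    refine setIntegral_mono_on j1 (hi.const_mul 4).integrableOn hmeas fun x hx => ?_
    rw [shellCut_eq_one (by linarith) (by linarith) (z := (t, x)) (by simp only; linarith [hx.1])
      (by simp only; linarith [hx.2])]
    have h1 : jb ‖x - x₀‖ ≤ 4 * ρ := by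
      have h2 := norm_sub_le x x₀
      have h3 := jb_le_one_add ‖x - x₀‖
      rw [abs_norm] at h3
      linarith [hx.2]
    have h4 : (4 * ρ)⁻¹ ≤ newt x₀ (t, x) := inv_anti₀ (jb_pos _) h1
    have h5 := mul_le_mul_of_nonneg_right h4 (gradSq_nonneg ι v t x)
    have h6 : 0 ≤ newt x₀ (t, x) ^ 5 * v i₀ (t, x) ^ 2 := by
      have := newt_pos x₀ (t, x); positivity
    have h7 : (4 * ρ)⁻¹ = 1 / 4 * ρ⁻¹ := by rw [mul_inv]; norm_num
    rw [h7] at h5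
    linarith
  -- Here every point of the shell is its own centre: the Sobolev bound holds pointwise, and the
  -- factor ρ⁻³ pays for the volume.
  have k2 : ∫ x in annulus ρ (2 * ρ), ρ⁻¹ ^ 3 * v i₀ (t, x) ^ 2 ≤ vol * 8 * (Cs * E) := by
    calc ∫ x in annulus ρ (2 * ρ), ρ⁻¹ ^ 3 * v i₀ (t, x) ^ 2
        ≤ ∫ _ in annulus ρ (2 * ρ), ρ⁻¹ ^ 3 * (Cs * E) := by
          refine setIntegral_mono_on j2 (continuousOn_const.integrableOn_compact hc) hmeas
            fun x hx => ?_
          exact mul_le_mul_of_nonneg_left (hpt x hx) (by positivity)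
      _ ≤ vol * (2 * ρ) ^ 3 * (ρ⁻¹ ^ 3 * (Cs * E)) :=
          setIntegral_annulus_const_le _ _ _ (by positivity) (by positivity)
      _ = vol * 8 * (Cs * E) := by field_simp; ring
  have z4 : 0 ≤ C₂ * (α * (a2 + b) + β * P ^ 2) := by positivity
  have : 4 * E + vol * 8 * (Cs * E) = (4 * C₃ + vol * 8 * (Cs * C₃)) * (α * (a2 + b) + β * P ^ 2) := by
    rw [hE]; ring
  linarith

end Exterior

/-! ### Solutions as slice systems -/

section Words

/-- The lists of space indices of length at most `K`. -/
def spIdx (K : ℕ) : Finset (List (Fin 3)) := (List.finite_length_le (Fin 3) K).toFinset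

lemma mem_spIdx {K : ℕ} {l : List (Fin 3)} : l ∈ spIdx K ↔ l.length ≤ K := by
  simp [spIdx]

/-- The space derivatives of a function. -/
def spd (φ : Spacetime → ℝ) (l : List (Fin 3)) : Spacetime → ℝ := pdl (l.map Fin.succ) φ

lemma contDiff_spd {φ : Spacetime → ℝ} (hφ : ContDiff ℝ ∞ φ) (l : List (Fin 3)) :
    ContDiff ℝ ∞ (spd φ l) := contDiff_pdl _ hφ

lemma pd_spd {φ : Spacetime → ℝ} (hφ : ContDiff ℝ ∞ φ) (i : Fin 3) (l : List (Fin 3)) :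
    pd i.succ (spd φ l) = spd φ (i :: l) := by
  rw [spd, pd_pdl _ _ hφ]; rfl

lemma exists_bound_of_finite {α : Type*} {S : Set α} (hS : S.Finite) {P : α → ℝ → Prop}
    (hmono : ∀ a c c', c ≤ c' → P a c → P a c') (h : ∀ a ∈ S, ∃ c, P a c) :
    ∃ C : ℝ, 0 ≤ C ∧ ∀ a ∈ S, P a C := by
  classical
  choose! c hc using h
  refine ⟨∑ a ∈ hS.toFinset, |c a|, Finset.sum_nonneg fun _ _ => abs_nonneg _, fun a ha => ?_⟩
  refine hmono a (c a) _ ((le_abs_self _).trans ?_) (hc a ha)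
  exact Finset.single_le_sum (f := fun a => |c a|) (fun _ _ => abs_nonneg _) (by simpa using ha)

lemma vf_eq_pdl (l : List (Fin 4)) (k : ℕ) {u : Spacetime → ℝ} (hu : ContDiff ℝ ∞ (scal^[k] u)) :
    vf ⟨fun a => l.count a, 0, k⟩ u = pdl l (scal^[k] u) := by
  rw [vf, pdl_eq_pdMulti l hu]; rfl

lemma rotMulti_single (a : Fin 3) (n : ℕ) (u : Spacetime → ℝ) :
    rotMulti (Pi.single a n) u = (rot a)^[n] u := by
  fin_cases a <;> simp [rotMulti]

lemma vf_eq_pdl_rot (l : List (Fin 4)) (a : Fin 3) (n : ℕ) {u : Spacetime → ℝ}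
    (hu : ContDiff ℝ ∞ ((rot a)^[n] u)) :
    vf ⟨fun a => l.count a, Pi.single a n, 0⟩ u = pdl l ((rot a)^[n] u) := by
  rw [vf, pdl_eq_pdMulti l hu, rotMulti_single]; rfl

lemma SZ.exists_pdl_bound {w u : Spacetime → ℝ} (h : SZ w u) (n : ℕ) :
    ∃ C : ℝ, 0 ≤ C ∧ ∀ l : List (Fin 4), l.length ≤ n → ∀ z : Spacetime, 0 ≤ z.1 →
      |pdl l u z| ≤ C * |w z| ∧ |pdl l (scal u) z| ≤ C * |w z| := by
  refine exists_bound_of_finite (S := {l : List (Fin 4) | l.length ≤ n})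
    (P := fun l C => ∀ z : Spacetime, 0 ≤ z.1 → |pdl l u z| ≤ C * |w z| ∧
      |pdl l (scal u) z| ≤ C * |w z|) (List.finite_length_le _ n) ?_ ?_
  · intro l c c' hc h z hz
    have := mul_le_mul_of_nonneg_right hc (abs_nonneg (w z))
    exact ⟨(h z hz).1.trans this, (h z hz).2.trans this⟩
  · intro l _
    obtain ⟨C₀, h₀⟩ := h.2 ⟨fun a => l.count a, 0, 0⟩
    obtain ⟨C₁, h₁⟩ := h.2 ⟨fun a => l.count a, 0, 1⟩
    rw [vf_eq_pdl l 0 h.1] at h₀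
    rw [vf_eq_pdl l 1 (contDiff_scal h.1)] at h₁
    refine ⟨max C₀ C₁, fun z hz => ⟨(h₀ z hz).trans ?_, (h₁ z hz).trans ?_⟩⟩
    · exact mul_le_mul_of_nonneg_right (le_max_left _ _) (abs_nonneg _)
    · exact mul_le_mul_of_nonneg_right (le_max_right _ _) (abs_nonneg _)

/-- The bounds for the derivatives of the coefficients up to order `n`. -/
structure CoeffBounds (n : ℕ) (C s : ℝ) (g : Spacetime → Matrix (Fin 4) (Fin 4) ℝ)
    (A : Fin 4 → Spacetime → ℝ) (V : Spacetime → ℝ) : Prop where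
  metric : ∀ α β (l : List (Fin 4)), l.length ≤ n → ∀ z : Spacetime, 0 ≤ z.1 →
    |pdl l (metricDiff g α β) z| ≤ C * jb ‖z.2‖ ^ (-1 - s) ∧
    |pdl l (scal (metricDiff g α β)) z| ≤ C * jb ‖z.2‖ ^ (-1 - s)
  first : ∀ μ (l : List (Fin 4)), l.length ≤ n → ∀ z : Spacetime, 0 ≤ z.1 →
    |pdl l (A μ) z| ≤ C * jb ‖z.2‖ ^ (-1 - s) ∧ |pdl l (scal (A μ)) z| ≤ C * jb ‖z.2‖ ^ (-1 - s)
  potential : ∀ l : List (Fin 4), l.length ≤ n → ∀ z : Spacetime, 0 ≤ z.1 →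
    |pdl l V z| ≤ C * jb ‖z.2‖ ^ (-2 - s)

lemma abs_rWeight_le {a b : ℝ} (h : a ≤ b) (z : Spacetime) : |rWeight a z| ≤ jb ‖z.2‖ ^ b := by
  rw [rWeight, abs_of_pos (Real.rpow_pos_of_pos (jb_pos _) _)]
  exact Real.rpow_le_rpow_of_exponent_le (one_le_jb _) h

lemma AdmissibleCoeffs.smoothCoeffs {σ δ : ℝ} {g : Spacetime → Matrix (Fin 4) (Fin 4) ℝ}
    {A : Fin 4 → Spacetime → ℝ} {V : Spacetime → ℝ} (h : AdmissibleCoeffs σ δ g A V) :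
    SmoothCoeffs g A V :=
  ⟨fun α β => (h.metric_decay α β).1, fun μ => (h.A_decay μ).1, h.V_decay.1⟩

lemma AdmissibleCoeffs.coeffBounds {σ δ s : ℝ} {g : Spacetime → Matrix (Fin 4) (Fin 4) ℝ}
    {A : Fin 4 → Spacetime → ℝ} {V : Spacetime → ℝ} (h : AdmissibleCoeffs σ δ g A V)
    (hσ : s ≤ σ) (hδ : s ≤ δ) (n : ℕ) : ∃ C : ℝ, 0 ≤ C ∧ CoeffBounds n C s g A V := by
  choose Cg hCg0 hCg using fun α β => (h.metric_decay α β).exists_pdl_bound n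
  choose CA hCA0 hCA using fun μ => (h.A_decay μ).exists_pdl_bound n
  obtain ⟨CV, hCV0, hCV⟩ := h.V_decay.exists_pdl_bound n
  have hSg : 0 ≤ ∑ α, ∑ β, Cg α β := Finset.sum_nonneg fun α _ => Finset.sum_nonneg fun β _ => hCg0 α β
  have hSA : 0 ≤ ∑ μ, CA μ := Finset.sum_nonneg fun μ _ => hCA0 μ
  have key : ∀ {C C' a b y : ℝ} {z : Spacetime}, 0 ≤ C → C ≤ C' → a ≤ b →
      y ≤ C * |rWeight a z| → y ≤ C' * jb ‖z.2‖ ^ b := fun {C C' a b y z} hC hCC hab hy =>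
    hy.trans (mul_le_mul hCC (abs_rWeight_le hab z) (abs_nonneg _) (hC.trans hCC))
  have hg : ∀ α β, Cg α β ≤ (∑ α, ∑ β, Cg α β) + (∑ μ, CA μ) + CV := fun α β => by
    have h1 := Finset.single_le_sum (f := fun β => Cg α β) (fun β _ => hCg0 α β) (Finset.mem_univ β)
    have h2 := Finset.single_le_sum (f := fun α => ∑ β, Cg α β)
      (fun α _ => Finset.sum_nonneg fun β _ => hCg0 α β) (Finset.mem_univ α)
    linarith
  have hA : ∀ μ, CA μ ≤ (∑ α, ∑ β, Cg α β) + (∑ μ, CA μ) + CV := fun μ => by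
    have h1 := Finset.single_le_sum (f := CA) (fun β _ => hCA0 β) (Finset.mem_univ μ)
    linarith
  refine ⟨(∑ α, ∑ β, Cg α β) + (∑ μ, CA μ) + CV, by positivity, ⟨?_, ?_, ?_⟩⟩
  · intro α β l hl z hz
    obtain ⟨h1, h2⟩ := hCg α β l hl z hz
    exact ⟨key (hCg0 α β) (hg α β) (by linarith) h1, key (hCg0 α β) (hg α β) (by linarith) h2⟩
  · intro μ l hl z hz
    obtain ⟨h1, h2⟩ := hCA μ l hl z hz
    exact ⟨key (hCA0 μ) (hA μ) (by linarith) h1, key (hCA0 μ) (hA μ) (by linarith) h2⟩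
  · intro l hl z hz
    exact key hCV0 (by linarith) (by linarith) (hCV l hl z hz).1

/-- A bound for the derivatives of `φ`, `Sφ`, `S²φ`, `Ωφ`, `Ω²φ` at a point. -/
structure Apriori (n : ℕ) (φ : Spacetime → ℝ) (z : Spacetime) (B : ℝ) : Prop where
  base : ∀ l : List (Fin 4), l.length ≤ n → |pdl l φ z| ≤ B
  scal₁ : ∀ l : List (Fin 4), l.length ≤ n → |pdl l (scal φ) z| ≤ B
  scal₂ : ∀ l : List (Fin 4), l.length ≤ n → |pdl l (scal (scal φ)) z| ≤ B
  rot₁ : ∀ a, ∀ l : List (Fin 4), l.length ≤ n → |pdl l (rot a φ) z| ≤ B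
  rot₂ : ∀ a, ∀ l : List (Fin 4), l.length ≤ n → |pdl l (rot a (rot a φ)) z| ≤ B

/-- S has weighted length 6 and Ω length 3. Two powers of S are the most expensive fields that
occur, hence the 12. -/
lemma apriori_of_vf {n M : ℕ} (hM : n + 12 ≤ M) {φ : Spacetime → ℝ} (hφ : ContDiff ℝ ∞ φ)
    {z : Spacetime} {B : ℝ} (h : ∀ J : VFIndex, J.len ≤ M → |vf J φ z| ≤ B) : Apriori n φ z B := by
  have h1 : ∀ k ≤ 2, ContDiff ℝ ∞ (scal^[k] φ) → ∀ l : List (Fin 4), l.length ≤ n →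
      |pdl l (scal^[k] φ) z| ≤ B := fun k hk hs l hl => by
    rw [← vf_eq_pdl l k hs]
    refine h _ ?_
    simp only [VFIndex.len, sum_count_eq_length, Pi.zero_apply, Finset.sum_const_zero]
    omega
  have h2 : ∀ a, ∀ k ≤ 2, ContDiff ℝ ∞ ((rot a)^[k] φ) → ∀ l : List (Fin 4), l.length ≤ n →
      |pdl l ((rot a)^[k] φ) z| ≤ B := fun a k hk hs l hl => by
    rw [← vf_eq_pdl_rot l a k hs]
    refine h _ ?_
    simp only [VFIndex.len, sum_count_eq_length, Finset.sum_pi_single', Finset.mem_univ, if_true]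
    omega
  exact ⟨h1 0 (by norm_num) hφ, h1 1 (by norm_num) (contDiff_scal hφ),
    h1 2 le_rfl (contDiff_scal (contDiff_scal hφ)), fun a => h2 a 1 (by norm_num) (contDiff_rot a hφ),
    fun a => h2 a 2 le_rfl (contDiff_rot a (contDiff_rot a hφ))⟩

end Words

section SolutionSystem

variable {g : Spacetime → Matrix (Fin 4) (Fin 4) ℝ} {A : Fin 4 → Spacetime → ℝ}
  {V φ : Spacetime → ℝ}

lemma abs_coord_le_norm (x : Space) (i : Fin 3) : |x i| ≤ ‖x‖ := by
  simpa using PiLp.norm_apply_le x i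

/-- The time derivative through the scaling field and the space derivatives. -/
lemma abs_pd_zero_le {v : Spacetime → ℝ} {z : Spacetime} (hz : 0 < z.1) (hx : ‖z.2‖ ≤ z.1 / 2)
    {b q : ℝ} (hS : |scal v z| ≤ b) (hq : ∀ i : Fin 3, |pd i.succ v z| ≤ q) :
    |pd 0 v z| ≤ z.1⁻¹ * b + 3 / 2 * q := by
  have e : pd 0 v z = z.1⁻¹ * (scal v z - ∑ i : Fin 3, z.2 i * pd i.succ v z) := by
    rw [scal]; field_simp; ring
  have h1 : |∑ i : Fin 3, z.2 i * pd i.succ v z| ≤ 3 * (z.1 / 2 * q) :=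
    abs_sum_mul_le (fun i => (abs_coord_le_norm _ i).trans hx) hq
  rw [e, abs_mul, abs_of_pos (inv_pos.2 hz)]
  calc z.1⁻¹ * |scal v z - ∑ i : Fin 3, z.2 i * pd i.succ v z|
      ≤ z.1⁻¹ * (b + 3 * (z.1 / 2 * q)) := by
        gcongr
        exact (abs_sub _ _).trans (add_le_add hS h1)
    _ = _ := by field_simp

lemma abs_pdl_flux_le {n : ℕ} {Cc s a₁ : ℝ} (hc : SmoothCoeffs g A V) (hφ : ContDiff ℝ ∞ φ)
    (hb : CoeffBounds n Cc s g A V) (hCc : 0 ≤ Cc) {z : Spacetime} (hz : 0 ≤ z.1)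
    {l : List (Fin 4)} (hl : l.length ≤ n)
    (h : ∀ l', l'.Sublist l → |pdl l' φ z| ≤ a₁ ∧ ∀ β, |pdl l' (pd β φ) z| ≤ a₁) (μ : Fin 4) :
    |pdl l (flux g A φ μ) z| ≤ 5 * 2 ^ n * (Cc * jb ‖z.2‖ ^ (-1 - s) * a₁) := by
  have ha : 0 ≤ a₁ := (abs_nonneg _).trans (h l (List.Sublist.refl _)).1
  have hj : 0 ≤ jb ‖z.2‖ ^ (-1 - s) := Real.rpow_nonneg (jb_pos _).le _
  have h2 : (2 : ℝ) ^ l.length ≤ 2 ^ n := pow_le_pow_right₀ (by norm_num) hl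
  unfold flux
  rw [pdl_add l (ContDiff.sum fun β _ => (hc.metric μ β).mul (contDiff_pd β hφ))
    ((hc.first μ).mul hφ), pdl_sum l _ (fun β _ => (hc.metric μ β).mul (contDiff_pd β hφ))]
  have e1 : ∀ β, |pdl l (fun y => metricDiff g μ β y * pd β φ y) z| ≤
      2 ^ n * (Cc * jb ‖z.2‖ ^ (-1 - s) * a₁) := fun β => by
    refine (abs_pdl_mul_le l (hc.metric μ β) (contDiff_pd β hφ) (a := Cc * jb ‖z.2‖ ^ (-1 - s))
      (b := a₁) (fun l' hl' => (hb.metric μ β l' (hl'.length_le.trans hl) z hz).1)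
      fun l' hl' => (h l' hl').2 β).trans ?_
    gcongr
  have e2 : |pdl l (fun y => A μ y * φ y) z| ≤ 2 ^ n * (Cc * jb ‖z.2‖ ^ (-1 - s) * a₁) := by
    refine (abs_pdl_mul_le l (hc.first μ) hφ (a := Cc * jb ‖z.2‖ ^ (-1 - s))
      (b := a₁) (fun l' hl' => (hb.first μ l' (hl'.length_le.trans hl) z hz).1)
      fun l' hl' => (h l' hl').1).trans ?_
    gcongr
  have e3 : |∑ β, pdl l (fun y => metricDiff g μ β y * pd β φ y) z| ≤
      4 * (2 ^ n * (Cc * jb ‖z.2‖ ^ (-1 - s) * a₁)) :=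
    (Finset.abs_sum_le_sum_abs _ _).trans ((Finset.sum_le_sum fun β _ => e1 β).trans
      (le_of_eq (by simp)))
  refine (abs_add_le _ _).trans ?_
  linarith

lemma scal_flux (hc : SmoothCoeffs g A V) (hφ : ContDiff ℝ ∞ φ) (μ : Fin 4) :
    scal (flux g A φ μ) = fun z => (∑ β, (scal (metricDiff g μ β) z * pd β φ z
      + metricDiff g μ β z * scal (pd β φ) z)) + (scal (A μ) z * φ z + A μ z * scal φ z) := by
  have hs : ∀ β, ContDiff ℝ ∞ fun z => metricDiff g μ β z * pd β φ z := fun β =>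
    (hc.metric μ β).mul (contDiff_pd β hφ)
  have e : flux g A φ μ = fun z => (metricDiff g μ 0 z * pd 0 φ z + metricDiff g μ 1 z * pd 1 φ z)
      + ((metricDiff g μ 2 z * pd 2 φ z + metricDiff g μ 3 z * pd 3 φ z) + A μ z * φ z) := by
    ext z; simp only [flux, Fin.sum_univ_four]; ring
  rw [e, scal_add ((hs 0).add (hs 1)) (((hs 2).add (hs 3)).add ((hc.first μ).mul hφ)),
    scal_add (hs 0) (hs 1), scal_add ((hs 2).add (hs 3)) ((hc.first μ).mul hφ),
    scal_add (hs 2) (hs 3), scal_mul (hc.metric μ 0) (contDiff_pd 0 hφ),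
    scal_mul (hc.metric μ 1) (contDiff_pd 1 hφ), scal_mul (hc.metric μ 2) (contDiff_pd 2 hφ),
    scal_mul (hc.metric μ 3) (contDiff_pd 3 hφ), scal_mul (hc.first μ) hφ]
  ext z; simp only [Fin.sum_univ_four]; ring

lemma abs_pdl_scal_flux_le {n : ℕ} {Cc s a₁ : ℝ} (hc : SmoothCoeffs g A V) (hφ : ContDiff ℝ ∞ φ)
    (hb : CoeffBounds n Cc s g A V) (hCc : 0 ≤ Cc) {z : Spacetime} (hz : 0 ≤ z.1)
    {l : List (Fin 4)} (hl : l.length ≤ n)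
    (h : ∀ l', l'.Sublist l → (|pdl l' φ z| ≤ a₁ ∧ |pdl l' (scal φ) z| ≤ a₁) ∧
      ∀ β, |pdl l' (pd β φ) z| ≤ a₁ ∧ |pdl l' (scal (pd β φ)) z| ≤ a₁) (μ : Fin 4) :
    |pdl l (scal (flux g A φ μ)) z| ≤ 10 * 2 ^ n * (Cc * jb ‖z.2‖ ^ (-1 - s) * a₁) := by
  have ha : 0 ≤ a₁ := (abs_nonneg _).trans (h l (List.Sublist.refl _)).1.1
  have hj : 0 ≤ jb ‖z.2‖ ^ (-1 - s) := Real.rpow_nonneg (jb_pos _).le _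
  have h2 : (2 : ℝ) ^ l.length ≤ 2 ^ n := pow_le_pow_right₀ (by norm_num) hl
  set T := 2 ^ n * (Cc * jb ‖z.2‖ ^ (-1 - s) * a₁) with hT
  have key : ∀ {u v : Spacetime → ℝ}, ContDiff ℝ ∞ u → ContDiff ℝ ∞ v →
      (∀ l', l'.Sublist l → |pdl l' u z| ≤ Cc * jb ‖z.2‖ ^ (-1 - s)) →
      (∀ l', l'.Sublist l → |pdl l' v z| ≤ a₁) → |pdl l (fun y => u y * v y) z| ≤ T :=
    fun hu hv h3 h4 => by
      refine (abs_pdl_mul_le l hu hv h3 h4).trans ?_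
      rw [hT]; gcongr
  have m1 := fun β => contDiff_scal (hc.metric μ β)
  have m2 := fun β => contDiff_scal (contDiff_pd β hφ)
  have hs1 : ∀ β, ContDiff ℝ ∞ fun z => scal (metricDiff g μ β) z * pd β φ z := fun β =>
    (m1 β).mul (contDiff_pd β hφ)
  have hs2 : ∀ β, ContDiff ℝ ∞ fun z => metricDiff g μ β z * scal (pd β φ) z := fun β =>
    (hc.metric μ β).mul (m2 β)
  have hs3 : ContDiff ℝ ∞ fun z => scal (A μ) z * φ z := (contDiff_scal (hc.first μ)).mul hφ
  have hs4 : ContDiff ℝ ∞ fun z => A μ z * scal φ z := (hc.first μ).mul (contDiff_scal hφ)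
  rw [scal_flux hc hφ, pdl_add l (ContDiff.sum fun β _ => (hs1 β).add (hs2 β)) (hs3.add hs4),
    pdl_sum l _ (fun β _ => (hs1 β).add (hs2 β)), pdl_add l hs3 hs4]
  have e1 : ∀ β, |pdl l (fun y => scal (metricDiff g μ β) y * pd β φ y
      + metricDiff g μ β y * scal (pd β φ) y) z| ≤ 2 * T := fun β => by
    rw [pdl_add l (hs1 β) (hs2 β), two_mul]
    refine (abs_add_le _ _).trans (add_le_add ?_ ?_)
    · exact key (m1 β) (contDiff_pd β hφ)
        (fun l' hl' => (hb.metric μ β l' (hl'.length_le.trans hl) z hz).2)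
        fun l' hl' => ((h l' hl').2 β).1
    · exact key (hc.metric μ β) (m2 β)
        (fun l' hl' => (hb.metric μ β l' (hl'.length_le.trans hl) z hz).1)
        fun l' hl' => ((h l' hl').2 β).2
  have e2 : |pdl l (fun y => scal (A μ) y * φ y) z| ≤ T :=
    key (contDiff_scal (hc.first μ)) hφ
      (fun l' hl' => (hb.first μ l' (hl'.length_le.trans hl) z hz).2) fun l' hl' => (h l' hl').1.1
  have e3 : |pdl l (fun y => A μ y * scal φ y) z| ≤ T :=
    key (hc.first μ) (contDiff_scal hφ)
      (fun l' hl' => (hb.first μ l' (hl'.length_le.trans hl) z hz).1) fun l' hl' => (h l' hl').1.2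
  have e4 : |∑ β, pdl l (fun y => scal (metricDiff g μ β) y * pd β φ y
      + metricDiff g μ β y * scal (pd β φ) y) z| ≤ 4 * (2 * T) :=
    (Finset.abs_sum_le_sum_abs _ _).trans ((Finset.sum_le_sum fun β _ => e1 β).trans
      (le_of_eq (by simp)))
  refine (abs_add_le _ _).trans ?_
  have := abs_add_le (pdl l (fun y => scal (A μ) y * φ y) z) (pdl l (fun y => A μ y * scal φ y) z)
  linarith

lemma Apriori.abs_scal_pd_le {n : ℕ} {z : Spacetime} {B : ℝ} (hφ : ContDiff ℝ ∞ φ)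
    (h : Apriori n φ z B) {l : List (Fin 4)} (hl : l.length + 1 ≤ n) (β : Fin 4) :
    |pdl l (scal (pd β φ)) z| ≤ 5 * B := by
  rw [isField_scal.pdl_comm_eq l β hφ]
  refine (abs_add_le _ _).trans ?_
  have h1 := h.scal₁ (β :: l) (by simpa using hl)
  have h2 := abs_sum_coeff_le isField_scal β (a := fun β' => pdl (β' :: l) φ z) (B := B)
    (fun β' => h.base _ (by simpa using hl))
  linarith

lemma sublist_map_succ {l : List (Fin 3)} {l' : List (Fin 4)} (h : l'.Sublist (l.map Fin.succ)) :
    ∃ l₀ : List (Fin 3), l₀.length ≤ l.length ∧ l' = l₀.map Fin.succ := by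
  obtain ⟨l₀, h0, rfl⟩ := List.sublist_map_iff.1 h
  exact ⟨l₀, h0.length_le, rfl⟩

/-- A nonempty word is a first derivative of a shorter one, hence part of the gradient energy; the
empty word is the base function. No Poincaré inequality is needed to control the family. -/
lemma abs_spd_le_dom (hφ : ContDiff ℝ ∞ φ) {K : ℕ} {l : List (Fin 3)} (hl : l.length ≤ K + 1)
    (t : ℝ) (x : Space) :
    |spd φ l (t, x)| ≤ |spd φ [] (t, x)| + Real.sqrt (gradSq (spIdx K) (spd φ) t x) := by
  cases l with
  | nil => have := Real.sqrt_nonneg (gradSq (spIdx K) (spd φ) t x); linarith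
  | cons i l =>
    have h1 := abs_pd_le_sqrt_gradSq (v := spd φ) (t := t) (mem_spIdx.2 (by simpa using hl : l.length ≤ K))
      i x
    rw [pd_spd hφ] at h1
    have := abs_nonneg (spd φ [] (t, x))
    linarith

set_option maxHeartbeats 1000000 in
/-- The space derivatives of a solution form a slice system. -/
theorem exists_sliceSystem (hc : SmoothCoeffs g A V) {s : ℝ} {K : ℕ}
    {Cc : ℝ} (hCc : 0 ≤ Cc) (hb : CoeffBounds K Cc s g A V) :
    ∃ C₁ : ℝ, 0 ≤ C₁ ∧ ∀ (φ : Spacetime → ℝ) (D t : ℝ), ContDiff ℝ ∞ φ →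
      (∀ z : Spacetime, 0 < z.1 → waveOp g A V φ z = 0) → 0 ≤ D → 1 ≤ t →
      (∀ x : Space, ‖x‖ ≤ t / 2 → Apriori (K + 1) φ (t, x) (D * (jb ‖x‖)⁻¹)) →
      SliceSystem (spIdx K) [] (spd φ) C₁ s D t := by
  set N₁ : ℝ := 5 * 2 ^ K * Cc with hN₁
  have hN₁0 : 0 ≤ N₁ := by positivity
  have h5 : (1 : ℝ) ≤ 5 ^ K := one_le_pow₀ (by norm_num)
  have h25 : (1 : ℝ) ≤ 25 ^ K := one_le_pow₀ (by norm_num)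
  set C₁ : ℝ := 2 * 5 ^ K + 9 * 25 ^ K + 2 * (N₁ * (4 * 5 ^ K)) + 5 ^ K * (10 * N₁) * 4 + 2 ^ K * Cc
    with hC₁
  refine ⟨C₁, by positivity, fun φ D t hφ heq hD ht hap => ?_⟩
  have ht0 : 0 < t := by linarith
  refine ⟨mem_spIdx.2 (Nat.zero_le _), fun l _ => contDiff_spd hφ l, fun l hl => ?_,
    fun l hl x => abs_spd_le_dom hφ (Nat.le_succ_of_le (mem_spIdx.1 hl)) t x, fun l hl x hx => ?_⟩
  · have hlK : l.length ≤ K := mem_spIdx.1 hl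
    have hlK' : (l.map Fin.succ).length ≤ K := by simpa using hlK
    refine ⟨divField g A φ (l.map Fin.succ) t, srcField g A V φ (l.map Fin.succ) t,
      contDiff_divField hc hφ _ t, contDiff_srcField hc hφ _ t,
      fun x => slice_equation hc hφ heq (l.map Fin.succ) (z := (t, x)) ht0, fun x hx => ?_⟩
    have H := hap x hx
    have hj0 := jb_pos ‖x‖
    have hj1 := one_le_jb ‖x‖
    set B := D * (jb ‖x‖)⁻¹ with hB
    have hB0 : 0 ≤ B := by positivity
    set q := Real.sqrt (gradSq (spIdx K) (spd φ) t x) with hq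
    have hq0 : 0 ≤ q := Real.sqrt_nonneg _
    set f := |spd φ [] (t, x)| with hf
    have hf0 : 0 ≤ f := abs_nonneg _
    set A₁ := jb ‖x‖ ^ (-1 - s) with hA₁
    set A₂ := jb ‖x‖ ^ (-2 - s) with hA₂
    have hA₁0 : 0 ≤ A₁ := by positivity
    have hA₂0 : 0 ≤ A₂ := by positivity
    have hA₁₂ : A₁ * (jb ‖x‖)⁻¹ = A₂ := by
      rw [hA₁, hA₂, ← Real.rpow_neg_one, ← Real.rpow_add hj0]; congr 1; ring
    have hA₂₁ : A₂ ≤ A₁ := Real.rpow_le_rpow_of_exponent_le hj1 (by linarith)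
    set τ := t⁻¹ with hτ
    have hτ0 : 0 < τ := by positivity
    have hxτ : τ * ‖x‖ ≤ 1 / 2 := by
      calc τ * ‖x‖ ≤ τ * (t / 2) := by gcongr
        _ = 1 / 2 := by rw [hτ]; field_simp
    have hrB : ‖x‖ * B ≤ D := by
      calc ‖x‖ * B ≤ jb ‖x‖ * (D * (jb ‖x‖)⁻¹) := by
            rw [hB]; gcongr; exact le_jb _
        _ = D := by field_simp
    have base : ∀ l' : List (Fin 4), l'.length ≤ K + 1 → |pdl l' φ (t, x)| ≤ B := H.base
    have hS : ∀ l' : List (Fin 4), l'.length ≤ K → |scal (pdl l' φ) (t, x)| ≤ 5 ^ K * B := by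
      intro l' hl'
      refine (isField_scal.abs_pdl_le l' hφ (B := B) (fun m hm => base m (by omega))
        fun m hm => H.scal₁ m (by omega)).trans ?_
      gcongr
      norm_num
    -- derivatives of the solution along the words that occur in the flux
    have hword : ∀ l', l'.Sublist (l.map Fin.succ) → |pdl l' φ (t, x)| ≤ 4 * 5 ^ K * (q + f + τ * B) ∧
        ∀ β, |pdl l' (pd β φ) (t, x)| ≤ 4 * 5 ^ K * (q + f + τ * B) := by
      intro l' hl'
      obtain ⟨l₀, hl₀, rfl⟩ := sublist_map_succ hl'
      have hτB : 0 ≤ τ * B := by positivity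
      have hbig : q + f + 2 * (5 ^ K * (τ * B)) + q ≤ 4 * 5 ^ K * (q + f + τ * B) := by
        have h1 := mul_le_mul_of_nonneg_right h5 hq0
        have h2 := mul_le_mul_of_nonneg_right h5 hf0
        have h3 : 0 ≤ 5 ^ K * (τ * B) := by positivity
        linarith
      have h3 : 0 ≤ 5 ^ K * (τ * B) := by positivity
      have hsp : ∀ i : Fin 3, |pd i.succ (pdl (l₀.map Fin.succ) φ) (t, x)| ≤ q := fun i =>
        abs_pd_le_sqrt_gradSq (v := spd φ) (mem_spIdx.2 (hl₀.trans hlK)) i x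
      refine ⟨?_, fun β => ?_⟩
      · have := abs_spd_le_dom hφ (K := K) (l := l₀) (by omega) t x
        change |spd φ l₀ (t, x)| ≤ _
        linarith
      · have e : pdl (l₀.map Fin.succ) (pd β φ) = pd β (pdl (l₀.map Fin.succ) φ) :=
          (pd_pdl β _ hφ).symm
        rw [e]
        refine Fin.cases ?_ (fun i => ?_) β
        · have h0 := abs_pd_zero_le (v := pdl (l₀.map Fin.succ) φ) (z := (t, x)) ht0 hx
            (hS _ (by simpa using hl₀.trans hlK)) hsp
          simp only at h0
          rw [← hτ] at h0
          linarith
        · have := hsp i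
          linarith
    have hfl := abs_pdl_flux_le hc hφ hb hCc (z := (t, x)) ht0.le hlK' hword
    -- The time derivative inside the flux was expressed by t⁻¹S and space derivatives. Its S part
    -- contributes the known term D t⁻¹⟨r⟩^{-1-s}; all the rest is controlled by q + f and is
    -- perturbative.
    have hfl' : ∀ μ, |pdl (l.map Fin.succ) (flux g A φ μ) (t, x)| ≤
        N₁ * (4 * 5 ^ K) * (A₁ * (q + f) + D * (τ * A₁)) := fun μ => by
      refine (hfl μ).trans ?_
      have h1 : A₁ * (τ * B) ≤ D * (τ * A₁) := by
        calc A₁ * (τ * B) = D * (τ * (A₁ * (jb ‖x‖)⁻¹)) := by rw [hB]; ring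
          _ = D * (τ * A₂) := by rw [hA₁₂]
          _ ≤ _ := by gcongr
      have h2 := mul_le_mul_of_nonneg_left h1 (by positivity : 0 ≤ N₁ * (4 * 5 ^ K))
      simp only [hN₁] at h2 ⊢
      linarith
    have hA₁q : 0 ≤ A₁ * (q + f) := by positivity
    have hA₂q : 0 ≤ A₂ * (q + f) := by positivity
    have s1e : fluxSrc s D t x = D * τ ^ 2 + D * (τ * A₁) := by
      rw [fluxSrc, hτ, inv_pow]; ring
    have s2e : bulkSrc s D t x = D * (τ ^ 2 * (jb ‖x‖)⁻¹) + D * (τ * A₂) := by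
      rw [bulkSrc, hτ, inv_pow]; ring
    have d1 : 0 ≤ D * τ ^ 2 := by positivity
    have d2 : 0 ≤ D * (τ * A₁) := by positivity
    have d3 : 0 ≤ D * (τ ^ 2 * (jb ‖x‖)⁻¹) := by positivity
    have d4 : 0 ≤ D * (τ * A₂) := by positivity
    constructor
    · intro i
      rw [s1e]
      have hxi := abs_coord_le_norm x i
      -- The factor x uses up the decay D/⟨r⟩ of the a priori bound, which leaves D t⁻² without
      -- decay in r.
      have p1 : |(-2 * t⁻¹ ^ 2) * (x i * scal (pdl (l.map Fin.succ) φ) (t, x))| ≤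
          2 * 5 ^ K * (D * τ ^ 2) := by
        rw [abs_mul, abs_mul, abs_mul, abs_neg, abs_two, ← hτ, abs_of_nonneg (sq_nonneg τ)]
        calc 2 * τ ^ 2 * (|x i| * |scal (pdl (l.map Fin.succ) φ) (t, x)|)
            ≤ 2 * τ ^ 2 * (‖x‖ * (5 ^ K * B)) := by gcongr; exact hS _ hlK'
          _ = 2 * 5 ^ K * (τ ^ 2 * (‖x‖ * B)) := by ring
          _ ≤ 2 * 5 ^ K * (τ ^ 2 * D) := by gcongr
          _ = _ := by ring
      have p2 := hfl' i.succ
      have p3 : |t⁻¹ * (x i * pdl (l.map Fin.succ) (flux g A φ 0) (t, x))| ≤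
          N₁ * (4 * 5 ^ K) * (A₁ * (q + f) + D * (τ * A₁)) := by
        rw [abs_mul, abs_mul, ← hτ, abs_of_pos hτ0, ← mul_assoc]
        have h1 : τ * |x i| ≤ 1 := by
          have := mul_le_mul_of_nonneg_left hxi hτ0.le
          linarith
        exact (mul_le_of_le_one_left (abs_nonneg _) h1).trans (hfl' 0)
      have hsum : |divField g A φ (l.map Fin.succ) t i (t, x)| ≤ 2 * 5 ^ K * (D * τ ^ 2)
          + 2 * (N₁ * (4 * 5 ^ K) * (A₁ * (q + f) + D * (τ * A₁))) := by
        rw [divField]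
        refine (abs_add_le _ _).trans ?_
        have := abs_add_le ((-2 * t⁻¹ ^ 2) * (x i * scal (pdl (l.map Fin.succ) φ) (t, x)))
          ((-1) * pdl (l.map Fin.succ) (flux g A φ i.succ) (t, x))
        rw [abs_mul (-1 : ℝ), abs_neg, abs_one, one_mul] at this
        simp only at this ⊢
        linarith
      refine hsum.trans ?_
      have c1 : 2 * 5 ^ K * (D * τ ^ 2) ≤ C₁ * (D * τ ^ 2) := by
        refine mul_le_mul_of_nonneg_right ?_ d1
        have : 0 ≤ 9 * (25 : ℝ) ^ K + 2 * (N₁ * (4 * 5 ^ K)) + 5 ^ K * (10 * N₁) * 4 + 2 ^ K * Cc := by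
          positivity
        rw [hC₁]; linarith
      have c2 : 2 * (N₁ * (4 * 5 ^ K)) * (A₁ * (q + f) + D * (τ * A₁)) ≤
          C₁ * (A₁ * (q + f) + D * (τ * A₁)) := by
        refine mul_le_mul_of_nonneg_right ?_ (by positivity)
        have : 0 ≤ 2 * (5 : ℝ) ^ K + 9 * (25 : ℝ) ^ K + 5 ^ K * (10 * N₁) * 4 + 2 ^ K * Cc := by
          positivity
        rw [hC₁]; linarith
      linarith
    · rw [s2e]
      have p1 : |t⁻¹ ^ 2 * (scal (scal (pdl (l.map Fin.succ) φ)) (t, x)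
          + 5 * scal (pdl (l.map Fin.succ) φ) (t, x)
          - ∑ a, rot a (rot a (pdl (l.map Fin.succ) φ)) (t, x))| ≤
          9 * 25 ^ K * (D * (τ ^ 2 * (jb ‖x‖)⁻¹)) := by
        have a1 : |scal (scal (pdl (l.map Fin.succ) φ)) (t, x)| ≤ 25 ^ K * B := by
          refine (isField_scal.abs_pdl_le₂ _ hφ (B := B) (fun m hm => base m (by omega))
            (fun m hm => H.scal₁ m (by omega)) fun m hm => H.scal₂ m (by omega)).trans ?_
          gcongr
          norm_num
        have a2 : ∀ a, |rot a (rot a (pdl (l.map Fin.succ) φ)) (t, x)| ≤ 25 ^ K * B := fun a => by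
          refine ((isField_rot a).abs_pdl_le₂ _ hφ (B := B) (fun m hm => base m (by omega))
            (fun m hm => H.rot₁ a m (by omega)) fun m hm => H.rot₂ a m (by omega)).trans ?_
          gcongr
          norm_num
        have a3 : |∑ a, rot a (rot a (pdl (l.map Fin.succ) φ)) (t, x)| ≤ 3 * (25 ^ K * B) :=
          (Finset.abs_sum_le_sum_abs _ _).trans ((Finset.sum_le_sum fun a _ => a2 a).trans
            (le_of_eq (by simp)))
        have a4 : |scal (pdl (l.map Fin.succ) φ) (t, x)| ≤ 25 ^ K * B := by
          refine (hS _ hlK').trans ?_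
          gcongr
          norm_num
        rw [abs_mul, ← hτ, abs_of_nonneg (sq_nonneg τ)]
        have a5 : |scal (scal (pdl (l.map Fin.succ) φ)) (t, x)
            + 5 * scal (pdl (l.map Fin.succ) φ) (t, x)
            - ∑ a, rot a (rot a (pdl (l.map Fin.succ) φ)) (t, x)| ≤ 9 * (25 ^ K * B) := by
          refine (abs_sub _ _).trans ?_
          have := abs_add_le (scal (scal (pdl (l.map Fin.succ) φ)) (t, x))
            (5 * scal (pdl (l.map Fin.succ) φ) (t, x))
          rw [abs_mul (5 : ℝ), abs_of_pos (by norm_num : (0 : ℝ) < 5)] at this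
          linarith
        calc τ ^ 2 * _ ≤ τ ^ 2 * (9 * (25 ^ K * B)) := by gcongr
          _ = _ := by rw [hB]; ring
      have hwB : ∀ l' : List (Fin 4), l'.length ≤ K →
          (|pdl l' φ (t, x)| ≤ 5 * B ∧ |pdl l' (scal φ) (t, x)| ≤ 5 * B) ∧
          ∀ β, |pdl l' (pd β φ) (t, x)| ≤ 5 * B ∧ |pdl l' (scal (pd β φ)) (t, x)| ≤ 5 * B := by
        intro l' hl'
        have b1 := base l' (by omega)
        have b2 := H.scal₁ l' (by omega)
        refine ⟨⟨by linarith, by linarith⟩, fun β => ⟨?_, H.abs_scal_pd_le hφ (by omega) β⟩⟩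
        have b3 := base (β :: l') (by simpa using hl')
        change |pdl l' (pd β φ) (t, x)| ≤ B at b3
        linarith
      have hBA : A₁ * B = D * A₂ := by rw [hB, ← hA₁₂]; ring
      -- In the source the flux carries an explicit t⁻¹, so the cruder a priori bound
      -- ⟨r⟩^{-1-s}·D/⟨r⟩ = D⟨r⟩^{-2-s} suffices and q is not needed.
      have g1 : ∀ l' : List (Fin 4), l'.length ≤ K →
          |pdl l' (flux g A φ 0) (t, x)| ≤ 10 * N₁ * (D * A₂) := fun l' hl' => by
        refine (abs_pdl_flux_le hc hφ hb hCc (z := (t, x)) ht0.le hl' (a₁ := 5 * B)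
          (fun m hm => ⟨(hwB m (hm.length_le.trans hl')).1.1,
            fun β => ((hwB m (hm.length_le.trans hl')).2 β).1⟩) 0).trans ?_
        have : 0 ≤ N₁ * (A₁ * B) := by positivity
        rw [← hBA]
        simp only [hN₁] at this ⊢
        linarith
      have g2 : ∀ l' : List (Fin 4), l'.length ≤ K →
          |pdl l' (scal (flux g A φ 0)) (t, x)| ≤ 10 * N₁ * (D * A₂) := fun l' hl' => by
        refine (abs_pdl_scal_flux_le hc hφ hb hCc (z := (t, x)) ht0.le hl' (a₁ := 5 * B)
          (fun m hm => hwB m (hm.length_le.trans hl')) 0).trans ?_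
        rw [← hBA]
        simp only [hN₁]
        exact le_of_eq (by ring)
      have g3 : |scal (pdl (l.map Fin.succ) (flux g A φ 0)) (t, x)| ≤
          5 ^ K * (10 * N₁) * (D * A₂) := by
        refine (isField_scal.abs_pdl_le _ (contDiff_flux hc hφ 0) (B := 10 * N₁ * (D * A₂))
          (fun m hm => g1 m (by omega)) fun m hm => g2 m (by omega)).trans ?_
        rw [← mul_assoc]
        gcongr
        norm_num
      have p2 : |t⁻¹ * (scal (pdl (l.map Fin.succ) (flux g A φ 0)) (t, x)
          + 3 * pdl (l.map Fin.succ) (flux g A φ 0) (t, x))| ≤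
          5 ^ K * (10 * N₁) * 4 * (D * (τ * A₂)) := by
        rw [abs_mul, ← hτ, abs_of_pos hτ0]
        have h1 := abs_add_le (scal (pdl (l.map Fin.succ) (flux g A φ 0)) (t, x))
          (3 * pdl (l.map Fin.succ) (flux g A φ 0) (t, x))
        rw [abs_mul (3 : ℝ), abs_of_pos (by norm_num : (0 : ℝ) < 3)] at h1
        have h2 := g1 _ hlK'
        have h3 : 1 * (10 * N₁ * (D * A₂)) ≤ 5 ^ K * (10 * N₁ * (D * A₂)) := by gcongr
        calc τ * _ ≤ τ * (5 ^ K * (10 * N₁) * 4 * (D * A₂)) := by gcongr; linarith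
          _ = _ := by ring
      have p3 : |pdl (l.map Fin.succ) (fun y => V y * φ y) (t, x)| ≤ 2 ^ K * Cc * (A₂ * (q + f)) := by
        refine (abs_pdl_mul_le _ hc.potential hφ (a := Cc * A₂) (b := q + f)
          (fun l' hl' => hb.potential l' (hl'.length_le.trans hlK') (t, x) ht0.le)
          fun l' hl' => ?_).trans ?_
        · obtain ⟨l₀, hl₀, rfl⟩ := sublist_map_succ hl'
          have := abs_spd_le_dom hφ (K := K) (l := l₀) (by omega) t x
          change |spd φ l₀ (t, x)| ≤ _
          linarith
        · have h2 : (2 : ℝ) ^ (l.map Fin.succ).length ≤ 2 ^ K := pow_le_pow_right₀ (by norm_num) hlK'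
          calc (2 : ℝ) ^ (l.map Fin.succ).length * (Cc * A₂ * (q + f)) ≤ 2 ^ K * (Cc * A₂ * (q + f)) := by
                gcongr
            _ = _ := by ring
      have hsum : |srcField g A V φ (l.map Fin.succ) t (t, x)| ≤
          9 * 25 ^ K * (D * (τ ^ 2 * (jb ‖x‖)⁻¹)) + 5 ^ K * (10 * N₁) * 4 * (D * (τ * A₂))
          + 2 ^ K * Cc * (A₂ * (q + f)) := by
        rw [srcField]
        exact (abs_sub _ _).trans (add_le_add ((abs_sub _ _).trans (add_le_add p1 p2)) p3)
      refine hsum.trans ?_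
      have c1 : 9 * 25 ^ K * (D * (τ ^ 2 * (jb ‖x‖)⁻¹)) ≤ C₁ * (D * (τ ^ 2 * (jb ‖x‖)⁻¹)) := by
        refine mul_le_mul_of_nonneg_right ?_ d3
        have : 0 ≤ 2 * (5 : ℝ) ^ K + 2 * (N₁ * (4 * 5 ^ K)) + 5 ^ K * (10 * N₁) * 4 + 2 ^ K * Cc := by
          positivity
        rw [hC₁]; linarith
      have c2 : 5 ^ K * (10 * N₁) * 4 * (D * (τ * A₂)) ≤ C₁ * (D * (τ * A₂)) := by
        refine mul_le_mul_of_nonneg_right ?_ d4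
        have : 0 ≤ 2 * (5 : ℝ) ^ K + 9 * (25 : ℝ) ^ K + 2 * (N₁ * (4 * 5 ^ K)) + 2 ^ K * Cc := by
          positivity
        rw [hC₁]; linarith
      have c3 : 2 ^ K * Cc * (A₂ * (q + f)) ≤ C₁ * (A₂ * (q + f)) := by
        refine mul_le_mul_of_nonneg_right ?_ hA₂q
        have : 0 ≤ 2 * (5 : ℝ) ^ K + 9 * (25 : ℝ) ^ K + 2 * (N₁ * (4 * 5 ^ K)) + 5 ^ K * (10 * N₁) * 4 := by
          positivity
        rw [hC₁]; linarith
      linarith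
  · have H := hap x hx
    have hlK : l.length ≤ K := mem_spIdx.1 hl
    refine ⟨H.base _ (by simpa using Nat.le_succ_of_le hlK), fun i => ?_⟩
    rw [pd_spd hφ]
    exact H.base _ (by simpa using hlK)

/-- The longest word in the Sobolev inequality has three letters and must be a gradient of a word in
the family, hence K ≥ 2. -/
lemma sobolevDominated_spd (hφ : ContDiff ℝ ∞ φ) {K : ℕ} (hK : 2 ≤ K) (t : ℝ) :
    SobolevDominated (spIdx K) [] (spd φ) t := by
  intro l hl x
  have hl' : l.Sublist ([0, 1, 2].map Fin.succ) := hl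
  obtain ⟨l₀, h0, rfl⟩ := sublist_map_succ hl'
  have hg := gradSq_nonneg (spIdx K) (spd φ) t x
  cases l₀ with
  | nil => simp only [List.map_nil, spd, pdl]; linarith
  | cons i l =>
    have h1 := abs_pd_le_sqrt_gradSq (v := spd φ) (t := t)
      (mem_spIdx.2 (by simp at h0; omega : l.length ≤ K)) i x
    rw [pd_spd hφ] at h1
    have h2 : spd φ (i :: l) (t, x) ^ 2 ≤ gradSq (spIdx K) (spd φ) t x := by
      rw [← sq_abs, ← Real.sq_sqrt hg]
      exact pow_le_pow_left₀ (abs_nonneg _) h1 2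
    have := sq_nonneg (spd φ [] (t, x))
    change spd φ (i :: l) (t, x) ^ 2 ≤ _
    linarith

end SolutionSystem

/-! ### Exterior bounds for a solution in terms of its size in a fixed ball -/

section ExteriorSolution

variable {g : Spacetime → Matrix (Fin 4) (Fin 4) ℝ} {A : Fin 4 → Spacetime → ℝ}
  {V φ : Spacetime → ℝ}

/-- The sum of the squares of the space derivatives of order at most `k`. -/
def nSq (k : ℕ) (φ : Spacetime → ℝ) (t : ℝ) (x : Space) : ℝ := ∑ l ∈ spIdx k, spd φ l (t, x) ^ 2

lemma nSq_nonneg (k : ℕ) (φ : Spacetime → ℝ) (t : ℝ) (x : Space) : 0 ≤ nSq k φ t x :=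
  Finset.sum_nonneg fun _ _ => sq_nonneg _

lemma continuous_nSq (hφ : ContDiff ℝ ∞ φ) (k : ℕ) (t : ℝ) : Continuous (nSq k φ t) :=
  continuous_finsetSum _ fun l _ => (continuous_slice (contDiff_spd hφ l) t).pow 2

lemma nSq_succ_le (hφ : ContDiff ℝ ∞ φ) (k : ℕ) (t : ℝ) (x : Space) :
    nSq (k + 1) φ t x ≤ 2 * (spIdx (k + 1)).card * (spd φ [] (t, x) ^ 2 + gradSq (spIdx k) (spd φ) t x) := by
  have h : ∀ l ∈ spIdx (k + 1), spd φ l (t, x) ^ 2 ≤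
      2 * (spd φ [] (t, x) ^ 2 + gradSq (spIdx k) (spd φ) t x) := by
    intro l hl
    have h1 := abs_spd_le_dom hφ (mem_spIdx.1 hl) t x
    have h2 := Real.sq_sqrt (gradSq_nonneg (spIdx k) (spd φ) t x)
    rw [← sq_abs (spd φ l (t, x)), ← sq_abs (spd φ [] (t, x)), ← h2]
    calc |spd φ l (t, x)| ^ 2 ≤ (|spd φ [] (t, x)| + √(gradSq (spIdx k) (spd φ) t x)) ^ 2 := by gcongr
      _ ≤ _ := by nlinarith [sq_nonneg (|spd φ [] (t, x)| - √(gradSq (spIdx k) (spd φ) t x))]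
  refine (Finset.sum_le_sum h).trans (le_of_eq ?_)
  rw [Finset.sum_const, nsmul_eq_mul]; ring

lemma sq_le_nSq {k : ℕ} {l : List (Fin 3)} (hl : l.length ≤ k) (φ : Spacetime → ℝ) (t : ℝ) (x : Space) :
    spd φ l (t, x) ^ 2 ≤ nSq k φ t x :=
  Finset.single_le_sum (f := fun l => spd φ l (t, x) ^ 2) (fun _ _ => sq_nonneg _) (mem_spIdx.2 hl)

lemma setIntegral_annulus_mono {f : Space → ℝ} (hf : Continuous f) (h0 : ∀ x, 0 ≤ f x)
    {R R' ρ ρ' : ℝ} (hR : R' ≤ R) (hρ : ρ ≤ ρ') :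
    ∫ x in annulus R ρ, f x ≤ ∫ x in annulus R' ρ', f x :=
  setIntegral_mono_set (hf.continuousOn.integrableOn_compact (isCompact_annulus _ _))
    (Filter.Eventually.of_forall h0)
    (show annulus R ρ ⊆ annulus R' ρ' from fun _ hx => ⟨hR.trans hx.1, hx.2.trans hρ⟩).eventuallyLE

set_option maxHeartbeats 800000 in
/-- The exterior bounds for a solution, in terms of its size in a fixed ball. -/
theorem exists_exterior_bounds (hc : SmoothCoeffs g A V) {s : ℝ} (hs : 0 < s) (hs1 : s ≤ 1) {k : ℕ}
    (hk : 1 ≤ k) {Cc : ℝ} (hCc : 0 ≤ Cc) (hb : CoeffBounds (k + 1) Cc s g A V) :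
    ∃ C R T₁ : ℝ, 0 ≤ C ∧ 1 ≤ R ∧ 16 ≤ T₁ ∧ ∀ (φ : Spacetime → ℝ) (D t : ℝ), ContDiff ℝ ∞ φ →
      (∀ z : Spacetime, 0 < z.1 → waveOp g A V φ z = 0) → 0 ≤ D → T₁ ≤ t →
      (∀ x : Space, ‖x‖ ≤ t / 2 → Apriori (k + 2) φ (t, x) (D * (jb ‖x‖)⁻¹)) →
      (∀ x ∈ annulus R (t / 2), φ (t, x) ^ 2 ≤
        C * ((D * t⁻¹) ^ 2 + ∫ x in Metric.closedBall (0 : Space) (32 * R), nSq k φ t x)) ∧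
      ∀ ρ : ℝ, 4 * R ≤ ρ → 16 * ρ ≤ t →
        ∫ x in annulus ρ (2 * ρ), (ρ⁻¹ * gradSq (spIdx (k + 1)) (spd φ) t x + ρ⁻¹ ^ 3 * φ (t, x) ^ 2) ≤
          C * (ρ ^ (-(s / 2)) * (∫ x in Metric.closedBall (0 : Space) (32 * R), nSq k φ t x)
            + ρ ^ (s / 2) * (D * t⁻¹) ^ 2) := by
  have hb0 : CoeffBounds k Cc s g A V :=
    ⟨fun α β l hl => hb.metric α β l (by omega), fun μ l hl => hb.first μ l (by omega),
      fun l hl => hb.potential l (by omega)⟩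
  obtain ⟨E₀, hE₀, hsys₀⟩ := exists_sliceSystem hc hCc hb0
  obtain ⟨E₁, hE₁, hsys₁⟩ := exists_sliceSystem hc hCc hb
  obtain ⟨Ce, Re, Te, hCe, hRe, hTe, hext⟩ := SliceSystem.exterior_bounds (spIdx (k + 1)) hE₁ hs hs1
  obtain ⟨Ca, Ra, hCa, hRa, hcac₁⟩ := SliceSystem.caccioppoli (spIdx (k + 1)) hE₁ hs
  obtain ⟨Cb, Rb, hCb, hRb, hcac₀⟩ := SliceSystem.caccioppoli (spIdx k) hE₀ hs
  obtain ⟨Cs, hCs, hsob⟩ := sobolev_unit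
  -- The factor 8 leaves room for the inner radii R/8, R/4, R/2 of the nested annuli, all of which
  -- must exceed the thresholds of the estimates used on them.
  set R := 8 * (Re + Ra + Rb) with hR
  have hR1 : 24 ≤ R := by linarith
  set vol := (volume : Measure Space).real (Metric.ball 0 1) with hvol
  have hvol0 : 0 ≤ vol := measureReal_nonneg
  set N₁ : ℝ := 2 * (spIdx (k + 1)).card with hN₁
  have hN₁0 : 0 ≤ N₁ := by positivity
  set v₁ := vol * (16 * R) ^ 3
  set v₂ := vol * (32 * R) ^ 3
  have hv₁ : 0 ≤ v₁ := by positivity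
  have hv₂ : 0 ≤ v₂ := by positivity
  set Q := (1 + Cs) * (1 + Ca * N₁) * (1 + Cb) with hQ
  have hQ0 : 0 ≤ Q := by positivity
  set Q' := (1 + Cs) * (Ca * v₁ + (1 + Ca * N₁) * (Cb * v₂)) with hQ'
  have hQ'0 : 0 ≤ Q' := by positivity
  refine ⟨Ce * (1 + Q + Q'), R, max Te (64 * R), by positivity, by linarith,
    hTe.trans (le_max_left _ _), ?_⟩
  intro φ D t hφ heq hD ht hap
  have htTe : Te ≤ t := (le_max_left _ _).trans ht
  have htR : 64 * R ≤ t := (le_max_right _ _).trans ht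
  have ht1 : 1 ≤ t := by linarith
  have S₁ := hsys₁ φ D t hφ heq hD ht1 hap
  have S₀ := hsys₀ φ D t hφ heq hD ht1 fun x hx =>
    ⟨fun l hl => (hap x hx).base l (by omega), fun l hl => (hap x hx).scal₁ l (by omega),
      fun l hl => (hap x hx).scal₂ l (by omega), fun a l hl => (hap x hx).rot₁ a l (by omega),
      fun a l hl => (hap x hx).rot₂ a l (by omega)⟩
  have hdom := sobolevDominated_spd hφ (K := k + 1) (by omega) t
  set P := D * t⁻¹ with hP
  set N := ∫ x in Metric.closedBall (0 : Space) (32 * R), nSq k φ t x with hN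
  have hN0 : 0 ≤ N := integral_nonneg fun x => nSq_nonneg _ _ _ _
  have cg : ∀ K, Continuous (gradSq (spIdx K) (spd φ) t) := fun K =>
    continuous_gradSq fun l _ => contDiff_spd hφ l
  have cφ : Continuous fun x => spd φ [] (t, x) ^ 2 := (continuous_slice (contDiff_spd hφ []) t).pow 2
  have hin : ∀ {f : Space → ℝ}, Continuous f → ∀ R ρ, IntegrableOn f (annulus R ρ) := fun hf R ρ =>
    hf.continuousOn.integrableOn_compact (isCompact_annulus R ρ)
  have hnS : ∫ x in annulus (R / 8) (32 * R), nSq k φ t x ≤ N :=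
    setIntegral_mono_set ((continuous_nSq hφ k t).continuousOn.integrableOn_compact
      (isCompact_closedBall _ _)) (Filter.Eventually.of_forall fun x => nSq_nonneg _ _ _ _)
      (show annulus (R / 8) (32 * R) ⊆ Metric.closedBall 0 (32 * R) from fun x hx => by
        simpa using hx.2).eventuallyLE
  have hφN : ∀ R' ρ', R / 8 ≤ R' → ρ' ≤ 32 * R → ∫ x in annulus R' ρ', spd φ [] (t, x) ^ 2 ≤ N := by
    intro R' ρ' h1 h2
    refine le_trans ?_ hnS
    refine (setIntegral_annulus_mono cφ (fun _ => sq_nonneg _) h1 h2).trans ?_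
    exact setIntegral_mono (hin cφ _ _) (hin (continuous_nSq hφ k t) _ _)
      fun x => sq_le_nSq (Nat.zero_le k) φ t x
  -- Two Caccioppoli steps on nested annuli, each gaining one derivative. Hence the boundary terms
  -- of the exterior bound, which contain derivatives of order k + 2, are controlled by those of
  -- order k in the ball of radius 32R.
  have c0 := hcac₀ [] (spd φ) D t (R / 8) (16 * R) S₀ hD (by linarith) (by linarith) (by linarith)
  rw [show 2 * (R / 8) = R / 4 by ring, show 2 * (16 * R) = 32 * R by ring] at c0
  have c0' : ∫ x in annulus (R / 4) (16 * R), gradSq (spIdx k) (spd φ) t x ≤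
      Cb * (N + v₂ * P ^ 2) := by
    refine c0.trans (mul_le_mul_of_nonneg_left ?_ hCb)
    change ∫ x in _, (nSq k φ t x + P ^ 2) ≤ _
    rw [integral_add (hin (continuous_nSq hφ k t) _ _) (hin continuous_const _ _)]
    exact add_le_add hnS (setIntegral_annulus_const_le _ _ _ (by positivity) (sq_nonneg _))
  have c1 := hcac₁ [] (spd φ) D t (R / 4) (8 * R) S₁ hD (by linarith) (by linarith) (by linarith)
  rw [show 2 * (R / 4) = R / 2 by ring, show 2 * (8 * R) = 16 * R by ring] at c1
  have c1' : ∫ x in annulus (R / 2) (8 * R), gradSq (spIdx (k + 1)) (spd φ) t x ≤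
      Ca * (N₁ * (N + Cb * (N + v₂ * P ^ 2)) + v₁ * P ^ 2) := by
    refine c1.trans (mul_le_mul_of_nonneg_left ?_ hCa)
    change ∫ x in _, (nSq (k + 1) φ t x + P ^ 2) ≤ _
    rw [integral_add (hin (continuous_nSq hφ (k + 1) t) _ _) (hin continuous_const _ _)]
    refine add_le_add ?_ (setIntegral_annulus_const_le _ _ _ (by positivity) (sq_nonneg _))
    calc ∫ x in annulus (R / 4) (16 * R), nSq (k + 1) φ t x
        ≤ ∫ x in annulus (R / 4) (16 * R), N₁ * (spd φ [] (t, x) ^ 2 + gradSq (spIdx k) (spd φ) t x) :=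
          setIntegral_mono (hin (continuous_nSq hφ (k + 1) t) _ _)
            (hin (continuous_const.mul (cφ.add (cg k))) _ _) fun x => nSq_succ_le hφ k t x
      _ = N₁ * ((∫ x in annulus (R / 4) (16 * R), spd φ [] (t, x) ^ 2)
          + ∫ x in annulus (R / 4) (16 * R), gradSq (spIdx k) (spd φ) t x) := by
          rw [integral_const_mul, integral_add (hin cφ _ _) (hin (cg k) _ _)]
      _ ≤ _ := by
          refine mul_le_mul_of_nonneg_left (add_le_add (hφN _ _ ?_ ?_) c0') hN₁0 <;> linarith
  set Y := ∫ x in annulus (R / 2) (8 * R), (spd φ [] (t, x) ^ 2 + gradSq (spIdx (k + 1)) (spd φ) t x)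
    with hY
  have hdens : ∀ x, 0 ≤ spd φ [] (t, x) ^ 2 + gradSq (spIdx (k + 1)) (spd φ) t x := fun x =>
    add_nonneg (sq_nonneg _) (gradSq_nonneg _ _ _ _)
  have hY0 : 0 ≤ Y := integral_nonneg hdens
  have hYb : Y ≤ (1 + Ca * N₁) * (1 + Cb) * N + (Ca * v₁ + (1 + Ca * N₁) * (Cb * v₂)) * P ^ 2 := by
    rw [hY, integral_add (hin cφ _ _) (hin (cg _) _ _)]
    have h1 := hφN (R / 2) (8 * R) (by linarith) (by linarith)
    have h2 : 0 ≤ Cb * v₂ * P ^ 2 := by positivity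
    have h3 : 0 ≤ Cb * N := by positivity
    linarith
  have ha2 : ∫ x in annulus R (2 * R), (spd φ [] (t, x) ^ 2 + gradSq (spIdx (k + 1)) (spd φ) t x) ≤ Y :=
    setIntegral_annulus_mono (cφ.add (cg _)) hdens (by linarith) (by linarith)
  -- The boundary values follow from Sobolev: as R ≥ 24, the ball of radius 2 about such a point
  -- stays inside R/2 ≤ |y| ≤ 8R.
  have hbb : ∀ x ∈ annulus R (4 * R), spd φ [] (t, x) ^ 2 ≤ Cs * Y := by
    intro x hx
    refine (hsob (spd φ []) (contDiff_spd hφ []) t x _ (cφ.add (cg (k + 1))).continuousOn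
      fun y _ l hl => hdom l hl y).trans (mul_le_mul_of_nonneg_left ?_ hCs)
    refine setIntegral_mono_set (hin (cφ.add (cg (k + 1))) _ _) (Filter.Eventually.of_forall hdens)
      (show Metric.closedBall x 2 ⊆ annulus (R / 2) (8 * R) from fun y hy => ?_).eventuallyLE
    rw [Metric.mem_closedBall, dist_eq_norm] at hy
    have h1 := norm_sub_norm_le y x
    have h2 := norm_sub_norm_le x y
    rw [norm_sub_rev] at h2
    exact ⟨by linarith [hx.1], by linarith [hx.2]⟩
  obtain ⟨r1, r2⟩ := hext [] (spd φ) D t R (Cs * Y) S₁ hdom hD (by linarith) htTe (by positivity) hbb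
  set a2 := ∫ x in annulus R (2 * R), (spd φ [] (t, x) ^ 2 + gradSq (spIdx (k + 1)) (spd φ) t x)
  have hab : a2 + Cs * Y ≤ Q * N + Q' * P ^ 2 := by
    have h1 := mul_le_mul_of_nonneg_left hYb (by linarith : 0 ≤ 1 + Cs)
    rw [hQ, hQ']
    linarith
  have hP2 : 0 ≤ P ^ 2 := sq_nonneg P
  constructor
  · intro x hx
    refine (r1 x hx).trans ?_
    rw [mul_assoc]
    refine mul_le_mul_of_nonneg_left ?_ hCe
    have h1 : 0 ≤ Q * P ^ 2 := by positivity
    have h2 : 0 ≤ Q' * N := by positivity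
    linarith
  · intro ρ hρ hρt
    refine (r2 ρ hρ hρt).trans ?_
    rw [mul_assoc]
    refine mul_le_mul_of_nonneg_left ?_ hCe
    have hρ1 : 1 ≤ ρ := by linarith
    have hα0 : 0 ≤ ρ ^ (-(s / 2)) := by positivity
    have hβ1 : 1 ≤ ρ ^ (s / 2) := Real.one_le_rpow hρ1 (by linarith)
    have hα1 : ρ ^ (-(s / 2)) ≤ 1 := by
      rw [← Real.rpow_zero ρ]; exact Real.rpow_le_rpow_of_exponent_le hρ1 (by linarith)
    set α := ρ ^ (-(s / 2))
    set β := ρ ^ (s / 2)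
    have h1 := mul_le_mul_of_nonneg_left hab hα0
    have h2 : α * (Q' * P ^ 2) ≤ β * (Q' * P ^ 2) := by gcongr; linarith
    have h3 : 0 ≤ β * (Q * P ^ 2) := by positivity
    have h4 : 0 ≤ α * N := by positivity
    have h5 : 0 ≤ α * (Q' * N) := by positivity
    linarith

end ExteriorSolution

/-! ### Consequences of local energy decay -/

section LED

variable {g : Spacetime → Matrix (Fin 4) (Fin 4) ℝ} {A : Fin 4 → Spacetime → ℝ}
  {V : Spacetime → ℝ}

lemma contDiff_waveOp (hc : SmoothCoeffs g A V) {u : Spacetime → ℝ} (hu : ContDiff ℝ ∞ u) :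
    ContDiff ℝ ∞ (waveOp g A V u) := by
  rw [show waveOp g A V u = _ from funext (waveOp_eq hc hu)]
  have h1 := contDiff_lap hu
  have h2 := hc.potential
  have h3 : ContDiff ℝ ∞ fun z => ∑ μ, pd μ (flux g A u μ) z :=
    ContDiff.sum fun μ _ => contDiff_pd μ (contDiff_flux hc hu μ)
  fun_prop

lemma measurableSet_shell (j : ℕ) : MeasurableSet (shell j) := by
  unfold shell
  split_ifs
  · exact measurableSet_lt continuous_norm.measurable measurable_const
  · exact (measurableSet_lt measurable_const continuous_norm.measurable).inter
      (measurableSet_lt continuous_norm.measurable measurable_const)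

/-- The dyadic regions are open and miss the spheres |x| = 2^{j+1}; these are null sets, so the
regions cover space up to measure zero. -/
lemma exists_mem_shell {x : Space} (hx : ∀ j : ℕ, ‖x‖ ≠ 2 ^ (j + 1)) : ∃ j, x ∈ shell j := by
  rcases lt_or_ge ‖x‖ 2 with h | h
  · exact ⟨0, by simpa [shell] using h⟩
  · obtain ⟨n, h1, h2⟩ := exists_nat_pow_near (by linarith : (1 : ℝ) ≤ ‖x‖) (by norm_num : (1 : ℝ) < 2)
    have hn : n ≠ 0 := by
      rintro rfl
      norm_num at h2; linarith
    obtain ⟨m, rfl⟩ := Nat.exists_eq_succ_of_ne_zero hn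
    refine ⟨m + 1, ?_⟩
    simp only [shell, hn, if_false, Set.mem_ofPred_eq]
    exact ⟨lt_of_le_of_ne h1 (hx m).symm, h2⟩

lemma ae_norm_ne : ∀ᵐ z : Spacetime, ∀ j : ℕ, ‖z.2‖ ≠ 2 ^ (j + 1) := by
  rw [ae_all_iff]
  intro j
  have h : volume (Set.univ ×ˢ Metric.sphere (0 : Space) (2 ^ (j + 1)) : Set Spacetime) = 0 := by
    rw [Measure.volume_eq_prod, Measure.prod_prod, Measure.addHaar_sphere, mul_zero]
  refine measure_mono_null (fun z hz => ?_) h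
  simp only [Set.mem_compl_iff, Set.mem_ofPred_eq, not_not] at hz
  simpa using hz

lemma eLpNorm_two_sq (f : Spacetime → ℝ) (μ : Measure Spacetime) :
    eLpNorm f 2 μ ^ 2 = ∫⁻ z, ‖f z‖ₑ ^ 2 ∂μ := by
  rw [eLpNorm_eq_lintegral_rpow_enorm_toReal two_ne_zero ENNReal.ofNat_ne_top]
  rw [← ENNReal.rpow_natCast, ← ENNReal.rpow_mul]
  simp

/-- The `L²` norm over space-time is at most the sum of the norms over the dyadic regions. -/
lemma eLpNorm_le_tsum_shell (f : Spacetime → ℝ) (I : Set ℝ) :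
    eLpNorm f 2 (volume.restrict (I ×ˢ Set.univ)) ≤
      ∑' j : ℕ, eLpNorm f 2 (volume.restrict (I ×ˢ shell j)) := by
  set a : ℕ → ℝ≥0∞ := fun j => eLpNorm f 2 (volume.restrict (I ×ˢ shell j)) with ha
  have h1 : eLpNorm f 2 (volume.restrict (I ×ˢ Set.univ)) ^ 2 ≤ ∑' j, a j ^ 2 := by
    simp only [ha, eLpNorm_two_sq]
    refine le_trans ?_ (lintegral_iUnion_le _ _)
    refine lintegral_mono_set' ?_
    filter_upwards [ae_norm_ne] with z hz hz'
    obtain ⟨j, hj⟩ := exists_mem_shell hz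
    exact Set.mem_iUnion.2 ⟨j, hz'.1, hj⟩
  -- The ℓ² norm is at most the ℓ¹ norm: each a_j is at most the whole sum.
  have h2 : ∑' j, a j ^ 2 ≤ (∑' j, a j) ^ 2 := by
    rw [sq (∑' j, a j), ← ENNReal.tsum_mul_right]
    refine ENNReal.tsum_le_tsum fun j => ?_
    rw [sq]
    exact mul_le_mul_right (ENNReal.le_tsum j) _
  exact (ENNReal.pow_le_pow_left_iff two_ne_zero).1 (h1.trans h2)

lemma rWeight_pos (a : ℝ) (z : Spacetime) : 0 < rWeight a z := Real.rpow_pos_of_pos (jb_pos _) _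

lemma eLpNorm_le_normLEstar (f : Spacetime → ℝ) (I : Set ℝ) :
    eLpNorm f 2 (volume.restrict (I ×ˢ Set.univ)) ≤ normLEstar I f := by
  refine (eLpNorm_le_tsum_shell f I).trans (ENNReal.tsum_le_tsum fun j => ?_)
  refine eLpNorm_mono fun z => ?_
  rw [norm_mul, Real.norm_of_nonneg (rWeight_pos _ z).le]
  exact le_mul_of_one_le_left (norm_nonneg _) (Real.one_le_rpow (one_le_jb _) (by norm_num))

lemma eLpNorm_mul_le {f h : Spacetime → ℝ} {c : ℝ≥0} (hc : ∀ z, |h z| ≤ c) (μ : Measure Spacetime) :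
    eLpNorm (fun z => h z * f z) 2 μ ≤ c * eLpNorm f 2 μ := by
  refine (eLpNorm_le_nnreal_smul_eLpNorm_of_ae_le_mul (c := c) (g := f)
    (Filter.Eventually.of_forall fun z => ?_) 2).trans (le_of_eq ?_)
  · rw [← NNReal.coe_le_coe]
    simp only [coe_nnnorm, NNReal.coe_mul, norm_mul, Real.norm_eq_abs]
    exact mul_le_mul_of_nonneg_right (hc z) (abs_nonneg _)
  · rw [ENNReal.smul_def, smul_eq_mul]

lemma normLEstar_mul_le {f h : Spacetime → ℝ} {c : ℝ≥0} (hc : ∀ z, |h z| ≤ c) (I : Set ℝ) :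
    normLEstar I (fun z => h z * f z) ≤ c * normLEstar I f := by
  unfold normLEstar
  rw [← ENNReal.tsum_mul_left]
  refine ENNReal.tsum_le_tsum fun j => ?_
  have := eLpNorm_mul_le (f := fun z => rWeight (1 / 2) z * f z) hc (volume.restrict (I ×ˢ shell j))
  refine le_trans (le_of_eq ?_) this
  congr 1; ext z; ring

lemma normLEstar_mono_set {I J : Set ℝ} (h : I ⊆ J) (f : Spacetime → ℝ) :
    normLEstar I f ≤ normLEstar J f :=
  ENNReal.tsum_le_tsum fun _ => eLpNorm_mono_measure _
    (Measure.restrict_mono (Set.prod_mono h subset_rfl) le_rfl)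

lemma normLE_mono_set {I J : Set ℝ} (h : I ⊆ J) (f : Spacetime → ℝ) : normLE I f ≤ normLE J f :=
  iSup_mono fun _ => eLpNorm_mono_measure _
    (Measure.restrict_mono (Set.prod_mono h subset_rfl) le_rfl)

lemma mem_multiIdx {n k : ℕ} {α : Fin n → ℕ} : α ∈ multiIdx n k ↔ ∑ a, α a ≤ k := by
  simp only [multiIdx, Finset.mem_filter, Fintype.mem_piFinset, Finset.mem_range, and_iff_right_iff_imp]
  intro h a
  have := Finset.single_le_sum (f := α) (fun _ _ => Nat.zero_le _) (Finset.mem_univ a)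
  omega

lemma multiIdx_mono {n k k' : ℕ} (h : k ≤ k') : multiIdx n k ⊆ multiIdx n k' := fun _ hα =>
  mem_multiIdx.2 ((mem_multiIdx.1 hα).trans h)

lemma le_normUpTo {N : (Spacetime → ℝ) → ℝ≥0∞} {k : ℕ} {u : Spacetime → ℝ} {α : Fin 4 → ℕ}
    (hα : α ∈ multiIdx 4 k) : N (pdMulti α u) ≤ normUpTo N k u :=
  Finset.single_le_sum (f := fun α => N (pdMulti α u)) (fun _ _ => zero_le) hα

lemma contDiff_pdMulti (α : Fin 4 → ℕ) {u : Spacetime → ℝ} (hu : ContDiff ℝ ∞ u) :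
    ContDiff ℝ ∞ (pdMulti α u) := by rw [pdMulti_eq_pdl]; exact contDiff_pdl _ hu

lemma exists_pd_pdMulti {k : ℕ} {α : Fin 4 → ℕ} (hα : α ∈ multiIdx 4 k) (β : Fin 4) :
    ∃ γ ∈ multiIdx 4 (k + 1), ∀ {u : Spacetime → ℝ}, ContDiff ℝ ∞ u →
      pd β (pdMulti α u) = pdMulti γ u := by
  obtain ⟨l, hl, h⟩ := exists_pdMulti_eq_pdl α
  refine ⟨fun a => (β :: l).count a, mem_multiIdx.2 ?_, fun {u} hu => ?_⟩
  · rw [sum_count_eq_length, List.length_cons, hl]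
    exact Nat.succ_le_succ (mem_multiIdx.1 hα)
  · rw [h, pd_pdl β l hu, pdl_eq_pdMulti _ hu]

lemma exists_cutoff_bound {χ : Space → ℝ} (hχ : ContDiff ℝ ∞ χ) (hs : HasCompactSupport χ) :
    ∃ c : ℝ≥0, (∀ x, |χ x| ≤ c) ∧ (∀ x, |1 - χ x| ≤ c) ∧
      ∀ (i : Fin 3) (z : Spacetime), |pd i.succ (fun z => χ z.2) z| ≤ c := by
  obtain ⟨C, hC⟩ := hχ.continuous.bounded_above_of_compact_support hs
  obtain ⟨C', hC'⟩ := (hχ.continuous_fderiv (by simp)).bounded_above_of_compact_support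
    (hs.fderiv (𝕜 := ℝ))
  have h0 : 0 ≤ C := (norm_nonneg _).trans (hC 0)
  have h0' : 0 ≤ C' := (norm_nonneg _).trans (hC' 0)
  refine ⟨⟨1 + C + C', by positivity⟩, fun x => ?_, fun x => ?_, fun i z => ?_⟩
  · have := hC x
    rw [Real.norm_eq_abs] at this
    change |χ x| ≤ 1 + C + C'
    linarith
  · have := hC x
    rw [Real.norm_eq_abs] at this
    change |1 - χ x| ≤ 1 + C + C'
    have h2 := abs_sub (1 : ℝ) (χ x)
    rw [abs_one] at h2
    linarith
  · change |pd i.succ (fun z => χ z.2) z| ≤ 1 + C + C'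
    have h1 := fderiv_slice (u := fun z : Spacetime => χ z.2) (hχ.comp contDiff_snd) z.1 z.2 i
    rw [Prod.mk.eta] at h1
    rw [← h1]
    have h2 := (fderiv ℝ χ z.2).le_opNorm (EuclideanSpace.single i 1)
    have h3 := hC' z.2
    simp only [PiLp.norm_single, norm_one, mul_one, Real.norm_eq_abs] at h2
    exact h2.trans (by linarith)

/-- The H¹ norm on the support of χ costs one derivative of F, so the weak norm of order k is
controlled by the strong one of order k + 1. The constant is 8 = 1 + 1 + 3·2. -/
lemma normLEstarw_le {χ : Space → ℝ} (hχ : ContDiff ℝ ∞ χ) {c : ℝ≥0} (h1 : ∀ x, |χ x| ≤ c)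
    (h2 : ∀ x, |1 - χ x| ≤ c) (h3 : ∀ (i : Fin 3) (z : Spacetime), |pd i.succ (fun z => χ z.2) z| ≤ c)
    {I : Set ℝ} {F : Spacetime → ℝ} (hF : ContDiff ℝ ∞ F) {B : ℝ≥0∞}
    (hB : normLEstar I F ≤ B) (hB' : ∀ i : Fin 3, normLEstar I (pd i.succ F) ≤ B) :
    normLEstarw χ I F ≤ 8 * (c * B) := by
  have hχ' : ContDiff ℝ ∞ fun z : Spacetime => χ z.2 := hχ.comp contDiff_snd
  have a1 : normLEstar I (fun z => (1 - χ z.2) * F z) ≤ c * B :=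
    (normLEstar_mul_le (fun z => h2 z.2) I).trans (by gcongr)
  have key : ∀ {h f : Spacetime → ℝ}, (∀ z, |h z| ≤ c) → normLEstar I f ≤ B →
      eLpNorm (fun z => h z * f z) 2 (volume.restrict (I ×ˢ Set.univ)) ≤ c * B := fun hh hf =>
    (eLpNorm_mul_le hh _).trans (by gcongr; exact (eLpNorm_le_normLEstar _ I).trans hf)
  have a2 := key (fun z => h1 z.2) hB
  have a3 : ∀ i : Fin 3, eLpNorm (pd i.succ fun z => χ z.2 * F z) 2 (volume.restrict (I ×ˢ Set.univ))
      ≤ 2 * (c * B) := fun i => by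
    rw [pd_mul _ hχ' hF, two_mul]
    refine (eLpNorm_add_le (f := fun z => pd i.succ (fun z => χ z.2) z * F z)
      (g := fun z => χ z.2 * pd i.succ F z) ?_ ?_ (by norm_num)).trans
      (add_le_add (key (h3 i) hB) (key (fun z => h1 z.2) (hB' i)))
    · exact ((contDiff_pd _ hχ').mul hF).continuous.aestronglyMeasurable
    · exact (hχ'.mul (contDiff_pd _ hF)).continuous.aestronglyMeasurable
  have a4 : ∑ i : Fin 3, eLpNorm (pd i.succ fun z => χ z.2 * F z) 2 (volume.restrict (I ×ˢ Set.univ))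
      ≤ 6 * (c * B) := (Finset.sum_le_sum fun i _ => a3 i).trans (le_of_eq (by
        rw [Finset.sum_const, Finset.card_univ, Fintype.card_fin, nsmul_eq_mul, ← mul_assoc]; norm_num))
  calc normLEstarw χ I F ≤ c * B + (c * B + 6 * (c * B)) := add_le_add a1 (add_le_add a2 a4)
    _ = 8 * (c * B) := by ring

lemma energyH_eq_zero {u : Spacetime → ℝ} {T : ℝ} {U : Set ℝ} (hU : IsOpen U) (hT : T ∈ U)
    (h : ∀ z : Spacetime, z.1 ∈ U → u z = 0) (k : ℕ) : energyH k u T = 0 := by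
  refine Finset.sum_eq_zero fun α _ => Finset.sum_eq_zero fun β _ => ?_
  obtain ⟨l, -, hl⟩ := exists_pdMulti_eq_pdl (Fin.cons 0 β)
  have : (fun x : Space => pdMulti (Fin.cons 0 β) (pd α u) (T, x)) = fun _ => 0 := by
    ext x
    rw [hl]
    change pdl (α :: l) u (T, x) = 0
    refine pdl_eq_zero_of_eventuallyEq _ ?_
    filter_upwards [(hU.preimage continuous_fst).mem_nhds (show (T, x) ∈ Prod.fst ⁻¹' U from hT)]
      with z hz using h z hz
  rw [this]; exact eLpNorm_zero'

/-- The common consequence of weak and stationary local energy decay for functions that vanish near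
the ends of a time interval. -/
theorem exists_led_bound (hc : SmoothCoeffs g A V) (h : WeakLED g A V ∨ StationaryLED g A V) (k : ℕ) :
    ∃ C : ℝ≥0, ∀ (T₁ a b T₂ : ℝ) (u : Spacetime → ℝ), 0 ≤ T₁ → T₁ < a → a < b → b < T₂ →
      ContDiff ℝ ∞ u → (∀ z : Spacetime, z.1 < a ∨ b < z.1 → u z = 0) →
      (∃ ρ : ℝ, ∀ z : Spacetime, ρ < ‖z.2‖ → u z = 0) → ∀ α ∈ multiIdx 4 k, ∀ j : ℕ,
      eLpNorm (fun z => rWeight (-1 / 2) z * (rWeight (-1) z * pdMulti α u z)) 2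
          (volume.restrict (Set.Icc T₁ T₂ ×ˢ shell j)) ≤
        C * (normUpTo (normLEstar (Set.Ici T₁)) (k + 1) (waveOp g A V u)
          + normUpTo (normLE (Set.Ici T₁)) k (pd 0 u)) := by
  have hup : ∀ (T₁ : ℝ) (u : Spacetime → ℝ), normUpTo (normLEstar (Set.Ici T₁)) k u ≤
      normUpTo (normLEstar (Set.Ici T₁)) (k + 1) u := fun T₁ u =>
    Finset.sum_le_sum_of_subset (multiIdx_mono (Nat.le_succ k))
  -- Only the undifferentiated part of the LE¹ norm is kept: on the support of χ the weak norm does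
  -- not contain the gradient. The derivatives needed later come from taking the order k.
  rcases h with ⟨χ, hχ, hχs, hW⟩ | hS
  · obtain ⟨C, hC⟩ := hW k
    obtain ⟨c, h1, h2, h3⟩ := exists_cutoff_bound hχ hχs
    refine ⟨C * ((multiIdx 4 k).card * (8 * c)), ?_⟩
    intro T₁ a b T₂ u hT₁ ha hab hb hu hsupp ⟨ρ, hρ⟩ α hα j
    set B := normUpTo (normLEstar (Set.Ici T₁)) (k + 1) (waveOp g A V u)
    have hP := contDiff_waveOp hc hu
    have hBk : normUpTo (normLEstarw χ (Set.Ici T₁)) k (waveOp g A V u) ≤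
        (multiIdx 4 k).card * (8 * (c * B)) := by
      refine (Finset.sum_le_sum fun γ hγ => ?_).trans (le_of_eq (by
        rw [Finset.sum_const, nsmul_eq_mul]))
      refine normLEstarw_le hχ h1 h2 h3 (contDiff_pdMulti γ hP)
        (le_normUpTo (multiIdx_mono (Nat.le_succ k) hγ)) fun i => ?_
      obtain ⟨γ', hγ', he⟩ := exists_pd_pdMulti hγ i.succ
      rw [he hP]
      exact le_normUpTo hγ'
    have hmain := hC T₁ hT₁ u ⟨hu, fun T => ⟨ρ, fun z _ _ hz => hρ z hz⟩⟩
    rw [energyH_eq_zero (isOpen_Iio (a := a)) (Set.mem_Iio.2 ha) (fun z hz => hsupp z (Or.inl hz)),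
      zero_add] at hmain
    calc _ ≤ normLE (Set.Icc T₁ T₂) (fun z => rWeight (-1) z * pdMulti α u z) :=
          le_iSup (fun j => eLpNorm (fun z => rWeight (-1 / 2) z * (rWeight (-1) z * pdMulti α u z)) 2
            (volume.restrict (Set.Icc T₁ T₂ ×ˢ shell j))) j
      _ ≤ normLE (Set.Ici T₁) (fun z => rWeight (-1) z * pdMulti α u z) :=
          normLE_mono_set (fun t ht => ht.1) _
      _ ≤ normLE1w χ (Set.Ici T₁) (pdMulti α u) := le_add_self
      _ ≤ normUpTo (normLE1w χ (Set.Ici T₁)) k u := le_normUpTo hα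
      _ ≤ C * ((multiIdx 4 k).card * (8 * (c * B))) := hmain.trans (by gcongr)
      _ = ↑(C * ((multiIdx 4 k).card * (8 * c))) * B := by push_cast; ring
      _ ≤ _ := by gcongr; exact le_self_add
  · obtain ⟨C, hC⟩ := hS k
    refine ⟨C, ?_⟩
    intro T₁ a b T₂ u hT₁ ha hab hb hu hsupp ⟨ρ, hρ⟩ α hα j
    -- In the stationary case the energies at both ends vanish by the support assumption, and ∂_t u
    -- stays on the right-hand side. The weak case only has the initial energy and no such term.
    have hmain := hC T₁ T₂ hT₁ (by linarith) u ⟨hu, fun T => ⟨ρ, fun z _ _ hz => hρ z hz⟩⟩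
    rw [energyH_eq_zero (isOpen_Iio (a := a)) (Set.mem_Iio.2 ha) (fun z hz => hsupp z (Or.inl hz)),
      energyH_eq_zero (isOpen_Ioi (a := b)) (Set.mem_Ioi.2 hb) (fun z hz => hsupp z (Or.inr hz)),
      zero_add, zero_add] at hmain
    have hsub : Set.Icc T₁ T₂ ⊆ Set.Ici T₁ := fun t ht => ht.1
    calc _ ≤ normLE (Set.Icc T₁ T₂) (fun z => rWeight (-1) z * pdMulti α u z) :=
          le_iSup (fun j => eLpNorm (fun z => rWeight (-1 / 2) z * (rWeight (-1) z * pdMulti α u z)) 2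
            (volume.restrict (Set.Icc T₁ T₂ ×ˢ shell j))) j
      _ ≤ normLE1 (Set.Icc T₁ T₂) (pdMulti α u) := le_add_self
      _ ≤ normUpTo (normLE1 (Set.Icc T₁ T₂)) k u := le_normUpTo hα
      _ ≤ _ := hmain
      _ ≤ _ := by
        gcongr
        · exact (Finset.sum_le_sum fun γ _ => normLEstar_mono_set hsub _).trans (hup T₁ _)
        · exact Finset.sum_le_sum fun γ _ => normLE_mono_set hsub _

end LED

/-! ### Space-time cutoffs and their commutator with the wave operator -/

variable {g : Spacetime → Matrix (Fin 4) (Fin 4) ℝ} {A : Fin 4 → Spacetime → ℝ}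
  {V φ : Spacetime → ℝ}

/-- The Leibniz bound with a geometric gain for every derivative. -/
lemma abs_pdl_mul_le_pow {u v : Spacetime → ℝ} (l : List (Fin 4)) (hu : ContDiff ℝ ∞ u)
    (hv : ContDiff ℝ ∞ v) {z : Spacetime} {a b c : ℝ}
    (ha : ∀ l', l'.Sublist l → |pdl l' u z| ≤ a * c ^ l'.length)
    (hb : ∀ l', l'.Sublist l → |pdl l' v z| ≤ b * c ^ l'.length) :
    |pdl l (fun y => u y * v y) z| ≤ 2 ^ l.length * (a * b * c ^ l.length) := by
  induction l generalizing u v a b with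
  | nil =>
    have h1 := ha [] (List.Sublist.refl _)
    have h2 := hb [] (List.Sublist.refl _)
    simp only [pdl, List.length_nil, pow_zero, one_mul, mul_one] at *
    rw [abs_mul]
    exact mul_le_mul h1 h2 (abs_nonneg _) ((abs_nonneg _).trans h1)
  | cons β l ih =>
    simp only [pdl]
    rw [pd_mul β hu hv, pdl_add l (by fun_prop) (by fun_prop)]
    have h1 := ih (a := a * c) (b := b) (contDiff_pd β hu) hv
      (fun l' hl' => (ha (β :: l') (hl'.cons_cons β)).trans_eq (by rw [List.length_cons]; ring))
      (fun l' hl' => hb l' (hl'.cons β))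
    have h2 := ih (a := a) (b := b * c) hu (contDiff_pd β hv) (fun l' hl' => ha l' (hl'.cons β))
      (fun l' hl' => (hb (β :: l') (hl'.cons_cons β)).trans_eq (by rw [List.length_cons]; ring))
    refine (abs_add_le _ _).trans ((add_le_add h1 h2).trans_eq ?_)
    rw [List.length_cons]; ring

/-- The function `t ↦ ψ ((t - t₀) / L)` on spacetime. -/
def timeCut (ψ : ℝ → ℝ) (t₀ L : ℝ) : Spacetime → ℝ := fun z => ψ (L⁻¹ * (z.1 - t₀))

section TimeCut

variable {ψ : ℝ → ℝ}

lemma contDiff_timeCut (hψ : ContDiff ℝ ∞ ψ) (t₀ L : ℝ) : ContDiff ℝ ∞ (timeCut ψ t₀ L) := by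
  unfold timeCut; fun_prop

lemma contDiff_deriv_of_smooth (hψ : ContDiff ℝ ∞ ψ) : ContDiff ℝ ∞ (deriv ψ) :=
  (contDiff_infty_iff_deriv.1 hψ).2

lemma pd_timeCut (hψ : ContDiff ℝ ∞ ψ) (t₀ L : ℝ) (β : Fin 4) :
    pd β (timeCut ψ t₀ L) = fun z => (if β = 0 then L⁻¹ else 0) * timeCut (deriv ψ) t₀ L z := by
  ext z
  have h1 : HasFDerivAt (fun z : Spacetime => L⁻¹ * (z.1 - t₀))
      (L⁻¹ • ContinuousLinearMap.fst ℝ ℝ Space) z :=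
    ((hasFDerivAt_fst (𝕜 := ℝ)).sub_const t₀).const_mul L⁻¹
  have h2 := ((hψ.differentiable (by simp)) (L⁻¹ * (z.1 - t₀))).hasDerivAt.comp_hasFDerivAt z h1
  have e : fderiv ℝ (timeCut ψ t₀ L) z = _ := h2.fderiv
  refine Fin.cases ?_ (fun i => ?_) β
  · simp [pd, e, timeCut, coordVec, mul_comm]
  · simp [pd, e, coordVec]

lemma exists_timeCut_bound (n : ℕ) (hψ : ContDiff ℝ ∞ ψ) (hs : HasCompactSupport ψ) :
    ∃ C : ℝ, 0 ≤ C ∧ ∀ m : List (Fin 4), m.length ≤ n → ∀ t₀ L : ℝ, 0 < L → ∀ z : Spacetime,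
      |pdl m (timeCut ψ t₀ L) z| ≤ C * L⁻¹ ^ m.length := by
  refine exists_bound_of_finite (S := {m : List (Fin 4) | m.length ≤ n})
    (P := fun m C => ∀ t₀ L : ℝ, 0 < L → ∀ z : Spacetime,
      |pdl m (timeCut ψ t₀ L) z| ≤ C * L⁻¹ ^ m.length) (List.finite_length_le _ n) ?_ ?_
  · intro m c c' hcc h t₀ L hL z
    exact (h t₀ L hL z).trans (by gcongr)
  · intro m hm
    clear hm
    induction m generalizing ψ with
    | nil =>
      obtain ⟨C, hC⟩ := hψ.continuous.bounded_above_of_compact_support hs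
      exact ⟨C, fun t₀ L _ z => by simpa [pdl, timeCut] using hC (L⁻¹ * (z.1 - t₀))⟩
    | cons β m ih =>
      obtain ⟨C, hC⟩ := ih (contDiff_deriv_of_smooth hψ) hs.deriv
      refine ⟨C, fun t₀ L hL z => ?_⟩
      simp only [pdl]
      rw [pd_timeCut hψ, pdl_const_mul m _ (contDiff_timeCut (contDiff_deriv_of_smooth hψ) _ _), abs_mul,
        List.length_cons, pow_succ]
      have h1 : |if β = 0 then L⁻¹ else 0| ≤ L⁻¹ := by
        have := inv_pos.2 hL
        split_ifs <;> simp [abs_of_pos, this.le, hL]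
      have := mul_le_mul h1 (hC t₀ L hL z) (abs_nonneg _) (inv_nonneg.2 hL.le)
      linarith

end TimeCut

/-- The product of a cutoff in time at scale `L` around `t₀` and a cutoff to the ball of radius `2ρ`. -/
def cutoff (ψ : ℝ → ℝ) (t₀ L ρ : ℝ) : Spacetime → ℝ :=
  fun z => timeCut ψ t₀ L z * spaceCut bumpB ρ 0 z

section Cutoff

variable {ψ : ℝ → ℝ}

lemma contDiff_cutoff (hψ : ContDiff ℝ ∞ ψ) (t₀ L ρ : ℝ) : ContDiff ℝ ∞ (cutoff ψ t₀ L ρ) :=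
  (contDiff_timeCut hψ t₀ L).mul (contDiff_spaceCut bumpB_contDiff ρ 0)

lemma pd_zero_cutoff (hψ : ContDiff ℝ ∞ ψ) (t₀ L ρ : ℝ) :
    pd 0 (cutoff ψ t₀ L ρ) = fun z => L⁻¹ * cutoff (deriv ψ) t₀ L ρ z := by
  have e : pd 0 (spaceCut bumpB ρ 0) = fun _ => 0 := by
    rw [pd_spaceCut bumpB_contDiff]; ext z; simp [spaceCut, psd, coordVec]
  unfold cutoff
  rw [pd_mul 0 (contDiff_timeCut hψ _ _) (contDiff_spaceCut bumpB_contDiff ρ 0), pd_timeCut hψ, e]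
  ext z; simp; ring

lemma pdl_cutoff_of_zero_mem (hψ : ContDiff ℝ ∞ ψ) (t₀ L ρ : ℝ) {m : List (Fin 4)}
    (h : (0 : Fin 4) ∈ m) :
    pdl m (cutoff ψ t₀ L ρ) = fun z => L⁻¹ * pdl (m.erase 0) (cutoff (deriv ψ) t₀ L ρ) z := by
  rw [pdl_perm (List.perm_cons_erase h) (contDiff_cutoff hψ _ _ _), pdl, pd_zero_cutoff hψ,
    pdl_const_mul _ _ (contDiff_cutoff (contDiff_deriv_of_smooth hψ) _ _ _)]

/-- For |x| < ρ the spatial factor is identically 1, so the first space derivative already vanishes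
near z. -/
lemma pdl_cutoff_of_lt (hψ : ContDiff ℝ ∞ ψ) (t₀ L : ℝ) {ρ : ℝ} (hρ : 0 < ρ) {m : List (Fin 4)}
    (hm : m ≠ []) (h : (0 : Fin 4) ∉ m) {z : Spacetime} (hz : ‖z.2‖ < ρ) :
    pdl m (cutoff ψ t₀ L ρ) z = 0 := by
  obtain ⟨β, m, rfl⟩ := List.exists_cons_of_ne_nil hm
  have hβ : β ≠ 0 := fun h' => h (by simp [h'])
  refine pdl_eq_zero_of_eventuallyEq m ?_
  unfold cutoff
  rw [pd_mul β (contDiff_timeCut hψ _ _) (contDiff_spaceCut bumpB_contDiff ρ 0), pd_timeCut hψ]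
  filter_upwards [(isOpen_lt (continuous_norm.comp continuous_snd) continuous_const).mem_nhds hz]
    with y hy
  have : spaceCut bumpB ρ 0 =ᶠ[nhds y] fun _ => 1 := by
    filter_upwards [(isOpen_lt (continuous_norm.comp continuous_snd) continuous_const).mem_nhds hy]
      with y' hy'
    exact spaceCut_eq_one hρ (le_of_lt hy')
  simp [hβ, pd, this.fderiv_eq]

/-- As ρ² ≤ L, a time derivative is cheaper than a space derivative, and every derivative gains at
least ρ⁻¹. -/
lemma exists_cutoff_pdl_bound (n : ℕ) (hψ : ContDiff ℝ ∞ ψ) (hs : HasCompactSupport ψ) :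
    ∃ C : ℝ, 0 ≤ C ∧ ∀ m : List (Fin 4), m.length ≤ n → ∀ t₀ L ρ : ℝ, 1 ≤ ρ → ρ ^ 2 ≤ L →
      ∀ z : Spacetime, |pdl m (cutoff ψ t₀ L ρ) z| ≤ C * ρ⁻¹ ^ m.length := by
  obtain ⟨C₁, h₁, hC₁⟩ := exists_timeCut_bound n hψ hs
  obtain ⟨C₂, h₂, hC₂⟩ := exists_psdl_bound_le bumpB_contDiff bumpB.hasCompactSupport n
  refine ⟨2 ^ n * (C₁ * C₂), by positivity, fun m hm t₀ L ρ hρ hL z => ?_⟩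
  have hρ0 : 0 < ρ := by linarith
  have hρL : ρ ≤ L := by nlinarith
  refine (abs_pdl_mul_le_pow (a := C₁) (b := C₂) (c := ρ⁻¹) m (contDiff_timeCut hψ t₀ L)
    (contDiff_spaceCut bumpB_contDiff ρ 0) (fun l' hl' => ?_) (fun l' hl' => ?_)).trans ?_
  · refine (hC₁ l' (hl'.length_le.trans hm) t₀ L (by linarith) z).trans ?_
    have : 0 ≤ L⁻¹ := inv_nonneg.2 (by linarith)
    gcongr
  · rw [pdl_spaceCut bumpB_contDiff, abs_mul, abs_of_nonneg (by positivity), mul_comm]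
    gcongr
    exact hC₂ _ (hl'.length_le.trans hm) _
  · rw [← mul_assoc]
    gcongr
    norm_num


/-- A fixed smooth bump on the line: `1` on `[-1, 1]`, supported in `[-2, 2]`. -/
def bumpT : ContDiffBump (0 : ℝ) := ⟨1, 2, one_pos, one_lt_two⟩

lemma bumpT_contDiff : ContDiff ℝ ∞ (bumpT : ℝ → ℝ) := bumpT.contDiff

/-- The derivatives of the cutoff. -/
lemma exists_cutoff_bounds (n : ℕ) : ∃ C : ℝ, 0 ≤ C ∧ ∀ m : List (Fin 4), m.length ≤ n →
    ∀ t₀ L ρ : ℝ, 1 ≤ ρ → ρ ^ 2 ≤ L → ∀ z : Spacetime,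
      |pdl m (cutoff bumpT t₀ L ρ) z| ≤ C * ρ⁻¹ ^ m.length ∧
      ((0 : Fin 4) ∈ m ∨ m ≠ [] ∧ ‖z.2‖ < ρ → |pdl m (cutoff bumpT t₀ L ρ) z| ≤ C * L⁻¹) := by
  obtain ⟨C₁, h₁, hC₁⟩ := exists_cutoff_pdl_bound n bumpT_contDiff bumpT.hasCompactSupport
  obtain ⟨C₂, h₂, hC₂⟩ := exists_cutoff_pdl_bound n (contDiff_deriv_of_smooth bumpT_contDiff)
    bumpT.hasCompactSupport.deriv
  refine ⟨C₁ + C₂, by positivity, fun m hm t₀ L ρ hρ hL z => ⟨?_, fun h => ?_⟩⟩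
  · refine (hC₁ m hm t₀ L ρ hρ hL z).trans ?_
    gcongr; linarith
  have hL0 : 0 ≤ L⁻¹ := inv_nonneg.2 (by nlinarith)
  by_cases h0 : (0 : Fin 4) ∈ m
  · rw [pdl_cutoff_of_zero_mem bumpT_contDiff _ _ _ h0, abs_mul, abs_of_nonneg hL0, mul_comm]
    gcongr
    refine (hC₂ (m.erase 0) (List.length_erase_le.trans hm) t₀ L ρ hρ hL z).trans ?_
    have := mul_le_mul_of_nonneg_left
      (pow_le_one₀ (n := (m.erase 0).length) (by positivity : 0 ≤ ρ⁻¹) (inv_le_one_of_one_le₀ hρ)) h₂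
    linarith
  · obtain ⟨hm', hz⟩ := h.resolve_left h0
    rw [pdl_cutoff_of_lt bumpT_contDiff _ _ (by linarith) hm' h0 hz, abs_zero]
    positivity

end Cutoff

/-- The zeroth-order coefficient of the commutator of the wave operator with a cutoff. -/
def commZero (g : Spacetime → Matrix (Fin 4) (Fin 4) ℝ) (A : Fin 4 → Spacetime → ℝ)
    (c : Spacetime → ℝ) : Spacetime → ℝ :=
  fun z => ∑ α, (∑ β, (pd α (fun y => g y α β) z * pd β c z + g z α β * pd α (pd β c) z)
    + A α z * pd α c z)

/-- The first-order coefficients of the commutator of the wave operator with a cutoff. -/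
def commOne (g : Spacetime → Matrix (Fin 4) (Fin 4) ℝ) (c : Spacetime → ℝ) (α : Fin 4) :
    Spacetime → ℝ :=
  fun z => ∑ β, (g z α β * pd β c z + g z β α * pd β c z)

lemma SmoothCoeffs.contDiff_metric (hc : SmoothCoeffs g A V) (α β : Fin 4) :
    ContDiff ℝ ∞ (fun z => g z α β) := by
  have := (hc.metric α β).add (contDiff_const (c := mink α β))
  simpa [metricDiff] using this

lemma contDiff_commZero (hc : SmoothCoeffs g A V) {c : Spacetime → ℝ} (hcut : ContDiff ℝ ∞ c) :
    ContDiff ℝ ∞ (commZero g A c) := by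
  have := hc.contDiff_metric
  have := hc.first
  unfold commZero
  exact ContDiff.sum fun α _ => (ContDiff.sum fun β _ => by fun_prop).add (by fun_prop)

lemma contDiff_commOne (hc : SmoothCoeffs g A V) {c : Spacetime → ℝ} (hcut : ContDiff ℝ ∞ c)
    (α : Fin 4) : ContDiff ℝ ∞ (commOne g c α) := by
  have := hc.contDiff_metric
  unfold commOne
  exact ContDiff.sum fun β _ => by fun_prop

/-- Every coefficient of the commutator contains a derivative of the cutoff. For a solution the
source of the truncated function therefore lives where the cutoff varies. -/
lemma waveOp_mul (hc : SmoothCoeffs g A V) {c : Spacetime → ℝ} (hcut : ContDiff ℝ ∞ c)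
    (hφ : ContDiff ℝ ∞ φ) :
    waveOp g A V (fun y => c y * φ y) = fun z => (commZero g A c z * φ z
      + ∑ α, commOne g c α z * pd α φ z) + c z * waveOp g A V φ z := by
  have hg := hc.contDiff_metric
  have hA := hc.first
  ext z
  have h1 : ∀ α β, pd α (fun y => g y α β * pd β (fun y => c y * φ y) y) z =
      (pd α (fun y => g y α β) z * pd β c z + g z α β * pd α (pd β c) z) * φ z
      + g z α β * pd β c z * pd α φ z + g z α β * pd α c z * pd β φ z
      + c z * pd α (fun y => g y α β * pd β φ y) z := by
    intro α β
    rw [pd_mul β hcut hφ, pd_mul α (hg α β) (by fun_prop), pd_add α (by fun_prop) (by fun_prop),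
      pd_mul α (by fun_prop) hφ, pd_mul α hcut (by fun_prop), pd_mul α (hg α β) (by fun_prop)]
    ring
  have h2 : ∀ μ, pd μ (fun y => A μ y * (c y * φ y)) z =
      A μ z * pd μ c z * φ z + c z * pd μ (fun y => A μ y * φ y) z := by
    intro μ
    rw [pd_mul μ (hA μ) (hcut.mul hφ), pd_mul μ hcut hφ, pd_mul μ (hA μ) hφ]
    ring
  have h3 : ∑ α, ∑ β, g z α β * pd α c z * pd β φ z = ∑ α, ∑ β, g z β α * pd β c z * pd α φ z :=
    Finset.sum_comm
  simp only [waveOp, h1, h2, Finset.sum_add_distrib, commZero, commOne, Finset.sum_mul, Finset.mul_sum,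
    add_mul, mul_add, h3]
  ring

lemma abs_sum_four_le {f : Fin 4 → ℝ} {b : ℝ} (h : ∀ i, |f i| ≤ b) : |∑ i, f i| ≤ 4 * b :=
  (Finset.abs_sum_le_sum_abs _ _).trans ((Finset.sum_le_card_nsmul _ _ b fun i _ => h i).trans_eq (by simp))

/-- The derivatives of the coefficients of the commutator. -/
lemma abs_pdl_comm_le (hc : SmoothCoeffs g A V) {c : Spacetime → ℝ} (hcut : ContDiff ℝ ∞ c) {n : ℕ}
    {z : Spacetime} {G γ κ₁ κ₂ : ℝ}
    (hG : ∀ α β (m : List (Fin 4)), m.length ≤ n → |pdl m (fun y => g y α β) z| ≤ G)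
    (hγ : ∀ α β (m : List (Fin 4)), m ≠ [] → m.length ≤ n + 1 → |pdl m (fun y => g y α β) z| ≤ γ)
    (hA : ∀ α (m : List (Fin 4)), m.length ≤ n → |pdl m (A α) z| ≤ γ)
    (h1 : ∀ m : List (Fin 4), m ≠ [] → m.length ≤ n + 2 → |pdl m c z| ≤ κ₁)
    (h2 : ∀ m : List (Fin 4), 2 ≤ m.length → m.length ≤ n + 2 → |pdl m c z| ≤ κ₂)
    {m : List (Fin 4)} (hm : m.length ≤ n) :
    |pdl m (commZero g A c) z| ≤ 2 ^ n * (20 * (γ * κ₁) + 16 * (G * κ₂)) ∧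
      ∀ α, |pdl m (commOne g c α) z| ≤ 2 ^ n * (8 * (G * κ₁)) := by
  have hg := hc.contDiff_metric
  have hAs := hc.first
  have hG0 : 0 ≤ G := (abs_nonneg _).trans (hG 0 0 [] (by simp))
  have hγ0 : 0 ≤ γ := (abs_nonneg _).trans (hA 0 [] (by simp))
  have hκ₁ : 0 ≤ κ₁ := (abs_nonneg _).trans (h1 [0] (by simp) (by simp))
  have hκ₂ : 0 ≤ κ₂ := (abs_nonneg _).trans (h2 [0, 0] (by simp) (by simp))
  have hpow : (2 : ℝ) ^ m.length ≤ 2 ^ n := pow_le_pow_right₀ (by norm_num) hm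
  have up : ∀ {a b : ℝ}, 0 ≤ b → a ≤ 2 ^ m.length * b → a ≤ 2 ^ n * b := fun hb h =>
    h.trans (mul_le_mul_of_nonneg_right hpow hb)
  have len : ∀ {l' : List (Fin 4)}, l'.Sublist m → l'.length ≤ n := fun h => h.length_le.trans hm
  have p1 : ∀ β, ∀ l', l'.Sublist m → |pdl l' (pd β c) z| ≤ κ₁ := fun β l' hl =>
    h1 (β :: l') (by simp) (by have := len hl; simp; omega)
  have t1 : ∀ α β, |pdl m (fun y => pd α (fun y => g y α β) y * pd β c y) z| ≤ 2 ^ n * (γ * κ₁) :=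
    fun α β => up (by positivity) (abs_pdl_mul_le m (contDiff_pd α (hg α β)) (by fun_prop)
      (fun l' hl => hγ α β (α :: l') (by simp) (by have := len hl; simp; omega)) (p1 β))
  have t2 : ∀ α β, |pdl m (fun y => g y α β * pd α (pd β c) y) z| ≤ 2 ^ n * (G * κ₂) :=
    fun α β => up (by positivity) (abs_pdl_mul_le m (hg α β) (by fun_prop)
      (fun l' hl => hG α β l' (len hl))
      (fun l' hl => h2 (β :: α :: l') (by simp) (by have := len hl; simp; omega)))
  have t3 : ∀ α, |pdl m (fun y => A α y * pd α c y) z| ≤ 2 ^ n * (γ * κ₁) :=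
    fun α => up (by positivity) (abs_pdl_mul_le m (hAs α) (by fun_prop) (fun l' hl => hA α l' (len hl))
      (p1 α))
  have t4 : ∀ α β δ, |pdl m (fun y => g y α β * pd δ c y) z| ≤ 2 ^ n * (G * κ₁) :=
    fun α β δ => up (by positivity) (abs_pdl_mul_le m (hg α β) (by fun_prop)
      (fun l' hl => hG α β l' (len hl)) (p1 δ))
  constructor
  · unfold commZero
    rw [pdl_sum m _ (fun α _ => (ContDiff.sum fun β _ => by fun_prop).add (by fun_prop))]
    refine (abs_sum_four_le (b := 4 * (2 ^ n * (γ * κ₁) + 2 ^ n * (G * κ₂)) + 2 ^ n * (γ * κ₁))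
      fun α => ?_).trans_eq (by ring)
    rw [pdl_add m (ContDiff.sum fun β _ => by fun_prop) (by fun_prop),
      pdl_sum m _ (fun β _ => by fun_prop)]
    refine (abs_add_le _ _).trans (add_le_add (abs_sum_four_le fun β => ?_) (t3 α))
    rw [pdl_add m (by fun_prop) (by fun_prop)]
    exact (abs_add_le _ _).trans (add_le_add (t1 α β) (t2 α β))
  · intro α
    unfold commOne
    rw [pdl_sum m _ (fun β _ => by fun_prop)]
    refine (abs_sum_four_le (b := 2 ^ n * (G * κ₁) + 2 ^ n * (G * κ₁)) fun β => ?_).trans_eq (by ring)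
    rw [pdl_add m (by fun_prop) (by fun_prop)]
    exact (abs_add_le _ _).trans (add_le_add (t4 _ _ _) (t4 _ _ _))

/-! ### The source of a truncated solution -/

variable {g : Spacetime → Matrix (Fin 4) (Fin 4) ℝ} {A : Fin 4 → Spacetime → ℝ}
  {V φ : Spacetime → ℝ}

lemma abs_mink_le (α β : Fin 4) : |mink α β| ≤ 1 := by
  rw [mink, Matrix.diagonal_apply]
  split_ifs
  · refine Fin.cases ?_ (fun i => ?_) α <;> simp
  · simp

lemma pd_metric (α β δ : Fin 4) : pd δ (fun y => g y α β) = pd δ (metricDiff g α β) := by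
  ext z
  have : metricDiff g α β = fun y => (fun y => g y α β) y - mink α β := rfl
  rw [pd, pd, this, fderiv_sub_const]

/-- The Minkowski part of the metric is constant. One derivative removes it, and only the decaying
difference remains. -/
lemma CoeffBounds.abs_pdl_metric_le {n : ℕ} {Cc s : ℝ} (hCc : 0 ≤ Cc) (hs : 0 < s)
    (hb : CoeffBounds n Cc s g A V) {z : Spacetime} (hz : 0 ≤ z.1) (α β : Fin 4)
    {m : List (Fin 4)} (hm : m.length ≤ n) :
    |pdl m (fun y => g y α β) z| ≤ Cc + 1 ∧
      (m ≠ [] → |pdl m (fun y => g y α β) z| ≤ Cc * (jb ‖z.2‖)⁻¹) := by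
  have hj : jb ‖z.2‖ ^ (-1 - s) ≤ (jb ‖z.2‖)⁻¹ := by
    rw [← Real.rpow_neg_one]
    exact Real.rpow_le_rpow_of_exponent_le (one_le_jb _) (by linarith)
  have hj1 : (jb ‖z.2‖)⁻¹ ≤ 1 := inv_le_one_of_one_le₀ (one_le_jb _)
  have h0 := ((hb.metric α β m hm z hz).1).trans (mul_le_mul_of_nonneg_left hj hCc)
  have h1 : Cc * (jb ‖z.2‖)⁻¹ ≤ Cc := mul_le_of_le_one_right hCc hj1
  cases m with
  | nil =>
    refine ⟨?_, fun h => absurd rfl h⟩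
    have e : g z α β = metricDiff g α β z + mink α β := by simp [metricDiff]
    simp only [pdl] at h0 ⊢
    rw [e]
    exact (abs_add_le _ _).trans (add_le_add (h0.trans h1) (abs_mink_le α β))
  | cons δ m =>
    simp only [pdl] at h0 ⊢
    rw [pd_metric]
    exact ⟨by linarith, fun _ => h0⟩

lemma exists_map_succ {m : List (Fin 4)} (h : (0 : Fin 4) ∉ m) :
    ∃ l : List (Fin 3), m = l.map Fin.succ := by
  induction m with
  | nil => exact ⟨[], rfl⟩
  | cons β m ih =>
    simp only [List.mem_cons, not_or] at h
    obtain ⟨l, rfl⟩ := ih h.2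
    obtain ⟨i, rfl⟩ := Fin.exists_succ_eq.2 (Ne.symm h.1)
    exact ⟨i :: l, rfl⟩

/-- The source and the time derivative of a truncated solution. -/
theorem exists_source_bound (hc : SmoothCoeffs g A V) {s : ℝ} (hs : 0 < s) {n : ℕ} {Cc : ℝ}
    (hCc : 0 ≤ Cc) (hb : CoeffBounds (n + 1) Cc s g A V) :
    ∃ C : ℝ, 0 ≤ C ∧ ∀ (φ : Spacetime → ℝ) (t₀ L ρ N Nt Q : ℝ) (z : Spacetime), ContDiff ℝ ∞ φ →
      (∀ z : Spacetime, 0 < z.1 → waveOp g A V φ z = 0) → 1 ≤ ρ → ρ ^ 2 ≤ L → 0 < z.1 → 0 ≤ Q →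
      (∀ m : List (Fin 4), m.length ≤ n + 1 → |pdl m φ z| ≤ N) →
      (∀ m : List (Fin 4), (0 : Fin 4) ∈ m → m.length ≤ n + 1 → |pdl m φ z| ≤ Nt) →
      (∀ l : List (Fin 3), l ≠ [] → l.length ≤ n + 1 → |spd φ l z| ≤ Q) →
      ∀ l : List (Fin 4), l.length ≤ n →
        |pdl l (waveOp g A V (fun y => cutoff bumpT t₀ L ρ y * φ y)) z| ≤
          C * ((if ρ ≤ ‖z.2‖ then ρ⁻¹ * Q + ρ⁻¹ ^ 2 * |φ z| else 0) + (L⁻¹ * N + Nt)) ∧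
        |pdl l (pd 0 (fun y => cutoff bumpT t₀ L ρ y * φ y)) z| ≤ C * (L⁻¹ * N + Nt) := by
  obtain ⟨Ck, hCk, hcut⟩ := exists_cutoff_bounds (n + 2)
  set G := Cc + 1 with hG
  have hG1 : 1 ≤ G := by linarith
  refine ⟨4 ^ n * (200 * (G * (Ck + 1))), by positivity, ?_⟩
  intro φ t₀ L ρ N Nt Q z hφ hsol hρ hL hz hQ hN hNt hspQ l hl
  set c := cutoff bumpT t₀ L ρ with hcdef
  have hcs : ContDiff ℝ ∞ c := contDiff_cutoff bumpT_contDiff _ _ _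
  have hρ0 : 0 < ρ := by linarith
  have hρi : ρ⁻¹ ≤ 1 := inv_le_one_of_one_le₀ hρ
  have hρi0 : 0 < ρ⁻¹ := inv_pos.2 hρ0
  have hL0 : 0 < L := by nlinarith
  have hLi : 0 < L⁻¹ := inv_pos.2 hL0
  have hN0 : 0 ≤ N := (abs_nonneg _).trans (hN [] (by simp))
  have hNt0 : 0 ≤ Nt := (abs_nonneg _).trans (hNt [0] (by simp) (by simp))
  have hsub : ∀ {l' : List (Fin 4)}, l'.Sublist l → l'.length ≤ n := fun h => h.length_le.trans hl
  have hpow : (2 : ℝ) ^ l.length ≤ 2 ^ n := pow_le_pow_right₀ (by norm_num) hl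
  have h24 : (2 : ℝ) ^ n * 2 ^ n = 4 ^ n := by rw [← mul_pow]; norm_num
  have h4 : (2 : ℝ) ^ n ≤ 4 ^ n := pow_le_pow_left₀ (by norm_num) (by norm_num) n
  constructor
  · have hE := contDiff_commZero hc hcs
    have hF := fun α => contDiff_commOne hc hcs α
    have hP := contDiff_waveOp hc hφ
    -- Near z the equation holds, so only the commutator terms survive.
    have h0 : pdl l (fun z => c z * waveOp g A V φ z) z = 0 := pdl_eq_zero_of_eventuallyEq l (by
      filter_upwards [(isOpen_lt continuous_const continuous_fst).mem_nhds hz] with y hy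
      rw [hsol y hy, mul_zero])
    rw [waveOp_mul hc hcs hφ, pdl_add l (by fun_prop) (hcs.mul hP)]
    simp only [h0, add_zero]
    rw [pdl_add l (by fun_prop) (by fun_prop),
      pdl_sum l _ (fun α _ => by fun_prop)]
    -- One estimate for two regions. The bounds κ₁ and κ₂ for the derivatives of the cutoff of order
    -- at least one and at least two are separated, because for r ≥ ρ they differ by a factor ρ⁻¹.
    have main : ∀ {γ κ₁ κ₂ n₀ n₁ : ℝ}, (jb ‖z.2‖)⁻¹ * Cc ≤ γ → 0 ≤ γ → 0 ≤ κ₁ → 0 ≤ κ₂ →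
        (∀ m : List (Fin 4), m ≠ [] → m.length ≤ n + 2 → |pdl m c z| ≤ κ₁) →
        (∀ m : List (Fin 4), 2 ≤ m.length → m.length ≤ n + 2 → |pdl m c z| ≤ κ₂) →
        (∀ m : List (Fin 4), m.length ≤ n + 1 → |pdl m φ z| ≤ n₀) →
        (∀ m : List (Fin 4), m ≠ [] → m.length ≤ n + 1 → |pdl m φ z| ≤ n₁) →
        |pdl l (fun y => commZero g A c y * φ y) z + ∑ α, pdl l (fun y => commOne g c α y * pd α φ y) z| ≤
          4 ^ n * ((20 * (γ * κ₁) + 16 * (G * κ₂)) * n₀ + 32 * (G * κ₁) * n₁) := by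
      intro γ κ₁ κ₂ n₀ n₁ hγ hγ0 hκ₁ hκ₂ hc1 hc2 hn₀ hn₁
      have hn₀0 : 0 ≤ n₀ := (abs_nonneg _).trans (hn₀ [] (by simp))
      have hn₁0 : 0 ≤ n₁ := (abs_nonneg _).trans (hn₁ [0] (by simp) (by simp))
      have hcm : ∀ l' : List (Fin 4), l'.Sublist l → _ := fun l' hl' =>
        abs_pdl_comm_le hc hcs (n := n) (z := z) (G := G) (γ := γ) (κ₁ := κ₁) (κ₂ := κ₂)
        (fun α β m hm => (hb.abs_pdl_metric_le hCc hs hz.le α β (by omega)).1)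
        (fun α β m hm0 hm => ((hb.abs_pdl_metric_le hCc hs hz.le α β hm).2 hm0).trans
          (by rw [mul_comm]; exact hγ))
        (fun α m hm => ((hb.first α m (by omega) z hz.le).1).trans (le_trans (by
          rw [mul_comm]
          gcongr
          rw [← Real.rpow_neg_one]
          exact Real.rpow_le_rpow_of_exponent_le (one_le_jb _) (by linarith)) hγ)) hc1 hc2 (hsub hl')
      have k1 := abs_pdl_mul_le l hE hφ (fun l' hl' => (hcm l' hl').1)
        (fun l' hl' => hn₀ l' (by have := hsub hl'; omega))
      have k2 := fun α => abs_pdl_mul_le l (hF α) (contDiff_pd α hφ) (fun l' hl' => (hcm l' hl').2 α)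
        (fun l' hl' => hn₁ (α :: l') (by simp) (by have := hsub hl'; simpa using this))
      refine (abs_add_le _ _).trans ((add_le_add k1 (abs_sum_four_le k2)).trans ?_)
      have e1 : 2 ^ l.length * (2 ^ n * (20 * (γ * κ₁) + 16 * (G * κ₂)) * n₀) ≤
          2 ^ n * (2 ^ n * (20 * (γ * κ₁) + 16 * (G * κ₂)) * n₀) := by gcongr
      have e2 : 2 ^ l.length * (2 ^ n * (8 * (G * κ₁)) * n₁) ≤ 2 ^ n * (2 ^ n * (8 * (G * κ₁)) * n₁) := by
        gcongr
      rw [← h24]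
      linarith
    have hji : (jb ‖z.2‖)⁻¹ ≤ 1 := inv_le_one_of_one_le₀ (one_le_jb _)
    -- For r ≥ ρ a derivative of the cutoff gains ρ⁻¹ and two gain ρ⁻², and derivatives of the
    -- metric and the coefficients A are at most ⟨r⟩⁻¹ ≤ ρ⁻¹. This gives ρ⁻¹∇φ + ρ⁻²φ. For r < ρ
    -- only time derivatives of the cutoff are nonzero, and each gains L⁻¹.
    split_ifs with hr
    · have hjρ : (jb ‖z.2‖)⁻¹ ≤ ρ⁻¹ := inv_anti₀ hρ0 (hr.trans (le_jb _))
      refine (main (γ := Cc * ρ⁻¹) (κ₁ := Ck * ρ⁻¹) (κ₂ := Ck * ρ⁻¹ ^ 2) (n₀ := |φ z| + Q + Nt)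
        (n₁ := Q + Nt) ?_ (by positivity) (by positivity) (by positivity) ?_ ?_ ?_ ?_).trans ?_
      · rw [mul_comm]; gcongr
      · intro m hm hmn
        refine ((hcut m hmn t₀ L ρ hρ hL z).1).trans ?_
        gcongr
        calc ρ⁻¹ ^ m.length ≤ ρ⁻¹ ^ 1 :=
              pow_le_pow_of_le_one hρi0.le hρi (List.length_pos_iff.2 hm)
          _ = ρ⁻¹ := pow_one _
      · intro m hm hmn
        refine ((hcut m hmn t₀ L ρ hρ hL z).1).trans ?_
        gcongr ?_ * ?_
        exact pow_le_pow_of_le_one hρi0.le hρi hm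
      · intro m hm
        have := abs_nonneg (φ z)
        by_cases h0 : (0 : Fin 4) ∈ m
        · have := hNt m h0 hm; linarith
        · obtain ⟨l₀, rfl⟩ := exists_map_succ h0
          cases l₀ with
          | nil => simp only [List.map_nil, pdl]; linarith
          | cons i l₀ =>
            have := hspQ (i :: l₀) (by simp) (by simpa using hm)
            simp only [spd] at this
            linarith
      · intro m hm0 hm
        by_cases h0 : (0 : Fin 4) ∈ m
        · have := hNt m h0 hm; linarith
        · obtain ⟨l₀, rfl⟩ := exists_map_succ h0
          have := hspQ l₀ (by simpa using hm0) (by simpa using hm)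
          simp only [spd] at this
          linarith
      · have e : (20 * (Cc * ρ⁻¹ * (Ck * ρ⁻¹)) + 16 * (G * (Ck * ρ⁻¹ ^ 2))) * (|φ z| + Q + Nt)
            + 32 * (G * (Ck * ρ⁻¹)) * (Q + Nt) =
            Ck * ((20 * Cc + 16 * G) * (ρ⁻¹ ^ 2 * (|φ z| + Q + Nt)) + 32 * G * (ρ⁻¹ * (Q + Nt))) := by ring
        rw [e, mul_assoc (4 ^ n)]
        gcongr 4 ^ n * ?_
        set X := ρ⁻¹ * Q + ρ⁻¹ ^ 2 * |φ z| + (L⁻¹ * N + Nt) with hX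
        have hp2 : ρ⁻¹ ^ 2 ≤ ρ⁻¹ := by nlinarith
        have hX0 : 0 ≤ X := by positivity
        have a1 : ρ⁻¹ ^ 2 * Q ≤ ρ⁻¹ * Q := mul_le_mul_of_nonneg_right hp2 hQ
        have a2 : ρ⁻¹ ^ 2 * Nt ≤ Nt := mul_le_of_le_one_left hNt0 (hp2.trans hρi)
        have a3 : ρ⁻¹ * Nt ≤ Nt := mul_le_of_le_one_left hNt0 hρi
        have a4 : 0 ≤ L⁻¹ * N := by positivity
        have a5 : 0 ≤ ρ⁻¹ ^ 2 * |φ z| := by positivity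
        have b1 : ρ⁻¹ ^ 2 * (|φ z| + Q + Nt) ≤ X := by rw [hX]; linarith
        have b2 : ρ⁻¹ * (Q + Nt) ≤ X := by rw [hX]; linarith
        have c1 : (20 * Cc + 16 * G) * (ρ⁻¹ ^ 2 * (|φ z| + Q + Nt)) ≤ 36 * G * X :=
          mul_le_mul (by linarith) b1 (by positivity) (by positivity)
        have c2 : 32 * G * (ρ⁻¹ * (Q + Nt)) ≤ 32 * G * X := by gcongr
        calc _ ≤ Ck * (36 * G * X + 32 * G * X) := by gcongr
          _ = 68 * (G * Ck * X) := by ring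
          _ ≤ 200 * (G * (Ck + 1)) * X := by
            have : 0 ≤ G * X := by positivity
            have h' : 0 ≤ G * Ck * X := by positivity
            nlinarith
    · push Not at hr
      refine (main (γ := Cc) (κ₁ := Ck * L⁻¹) (κ₂ := Ck * L⁻¹) (n₀ := N) (n₁ := N) ?_ hCc
        (by positivity) (by positivity) ?_ ?_ hN (fun m _ hm => hN m hm)).trans ?_
      · exact mul_le_of_le_one_left hCc hji
      · exact fun m hm hmn => (hcut m hmn t₀ L ρ hρ hL z).2 (Or.inr ⟨hm, hr⟩)
      · exact fun m hm hmn => (hcut m hmn t₀ L ρ hρ hL z).2 (Or.inr ⟨by rintro rfl; simp at hm, hr⟩)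
      · have e : (20 * (Cc * (Ck * L⁻¹)) + 16 * (G * (Ck * L⁻¹))) * N + 32 * (G * (Ck * L⁻¹)) * N
          = (20 * Cc + 48 * G) * (Ck * (L⁻¹ * N)) := by ring
        rw [e, mul_assoc (4 ^ n), zero_add]
        gcongr 4 ^ n * ?_
        calc (20 * Cc + 48 * G) * (Ck * (L⁻¹ * N)) ≤ (200 * G) * ((Ck + 1) * (L⁻¹ * N + Nt)) := by
              have : 0 ≤ L⁻¹ * N := by positivity
              gcongr <;> linarith
          _ = _ := by ring
  · have h1 : ∀ l' : List (Fin 4), l'.Sublist l → |pdl l' (pd 0 c) z| ≤ Ck * L⁻¹ := fun l' hl' =>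
      (hcut (0 :: l') (by have := hsub hl'; simp; omega) t₀ L ρ hρ hL z).2 (Or.inl (by simp))
    have h2 : ∀ l' : List (Fin 4), l'.Sublist l → |pdl l' c z| ≤ Ck := fun l' hl' =>
      ((hcut l' (by have := hsub hl'; omega) t₀ L ρ hρ hL z).1).trans
        (mul_le_of_le_one_right hCk (pow_le_one₀ hρi0.le hρi))
    rw [pd_mul 0 hcs hφ, pdl_add l (by fun_prop) (by fun_prop)]
    have k1 := abs_pdl_mul_le l (contDiff_pd 0 hcs) hφ h1
      (fun l' hl' => hN l' (by have := hsub hl'; omega))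
    have k2 := abs_pdl_mul_le l hcs (contDiff_pd 0 hφ) h2
      (fun l' hl' => hNt (0 :: l') (by simp) (by have := hsub hl'; simpa using this))
    refine (abs_add_le _ _).trans ((add_le_add k1 k2).trans ?_)
    calc 2 ^ l.length * (Ck * L⁻¹ * N) + 2 ^ l.length * (Ck * Nt)
        = 2 ^ l.length * (Ck * (L⁻¹ * N + Nt)) := by ring
      _ ≤ 4 ^ n * (200 * (G * (Ck + 1)) * (L⁻¹ * N + Nt)) := by
          have : 0 ≤ L⁻¹ * N + Nt := by positivity
          have h' : 1 * Ck ≤ 200 * G * (Ck + 1) := mul_le_mul (by linarith) (by linarith) hCk (by positivity)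
          exact mul_le_mul (hpow.trans h4) (mul_le_mul_of_nonneg_right (by linarith) this)
            (by positivity) (by positivity)
      _ = _ := by ring

/-! ### Local energy norms of functions supported in a cylinder -/

variable {g : Spacetime → Matrix (Fin 4) (Fin 4) ℝ} {A : Fin 4 → Spacetime → ℝ}
  {V φ : Spacetime → ℝ}

lemma setLIntegral_prod_ofReal (I : Set ℝ) {K : Set Space} (hK : IsCompact K) {f : Spacetime → ℝ}
    (hf : Continuous f) (h0 : ∀ z, 0 ≤ f z) :
    ∫⁻ z in I ×ˢ K, ENNReal.ofReal (f z) = ∫⁻ t in I, ENNReal.ofReal (∫ x in K, f (t, x)) := by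
  rw [Measure.volume_eq_prod, ← Measure.prod_restrict, lintegral_prod _ (by fun_prop)]
  refine lintegral_congr fun t => ?_
  rw [ofReal_integral_eq_lintegral_ofReal]
  · exact (Continuous.continuousOn (by fun_prop)).integrableOn_compact hK
  · exact Filter.Eventually.of_forall fun x => h0 _

lemma setLIntegral_prod_le {a b P : ℝ} {K : Set Space} (hK : IsCompact K) {f : Spacetime → ℝ}
    (hf : Continuous f) (h0 : ∀ z, 0 ≤ f z) (h : ∀ t ∈ Set.Icc a b, ∫ x in K, f (t, x) ≤ P) :
    ∫⁻ z in Set.Icc a b ×ˢ K, ENNReal.ofReal (f z) ≤ ENNReal.ofReal P * ENNReal.ofReal (b - a) := by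
  rw [setLIntegral_prod_ofReal _ hK hf h0]
  refine (setLIntegral_mono measurable_const fun t ht => ENNReal.ofReal_le_ofReal (h t ht)).trans ?_
  rw [setLIntegral_const, Real.volume_Icc]

lemma le_setLIntegral_prod {a b P : ℝ} {K : Set Space} (hK : IsCompact K) {f : Spacetime → ℝ}
    (hf : Continuous f) (h0 : ∀ z, 0 ≤ f z) (h : ∀ t ∈ Set.Icc a b, P ≤ ∫ x in K, f (t, x)) :
    ENNReal.ofReal P * ENNReal.ofReal (b - a) ≤ ∫⁻ z in Set.Icc a b ×ˢ K, ENNReal.ofReal (f z) := by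
  rw [setLIntegral_prod_ofReal _ hK hf h0, ← Real.volume_Icc, ← setLIntegral_const]
  exact setLIntegral_mono' measurableSet_Icc fun t ht => ENNReal.ofReal_le_ofReal (h t ht)

lemma enorm_sq_eq_ofReal (a : ℝ) : ‖a‖ₑ ^ 2 = ENNReal.ofReal (a ^ 2) := by
  rw [← ofReal_norm, ← ENNReal.ofReal_pow (norm_nonneg _), Real.norm_eq_abs, sq_abs]

lemma le_ofReal_sqrt {a : ℝ≥0∞} {b : ℝ} (h : a ^ 2 ≤ ENNReal.ofReal b) :
    a ≤ ENNReal.ofReal (Real.sqrt b) := by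
  rcases le_total 0 b with hb | hb
  · rwa [← ENNReal.pow_le_pow_left_iff two_ne_zero, ← ENNReal.ofReal_pow (Real.sqrt_nonneg _),
      Real.sq_sqrt hb]
  · rw [ENNReal.ofReal_of_nonpos hb] at h
    simp [pow_eq_zero_iff two_ne_zero] at h
    simp [h]

lemma ofReal_indicator (S : Set Spacetime) (f : Spacetime → ℝ) (z : Spacetime) :
    ENNReal.ofReal (S.indicator f z) = S.indicator (fun z => ENNReal.ofReal (f z)) z := by
  by_cases h : z ∈ S <;> simp [h]

lemma sqrt_add_le_sqrt_add_sqrt {a b : ℝ} (ha : 0 ≤ a) (hb : 0 ≤ b) :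
    Real.sqrt (a + b) ≤ Real.sqrt a + Real.sqrt b := by
  rw [Real.sqrt_le_left (by positivity)]
  nlinarith [Real.sq_sqrt ha, Real.sq_sqrt hb, mul_nonneg (Real.sqrt_nonneg a) (Real.sqrt_nonneg b)]

/-- An `L²` bound over a dyadic region from a pointwise bound by a constant on a cylinder and a
function on a cylindrical shell. -/
lemma eLpNorm_shell_le {F f : Spacetime → ℝ} {T₁ a b c r r₁ r₂ P : ℝ} {j : ℕ} (hf : Continuous f)
    (h0 : ∀ z, 0 ≤ f z) (hc : 0 ≤ c) (hP : 0 ≤ P)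
    (hF : ∀ z : Spacetime, T₁ ≤ z.1 → z.2 ∈ shell j → F z ^ 2 ≤
      (Set.Icc a b ×ˢ Metric.closedBall (0 : Space) r).indicator (fun _ => c) z
        + (Set.Icc a b ×ˢ annulus r₁ r₂).indicator f z)
    (hf' : ∀ t ∈ Set.Icc a b, ∫ x in annulus r₁ r₂, f (t, x) ≤ P) :
    eLpNorm F 2 (volume.restrict (Set.Ici T₁ ×ˢ shell j)) ≤ ENNReal.ofReal (Real.sqrt
      ((c * volume.real (Metric.closedBall (0 : Space) r) + P) * (b - a))) := by
  refine le_ofReal_sqrt ?_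
  have m1 : MeasurableSet (Set.Icc a b ×ˢ Metric.closedBall (0 : Space) r) :=
    measurableSet_Icc.prod measurableSet_closedBall
  have m2 : MeasurableSet (Set.Icc a b ×ˢ annulus r₁ r₂) :=
    measurableSet_Icc.prod (measurableSet_annulus _ _)
  rw [eLpNorm_two_sq]
  calc ∫⁻ z in Set.Ici T₁ ×ˢ shell j, ‖F z‖ₑ ^ 2
      ≤ ∫⁻ z in Set.Ici T₁ ×ˢ shell j,
          ((Set.Icc a b ×ˢ Metric.closedBall (0 : Space) r).indicator (fun _ => ENNReal.ofReal c) z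
          + (Set.Icc a b ×ˢ annulus r₁ r₂).indicator (fun z => ENNReal.ofReal (f z)) z) := by
        refine setLIntegral_mono' (measurableSet_Ici.prod (measurableSet_shell j)) fun z hz => ?_
        rw [enorm_sq_eq_ofReal]
        refine (ENNReal.ofReal_le_ofReal (hF z hz.1 hz.2)).trans (ENNReal.ofReal_add_le.trans ?_)
        exact add_le_add (ofReal_indicator _ _ _).le (ofReal_indicator _ _ _).le
    _ ≤ ∫⁻ z, ((Set.Icc a b ×ˢ Metric.closedBall (0 : Space) r).indicator (fun _ => ENNReal.ofReal c) z
          + (Set.Icc a b ×ˢ annulus r₁ r₂).indicator (fun z => ENNReal.ofReal (f z)) z) :=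
        setLIntegral_le_lintegral _ _
    _ = (∫⁻ z in Set.Icc a b ×ˢ Metric.closedBall (0 : Space) r, ENNReal.ofReal c)
          + ∫⁻ z in Set.Icc a b ×ˢ annulus r₁ r₂, ENNReal.ofReal (f z) := by
        rw [lintegral_add_left (measurable_const.indicator m1), lintegral_indicator m1,
          lintegral_indicator m2]
    _ ≤ ENNReal.ofReal (c * volume.real (Metric.closedBall (0 : Space) r)) * ENNReal.ofReal (b - a)
          + ENNReal.ofReal P * ENNReal.ofReal (b - a) := by
        refine add_le_add (setLIntegral_prod_le (isCompact_closedBall _ _) continuous_const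
          (fun _ => hc) fun t _ => ?_) (setLIntegral_prod_le (isCompact_annulus _ _) hf h0 hf')
        simp [mul_comm]
    _ = _ := by
        rw [← add_mul, ← ENNReal.ofReal_add (by positivity) hP, ← ENNReal.ofReal_mul (by positivity)]

lemma jb_le_three_mul {r ρ : ℝ} (hr : 0 ≤ r) (hρ : 1 ≤ ρ) (h : r ≤ 2 * ρ) : jb r ≤ 3 * ρ := by
  have := jb_le_one_add r
  rw [abs_of_nonneg hr] at this
  linarith

lemma rWeight_half_sq (z : Spacetime) : rWeight (1 / 2) z ^ 2 = jb ‖z.2‖ := by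
  rw [rWeight, ← Real.rpow_natCast, ← Real.rpow_mul (jb_pos _).le]; norm_num

/-- The `LE*` norm of a function that is of size `b` in a cylinder, plus a term in the outermost
dyadic shell. -/
lemma normLEstar_le_of_bound {F f : Spacetime → ℝ} {T₁ t₀ L b P : ℝ} {n : ℕ} (hn : 1 ≤ n)
    (hf : Continuous f) (h0 : ∀ z, 0 ≤ f z) (hL : 0 ≤ L) (hP : 0 ≤ P)
    (hsupp : ∀ z : Spacetime, 2 * L < |z.1 - t₀| ∨ 2 * 2 ^ n < ‖z.2‖ → F z = 0)
    (hF : ∀ z : Spacetime, |z.1 - t₀| ≤ 2 * L → ‖z.2‖ ≤ 2 * 2 ^ n →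
      F z ^ 2 ≤ (if 2 ^ n ≤ ‖z.2‖ then (2 ^ n)⁻¹ * f z else 0) + b ^ 2)
    (hf' : ∀ t, |t - t₀| ≤ 2 * L → ∫ x in annulus (2 ^ n) (2 * 2 ^ n), f (t, x) ≤ P) :
    normLEstar (Set.Ici T₁) F ≤ ENNReal.ofReal (Real.sqrt (12 * P * L) + (n + 1) * Real.sqrt
      (12 * 2 ^ n * b ^ 2 * volume.real (Metric.closedBall (0 : Space) (2 * 2 ^ n)) * L)) := by
  set ρ : ℝ := 2 ^ n with hρ
  have hρ1 : 1 ≤ ρ := one_le_pow₀ (by norm_num)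
  have hρ0 : 0 < ρ := by linarith
  set v := volume.real (Metric.closedBall (0 : Space) (2 * ρ)) with hv
  have hv0 : 0 ≤ v := measureReal_nonneg
  have hI : ∀ t, t ∈ Set.Icc (t₀ - 2 * L) (t₀ + 2 * L) ↔ |t - t₀| ≤ 2 * L := fun t => by
    rw [abs_le, Set.mem_Icc]; constructor <;> rintro ⟨h1, h2⟩ <;> constructor <;> linarith
  have hlen : t₀ + 2 * L - (t₀ - 2 * L) = 4 * L := by ring
  have hw : ∀ z : Spacetime, ‖z.2‖ ≤ 2 * ρ → (rWeight (1 / 2) z * F z) ^ 2 ≤ 3 * ρ * F z ^ 2 := by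
    intro z hz
    rw [mul_pow, rWeight_half_sq]
    exact mul_le_mul_of_nonneg_right (jb_le_three_mul (norm_nonneg _) hρ1 hz) (sq_nonneg _)
  set X := Real.sqrt (12 * P * L) with hX
  set Y := Real.sqrt (12 * ρ * b ^ 2 * v * L) with hY
  have hz0 : ∀ z : Spacetime, ¬(|z.1 - t₀| ≤ 2 * L ∧ ‖z.2‖ ≤ 2 * ρ) → rWeight (1 / 2) z * F z = 0 := by
    intro z hz
    rw [hsupp z (by by_contra h; push Not at h; exact hz h), mul_zero]
  have hshell : ∀ j, j ≤ n → ∀ z : Spacetime, z.2 ∈ shell j → ‖z.2‖ < 2 ^ (j + 1) := by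
    intro j _ z hz
    unfold shell at hz
    split_ifs at hz with h
    · subst h; simpa using hz
    · exact hz.2
  -- The regions j < n see only the size b, the region j = n sees also the shell term, and for j > n
  -- the function vanishes. The weight ⟨r⟩ ≤ 3ρ cancels the ρ⁻¹ of the shell term, and the window
  -- has length 4L, whence 12 = 3·4.
  have key : ∀ j, eLpNorm (fun z => rWeight (1 / 2) z * F z) 2 (volume.restrict (Set.Ici T₁ ×ˢ shell j))
      ≤ if j < n then ENNReal.ofReal Y else if j = n then ENNReal.ofReal (X + Y) else 0 := by
    intro j
    have hbd : ∀ (f' : Spacetime → ℝ), (∀ z, 0 ≤ f' z) → (∀ z : Spacetime, z.2 ∈ shell j →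
        |z.1 - t₀| ≤ 2 * L → ‖z.2‖ ≤ 2 * ρ → F z ^ 2 ≤
        (Set.Icc (t₀ - 2 * L) (t₀ + 2 * L) ×ˢ annulus ρ (2 * ρ)).indicator (fun z => ρ⁻¹ * f' z) z + b ^ 2) →
        ∀ z : Spacetime, T₁ ≤ z.1 → z.2 ∈ shell j → (rWeight (1 / 2) z * F z) ^ 2 ≤
        (Set.Icc (t₀ - 2 * L) (t₀ + 2 * L) ×ˢ Metric.closedBall (0 : Space) (2 * ρ)).indicator
          (fun _ => 3 * ρ * b ^ 2) z
        + (Set.Icc (t₀ - 2 * L) (t₀ + 2 * L) ×ˢ annulus ρ (2 * ρ)).indicator (fun z => 3 * f' z) z := by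
      intro f' hf'0 hf' z _ hz
      have hi : 0 ≤ (Set.Icc (t₀ - 2 * L) (t₀ + 2 * L) ×ˢ annulus ρ (2 * ρ)).indicator
          (fun z => 3 * f' z) z := Set.indicator_nonneg (fun z _ => by have := hf'0 z; positivity) _
      by_cases h : |z.1 - t₀| ≤ 2 * L ∧ ‖z.2‖ ≤ 2 * ρ
      · refine (hw z h.2).trans ((mul_le_mul_of_nonneg_left (hf' z hz h.1 h.2) (by positivity)).trans ?_)
        rw [Set.indicator_of_mem (a := z) (f := fun _ => 3 * ρ * b ^ 2) (Set.mem_prod.2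
          ⟨(hI _).2 h.1, by simpa using h.2⟩)]
        by_cases ha : z ∈ Set.Icc (t₀ - 2 * L) (t₀ + 2 * L) ×ˢ annulus ρ (2 * ρ)
        · rw [Set.indicator_of_mem ha, Set.indicator_of_mem ha, mul_add, ← mul_assoc, mul_assoc 3 ρ ρ⁻¹,
            mul_inv_cancel₀ hρ0.ne']
          linarith
        · rw [Set.indicator_of_notMem ha, Set.indicator_of_notMem ha]
          linarith
      · rw [hz0 z h]
        have : 0 ≤ (Set.Icc (t₀ - 2 * L) (t₀ + 2 * L) ×ˢ Metric.closedBall (0 : Space) (2 * ρ)).indicator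
          (fun _ => 3 * ρ * b ^ 2) z := Set.indicator_nonneg (fun z _ => by positivity) _
        simp only [ne_eq, OfNat.ofNat_ne_zero, not_false_eq_true, zero_pow]
        linarith
    split_ifs with h1 h2
    · refine (eLpNorm_shell_le (f := fun _ => 3 * 0) (P := 0) (by fun_prop) (by simp) (by positivity) le_rfl
        (hbd (fun _ => 0) (fun _ => le_rfl) fun z hz ht hr => ?_) (by simp)).trans_eq ?_
      · refine (hF z ht hr).trans (add_le_add_left ?_ _)
        have := hshell j h1.le z hz
        rw [if_neg (not_le.2 (this.trans_le (pow_le_pow_right₀ (by norm_num) h1)))]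
        simp
      · rw [hY, hlen]; congr 2; ring
    · subst h2
      refine (eLpNorm_shell_le (f := fun z => 3 * f z) (P := 3 * P) (by fun_prop)
        (fun z => by have := h0 z; positivity) (by positivity) (by positivity)
        (hbd f h0 fun z hz ht hr => ?_) fun t ht => ?_).trans ?_
      · refine (hF z ht hr).trans (add_le_add_left ?_ _)
        split_ifs with h
        · rw [Set.indicator_of_mem (show z ∈ Set.Icc (t₀ - 2 * L) (t₀ + 2 * L) ×ˢ annulus _ _ from
            ⟨(hI _).2 ht, h, hr⟩)]
        · rw [Set.indicator_of_notMem fun h' => h h'.2.1]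
      · rw [integral_const_mul]
        exact mul_le_mul_of_nonneg_left (hf' t ((hI t).1 ht)) (by norm_num)
      · refine ENNReal.ofReal_le_ofReal ?_
        rw [hlen, hX, hY]
        refine le_trans (le_of_eq ?_) (sqrt_add_le_sqrt_add_sqrt (by positivity) (by positivity))
        congr 1; ring
    · have h3 : n + 1 ≤ j := by omega
      have : ∀ z ∈ Set.Ici T₁ ×ˢ shell j, rWeight (1 / 2) z * F z = 0 := by
        intro z hz
        refine hz0 z fun h => ?_
        have hz2 := hz.2
        rw [shell, if_neg (by omega)] at hz2
        have : (2 : ℝ) ^ (n + 1) ≤ 2 ^ j := pow_le_pow_right₀ (by norm_num) h3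
        have h4 := hz2.1
        rw [pow_succ] at this
        linarith [h.2]
      rw [eLpNorm_congr_ae (g := fun _ => 0)]
      · simp
      · exact (ae_restrict_iff' (measurableSet_Ici.prod (measurableSet_shell j))).2
          (Filter.Eventually.of_forall this)
  unfold normLEstar
  refine (ENNReal.tsum_le_tsum key).trans ?_
  rw [tsum_eq_sum (s := Finset.range (n + 1)) (fun j hj => by
    rw [Finset.mem_range] at hj; rw [if_neg (by omega), if_neg (by omega)]), Finset.sum_range_succ,
    Finset.sum_congr rfl (g := fun _ => ENNReal.ofReal Y) (fun j hj => if_pos (Finset.mem_range.1 hj))]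
  have hX0 := Real.sqrt_nonneg (12 * P * L)
  have hY0 : 0 ≤ Y := Real.sqrt_nonneg _
  simp only [lt_irrefl, if_false, if_true, Finset.sum_const, Finset.card_range, nsmul_eq_mul]
  rw [← ENNReal.ofReal_natCast n, ← ENNReal.ofReal_mul (by positivity), ← ENNReal.ofReal_add (by positivity)
    (by positivity)]
  exact ENNReal.ofReal_le_ofReal (by linarith)

/-- The `LE` norm of a function that is of size `b` in a cylinder. -/
lemma normLE_le_of_bound {F : Spacetime → ℝ} {T₁ t₀ L b r : ℝ}
    (hsupp : ∀ z : Spacetime, 2 * L < |z.1 - t₀| ∨ r < ‖z.2‖ → F z = 0)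
    (hF : ∀ z : Spacetime, |z.1 - t₀| ≤ 2 * L → ‖z.2‖ ≤ r → F z ^ 2 ≤ b ^ 2) :
    normLE (Set.Ici T₁) F ≤ ENNReal.ofReal (Real.sqrt
      (4 * b ^ 2 * volume.real (Metric.closedBall (0 : Space) r) * L)) := by
  refine iSup_le fun j => ?_
  refine (eLpNorm_shell_le (f := fun _ => 0) (P := 0) (c := b ^ 2) (r := r) (a := t₀ - 2 * L)
    (b := t₀ + 2 * L) (r₁ := 0) (r₂ := 0) (by fun_prop) (by simp) (by positivity) le_rfl
    (fun z _ _ => ?_) (by simp)).trans_eq ?_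
  · by_cases h : |z.1 - t₀| ≤ 2 * L ∧ ‖z.2‖ ≤ r
    · rw [Set.indicator_of_mem (Set.mk_mem_prod (by
        rw [Set.mem_Icc]; have := abs_le.1 h.1; constructor <;> linarith) (by simpa using h.2))]
      have h1 : rWeight (-1 / 2) z ≤ 1 :=
        Real.rpow_le_one_of_one_le_of_nonpos (one_le_jb _) (by norm_num)
      rw [mul_pow]
      have h2 := mul_le_of_le_one_left (sq_nonneg (F z)) (pow_le_one₀ (n := 2) (rWeight_pos _ z).le h1)
      have h3 := hF z h.1 h.2
      simp only [Set.indicator_zero]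
      linarith
    · rw [hsupp z (by by_contra h'; push Not at h'; exact h h')]
      simp only [mul_zero, Set.indicator_zero, add_zero, ne_eq, OfNat.ofNat_ne_zero,
        not_false_eq_true, zero_pow]
      exact Set.indicator_nonneg (fun z _ => by positivity) _
  · congr 2; ring

/-! ### Supports of truncated functions and lower bounds for the weighted norms -/

variable {g : Spacetime → Matrix (Fin 4) (Fin 4) ℝ} {A : Fin 4 → Spacetime → ℝ}
  {V φ : Spacetime → ℝ}

lemma pdl_congr_of_eventuallyEq {f h : Spacetime → ℝ} {z : Spacetime} (l : List (Fin 4))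
    (hf : f =ᶠ[nhds z] h) : pdl l f z = pdl l h z := by
  suffices h' : pdl l f =ᶠ[nhds z] pdl l h from h'.self_of_nhds
  induction l generalizing f h with
  | nil => exact hf
  | cons β l ih =>
    refine ih ?_
    filter_upwards [hf.fderiv (𝕜 := ℝ)] with y hy
    simp [pd, hy]

lemma waveOp_eventuallyEq_zero {u : Spacetime → ℝ} {z : Spacetime} (hu : u =ᶠ[nhds z] fun _ => 0) :
    waveOp g A V u =ᶠ[nhds z] fun _ => 0 := by
  have hpd : ∀ {f : Spacetime → ℝ} (β : Fin 4), f =ᶠ[nhds z] (fun _ => 0) →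
      pd β f =ᶠ[nhds z] fun _ => 0 := fun β hf => by
    filter_upwards [hf.fderiv (𝕜 := ℝ)] with y hy
    simp [pd, hy]
  have h1 : ∀ α β, pd α (fun y => g y α β * pd β u y) =ᶠ[nhds z] fun _ => 0 := fun α β => hpd α (by
    filter_upwards [hpd β hu] with y hy
    rw [hy, mul_zero])
  have h2 : ∀ μ, pd μ (fun y => A μ y * u y) =ᶠ[nhds z] fun _ => 0 := fun μ => hpd μ (by
    filter_upwards [hu] with y hy
    rw [hy, mul_zero])
  filter_upwards [hu, Filter.eventually_all.2 fun α => Filter.eventually_all.2 (h1 α),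
    Filter.eventually_all.2 h2] with y h3 h4 h5
  simp [waveOp, h3, h4, h5]

lemma cutoff_eventuallyEq_zero {t₀ L ρ : ℝ} (hL : 0 < L) (hρ : 0 < ρ) {z : Spacetime}
    (hz : 2 * L < |z.1 - t₀| ∨ 2 * ρ < ‖z.2‖) :
    (fun y => cutoff bumpT t₀ L ρ y * φ y) =ᶠ[nhds z] fun _ => 0 := by
  rcases hz with hz | hz
  · filter_upwards [(isOpen_lt continuous_const (by fun_prop :
      Continuous fun y : Spacetime => |y.1 - t₀|)).mem_nhds hz] with y hy
    have : bumpT (L⁻¹ * (y.1 - t₀)) = 0 := bumpT.zero_of_le_dist (by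
      rw [dist_zero_right, norm_mul, norm_inv, Real.norm_of_nonneg hL.le, Real.norm_eq_abs, inv_mul_eq_div,
        le_div_iff₀ hL]
      exact hy.le)
    simp [cutoff, timeCut, this]
  · filter_upwards [(isOpen_lt continuous_const (by fun_prop :
      Continuous fun y : Spacetime => ‖y.2‖)).mem_nhds hz] with y hy
    rw [cutoff, spaceCut_eq_zero hρ (le_of_lt hy), mul_zero, zero_mul]

lemma cutoff_eventuallyEq_self {t₀ L ρ : ℝ} (hL : 0 < L) (hρ : 0 < ρ) {z : Spacetime}
    (hz : |z.1 - t₀| < L) (hz' : ‖z.2‖ < ρ) :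
    (fun y => cutoff bumpT t₀ L ρ y * φ y) =ᶠ[nhds z] φ := by
  filter_upwards [(isOpen_lt (by fun_prop : Continuous fun y : Spacetime => |y.1 - t₀|)
    continuous_const).mem_nhds hz, (isOpen_lt (by fun_prop :
      Continuous fun y : Spacetime => ‖y.2‖) continuous_const).mem_nhds hz'] with y hy hy'
  have : bumpT (L⁻¹ * (y.1 - t₀)) = 1 := bumpT.one_of_mem_closedBall (by
    rw [mem_closedBall_zero_iff, norm_mul, norm_inv, Real.norm_of_nonneg hL.le, Real.norm_eq_abs,
      inv_mul_eq_div, div_le_iff₀ hL]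
    simpa [bumpT] using (le_of_lt hy : |y.1 - t₀| ≤ L))
  rw [cutoff, spaceCut_eq_one hρ (le_of_lt hy'), timeCut, this, one_mul, one_mul]

lemma shell_subset {j : ℕ} {x : Space} (hx : x ∈ shell j) : ‖x‖ < 2 * 2 ^ j := by
  unfold shell at hx
  split_ifs at hx with h
  · subst h; simpa using hx
  · have := hx.2; rwa [pow_succ, mul_comm] at this

/-- Lower bound for the weighted `L²` norms over the dyadic regions. -/
lemma setLIntegral_shell_le {F G : Spacetime → ℝ} {I I' : Set ℝ} {j J : ℕ} (hj : j ≤ J) {B : ℝ}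
    (hB : 0 ≤ B) (hI : I ⊆ I') (hIm : MeasurableSet I)
    (hFG : ∀ z : Spacetime, z.1 ∈ I → z.2 ∈ shell j → F z = G z)
    (h : eLpNorm (fun z => rWeight (-1 / 2) z * (rWeight (-1) z * G z)) 2
      (volume.restrict (I' ×ˢ shell j)) ≤ ENNReal.ofReal B) :
    ∫⁻ z in I ×ˢ shell j, ENNReal.ofReal (F z ^ 2) ≤ ENNReal.ofReal (27 * 8 ^ J * B ^ 2) := by
  have h1 : eLpNorm (fun z => rWeight (-1 / 2) z * (rWeight (-1) z * G z)) 2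
      (volume.restrict (I' ×ˢ shell j)) ^ 2 ≤ ENNReal.ofReal (B ^ 2) := by
    rw [ENNReal.ofReal_pow hB]; gcongr
  rw [eLpNorm_two_sq] at h1
  rw [ENNReal.ofReal_mul (by positivity)]
  refine le_trans ?_ (mul_le_mul_right h1 _)
  rw [← lintegral_const_mul' _ _ ENNReal.ofReal_ne_top]
  refine le_trans ?_ (lintegral_mono_set (Set.prod_mono hI subset_rfl))
  refine setLIntegral_mono' (hIm.prod (measurableSet_shell j)) fun z hz => ?_
  rw [enorm_sq_eq_ofReal, ← ENNReal.ofReal_mul (by positivity), hFG z hz.1 hz.2]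
  refine ENNReal.ofReal_le_ofReal ?_
  have hjb := jb_pos ‖z.2‖
  have e : (rWeight (-1 / 2) z * (rWeight (-1) z * G z)) ^ 2 = (jb ‖z.2‖ ^ 3)⁻¹ * G z ^ 2 := by
    have : rWeight (-1 / 2) z ^ 2 = (jb ‖z.2‖)⁻¹ := by
      rw [rWeight, ← Real.rpow_natCast, ← Real.rpow_mul hjb.le, ← Real.rpow_neg_one]; norm_num
    rw [mul_pow, mul_pow, this, rWeight, Real.rpow_neg_one]
    field_simp
  -- The weights ⟨r⟩^{-1/2} and ⟨r⟩⁻¹ combine to ⟨r⟩⁻³ after squaring. Up to the J-th region ⟨r⟩ ≤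
  -- 3·2^J, so the weight is undone at a cost depending on J only.
  have h3 : jb ‖z.2‖ ^ 3 ≤ 27 * 8 ^ J := by
    have h4 := jb_le_three_mul (norm_nonneg z.2) (one_le_pow₀ (by norm_num : (1 : ℝ) ≤ 2) (n := j))
      (shell_subset hz.2).le
    calc jb ‖z.2‖ ^ 3 ≤ (3 * 2 ^ J) ^ 3 := by
          refine pow_le_pow_left₀ hjb.le (h4.trans ?_) 3
          have : (2 : ℝ) ^ j ≤ 2 ^ J := pow_le_pow_right₀ (by norm_num) hj
          linarith
      _ = 27 * 8 ^ J := by rw [mul_pow, ← pow_mul, mul_comm J 3, pow_mul]; norm_num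
  rw [e, ← mul_assoc]
  refine le_mul_of_one_le_left (sq_nonneg _) ?_
  rw [← div_eq_mul_inv, one_le_div (by positivity)]
  exact h3

/-- The closed ball of radius `2^{J+1}` is covered, up to null sets, by the dyadic regions. -/
lemma setLIntegral_ball_le_sum (f : Spacetime → ℝ≥0∞) (I : Set ℝ) (J : ℕ) :
    ∫⁻ z in I ×ˢ Metric.closedBall (0 : Space) (2 ^ (J + 1)), f z ≤
      ∑ j ∈ Finset.range (J + 1), ∫⁻ z in I ×ˢ shell j, f z := by
  have h : ∫⁻ z in I ×ˢ Metric.closedBall (0 : Space) (2 ^ (J + 1)), f z ≤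
      ∫⁻ z in ⋃ j ∈ Finset.range (J + 1), I ×ˢ shell j, f z := by
    refine lintegral_mono_set' ?_
    filter_upwards [ae_norm_ne] with z hz hz'
    obtain ⟨j, hj⟩ := exists_mem_shell hz
    refine Set.mem_iUnion₂.2 ⟨j, ?_, hz'.1, hj⟩
    rw [Finset.mem_range]
    by_contra h
    have hj0 : j ≠ 0 := by omega
    rw [shell, if_neg hj0] at hj
    have h1 : (2 : ℝ) ^ (J + 1) ≤ 2 ^ j := pow_le_pow_right₀ (by norm_num) (by omega)
    have h2 : ‖z.2‖ ≤ 2 ^ (J + 1) := by simpa using hz'.2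
    linarith [hj.1]
  refine h.trans ?_
  generalize Finset.range (J + 1) = S
  induction S using Finset.induction_on with
  | empty => simp
  | insert j S hj ih =>
    rw [Finset.set_biUnion_insert, Finset.sum_insert hj]
    exact (lintegral_union_le _ _ _).trans (add_le_add_right ih _)

/-! ### Local energy decay for a truncated solution -/

variable {g : Spacetime → Matrix (Fin 4) (Fin 4) ℝ} {A : Fin 4 → Spacetime → ℝ}
  {V φ : Spacetime → ℝ}

lemma continuous_spacetime_gradSq (hφ : ContDiff ℝ ∞ φ) (k : ℕ) :
    Continuous fun z : Spacetime => gradSq (spIdx k) (spd φ) z.1 z.2 :=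
  continuous_finsetSum _ fun l _ => continuous_finsetSum _ fun i _ =>
    ((contDiff_pd i.succ (contDiff_spd hφ l)).continuous).pow 2

lemma continuous_spacetime_nSq (hφ : ContDiff ℝ ∞ φ) (k : ℕ) :
    Continuous fun z : Spacetime => nSq k φ z.1 z.2 :=
  continuous_finsetSum _ fun l _ => ((contDiff_spd hφ l).continuous).pow 2

lemma normUpTo_le_card {N : (Spacetime → ℝ) → ℝ≥0∞} {k : ℕ} {u : Spacetime → ℝ} {a : ℝ}
    (h : ∀ α ∈ multiIdx 4 k, N (pdMulti α u) ≤ ENNReal.ofReal a) :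
    normUpTo N k u ≤ ENNReal.ofReal ((multiIdx 4 k).card * a) := by
  refine (Finset.sum_le_card_nsmul _ _ _ h).trans (le_of_eq ?_)
  rw [nsmul_eq_mul, ENNReal.ofReal_mul (by positivity), ENNReal.ofReal_natCast]

lemma mul_add_sq_le (c x y w : ℝ) :
    (c * (x + y + w)) ^ 2 ≤ 4 * c ^ 2 * (x ^ 2 + y ^ 2) + (2 * c * w) ^ 2 := by
  have h : (x + y + w) ^ 2 ≤ 4 * (x ^ 2 + y ^ 2) + 4 * w ^ 2 := by
    nlinarith [sq_nonneg (x - y), sq_nonneg (x + y - w)]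
  rw [mul_pow]
  exact (mul_le_mul_of_nonneg_left h (sq_nonneg c)).trans_eq (by ring)

set_option maxHeartbeats 1000000 in
/-- Local energy decay for a truncated solution: a lower bound `m` for the energy in a ball during a
time interval is controlled by the energy in a shell. -/
theorem exists_local_energy_bound (hc : SmoothCoeffs g A V) (hled : WeakLED g A V ∨ StationaryLED g A V)
    {s : ℝ} (hs : 0 < s) {k : ℕ} {Cc : ℝ} (hCc : 0 ≤ Cc) (hb : CoeffBounds (k + 2) Cc s g A V) (J : ℕ) :
    ∃ C : ℝ, 0 ≤ C ∧ ∀ n : ℕ, J + 1 ≤ n → ∃ Cn : ℝ, 0 ≤ Cn ∧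
      ∀ (φ : Spacetime → ℝ) (t₀ L N Nt P m : ℝ), ContDiff ℝ ∞ φ →
      (∀ z : Spacetime, 0 < z.1 → waveOp g A V φ z = 0) → (2 ^ n) ^ 2 ≤ L → 3 * L ≤ t₀ → 0 ≤ P →
      (∀ z : Spacetime, |z.1 - t₀| ≤ 2 * L → ‖z.2‖ ≤ 2 * 2 ^ n → ∀ m : List (Fin 4), m.length ≤ k + 2 →
        |pdl m φ z| ≤ N ∧ ((0 : Fin 4) ∈ m → |pdl m φ z| ≤ Nt)) →
      (∀ t, |t - t₀| ≤ 2 * L → ∫ x in annulus (2 ^ n) (2 * 2 ^ n),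
        ((2 ^ n)⁻¹ * gradSq (spIdx (k + 1)) (spd φ) t x + (2 ^ n)⁻¹ ^ 3 * φ (t, x) ^ 2) ≤ P) →
      (∀ t, |t - t₀| ≤ L / 2 → m ≤ ∫ x in Metric.closedBall (0 : Space) (2 ^ (J + 1)), nSq k φ t x) →
      m ≤ C * P + Cn * (L⁻¹ * N + Nt) ^ 2 := by
  obtain ⟨Cs, hCs, hsrc⟩ := exists_source_bound (n := k + 1) hc hs hCc hb
  obtain ⟨CL, hCL⟩ := exists_led_bound hc hled k
  set c₁ : ℝ := ((multiIdx 4 (k + 1)).card : ℝ) with hc₁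
  set c₂ : ℝ := ((multiIdx 4 k).card : ℝ) with hc₂
  set c₃ : ℝ := (spIdx k).card * (J + 1) * (27 * 8 ^ J) with hc₃
  -- This constant, in front of the shell energy, is chosen before n. It depends on the radius
  -- 2^{J+1} but not on the truncation radius 2^n, and for that reason the shell term can later be
  -- absorbed.
  refine ⟨c₃ * (2 * (CL * (c₁ + c₂)) ^ 2 * (48 * Cs ^ 2)), by positivity, fun n hn => ?_⟩
  set ρ : ℝ := 2 ^ n with hρ
  have hρ1 : 1 ≤ ρ := one_le_pow₀ (by norm_num)
  have hρ0 : 0 < ρ := by linarith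
  set v := volume.real (Metric.closedBall (0 : Space) (2 * ρ)) with hv
  have hv0 : 0 ≤ v := measureReal_nonneg
  -- This constant may depend on n: it contains the number of dyadic regions met by the cylinder and
  -- the volume of its cross section.
  refine ⟨c₃ * (2 * (CL * (c₁ + c₂)) ^ 2 * (48 * Cs ^ 2) * ((n + 2) ^ 2 * (ρ * v))), by positivity, ?_⟩
  intro φ t₀ L N Nt P m hφ hsol hL hLt hP hN hPt hm
  have hL1 : 1 ≤ L := le_trans (one_le_pow₀ hρ1) hL
  have hL0 : 0 < L := by linarith
  set b := L⁻¹ * N + Nt with hbdef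
  have hb0 : 0 ≤ b := by
    have hz : |((t₀, 0) : Spacetime).1 - t₀| ≤ 2 * L := by simp; linarith
    have hz' : ‖((t₀, 0) : Spacetime).2‖ ≤ 2 * ρ := by simp; linarith
    have h1 := (abs_nonneg _).trans (hN (t₀, 0) hz hz' [] (by simp)).1
    have h2 := (abs_nonneg _).trans ((hN (t₀, 0) hz hz' [0] (by simp)).2 (by simp))
    positivity
  set u : Spacetime → ℝ := fun y => cutoff bumpT t₀ L ρ y * φ y with hu
  have hus : ContDiff ℝ ∞ u := (contDiff_cutoff bumpT_contDiff _ _ _).mul hφ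
  have huz : ∀ z : Spacetime, 2 * L < |z.1 - t₀| ∨ 2 * ρ < ‖z.2‖ → u =ᶠ[nhds z] fun _ => 0 :=
    fun z hz => cutoff_eventuallyEq_zero hL0 hρ0 hz
  set q : Spacetime → ℝ := fun z => ρ⁻¹ * gradSq (spIdx (k + 1)) (spd φ) z.1 z.2 + ρ⁻¹ ^ 3 * φ z ^ 2
    with hq
  have hqc : Continuous q := ((continuous_spacetime_gradSq hφ (k + 1)).const_mul _).add
    ((hφ.continuous.pow 2).const_mul _)
  have hq0 : ∀ z, 0 ≤ q z := fun z => by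
    have := gradSq_nonneg (spIdx (k + 1)) (spd φ) z.1 z.2
    positivity
  -- A factor ρ⁻¹ is split off the squared source in the shell. It balances the weight ⟨r⟩ in the
  -- LE* norm, and the rest is the density bounded by P.
  have hpt : ∀ z : Spacetime, |z.1 - t₀| ≤ 2 * L → ‖z.2‖ ≤ 2 * ρ → ∀ l : List (Fin 4), l.length ≤ k + 1 →
      (pdl l (waveOp g A V u) z) ^ 2 ≤ (if ρ ≤ ‖z.2‖ then ρ⁻¹ * (4 * Cs ^ 2 * q z) else 0)
        + (2 * Cs * b) ^ 2 ∧ (pdl l (pd 0 u) z) ^ 2 ≤ (2 * Cs * b) ^ 2 := by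
    intro z hz hz' l hl
    have hz1 : 0 < z.1 := by have := (abs_le.1 hz).1; linarith
    set Q := Real.sqrt (gradSq (spIdx (k + 1)) (spd φ) z.1 z.2) with hQ
    have hQ2 : Q ^ 2 = gradSq (spIdx (k + 1)) (spd φ) z.1 z.2 := Real.sq_sqrt (gradSq_nonneg _ _ _ _)
    have hQ0 : 0 ≤ Q := Real.sqrt_nonneg _
    obtain ⟨h1, h2⟩ := hsrc φ t₀ L ρ N Nt Q z hφ hsol hρ1 hL hz1 hQ0 (fun m hm => (hN z hz hz' m hm).1)
      (fun m h0 hm => (hN z hz hz' m hm).2 h0) (fun l' hl0 hl' => by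
        obtain ⟨i, l', rfl⟩ := List.exists_cons_of_ne_nil hl0
        have h1 := abs_pd_le_sqrt_gradSq (v := spd φ) (t := z.1)
          (mem_spIdx.2 (by simpa using hl' : l'.length ≤ k + 1)) i z.2
        rwa [pd_spd hφ] at h1) l hl
    rw [← sq_abs (pdl l _ z), ← sq_abs (pdl l (pd 0 u) z)]
    have hCb : 0 ≤ Cs * b := by positivity
    constructor
    · refine (pow_le_pow_left₀ (abs_nonneg _) h1 2).trans ?_
      split_ifs with hr
      · have e : ρ⁻¹ * (4 * Cs ^ 2 * q z) = 4 * Cs ^ 2 * ((ρ⁻¹ * Q) ^ 2 + (ρ⁻¹ ^ 2 * |φ z|) ^ 2) := by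
          simp only [hq, ← hQ2, mul_pow, sq_abs]; ring
        rw [e]
        exact mul_add_sq_le _ _ _ _
      · rw [zero_add, zero_add]
        exact pow_le_pow_left₀ hCb (by linarith) 2
    · exact pow_le_pow_left₀ (abs_nonneg _) (h2.trans (by linarith)) 2
  set X := Real.sqrt (12 * (4 * Cs ^ 2 * P) * L) with hX
  set Y := Real.sqrt (12 * ρ * (2 * Cs * b) ^ 2 * v * L) with hY
  have hX0 : 0 ≤ X := Real.sqrt_nonneg _
  have hY0 : 0 ≤ Y := Real.sqrt_nonneg _
  have hLE1 : normUpTo (normLEstar (Set.Ici (t₀ - 3 * L))) (k + 1) (waveOp g A V u) ≤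
      ENNReal.ofReal (c₁ * (X + (n + 1) * Y)) := by
    refine normUpTo_le_card fun α hα => ?_
    obtain ⟨l, hl, he⟩ := exists_pdMulti_eq_pdl α
    have hl' : l.length ≤ k + 1 := hl.trans_le (mem_multiIdx.1 hα)
    rw [he]
    refine normLEstar_le_of_bound (by omega) (f := fun z => 4 * Cs ^ 2 * q z) (by fun_prop)
      (fun z => by have := hq0 z; positivity) hL0.le (by positivity) (fun z hz => ?_)
      (fun z hz hz' => (hpt z hz hz' l hl').1) (fun t ht => ?_)
    · exact pdl_eq_zero_of_eventuallyEq l (waveOp_eventuallyEq_zero (huz z hz))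
    · rw [integral_const_mul]
      exact mul_le_mul_of_nonneg_left (hPt t ht) (by positivity)
  have hLE2 : normUpTo (normLE (Set.Ici (t₀ - 3 * L))) k (pd 0 u) ≤ ENNReal.ofReal (c₂ * Y) := by
    refine normUpTo_le_card fun α hα => ?_
    obtain ⟨l, hl, he⟩ := exists_pdMulti_eq_pdl α
    have hl' : l.length ≤ k + 1 := (hl.trans_le (mem_multiIdx.1 hα)).trans (Nat.le_succ k)
    rw [he]
    refine (normLE_le_of_bound (r := 2 * ρ) (b := 2 * Cs * b) (fun z hz => ?_)
      (fun z hz hz' => (hpt z hz hz' l hl').2)).trans (ENNReal.ofReal_le_ofReal (Real.sqrt_le_sqrt ?_))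
    · exact pdl_eq_zero_of_eventuallyEq (0 :: l) (huz z hz)
    · have : 4 * 1 ≤ 12 * ρ := by linarith
      gcongr
      linarith
  set B := CL * (c₁ + c₂) * (X + (n + 2) * Y) with hB
  have hB0 : 0 ≤ B := by positivity
  have hRHS : CL * (normUpTo (normLEstar (Set.Ici (t₀ - 3 * L))) (k + 1) (waveOp g A V u)
      + normUpTo (normLE (Set.Ici (t₀ - 3 * L))) k (pd 0 u)) ≤ ENNReal.ofReal B := by
    refine (mul_le_mul_right (add_le_add hLE1 hLE2) _).trans ?_
    rw [← ENNReal.ofReal_add (by positivity) (by positivity), ← ENNReal.ofReal_coe_nnreal,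
      ← ENNReal.ofReal_mul (by positivity)]
    refine ENNReal.ofReal_le_ofReal ?_
    rw [hB, mul_assoc]
    refine mul_le_mul_of_nonneg_left ?_ (by positivity)
    have h1 : 0 ≤ c₁ * Y := mul_nonneg (Nat.cast_nonneg _) hY0
    have h2 : 0 ≤ c₂ * (X + (n + 1) * Y) := mul_nonneg (Nat.cast_nonneg _) (by positivity)
    refine le_of_sub_nonneg ((add_nonneg h1 h2).trans_eq ?_)
    ring
  have hB2 : B ^ 2 ≤ (2 * (CL * (c₁ + c₂)) ^ 2 * (48 * Cs ^ 2)) * (P + (n + 2) ^ 2 * (ρ * v) * b ^ 2) * L := by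
    have h1 := add_sq_le (a := X) (b := (n + 2) * Y)
    rw [mul_pow] at h1
    rw [hX, hY, Real.sq_sqrt (by positivity), Real.sq_sqrt (by positivity)] at h1
    rw [hB, mul_pow]
    refine (mul_le_mul_of_nonneg_left h1 (sq_nonneg _)).trans_eq (by ring)
  have hmain : ∫⁻ z in Set.Icc (t₀ - L / 2) (t₀ + L / 2) ×ˢ Metric.closedBall (0 : Space) (2 ^ (J + 1)),
      ENNReal.ofReal (nSq k φ z.1 z.2) ≤ ENNReal.ofReal (c₃ * B ^ 2) := by
    have hl : ∀ l ∈ spIdx k, ∫⁻ z in Set.Icc (t₀ - L / 2) (t₀ + L / 2) ×ˢ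
        Metric.closedBall (0 : Space) (2 ^ (J + 1)), ENNReal.ofReal (spd φ l z ^ 2) ≤
        ENNReal.ofReal ((J + 1) * (27 * 8 ^ J * B ^ 2)) := by
      intro l hl
      refine (setLIntegral_ball_le_sum _ _ J).trans ((Finset.sum_le_card_nsmul _ _
        (ENNReal.ofReal (27 * 8 ^ J * B ^ 2)) fun j hj => ?_).trans (le_of_eq ?_))
      · rw [Finset.mem_range] at hj
        refine setLIntegral_shell_le (G := pdMulti (fun a => (l.map Fin.succ).count a) u)
          (I' := Set.Icc (t₀ - 3 * L) (t₀ + 3 * L)) (by omega) hB0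
          (Set.Icc_subset_Icc (by linarith) (by linarith)) measurableSet_Icc (fun z hz hz' => ?_) ?_
        · rw [← pdl_eq_pdMulti _ hus]
          refine (pdl_congr_of_eventuallyEq _ (cutoff_eventuallyEq_self hL0 hρ0 ?_ ?_)).symm
          · rw [abs_lt]; rw [Set.mem_Icc] at hz; constructor <;> linarith
          · have h1 := shell_subset hz'
            have h2 : (2 : ℝ) ^ (j + 1) ≤ 2 ^ n := pow_le_pow_right₀ (by norm_num) (by omega)
            rw [pow_succ] at h2
            linarith
        -- The truncated function vanishes beyond distance 2L from t₀ and equals φ within distance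
        -- L. The interval of half-length 3L leaves margins where it vanishes near both ends.
        · refine (hCL (t₀ - 3 * L) (t₀ - 2 * L) (t₀ + 2 * L) (t₀ + 3 * L) u (by linarith) (by linarith)
            (by linarith) (by linarith) hus (fun z hz => (huz z (Or.inl ?_)).self_of_nhds)
            ⟨2 * ρ, fun z hz => (huz z (Or.inr hz)).self_of_nhds⟩ _ (mem_multiIdx.2 ?_) j).trans hRHS
          · rw [lt_abs]; rcases hz with h | h
            · right; linarith
            · left; linarith
          · rw [sum_count_eq_length]; simpa using mem_spIdx.1 hl
      · rw [Finset.card_range, nsmul_eq_mul, ← ENNReal.ofReal_natCast,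
          ← ENNReal.ofReal_mul (by positivity), Nat.cast_succ]
    calc _ = ∑ l ∈ spIdx k, ∫⁻ z in Set.Icc (t₀ - L / 2) (t₀ + L / 2) ×ˢ
        Metric.closedBall (0 : Space) (2 ^ (J + 1)), ENNReal.ofReal (spd φ l z ^ 2) := by
          rw [← lintegral_finsetSum' _ fun l _ => by
            have := (contDiff_spd hφ l).continuous
            fun_prop]
          refine lintegral_congr fun z => ?_
          rw [nSq, ENNReal.ofReal_sum_of_nonneg fun _ _ => sq_nonneg _]
      _ ≤ _ := (Finset.sum_le_card_nsmul _ _ _ hl).trans (le_of_eq ?_)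
    rw [nsmul_eq_mul, ← ENNReal.ofReal_natCast, ← ENNReal.ofReal_mul (by positivity)]
    congr 1
    rw [hc₃]; ring
  -- Integrated over the window of length L the lower bound m yields mL. The squared norm on the
  -- other side is also proportional to L, so L cancels.
  have hlow := (le_setLIntegral_prod (a := t₀ - L / 2) (b := t₀ + L / 2) (P := m)
    (isCompact_closedBall _ _) (continuous_spacetime_nSq hφ k) (fun z => nSq_nonneg _ _ _ _)
    (fun t ht => hm t (by rw [Set.mem_Icc] at ht; rw [abs_le]; constructor <;> linarith))).trans hmain
  have hfin : 0 ≤ c₃ * (2 * (CL * (c₁ + c₂)) ^ 2 * (48 * Cs ^ 2)) * P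
      + c₃ * (2 * (CL * (c₁ + c₂)) ^ 2 * (48 * Cs ^ 2) * ((n + 2) ^ 2 * (ρ * v))) * b ^ 2 := by positivity
  rcases le_total m 0 with hm0 | hm0
  · exact hm0.trans hfin
  rw [← ENNReal.ofReal_mul hm0, ENNReal.ofReal_le_ofReal_iff (by positivity)] at hlow
  have h1 : c₃ * B ^ 2 ≤ (c₃ * (2 * (CL * (c₁ + c₂)) ^ 2 * (48 * Cs ^ 2)) * P
      + c₃ * (2 * (CL * (c₁ + c₂)) ^ 2 * (48 * Cs ^ 2) * ((n + 2) ^ 2 * (ρ * v))) * b ^ 2) * L :=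
    (mul_le_mul_of_nonneg_left hB2 (by positivity)).trans_eq (by ring)
  refine le_of_mul_le_mul_right (le_trans ?_ h1) hL0
  have : t₀ + L / 2 - (t₀ - L / 2) = L := by ring
  rwa [this] at hlow

/-! ### Gains from time derivatives -/

variable {g : Spacetime → Matrix (Fin 4) (Fin 4) ℝ} {A : Fin 4 → Spacetime → ℝ}
  {V φ : Spacetime → ℝ}

lemma hasDerivAt_time {v : Spacetime → ℝ} (hv : ContDiff ℝ ∞ v) (t : ℝ) (x : Space) :
    HasDerivAt (fun t => v (t, x)) (pd 0 v (t, x)) t :=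
  (differentiableAt_of_smooth hv (t, x)).hasFDerivAt.comp_hasDerivAt t
    ((hasDerivAt_id t).prodMk (hasDerivAt_const t x))

/-- Interpolation between a function and its second derivative. -/
lemma abs_deriv_le_of_second {f f' f'' : ℝ → ℝ} (h1 : ∀ t, HasDerivAt f (f' t) t)
    (h2 : ∀ t, HasDerivAt f' (f'' t) t) {a h M₀ M₂ : ℝ} (hh : 0 < h)
    (hM₀ : ∀ t ∈ Set.Icc a (a + h), |f t| ≤ M₀) (hM₂ : ∀ t ∈ Set.Icc a (a + h), |f'' t| ≤ M₂) :
    |f' a| ≤ 2 * M₀ / h + h * M₂ := by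
  have hab : a < a + h := by linarith
  -- At some point ξ the derivative equals a difference quotient, which is at most 2M₀/h. From ξ
  -- back to a it changes by at most hM₂.
  obtain ⟨ξ, hξ, he⟩ := exists_hasDerivAt_eq_slope f f' hab
    (fun t _ => (h1 t).continuousAt.continuousWithinAt) (fun t _ => h1 t)
  have hξ' : ξ ∈ Set.Icc a (a + h) := Set.Ioo_subset_Icc_self hξ
  have ha : a ∈ Set.Icc a (a + h) := Set.left_mem_Icc.2 hab.le
  have hM₂0 : 0 ≤ M₂ := (abs_nonneg _).trans (hM₂ a ha)
  have e1 : |f' ξ - f' a| ≤ M₂ * |ξ - a| := by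
    have := Convex.norm_image_sub_le_of_norm_hasDerivWithin_le (f := f') (f' := f'') (C := M₂)
      (s := Set.Icc a (a + h)) (fun t _ => (h2 t).hasDerivWithinAt) (fun t ht => hM₂ t ht)
      (convex_Icc _ _) ha hξ'
    simpa using this
  have e2 : |ξ - a| ≤ h := by rw [abs_of_nonneg (by linarith [hξ.1])]; linarith [hξ.2]
  have e3 : |f' ξ| ≤ 2 * M₀ / h := by
    rw [he, add_sub_cancel_left, abs_div, abs_of_pos hh]
    gcongr
    have := (abs_sub _ _).trans (add_le_add (hM₀ (a + h) (Set.right_mem_Icc.2 hab.le)) (hM₀ a ha))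
    linarith
  have e4 : |f' a| ≤ |f' ξ| + |f' ξ - f' a| := by
    have := abs_sub_abs_le_abs_sub (f' a) (f' ξ); rw [abs_sub_comm] at this; linarith
  have := mul_le_mul_of_nonneg_left e2 hM₂0
  linarith

/-- In a fixed ball t∂_t = S - x·∇ has bounded coefficients, so one time derivative gains t⁻¹. -/
lemma Apriori.abs_pdl_of_zero_mem {n : ℕ} {z : Spacetime} {B r : ℝ} (hφ : ContDiff ℝ ∞ φ)
    (h : Apriori n φ z B) (hz : 0 < z.1) (hr : 1 ≤ r) (hx : ‖z.2‖ ≤ r) {m : List (Fin 4)}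
    (h0 : (0 : Fin 4) ∈ m) (hm : m.length ≤ n) : |pdl m φ z| ≤ 4 * 5 ^ n * (r * (B * z.1⁻¹)) := by
  have hB : 0 ≤ B := (abs_nonneg _).trans (h.base [] (by simp))
  set l := m.erase 0 with hl
  have hlen : l.length + 1 ≤ n := by
    have : l.length = m.length - 1 := List.length_erase_of_mem h0
    have := List.length_pos_of_mem h0
    omega
  rw [pdl_perm (List.perm_cons_erase h0) hφ, ← pd_pdl 0 _ hφ]
  set v := pdl l φ with hv
  have hS : |scal v z| ≤ 5 ^ n * B := by
    refine (isField_scal.abs_pdl_le l hφ (fun l' hl' => h.base l' (by omega))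
      (fun l' hl' => h.scal₁ l' (by omega))).trans ?_
    gcongr
    · norm_num
    · omega
  have hq : |∑ i : Fin 3, z.2 i * pd i.succ v z| ≤ 3 * (r * B) :=
    abs_sum_mul_le (fun i => (abs_coord_le_norm _ i).trans hx) (fun i => by
      rw [hv, pd_pdl _ _ hφ]; exact h.base _ (by simpa using hlen))
  have e : pd 0 v z = z.1⁻¹ * (scal v z - ∑ i : Fin 3, z.2 i * pd i.succ v z) := by
    rw [scal]; field_simp; ring
  rw [e, abs_mul, abs_of_pos (inv_pos.2 hz)]
  have h5 : (1 : ℝ) ≤ 5 ^ n := one_le_pow₀ (by norm_num)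
  have hrB : B ≤ r * B := le_mul_of_one_le_left hB hr
  have k1 : 5 ^ n * B ≤ 5 ^ n * (r * B) := by gcongr
  have k2 : r * B ≤ 5 ^ n * (r * B) := le_mul_of_one_le_left (by positivity) h5
  calc z.1⁻¹ * |scal v z - ∑ i : Fin 3, z.2 i * pd i.succ v z|
      ≤ z.1⁻¹ * (5 ^ n * B + 3 * (r * B)) := by
        gcongr
        exact (abs_sub _ _).trans (add_le_add hS hq)
    _ ≤ z.1⁻¹ * (4 * (5 ^ n * (r * B))) := by gcongr; linarith
    _ = _ := by ring

/-- By `time_sq_mul_pd_pd`, t²∂_t² is in a fixed ball a combination, with bounded coefficients, of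
quantities controlled a priori. Two time derivatives gain t⁻². -/
lemma Apriori.abs_pd_pd_zero_le {n : ℕ} {z : Spacetime} {B r : ℝ} (hφ : ContDiff ℝ ∞ φ)
    (h : Apriori n φ z B) (hz : 0 < z.1) (hr : 1 ≤ r) (hx : ‖z.2‖ ≤ r) {l : List (Fin 4)}
    (hl : l.length + 2 ≤ n) : |pd 0 (pd 0 (pdl l φ)) z| ≤ 50 * 25 ^ n * (r ^ 2 * (B * (z.1 ^ 2)⁻¹)) := by
  have hB : 0 ≤ B := (abs_nonneg _).trans (h.base [] (by simp))
  set v := pdl l φ with hv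
  have hvs : ContDiff ℝ ∞ v := contDiff_pdl l hφ
  have p5 : ∀ m : List (Fin 4), m.length ≤ n → 5 ^ m.length * B ≤ 25 ^ n * B := fun m hm => by
    gcongr
    calc (5 : ℝ) ^ m.length ≤ 5 ^ n := pow_le_pow_right₀ (by norm_num) hm
      _ ≤ 25 ^ n := by gcongr; norm_num
  have p25 : 25 ^ l.length * B ≤ 25 ^ n * B := by
    gcongr
    · norm_num
    · omega
  have hBn : B ≤ 25 ^ n * B := le_mul_of_one_le_left hB (one_le_pow₀ (by norm_num))
  have h1 : |scal (scal v) z| ≤ 25 ^ n * B := (isField_scal.abs_pdl_le₂ l hφ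
    (fun l' hl' => h.base l' (by omega)) (fun l' hl' => h.scal₁ l' (by omega))
    (fun l' hl' => h.scal₂ l' (by omega))).trans p25
  have h2 : ∀ m : List (Fin 4), m.length ≤ l.length + 1 → |scal (pdl m φ) z| ≤ 25 ^ n * B := fun m hm =>
    (isField_scal.abs_pdl_le m hφ (fun l' hl' => h.base l' (by omega))
      (fun l' hl' => h.scal₁ l' (by omega))).trans (p5 m (by omega))
  have h3 : ∀ a, |rot a (rot a v) z| ≤ 25 ^ n * B := fun a => ((isField_rot a).abs_pdl_le₂ l hφ
    (fun l' hl' => h.base l' (by omega)) (fun l' hl' => h.rot₁ a l' (by omega))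
    (fun l' hl' => h.rot₂ a l' (by omega))).trans p25
  have h4 : ∀ i : Fin 3, |pd i.succ (scal v) z| ≤ 2 * (25 ^ n * B) := fun i => by
    have e := congrFun (scal_pd i.succ hvs) z
    have e' : pd i.succ (scal v) z = scal (pdl (i.succ :: l) φ) z + pdl (i.succ :: l) φ z := by
      rw [← pd_pdl i.succ l hφ]
      simp only [ite_mul, neg_mul, one_mul, zero_mul, Finset.sum_ite_eq', Finset.mem_univ, if_true] at e
      linarith
    rw [e']
    have := h.base (i.succ :: l) (by simp; omega)
    exact (abs_add_le _ _).trans (by linarith [h2 (i.succ :: l) (by simp)])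
  have h5 : |lap v z| ≤ 3 * (25 ^ n * B) := by
    refine (Finset.abs_sum_le_sum_abs _ _).trans ((Finset.sum_le_card_nsmul _ _ (25 ^ n * B)
      fun i _ => ?_).trans_eq (by simp))
    rw [hv, pd_pdl _ _ hφ, pd_pdl _ _ hφ]
    exact (h.base _ (by simp; omega)).trans hBn
  have h6 : |∑ i : Fin 3, z.2 i * pd i.succ (scal v) z| ≤ 3 * (r * (2 * (25 ^ n * B))) :=
    abs_sum_mul_le (fun i => (abs_coord_le_norm _ i).trans hx) h4
  have h7 : |∑ a, rot a (rot a v) z| ≤ 3 * (25 ^ n * B) :=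
    (Finset.abs_sum_le_sum_abs _ _).trans ((Finset.sum_le_card_nsmul _ _ _ fun a _ => h3 a).trans_eq
      (by simp))
  have h8 : |‖z.2‖ ^ 2 * lap v z| ≤ r ^ 2 * (3 * (25 ^ n * B)) := by
    rw [abs_mul, abs_of_nonneg (by positivity)]
    gcongr
  set b := 25 ^ n * B with hb
  have hb0 : 0 ≤ b := by positivity
  have e := time_sq_mul_pd_pd hvs z
  have hS := h2 l (by omega)
  have key : |z.1 ^ 2 * pd 0 (pd 0 v) z| ≤ 50 * (r ^ 2 * b) := by
    rw [e]
    have a1 := abs_le.1 h1; have a2 := abs_le.1 hS; have a3 := abs_le.1 h6; have a4 := abs_le.1 h7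
    have a5 := abs_le.1 h8
    have c1 : r * b ≤ r ^ 2 * b := by gcongr; nlinarith
    have c2 : b ≤ r * b := le_mul_of_one_le_left hb0 hr
    rw [abs_le]
    constructor <;> linarith [a1.1, a1.2, a2.1, a2.2]
  rw [abs_mul, abs_of_pos (by positivity)] at key
  calc |pd 0 (pd 0 v) z| = (z.1 ^ 2)⁻¹ * (z.1 ^ 2 * |pd 0 (pd 0 v) z|) := by field_simp
    _ ≤ (z.1 ^ 2)⁻¹ * (50 * (r ^ 2 * b)) := by gcongr
    _ = _ := by rw [hb]; ring

/-- A solution together with a priori bounds during a time interval. -/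
structure Controlled (g : Spacetime → Matrix (Fin 4) (Fin 4) ℝ) (A : Fin 4 → Spacetime → ℝ)
    (V φ : Spacetime → ℝ) (D T₁ T₂ : ℝ) : Prop where
  smooth : ContDiff ℝ ∞ φ
  eqn : ∀ z : Spacetime, 0 < z.1 → waveOp g A V φ z = 0
  nonneg : 0 ≤ D
  bound : ∀ z : Spacetime, T₁ ≤ z.1 → z.1 ≤ T₂ → ‖z.2‖ ≤ z.1 / 2 →
    Apriori 16 φ z (D * (jb ‖z.2‖)⁻¹)

lemma Controlled.mono {D T₁ T₂ T₁' T₂' : ℝ} (h : Controlled g A V φ D T₁ T₂) (h1 : T₁ ≤ T₁')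
    (h2 : T₂' ≤ T₂) : Controlled g A V φ D T₁' T₂' :=
  ⟨h.smooth, h.eqn, h.nonneg, fun z h3 h4 => h.bound z (h1.trans h3) (h4.trans h2)⟩

/-- Decay at the rate `t^{-α}` of the space derivatives up to order `m` in the ball of radius `r`. -/
def InnerDecay (g : Spacetime → Matrix (Fin 4) (Fin 4) ℝ) (A : Fin 4 → Spacetime → ℝ)
    (V : Spacetime → ℝ) (n m : ℕ) (r α : ℝ) : Prop :=
  ∃ K T₀ : ℝ, 0 ≤ K ∧ ∀ (φ : Spacetime → ℝ) (D T : ℝ), T₀ ≤ T →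
    Controlled g A V φ D (T / 2 ^ n) (2 ^ n * T) → ∀ x : Space, ‖x‖ ≤ r →
      ∀ l : List (Fin 3), l.length ≤ m → |spd φ l (T, x)| ≤ K * (D * T ^ (-α))

/-! ### Decay in a ball at nearby times -/

variable {g : Spacetime → Matrix (Fin 4) (Fin 4) ℝ} {A : Fin 4 → Spacetime → ℝ}
  {V φ : Spacetime → ℝ}

lemma Apriori.mono {n n' : ℕ} (hn : n ≤ n') {z : Spacetime} {B B' : ℝ} (hB : B ≤ B')
    (h : Apriori n' φ z B) : Apriori n φ z B' :=
  ⟨fun l hl => (h.base l (hl.trans hn)).trans hB, fun l hl => (h.scal₁ l (hl.trans hn)).trans hB,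
    fun l hl => (h.scal₂ l (hl.trans hn)).trans hB, fun a l hl => (h.rot₁ a l (hl.trans hn)).trans hB,
    fun a l hl => (h.rot₂ a l (hl.trans hn)).trans hB⟩

lemma half_rpow_neg_le {T t α : ℝ} (hT : 0 < T) (ht : T / 2 ≤ t) (h0 : 0 ≤ α) (h1 : α ≤ 1) :
    t ^ (-α) ≤ 2 * T ^ (-α) := by
  calc t ^ (-α) ≤ (T / 2) ^ (-α) := Real.rpow_le_rpow_of_nonpos (by positivity) ht (by linarith)
    _ = 2 ^ α * T ^ (-α) := by
      rw [Real.div_rpow hT.le (by norm_num), Real.rpow_neg (by norm_num : (0 : ℝ) ≤ 2), div_inv_eq_mul,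
        mul_comm]
    _ ≤ 2 * T ^ (-α) := by
      gcongr
      calc (2 : ℝ) ^ α ≤ 2 ^ (1 : ℝ) := Real.rpow_le_rpow_of_exponent_le (by norm_num) h1
        _ = 2 := Real.rpow_one 2

/-- Decay in a ball at nearby times, and the improved decay of the time derivative. -/
lemma InnerDecay.exists_bounds {n k : ℕ} (hk : k + 2 ≤ 16) {r α : ℝ} (hr : 1 ≤ r) (h0 : 0 ≤ α)
    (h1 : α ≤ 1) (h : InnerDecay g A V n (k + 2) r α) :
    ∃ C T₀ : ℝ, 0 ≤ C ∧ 1 ≤ T₀ ∧ ∀ (φ : Spacetime → ℝ) (D T : ℝ), T₀ ≤ T →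
      Controlled g A V φ D (T / 2 ^ (n + 1)) (2 ^ (n + 1) * T) →
      (∀ t x, |t - T| ≤ T / 2 → ‖x‖ ≤ r → ∀ m : List (Fin 4), m.length ≤ k + 2 →
        |pdl m φ (t, x)| ≤ C * (D * T ^ (-α)) ∧
        ((0 : Fin 4) ∈ m → |pdl m φ (t, x)| ≤ C * (D * T⁻¹))) ∧
      ∀ t x, |t - T| ≤ T / 2 → ‖x‖ ≤ r → ∀ l : List (Fin 3), l.length ≤ k →
        |spd φ l (t, x) - spd φ l (T, x)| ≤ C * (D * T ^ (-1 - α / 2)) * |t - T| := by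
  obtain ⟨K, T₀, hK, hdec⟩ := h
  set C₁ := 2 * K + 8 * 5 ^ 16 * r with hC₁
  have hC₁0 : 0 ≤ C₁ := by positivity
  set C₂ : ℝ := 200 * 25 ^ 16 * r ^ 2 with hC₂
  have hC₂0 : 0 ≤ C₂ := by positivity
  refine ⟨8 * C₁ + C₂, max (2 * T₀) (4 * r), by positivity, ?_, ?_⟩
  · exact le_max_of_le_right (by linarith)
  intro φ D T hT hφ
  have hT1 : 2 * T₀ ≤ T := (le_max_left _ _).trans hT
  have hT2 : 4 * r ≤ T := (le_max_right _ _).trans hT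
  have hT0 : 0 < T := by linarith
  have hT3 : 1 ≤ T := by linarith
  have hD := hφ.nonneg
  have hφs := hφ.smooth
  have hpow : (2 : ℝ) ^ (n + 1) = 2 * 2 ^ n := by rw [pow_succ]; ring
  have hp1 : (1 : ℝ) ≤ 2 ^ n := one_le_pow₀ (by norm_num)
  have hap : ∀ t x, T / 2 ≤ t → t ≤ 2 * T → ‖x‖ ≤ r → Apriori 16 φ (t, x) D := by
    intro t x ht ht' hx
    have h3 : T / 2 ^ (n + 1) ≤ T / 2 := by
      rw [hpow]; exact div_le_div_of_nonneg_left hT0.le (by norm_num) (by linarith)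
    have h4 : 2 * T ≤ 2 ^ (n + 1) * T := by rw [hpow]; nlinarith
    refine (hφ.bound (t, x) (h3.trans ht) (ht'.trans h4) (by simp only; linarith)).mono le_rfl ?_
    exact mul_le_of_le_one_right hD (inv_le_one_of_one_le₀ (one_le_jb _))
  have hA : ∀ t x, T / 2 ≤ t → t ≤ 2 * T → ‖x‖ ≤ r → ∀ m : List (Fin 4), m.length ≤ k + 2 →
      |pdl m φ (t, x)| ≤ C₁ * (D * T ^ (-α)) ∧ ((0 : Fin 4) ∈ m → |pdl m φ (t, x)| ≤ C₁ * (D * T⁻¹)) := by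
    intro t x ht ht' hx m hm
    have ht0 : 0 < t := by linarith
    have hz : (0 : Fin 4) ∈ m → |pdl m φ (t, x)| ≤ C₁ * (D * T⁻¹) := fun hm0 => by
      refine ((hap t x ht ht' hx).abs_pdl_of_zero_mem hφs ht0 hr hx hm0 (by omega)).trans ?_
      have h3 : t⁻¹ ≤ 2 * T⁻¹ := by
        rw [← one_div, ← div_eq_mul_inv, div_le_div_iff₀ ht0 hT0]; linarith
      calc 4 * 5 ^ 16 * (r * (D * t⁻¹)) ≤ 4 * 5 ^ 16 * (r * (D * (2 * T⁻¹))) := by gcongr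
        _ = 8 * 5 ^ 16 * r * (D * T⁻¹) := by ring
        _ ≤ C₁ * (D * T⁻¹) := by gcongr; rw [hC₁]; linarith
    refine ⟨?_, hz⟩
    by_cases hm0 : (0 : Fin 4) ∈ m
    · refine (hz hm0).trans ?_
      gcongr
      rw [← Real.rpow_neg_one]
      exact Real.rpow_le_rpow_of_exponent_le hT3 (by linarith)
    · obtain ⟨l, rfl⟩ := exists_map_succ hm0
      have h5 : T / 2 ^ (n + 1) ≤ t / 2 ^ n := by
        rw [hpow, ← div_div]; gcongr
      have h6 : 2 ^ n * t ≤ 2 ^ (n + 1) * T := by rw [hpow]; nlinarith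
      refine (hdec φ D t (by linarith) (hφ.mono h5 h6) x hx l (by simpa using hm)).trans ?_
      calc K * (D * t ^ (-α)) ≤ K * (D * (2 * T ^ (-α))) := by
            gcongr; exact half_rpow_neg_le hT0 ht h0 h1
        _ = 2 * K * (D * T ^ (-α)) := by ring
        _ ≤ C₁ * (D * T ^ (-α)) := by
            gcongr; rw [hC₁]; have : 0 ≤ 8 * 5 ^ 16 * r := by positivity
            linarith
  have hbd : ∀ t, |t - T| ≤ T / 2 → T / 2 ≤ t ∧ t ≤ 3 / 2 * T := fun t ht => by
    have := abs_le.1 ht; constructor <;> linarith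
  have hup : ∀ {y : ℝ}, 0 ≤ y → C₁ * y ≤ (8 * C₁ + C₂) * y := fun hy =>
    mul_le_mul_of_nonneg_right (by linarith) hy
  refine ⟨fun t x ht hx m hm => ?_, fun t x ht hx l hl => ?_⟩
  · obtain ⟨h3, h4⟩ := hA t x (hbd t ht).1 (by linarith [(hbd t ht).2]) hx m hm
    exact ⟨h3.trans (hup (by positivity)), fun h' => (h4 h').trans (hup (by positivity))⟩
  set v := spd φ l with hv
  have hvs : ContDiff ℝ ∞ v := contDiff_spd hφs l
  have hder : ∀ t, |t - T| ≤ T / 2 → |pd 0 v (t, x)| ≤ (8 * C₁ + C₂) * (D * T ^ (-1 - α / 2)) := by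
    intro t ht
    obtain ⟨ht1, ht2⟩ := hbd t ht
    -- This step balances the two terms T^{-α}/h and hT⁻² of the interpolation: both become
    -- T^{-1-α/2}. The factor 1/4 keeps the interval inside times at most 2T.
    set h := T ^ (1 - α / 2) / 4 with hh
    have hh0 : 0 < h := by positivity
    have hhT : h ≤ T / 4 := by
      rw [hh]; gcongr
      calc T ^ (1 - α / 2) ≤ T ^ (1 : ℝ) := Real.rpow_le_rpow_of_exponent_le hT3 (by linarith)
        _ = T := Real.rpow_one T
    refine (abs_deriv_le_of_second (hasDerivAt_time hvs · x)
      (hasDerivAt_time (contDiff_pd 0 hvs) · x) hh0 (M₀ := C₁ * (D * T ^ (-α)))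
      (M₂ := C₂ * (D * T ^ (-2 : ℝ))) (fun t' ht' => ?_) (fun t' ht' => ?_)).trans ?_
    · exact (hA t' x (ht1.trans ht'.1) (by linarith [ht'.2]) hx _ (by simp; omega)).1
    · have h3 : T / 2 ≤ t' := ht1.trans ht'.1
      refine ((hap t' x h3 (by linarith [ht'.2]) hx).abs_pd_pd_zero_le hφs (by simp only; linarith)
        hr hx (l := l.map Fin.succ) (by simp; omega)).trans ?_
      have h4 : (t' ^ 2)⁻¹ ≤ 4 * T ^ (-2 : ℝ) := by
        rw [show (-2 : ℝ) = -((2 : ℕ) : ℝ) by norm_num, Real.rpow_neg hT0.le, Real.rpow_natCast]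
        calc (t' ^ 2)⁻¹ ≤ ((T / 2) ^ 2)⁻¹ := by gcongr
          _ = 4 * (T ^ 2)⁻¹ := by field_simp; norm_num
      calc 50 * 25 ^ 16 * (r ^ 2 * (D * (t' ^ 2)⁻¹)) ≤ 50 * 25 ^ 16 * (r ^ 2 * (D * (4 * T ^ (-2 : ℝ)))) := by
            gcongr
        _ = C₂ * (D * T ^ (-2 : ℝ)) := by rw [hC₂]; ring
    · have e1 : T ^ (-α) = T ^ (-1 - α / 2) * T ^ (1 - α / 2) := by
        rw [← Real.rpow_add hT0]; congr 1; ring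
      have e2 : T ^ (1 - α / 2) * T ^ (-2 : ℝ) = T ^ (-1 - α / 2) := by
        rw [← Real.rpow_add hT0]; congr 1; ring
      have hne : T ^ (1 - α / 2) ≠ 0 := by positivity
      have k1 : 2 * (C₁ * (D * T ^ (-α))) / h = 8 * C₁ * (D * T ^ (-1 - α / 2)) := by
        rw [e1, hh]; field_simp; ring
      have k2 : h * (C₂ * (D * T ^ (-2 : ℝ))) = C₂ / 4 * (D * T ^ (-1 - α / 2)) := by
        rw [← e2, hh]; ring
      rw [k1, k2, ← add_mul]
      gcongr
      linarith
  have := Convex.norm_image_sub_le_of_norm_hasDerivWithin_le (f := fun t => v (t, x))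
    (f' := fun t => pd 0 v (t, x)) (C := (8 * C₁ + C₂) * (D * T ^ (-1 - α / 2)))
    (s := Set.Icc (T - T / 2) (T + T / 2)) (x := T) (y := t)
    (fun t _ => (hasDerivAt_time hvs t x).hasDerivWithinAt)
    (fun t ht => hder t (abs_le.2 ⟨by linarith [ht.1], by linarith [ht.2]⟩)) (convex_Icc _ _)
    ⟨by linarith, by linarith⟩ ⟨by linarith [(abs_le.1 ht).1], by linarith [(abs_le.1 ht).2]⟩
  simpa only [Real.norm_eq_abs] using this

/-- Comparison of the energy in a ball at two times. -/
lemma setIntegral_nSq_le (hφ : ContDiff ℝ ∞ φ) {k : ℕ} {t t' r e : ℝ}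
    (h : ∀ x : Space, ‖x‖ ≤ r → ∀ l : List (Fin 3), l.length ≤ k → |spd φ l (t, x) - spd φ l (t', x)| ≤ e) :
    ∫ x in Metric.closedBall (0 : Space) r, nSq k φ t x ≤
      2 * (∫ x in Metric.closedBall (0 : Space) r, nSq k φ t' x)
        + 2 * ((spIdx k).card * volume.real (Metric.closedBall (0 : Space) r)) * e ^ 2 := by
  have hc := isCompact_closedBall (0 : Space) r
  have hi : ∀ t, IntegrableOn (nSq k φ t) (Metric.closedBall (0 : Space) r) := fun t =>
    (continuous_nSq hφ k t).continuousOn.integrableOn_compact hc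
  have hconst : IntegrableOn (fun _ : Space => 2 * ((spIdx k).card : ℝ) * e ^ 2) (Metric.closedBall (0 : Space) r) :=
    continuousOn_const.integrableOn_compact hc
  calc ∫ x in Metric.closedBall (0 : Space) r, nSq k φ t x
      ≤ ∫ x in Metric.closedBall (0 : Space) r, (2 * nSq k φ t' x + 2 * ((spIdx k).card : ℝ) * e ^ 2) := by
        refine setIntegral_mono_on (hi t) (((hi t').const_mul 2).add hconst) measurableSet_closedBall
          fun x hx => ?_
        have hl : ∀ l ∈ spIdx k, spd φ l (t, x) ^ 2 ≤ 2 * spd φ l (t', x) ^ 2 + 2 * e ^ 2 := fun l hl => by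
          have h1 := h x (by simpa using hx) l (mem_spIdx.1 hl)
          have h2 := sq_le_sq' (by linarith [(abs_le.1 h1).1]) (abs_le.1 h1).2
          nlinarith [sq_nonneg (spd φ l (t, x) - 2 * spd φ l (t', x))]
        refine (Finset.sum_le_sum hl).trans_eq ?_
        rw [Finset.sum_add_distrib, Finset.sum_const, nsmul_eq_mul, ← Finset.mul_sum, nSq]; ring
    _ = _ := by
        rw [integral_add ((hi t').const_mul 2) hconst, integral_const_mul]
        simp; ring

/-! ### Improving the rate of decay -/

variable {g : Spacetime → Matrix (Fin 4) (Fin 4) ℝ} {A : Fin 4 → Spacetime → ℝ}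
  {V φ : Spacetime → ℝ}

/-- With c = ρ², the window length L = T^λ satisfies ρ² ≤ L, as the cutoff bounds require, and 4L ≤
T, so that all times of the window are comparable to T. -/
lemma eventually_scale {lam c : ℝ} (h0 : 0 < lam) (h1 : lam < 1) :
    ∀ᶠ T : ℝ in Filter.atTop, c ≤ T ^ lam ∧ 4 * T ^ lam ≤ T := by
  filter_upwards [(tendsto_rpow_atTop h0).eventually_ge_atTop c,
    (tendsto_rpow_atTop (sub_pos.2 h1)).eventually_ge_atTop 4, Filter.eventually_gt_atTop 0] with T h2 h3 hT
  refine ⟨h2, ?_⟩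
  calc 4 * T ^ lam ≤ T ^ (1 - lam) * T ^ lam := by gcongr
    _ = T := by rw [← Real.rpow_add hT]; simp

/-- N is the energy at time T and S its possible variation during the window, which enters both the
lower bound N/2 - S and the upper bound 2N + 2S. With X ≤ 1/8 the right side takes at most N/4. -/
lemma absorb_energy {N S E X Y Z : ℝ} (hN : 0 ≤ N) (hS : 0 ≤ S) (hX : X ≤ 1 / 8)
    (h : N / 2 - S ≤ X * (2 * N + 2 * S) + Y + Z) (hE : 6 * S + 4 * Y + 4 * Z ≤ E) : N ≤ E := by
  have := mul_le_mul_of_nonneg_right hX (by positivity : 0 ≤ 2 * N + 2 * S)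
  linarith

set_option maxHeartbeats 1000000 in
/-- One round of the iteration: local energy decay improves the rate of decay in a large ball. -/
theorem exists_improve_decay (hc : SmoothCoeffs g A V) (hled : WeakLED g A V ∨ StationaryLED g A V)
    {s : ℝ} (hs : 0 < s) (hs1 : s ≤ 1) {k : ℕ} (hk : k + 5 ≤ 16) {Cc : ℝ} (hCc : 0 ≤ Cc)
    (hb : CoeffBounds (k + 5) Cc s g A V) :
    ∃ j₀ : ℕ, ∀ j, j₀ ≤ j → ∀ (n : ℕ) (α lam α' : ℝ), 0 ≤ α → α ≤ 1 → 0 < lam → lam < 1 → α' ≤ 1 →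
      α' ≤ α + lam → α' ≤ 1 + α / 2 - lam → InnerDecay g A V n (k + 5) (2 * 2 ^ j) α →
      InnerDecay g A V (n + 1) k (2 ^ j - 2) α' := by
  have hb' : CoeffBounds (k + 3 + 1) Cc s g A V :=
    ⟨fun α β l hl => hb.metric α β l (by omega), fun μ l hl => hb.first μ l (by omega),
      fun l hl => hb.potential l (by omega)⟩
  obtain ⟨Ce, R, Te, hCe, hR, hTe, hext⟩ := exists_exterior_bounds hc hs hs1 (k := k + 3) (by omega) hCc hb'
  -- The ball of radius 2^{J+1} contains the one in which the exterior bound measures the solution.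
  -- J is fixed before the truncation radius ρ = 2^j, so the constant CJ does not depend on ρ.
  obtain ⟨J, hJ⟩ : ∃ J : ℕ, 32 * R ≤ 2 ^ (J + 1) := by
    obtain ⟨J, hJ⟩ := pow_unbounded_of_one_lt (32 * R) (by norm_num : (1 : ℝ) < 2)
    exact ⟨J, hJ.le.trans (pow_le_pow_right₀ (by norm_num) (Nat.le_succ J))⟩
  obtain ⟨CJ, hCJ, hlocJ⟩ := exists_local_energy_bound hc hled hs (k := k + 3) hCc hb J
  obtain ⟨Csob, hCsob, hsob⟩ := sobolev_unit
  -- From here on ρ is so large that CJ·Ce·ρ^{-s/2} ≤ 1/8, whatever α and λ are.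
  obtain ⟨j₁, hj₁⟩ := pow_unbounded_of_one_lt ((4 * (2 * (CJ * Ce)) + 1) ^ (2 / s)) (by norm_num : (1 : ℝ) < 2)
  refine ⟨J + 1 + j₁, fun j hj n α lam α' hα0 hα1 hl0 hl1 ha1 ha2 ha3 hin => ?_⟩
  set ρ : ℝ := 2 ^ j with hρ
  have hJρ : (2 : ℝ) ^ (J + 1) ≤ ρ := pow_le_pow_right₀ (by norm_num) (by omega)
  have hRρ : 32 * R ≤ ρ := hJ.trans hJρ
  have hρ1 : 1 ≤ ρ := by linarith
  have hsmall : CJ * Ce * ρ ^ (-(s / 2)) ≤ 1 / 8 := by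
    have := rpow_neg_le_of_ge (C := 2 * (CJ * Ce)) (by positivity) hs
      (hj₁.le.trans (pow_le_pow_right₀ (by norm_num) (by omega) : (2 : ℝ) ^ j₁ ≤ ρ))
    linarith
  have hj1 : j - 1 + 1 = j := by omega
  -- The local energy bound is used twice with the same truncation: for the fixed ball, where the
  -- shell term is absorbed, and then for the ball of radius ρ itself, where it is already known and
  -- the constant may depend on j.
  obtain ⟨CnJ, hCnJ, hlJ⟩ := hlocJ j (by omega)
  obtain ⟨Cj, hCj, hlocj⟩ := exists_local_energy_bound hc hled hs (k := k + 3) hCc hb (j - 1)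
  obtain ⟨Cnj, hCnj, hlj⟩ := hlocj j hj1.le
  obtain ⟨C₁, T₁, hC₁, hT₁, hbnd⟩ := hin.exists_bounds (k := k + 3) (by omega) (by linarith) hα0 hα1
  obtain ⟨T₂, hT₂⟩ := Filter.eventually_atTop.1 (eventually_scale (c := ρ ^ 2) hl0 hl1)
  set cd : ℝ := ((spIdx (k + 3)).card : ℝ) with hcd
  set vJ := volume.real (Metric.closedBall (0 : Space) (2 ^ (J + 1))) with hvJ
  set vj := volume.real (Metric.closedBall (0 : Space) (2 ^ (j - 1 + 1))) with hvj
  set q := ρ ^ (s / 2) with hq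
  have hq0 : 0 ≤ q := by positivity
  set KJ := 6 * (cd * vJ * (2 * C₁) ^ 2) + 4 * (CJ * (Ce * (q * 4))) + 4 * (CnJ * (2 * C₁) ^ 2) with hKJ
  have hKJ0 : 0 ≤ KJ := by positivity
  set Kj := 2 * (cd * vj * (2 * C₁) ^ 2 + Cj * (Ce * (2 * KJ + 2 * (cd * vJ * (2 * C₁) ^ 2) + q * 4))
    + Cnj * (2 * C₁) ^ 2) with hKj
  have hKj0 : 0 ≤ Kj := by positivity
  refine ⟨Real.sqrt (Csob * Kj), max (max T₁ T₂) (max (2 * Te) (32 * ρ)), Real.sqrt_nonneg _, ?_⟩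
  intro φ D T hT hφ x hx l hl
  have hTT₁ : T₁ ≤ T := ((le_max_left _ _).trans (le_max_left _ _)).trans hT
  have hTT₂ : T₂ ≤ T := ((le_max_right _ _).trans (le_max_left _ _)).trans hT
  have hTTe : 2 * Te ≤ T := ((le_max_left _ _).trans (le_max_right _ _)).trans hT
  have hTρ : 32 * ρ ≤ T := ((le_max_right _ _).trans (le_max_right _ _)).trans hT
  have hT0 : 0 < T := by linarith
  have hT1 : 1 ≤ T := by linarith
  obtain ⟨hL1, hL2⟩ := hT₂ T hTT₂
  obtain ⟨hw, hslow⟩ := hbnd φ D T hTT₁ hφ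
  have hD := hφ.nonneg
  have hφs := hφ.smooth
  set L := T ^ lam with hL
  have hL0 : 0 < L := by positivity
  set E := D * T ^ (-α') with hE
  have hE0 : 0 ≤ E := by positivity
  have hexp : ∀ {p : ℝ}, p ≤ -α' → D * T ^ p ≤ E := fun hp =>
    mul_le_mul_of_nonneg_left (Real.rpow_le_rpow_of_exponent_le hT1 hp) hD
  have hDT : D * T⁻¹ ≤ E := by rw [← Real.rpow_neg_one]; exact hexp (by linarith)
  -- The source in the cylinder has the rates α + λ and 1, both at least α'.
  have hb1 : L⁻¹ * (C₁ * (D * T ^ (-α))) + C₁ * (D * T⁻¹) ≤ 2 * C₁ * E := by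
    have e1 : L⁻¹ * (C₁ * (D * T ^ (-α))) = C₁ * (D * T ^ (-lam + -α)) := by
      rw [Real.rpow_add hT0, hL, Real.rpow_neg hT0.le lam]; ring
    rw [e1]
    have h1 := mul_le_mul_of_nonneg_left (hexp (p := -lam + -α) (by linarith)) hC₁
    have h2 := mul_le_mul_of_nonneg_left hDT hC₁
    linarith
  have hb0 : 0 ≤ L⁻¹ * (C₁ * (D * T ^ (-α))) + C₁ * (D * T⁻¹) := by positivity
  have hbsq : (L⁻¹ * (C₁ * (D * T ^ (-α))) + C₁ * (D * T⁻¹)) ^ 2 ≤ (2 * C₁) ^ 2 * E ^ 2 := by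
    rw [← mul_pow]; exact pow_le_pow_left₀ hb0 hb1 2
  have hwin : ∀ t, |t - T| ≤ 2 * L → |t - T| ≤ T / 2 := fun t ht => ht.trans (by linarith)
  -- The variation during the window is at most L·T^{-1-α/2}. This is the rate 1 + α/2 - λ.
  have hsl : ∀ t, |t - T| ≤ 2 * L → ∀ x : Space, ‖x‖ ≤ ρ → ∀ l : List (Fin 3), l.length ≤ k + 3 →
      |spd φ l (t, x) - spd φ l (T, x)| ≤ 2 * C₁ * E := by
    intro t ht x hx l hl
    refine (hslow t x (hwin t ht) (by linarith) l hl).trans ?_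
    calc C₁ * (D * T ^ (-1 - α / 2)) * |t - T| ≤ C₁ * (D * T ^ (-1 - α / 2)) * (2 * L) := by gcongr
      _ = 2 * C₁ * (D * T ^ (-1 - α / 2 + lam)) := by rw [Real.rpow_add hT0]; ring
      _ ≤ 2 * C₁ * E := by gcongr; exact hexp (by linarith)
  set I : ℝ → ℝ → ℝ := fun r t => ∫ x in Metric.closedBall (0 : Space) r, nSq (k + 3) φ t x with hI
  have hI0 : ∀ r t, 0 ≤ I r t := fun r t => integral_nonneg fun x => nSq_nonneg _ _ _ _
  have hcmp : ∀ r ≤ ρ, ∀ t, |t - T| ≤ 2 * L →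
      I r t ≤ 2 * I r T + 2 * (cd * volume.real (Metric.closedBall (0 : Space) r) * (2 * C₁) ^ 2 * E ^ 2) ∧
      I r T / 2 - cd * volume.real (Metric.closedBall (0 : Space) r) * (2 * C₁) ^ 2 * E ^ 2 ≤ I r t := by
    intro r hr t ht
    have h1 := setIntegral_nSq_le hφs (k := k + 3) (t := t) (t' := T) (r := r) (e := 2 * C₁ * E)
      (fun x hx l hl => hsl t ht x (hx.trans hr) l hl)
    have h2 := setIntegral_nSq_le hφs (k := k + 3) (t := T) (t' := t) (r := r) (e := 2 * C₁ * E)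
      (fun x hx l hl => by rw [abs_sub_comm]; exact hsl t ht x (hx.trans hr) l hl)
    rw [mul_pow _ E] at h1 h2
    constructor <;> simp only [hI] <;> linarith
  set SJ := cd * vJ * (2 * C₁) ^ 2 * E ^ 2 with hSJ
  set P := Ce * (ρ ^ (-(s / 2)) * (2 * I (2 ^ (J + 1)) T + 2 * SJ) + q * (4 * E ^ 2)) with hP
  have hSJ0 : 0 ≤ SJ := by positivity
  have hP0 : 0 ≤ P := by have := hI0 (2 ^ (J + 1)) T; positivity
  have hPt : ∀ t, |t - T| ≤ 2 * L → ∫ x in annulus (2 ^ j) (2 * 2 ^ j),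
      ((2 ^ j)⁻¹ * gradSq (spIdx (k + 3 + 1)) (spd φ) t x + (2 ^ j)⁻¹ ^ 3 * φ (t, x) ^ 2) ≤ P := by
    intro t ht
    have ht' := abs_le.1 (hwin t ht)
    have h2n : (1 : ℝ) ≤ 2 ^ n := one_le_pow₀ (by norm_num)
    refine ((hext φ D t hφs hφ.eqn hD (by linarith) (fun x hx => ?_)).2 ρ (by linarith)
      (by linarith)).trans ?_
    · refine (hφ.bound (t, x) ?_ ?_ hx).mono (by omega) le_rfl
      · simp only
        calc T / 2 ^ (n + 1) ≤ T / 2 := by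
              rw [pow_succ]
              exact div_le_div_of_nonneg_left hT0.le (by norm_num) (by linarith)
          _ ≤ t := by linarith
      · simp only
        have := mul_le_mul_of_nonneg_right h2n hT0.le
        rw [pow_succ]
        linarith
    · rw [hP]
      have h1 : I (32 * R) t ≤ I (2 ^ (J + 1)) t :=
        setIntegral_mono_set ((continuous_nSq hφs _ t).continuousOn.integrableOn_compact
          (isCompact_closedBall _ _)) (Filter.Eventually.of_forall fun x => nSq_nonneg _ _ _ _)
          (Metric.closedBall_subset_closedBall hJ).eventuallyLE
      have h2 := (hcmp _ hJρ t ht).1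
      have h3 : (D * t⁻¹) ^ 2 ≤ 4 * E ^ 2 := by
        have h4 : t⁻¹ ≤ 2 * T⁻¹ := by
          rw [← one_div, ← div_eq_mul_inv, div_le_div_iff₀ (by linarith) hT0]; linarith
        have h5 : D * t⁻¹ ≤ 2 * E := by
          have := mul_le_mul_of_nonneg_left h4 hD; linarith
        exact (pow_le_pow_left₀ (mul_nonneg hD (inv_nonneg.2 (by linarith))) h5 2).trans_eq (by ring)
      gcongr
      exact h1.trans h2
  have hNb : ∀ z : Spacetime, |z.1 - T| ≤ 2 * L → ‖z.2‖ ≤ 2 * 2 ^ j → ∀ m : List (Fin 4),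
      m.length ≤ k + 3 + 2 → |pdl m φ z| ≤ C₁ * (D * T ^ (-α)) ∧
        ((0 : Fin 4) ∈ m → |pdl m φ z| ≤ C₁ * (D * T⁻¹)) :=
    fun z hz hz' m hm => hw z.1 z.2 (hwin _ hz) hz' m hm
  -- The shell energy P contains the energy of the same ball with the factor ρ^{-s/2}, and it is
  -- absorbed here.
  have hNJ : I (2 ^ (J + 1)) T ≤ KJ * E ^ 2 := by
    have h1 := hlJ φ T L _ _ P (I (2 ^ (J + 1)) T / 2 - SJ) hφs hφ.eqn hL1 (by linarith) hP0 hNb hPt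
      (fun t ht => (hcmp _ hJρ t (by linarith)).2)
    have h2 := mul_le_mul_of_nonneg_left hbsq hCnJ
    refine absorb_energy (S := SJ) (X := CJ * Ce * ρ ^ (-(s / 2))) (Y := CJ * (Ce * (q * 4)) * E ^ 2)
      (Z := CnJ * ((2 * C₁) ^ 2 * E ^ 2)) (hI0 _ _) hSJ0 hsmall ?_ ?_
    · refine (h1.trans (add_le_add_right h2 _)).trans_eq ?_
      rw [hP]; ring
    · rw [hKJ, hSJ]; exact le_of_eq (by ring)
  have hNj : I ρ T ≤ Kj * E ^ 2 := by
    have h1 := hlj φ T L _ _ P (I (2 ^ (j - 1 + 1)) T / 2 - cd * vj * (2 * C₁) ^ 2 * E ^ 2) hφs hφ.eqn hL1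
      (by linarith) hP0 hNb hPt (fun t ht => (hcmp _ (by rw [hj1]) t (by linarith)).2)
    have h2 := mul_le_mul_of_nonneg_left hbsq hCnj
    have h3 : P ≤ Ce * (2 * KJ + 2 * (cd * vJ * (2 * C₁) ^ 2) + q * 4) * E ^ 2 := by
      have h4 : ρ ^ (-(s / 2)) * (2 * I (2 ^ (J + 1)) T + 2 * SJ) ≤ 2 * (KJ * E ^ 2) + 2 * SJ := by
        refine (mul_le_of_le_one_left (by have := hI0 (2 ^ (J + 1)) T; positivity)
          (Real.rpow_le_one_of_one_le_of_nonpos hρ1 (by linarith))).trans ?_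
        linarith
      rw [hP, mul_assoc]
      refine mul_le_mul_of_nonneg_left ?_ hCe
      rw [hSJ] at h4 ⊢
      linarith
    have h5 := mul_le_mul_of_nonneg_left h3 hCj
    have h6 : I ρ T = I (2 ^ (j - 1 + 1)) T := by rw [hj1]
    rw [h6, hKj]
    linarith
  -- Sobolev costs three derivatives and an enlargement of the ball by 2; hence order k + 3 for the
  -- energy and the radius 2^j - 2 in the conclusion.
  have hfin : spd φ l (T, x) ^ 2 ≤ Csob * Kj * E ^ 2 := by
    have hqc := continuous_nSq hφs (k + 3) T
    refine (hsob (spd φ l) (contDiff_spd hφs l) T x (nSq (k + 3) φ T) hqc.continuousOn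
      (fun y _ l' hl' => ?_)).trans ?_
    · obtain ⟨l₀, h0, rfl⟩ := sublist_map_succ (l := [0, 1, 2]) (l' := l') hl'
      have : pdl (l₀.map Fin.succ) (spd φ l) = spd φ (l ++ l₀) := by
        rw [spd, spd, List.map_append, pdl_append]
      rw [this]
      refine sq_le_nSq ?_ φ T y
      simp at h0 ⊢; omega
    · rw [mul_assoc]
      refine mul_le_mul_of_nonneg_left (le_trans ?_ hNj) hCsob
      refine setIntegral_mono_set (hqc.continuousOn.integrableOn_compact
          (isCompact_closedBall _ _)) (Filter.Eventually.of_forall fun x => nSq_nonneg _ _ _ _)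
          (Metric.closedBall_subset_closedBall' ?_).eventuallyLE
      rw [dist_zero_right]; linarith
  rw [← Real.sqrt_sq hE0, ← Real.sqrt_mul (by positivity)]
  exact Real.abs_le_sqrt hfin

/-! ### Iteration, weights and conclusion -/

variable {g : Spacetime → Matrix (Fin 4) (Fin 4) ℝ} {A : Fin 4 → Spacetime → ℝ}
  {V φ : Spacetime → ℝ}

lemma CoeffBounds.mono {n n' : ℕ} (hn : n ≤ n') {C s : ℝ} (hb : CoeffBounds n' C s g A V) :
    CoeffBounds n C s g A V :=
  ⟨fun α β l hl => hb.metric α β l (hl.trans hn), fun μ l hl => hb.first μ l (hl.trans hn),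
    fun l hl => hb.potential l (hl.trans hn)⟩

lemma innerDecay_zero (r : ℝ) : InnerDecay g A V 0 16 r 0 := by
  refine ⟨1, max 0 (2 * r), zero_le_one, fun φ D T hT hφ x hx l hl => ?_⟩
  have h1 : 2 * r ≤ T := (le_max_right _ _).trans hT
  have := (hφ.bound (T, x) (by simp) (by simp) (by simp only; linarith)).base (l.map Fin.succ) (by simpa using hl)
  refine this.trans ?_
  simp only [neg_zero, Real.rpow_zero, mul_one, one_mul]
  exact mul_le_of_le_one_right hφ.nonneg (inv_le_one_of_one_le₀ (one_le_jb _))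

lemma InnerDecay.mono {n m : ℕ} {r r' α : ℝ} (hr : r' ≤ r) (h : InnerDecay g A V n m r α) :
    InnerDecay g A V n m r' α := by
  obtain ⟨K, T₀, hK, h⟩ := h
  exact ⟨K, T₀, hK, fun φ D T hT hφ x hx => h φ D T hT hφ x (hx.trans hr)⟩

/-- Decay at the rate `1/t` of a solution that is controlled by `D/⟨r⟩` in the region `r ≤ t/2`. -/
theorem exists_interior_decay (hc : SmoothCoeffs g A V) (hled : WeakLED g A V ∨ StationaryLED g A V)
    {s : ℝ} (hs : 0 < s) (hs1 : s ≤ 1) {Cc : ℝ} (hCc : 0 ≤ Cc) (hb : CoeffBounds 16 Cc s g A V) :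
    ∃ K T₀ : ℝ, 0 ≤ K ∧ ∀ (φ : Spacetime → ℝ) (D T : ℝ), T₀ ≤ T →
      Controlled g A V φ D (T / 8) (8 * T) → ∀ x : Space, ‖x‖ ≤ T / 2 → |φ (T, x)| ≤ K * (D * T⁻¹) := by
  -- Every round costs five derivatives, so three rounds descend from 16 through 11 and 6 to 1. One
  -- derivative must be left for the exterior bound with k = 1.
  obtain ⟨j₁, h₁⟩ := exists_improve_decay hc hled hs hs1 (k := 11) (by norm_num) hCc hb
  obtain ⟨j₂, h₂⟩ := exists_improve_decay hc hled hs hs1 (k := 6) (by norm_num) hCc (hb.mono (by norm_num))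
  obtain ⟨j₃, h₃⟩ := exists_improve_decay hc hled hs hs1 (k := 1) (by norm_num) hCc (hb.mono (by norm_num))
  obtain ⟨Ce, R, Te, hCe, hR, hTe, hext⟩ := exists_exterior_bounds hc hs hs1 (k := 1) le_rfl hCc
    (hb.mono (by norm_num))
  obtain ⟨j₄, h₄⟩ := pow_unbounded_of_one_lt (32 * R + 2) (by norm_num : (1 : ℝ) < 2)
  set j := j₁ + j₂ + j₃ + j₄ with hj
  have hp : (1 : ℝ) ≤ 2 ^ j := one_le_pow₀ (by norm_num)
  have hjR : 32 * R ≤ 2 ^ j - 2 := by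
    have : (2 : ℝ) ^ j₄ ≤ 2 ^ j := pow_le_pow_right₀ (by norm_num) (by omega)
    linarith
  -- A round passes from radius 2·2^i to radius 2^i - 2. Lowering the exponent by 2 between rounds
  -- makes the output of one contain the ball needed by the next.
  have hrad : ∀ i : ℕ, (2 : ℝ) * 2 ^ (j + i) ≤ 2 ^ (j + i + 2) - 2 := fun i => by
    have : (1 : ℝ) ≤ 2 ^ (j + i) := one_le_pow₀ (by norm_num)
    rw [pow_add 2 (j + i) 2]; linarith
  -- The exponents α → α' with window exponent λ are 0 → 1/2 with 1/2, 1/2 → 7/8 with 3/8, and 7/8 →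
  -- 1 with 1/4. In the first two rounds λ = 1/2 - α/4 balances α + λ against 1 + α/2 - λ. Each
  -- round doubles the range of times, whence T/8 and 8T.
  have d₁ := h₁ (j + 2 + 2) (by omega) 0 0 (1 / 2) (1 / 2) (by norm_num) (by norm_num) (by norm_num)
    (by norm_num) (by norm_num) (by norm_num) (by norm_num) (innerDecay_zero _)
  have d₂ := h₂ (j + 0 + 2) (by omega) 1 (1 / 2) (3 / 8) (7 / 8) (by norm_num) (by norm_num) (by norm_num)
    (by norm_num) (by norm_num) (by norm_num) (by norm_num) (d₁.mono (hrad 2))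
  obtain ⟨K, T₀, hK, hdec⟩ := h₃ (j + 0) (by omega) 2 (7 / 8) (1 / 4) 1 (by norm_num) (by norm_num)
    (by norm_num) (by norm_num) (by norm_num) (by norm_num) (by norm_num) (d₂.mono (hrad 0))
  set cv : ℝ := ((spIdx 1).card : ℝ) * volume.real (Metric.closedBall (0 : Space) (32 * R)) with hcv
  have hcv0 : 0 ≤ cv := by positivity
  refine ⟨K + Real.sqrt (Ce * (1 + cv * K ^ 2)), max T₀ Te, by positivity, ?_⟩
  intro φ D T hT hφ x hx
  have hT1 : T₀ ≤ T := (le_max_left _ _).trans hT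
  have hT2 : Te ≤ T := (le_max_right _ _).trans hT
  have hT0 : 0 < T := by linarith
  have hφ' : Controlled g A V φ D (T / 2 ^ 3) (2 ^ 3 * T) := by norm_num; exact hφ
  have hin := hdec φ D T hT1 hφ'
  have hE0 : 0 ≤ D * T⁻¹ := mul_nonneg hφ.nonneg (inv_nonneg.2 hT0.le)
  rw [Real.rpow_neg_one] at hin
  have hS := Real.sqrt_nonneg (Ce * (1 + cv * K ^ 2))
  rcases le_total ‖x‖ (2 ^ j - 2) with hxj | hxj
  · refine (hin x hxj [] (by simp)).trans ?_
    gcongr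
    linarith
  -- Outside the ball the exterior bound applies. Its right-hand side is D/T and the energy in
  -- radius 32R, and there the iteration has just given the rate 1 for φ and its first space
  -- derivatives.
  · have h5 := (hext φ D T hφ.smooth hφ.eqn hφ.nonneg hT2 (fun x hx => (hφ.bound (T, x)
      (by simp only; linarith) (by simp only; linarith) hx).mono (by norm_num) le_rfl)).1 x
      ⟨by linarith, hx⟩
    have h6 : ∫ x in Metric.closedBall (0 : Space) (32 * R), nSq 1 φ T x ≤ cv * K ^ 2 * (D * T⁻¹) ^ 2 := by
      have hcpt := isCompact_closedBall (0 : Space) (32 * R)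
      have h7 : ∀ x ∈ Metric.closedBall (0 : Space) (32 * R), nSq 1 φ T x ≤
          (spIdx 1).card * (K * (D * T⁻¹)) ^ 2 := fun x hx => by
        refine (Finset.sum_le_card_nsmul _ _ ((K * (D * T⁻¹)) ^ 2) fun l hl => ?_).trans_eq
          (by rw [nsmul_eq_mul])
        rw [← sq_abs]
        exact pow_le_pow_left₀ (abs_nonneg _) (hin x ((mem_closedBall_zero_iff.1 hx).trans hjR) l
          (mem_spIdx.1 hl)) 2
      refine (setIntegral_mono_on ((continuous_nSq hφ.smooth 1 T).continuousOn.integrableOn_compact hcpt)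
        (continuousOn_const.integrableOn_compact hcpt) measurableSet_closedBall h7).trans_eq ?_
      simp [hcv]; ring
    have h8 : φ (T, x) ^ 2 ≤ Ce * (1 + cv * K ^ 2) * (D * T⁻¹) ^ 2 := by
      refine h5.trans ?_
      rw [mul_assoc]
      refine mul_le_mul_of_nonneg_left ?_ hCe
      linarith
    have h9 := Real.abs_le_sqrt h8
    rw [Real.sqrt_mul (by positivity), Real.sqrt_sq hE0] at h9
    refine h9.trans ?_
    gcongr
    linarith

lemma rpow_le_of_comparable {a b c : ℝ} (ha : 0 < a) (hb : 0 < b) (hc : 1 ≤ c) (h1 : a ≤ c * b)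
    (h2 : b ≤ c * a) (y : ℝ) : a ^ y ≤ c ^ |y| * b ^ y := by
  have hc0 : 0 < c := by linarith
  rcases le_total 0 y with hy | hy
  · rw [abs_of_nonneg hy, ← Real.mul_rpow hc0.le hb.le]
    exact Real.rpow_le_rpow ha.le h1 hy
  · have h3 : c⁻¹ * b ≤ a := by rw [inv_mul_le_iff₀ hc0]; exact h2
    refine (Real.rpow_le_rpow_of_nonpos (by positivity) h3 hy).trans_eq ?_
    rw [Real.mul_rpow (by positivity) hb.le, abs_of_nonpos hy, Real.inv_rpow hc0.le, Real.rpow_neg hc0.le]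

lemma jb_le_mul {a b c : ℝ} (hc : 1 ≤ c) (h : |a| ≤ c * |b|) : jb a ≤ c * jb b := by
  rw [jb, Real.sqrt_le_left (by have := jb_pos b; positivity), mul_pow, jb_sq]
  have h1 := pow_le_pow_left₀ (abs_nonneg a) h 2
  rw [mul_pow, sq_abs, sq_abs] at h1
  nlinarith

/-- The weight of one term of the hypothesis in the region `r ≤ t/2`, at times comparable to `t`. -/
lemma weight_le {p q η t t' r : ℝ} (hp : p ≤ 1) (ht : 0 ≤ t) (h1 : t / 8 ≤ t') (h2 : t' ≤ 8 * t)
    (hr0 : 0 ≤ r) (hr : r ≤ t' / 2) :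
    jb r ^ (-p) * jb t' ^ (-q) * jb (t' - r) ^ (-η) ≤
      8 ^ |1 - p| * 8 ^ |q| * 16 ^ |η| * jb t ^ (1 - p - q - η) * (jb r)⁻¹ := by
  have hj := jb_pos r
  have hjt := jb_pos t
  have a1 : jb r ≤ 8 * jb t := jb_le_mul (by norm_num) (by
    rw [abs_of_nonneg hr0, abs_of_nonneg ht]; linarith)
  have a2 : jb t' ≤ 8 * jb t := jb_le_mul (by norm_num) (by
    rw [abs_of_nonneg (by linarith), abs_of_nonneg ht]; linarith)
  have a3 : jb t ≤ 8 * jb t' := jb_le_mul (by norm_num) (by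
    rw [abs_of_nonneg (a := t') (by linarith), abs_of_nonneg ht]; linarith)
  have a4 : jb (t' - r) ≤ 16 * jb t := jb_le_mul (by norm_num) (by
    rw [abs_of_nonneg (by linarith), abs_of_nonneg ht]; linarith)
  have a5 : jb t ≤ 16 * jb (t' - r) := jb_le_mul (by norm_num) (by
    rw [abs_of_nonneg (a := t' - r) (by linarith), abs_of_nonneg ht]; linarith)
  -- The hypothesis p ≤ 1 enters here: ⟨r⟩^{1-p} is increasing in r and may be replaced by its value
  -- at r ~ t.
  have b1 : jb r ^ (-p) ≤ 8 ^ |1 - p| * jb t ^ (1 - p) * (jb r)⁻¹ := by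
    have e : jb r ^ (-p) = jb r ^ (1 - p) * (jb r)⁻¹ := by
      rw [← Real.rpow_neg_one, ← Real.rpow_add hj]; congr 1; ring
    rw [e]
    gcongr
    rw [abs_of_nonneg (by linarith), ← Real.mul_rpow (by norm_num) hjt.le]
    exact Real.rpow_le_rpow hj.le a1 (by linarith)
  have b2 := rpow_le_of_comparable (jb_pos t') hjt (by norm_num) a2 a3 (-q)
  have b3 := rpow_le_of_comparable (jb_pos (t' - r)) hjt (by norm_num) a4 a5 (-η)
  rw [abs_neg] at b2 b3
  have e : jb t ^ (1 - p - q - η) = jb t ^ (1 - p) * jb t ^ (-q) * jb t ^ (-η) := by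
    rw [← Real.rpow_add hjt, ← Real.rpow_add hjt]; congr 1
  calc jb r ^ (-p) * jb t' ^ (-q) * jb (t' - r) ^ (-η)
      ≤ 8 ^ |1 - p| * jb t ^ (1 - p) * (jb r)⁻¹ * (8 ^ |q| * jb t ^ (-q)) * (16 ^ |η| * jb t ^ (-η)) := by
        have h3 : 0 ≤ jb t' ^ (-q) := (Real.rpow_pos_of_pos (jb_pos _) _).le
        have h4 : 0 ≤ jb (t' - r) ^ (-η) := (Real.rpow_pos_of_pos (jb_pos _) _).le
        gcongr
    _ = _ := by rw [e]; ring

/-- Finite sums of bounds. -/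
theorem exists_decay_sum {σ δ : ℝ} (hσ : 0 < σ) (hδ : 0 < δ) (hadm : AdmissibleCoeffs σ δ g A V)
    (hled : WeakLED g A V ∨ StationaryLED g A V) {k : ℕ} (hk : 1 ≤ k) (p q η : Fin k → ℝ)
    (hp : ∀ j, p j ≤ 1) :
    ∃ K : ℝ, ∀ (φ₀ φ₁ : Space → ℝ) (φ : Spacetime → ℝ), SolvesMain g A V φ₀ φ₁ φ → ∀ C : ℝ,
      BoundUpTo 28 φ C (fun z => ∑ j, jb ‖z.2‖ ^ (-p j) * jb z.1 ^ (-q j) * jb (z.1 - ‖z.2‖) ^ (-η j)) →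
      ∀ z : Spacetime, 0 ≤ z.1 → ((∀ j, 0 ≤ p j) ∨ ‖z.2‖ ≤ z.1) →
        |φ z| ≤ K * C * ∑ j, jb z.1 ^ (-p j - q j) * jb (z.1 - ‖z.2‖) ^ (-η j) := by
  -- A single exponent for all coefficients; the cap at 1 keeps s within the range of the kernel
  -- estimates.
  set s := min (min σ δ) 1 with hs
  have hs0 : 0 < s := by positivity
  obtain ⟨Cc, hCc, hb⟩ := hadm.coeffBounds (s := s) ((min_le_left _ _).trans (min_le_left _ _))
    ((min_le_left _ _).trans (min_le_right _ _)) 16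
  obtain ⟨Kc, T₀, hKc, hcore⟩ := exists_interior_decay hadm.smoothCoeffs hled hs0 (min_le_right _ _) hCc hb
  have hjp : ∀ a y : ℝ, 0 ≤ jb a ^ y := fun a y => (Real.rpow_pos_of_pos (jb_pos a) y).le
  set c₀ := 2 + |T₀| with hc₀
  have hc₀1 : 1 ≤ c₀ := by have := abs_nonneg T₀; linarith
  set Ka : Fin k → ℝ := fun j => c₀ ^ |p j| with hKa
  set Kb : Fin k → ℝ := fun j => 8 ^ |1 - p j| * 8 ^ |q j| * 16 ^ |η j| with hKb
  have hKa0 : ∀ j, 0 ≤ Ka j := fun j => by positivity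
  have hKb0 : ∀ j, 0 ≤ Kb j := fun j => by positivity
  refine ⟨(∑ j, Ka j) + Kc * (2 * ∑ j, Kb j * 2 ^ |η j|), fun φ₀ φ₁ φ hφ C hC z hz hpz => ?_⟩
  set w : Spacetime → ℝ := fun z => ∑ j, jb ‖z.2‖ ^ (-p j) * jb z.1 ^ (-q j) * jb (z.1 - ‖z.2‖) ^ (-η j)
    with hw
  set W := ∑ j, jb z.1 ^ (-p j - q j) * jb (z.1 - ‖z.2‖) ^ (-η j) with hW
  have hterm : ∀ j, 0 ≤ jb z.1 ^ (-p j - q j) * jb (z.1 - ‖z.2‖) ^ (-η j) := fun j =>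
    mul_nonneg (hjp _ _) (hjp _ _)
  have hW0 : 0 ≤ W := Finset.sum_nonneg fun j _ => hterm j
  have hWj : ∀ j, jb z.1 ^ (-p j - q j) * jb (z.1 - ‖z.2‖) ^ (-η j) ≤ W := fun j =>
    Finset.single_le_sum (f := fun j => jb z.1 ^ (-p j - q j) * jb (z.1 - ‖z.2‖) ^ (-η j))
      (fun j _ => hterm j) (Finset.mem_univ j)
  have hwpos : 0 < w z := Finset.sum_pos (fun j _ => mul_pos (mul_pos (Real.rpow_pos_of_pos (jb_pos _) _)
    (Real.rpow_pos_of_pos (jb_pos _) _)) (Real.rpow_pos_of_pos (jb_pos _) _)) ⟨⟨0, hk⟩, Finset.mem_univ _⟩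
  have hφw : |φ z| ≤ C * w z := hC ⟨0, 0, 0⟩ (by simp [VFIndex.len]) z hz
  -- The constant C is not assumed nonnegative; the weight is positive (at least one term, as k ≥
  -- 1), so the bound itself forces the sign.
  have hC0 : 0 ≤ C := by
    by_contra h
    have := mul_neg_of_neg_of_pos (not_le.1 h) hwpos
    linarith [abs_nonneg (φ z)]
  have hSa : 0 ≤ ∑ j, Ka j := Finset.sum_nonneg fun j _ => hKa0 j
  have hSb : 0 ≤ ∑ j, Kb j * 2 ^ |η j| := Finset.sum_nonneg fun j _ => mul_nonneg (hKb0 j) (by positivity)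
  have hjt := jb_pos z.1
  by_cases hreg : max T₀ 1 ≤ z.1 ∧ ‖z.2‖ ≤ z.1 / 2
  · obtain ⟨hT, hx⟩ := hreg
    have hT₀ : T₀ ≤ z.1 := (le_max_left _ _).trans hT
    have hz1 : 1 ≤ z.1 := (le_max_right _ _).trans hT
    -- D collects the weights of all terms at the fixed time t. Dividing by t at the end restores
    -- ⟨t⟩^{-p-q-η}, and ⟨t⟩^{-η} is comparable to ⟨t-r⟩^{-η} because r ≤ t/2.
    set D := C * ∑ j, Kb j * jb z.1 ^ (1 - p j - q j - η j) with hD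
    have hD0 : 0 ≤ D := mul_nonneg hC0 (Finset.sum_nonneg fun j _ => mul_nonneg (hKb0 j) (hjp _ _))
    have hcon : Controlled g A V φ D (z.1 / 8) (8 * z.1) := by
      refine ⟨hφ.smooth, hφ.eqn, hD0, fun y h1 h2 h3 => apriori_of_vf (M := 28) (by norm_num) hφ.smooth
        fun I hI => (hC I hI y (by linarith)).trans ?_⟩
      rw [hD, mul_assoc, Finset.sum_mul]
      refine mul_le_mul_of_nonneg_left (Finset.sum_le_sum fun j _ => ?_) hC0
      exact weight_le (hp j) hz h1 h2 (norm_nonneg _) h3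
    refine (hcore φ D z.1 hT₀ hcon z.2 hx).trans ?_
    have hinv : z.1⁻¹ ≤ 2 * (jb z.1)⁻¹ := by
      have h1 : jb z.1 ≤ 2 * z.1 := by
        have := jb_le_one_add z.1; rw [abs_of_nonneg hz] at this; linarith
      rw [← div_eq_mul_inv, ← one_div, div_le_div_iff₀ (by linarith) hjt]
      linarith
    have hsum : (∑ j, Kb j * jb z.1 ^ (1 - p j - q j - η j)) * (jb z.1)⁻¹ ≤
        (∑ j, Kb j * 2 ^ |η j|) * W := by
      rw [Finset.sum_mul, Finset.sum_mul]
      refine Finset.sum_le_sum fun j _ => ?_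
      have e : jb z.1 ^ (1 - p j - q j - η j) * (jb z.1)⁻¹ = jb z.1 ^ (-p j - q j) * jb z.1 ^ (-η j) := by
        rw [← Real.rpow_neg_one, ← Real.rpow_add hjt, ← Real.rpow_add hjt]; congr 1; ring
      have hcmp := rpow_le_of_comparable hjt (jb_pos (z.1 - ‖z.2‖)) (c := 2) (by norm_num)
        (jb_le_mul (by norm_num) (by rw [abs_of_nonneg hz, abs_of_nonneg (by linarith)]; linarith))
        (jb_le_mul (by norm_num) (by
          rw [abs_of_nonneg hz, abs_of_nonneg (by linarith)]; linarith [norm_nonneg z.2])) (-η j)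
      rw [abs_neg] at hcmp
      rw [mul_assoc (Kb j), mul_assoc (Kb j), e]
      refine mul_le_mul_of_nonneg_left ?_ (hKb0 j)
      calc jb z.1 ^ (-p j - q j) * jb z.1 ^ (-η j)
          ≤ jb z.1 ^ (-p j - q j) * (2 ^ |η j| * jb (z.1 - ‖z.2‖) ^ (-η j)) :=
            mul_le_mul_of_nonneg_left hcmp (hjp _ _)
        _ = 2 ^ |η j| * (jb z.1 ^ (-p j - q j) * jb (z.1 - ‖z.2‖) ^ (-η j)) := by ring
        _ ≤ 2 ^ |η j| * W := mul_le_mul_of_nonneg_left (hWj j) (by positivity)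
    calc Kc * (D * z.1⁻¹) ≤ Kc * (D * (2 * (jb z.1)⁻¹)) := by gcongr
      _ = Kc * (2 * C * ((∑ j, Kb j * jb z.1 ^ (1 - p j - q j - η j)) * (jb z.1)⁻¹)) := by rw [hD]; ring
      _ ≤ Kc * (2 * C * ((∑ j, Kb j * 2 ^ |η j|) * W)) := by gcongr
      _ = Kc * (2 * ∑ j, Kb j * 2 ^ |η j|) * C * W := by ring
      _ ≤ _ := by gcongr; linarith
  -- In the remaining region either r > t/2 or t is below a fixed bound. In both cases ⟨t⟩ is at
  -- most a constant times ⟨r⟩, and no decay has to be gained.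
  · have hcmp : jb z.1 ≤ c₀ * jb ‖z.2‖ := by
      by_cases hx : ‖z.2‖ ≤ z.1 / 2
      · have h1 : z.1 < max T₀ 1 := not_le.1 fun h => hreg ⟨h, hx⟩
        have h2 : max T₀ 1 ≤ 1 + |T₀| := max_le (by linarith [le_abs_self T₀]) (by linarith [abs_nonneg T₀])
        have h3 := jb_le_one_add z.1
        rw [abs_of_nonneg hz] at h3
        calc jb z.1 ≤ c₀ * 1 := by linarith
          _ ≤ c₀ * jb ‖z.2‖ := mul_le_mul_of_nonneg_left (one_le_jb _) (by linarith)
      · refine jb_le_mul hc₀1 ?_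
        rw [abs_of_nonneg hz, abs_of_nonneg (norm_nonneg _)]
        have := mul_nonneg (abs_nonneg T₀) (norm_nonneg z.2)
        rw [hc₀, add_mul]
        linarith
    have hle : ∀ j, jb ‖z.2‖ ^ (-p j) ≤ Ka j * jb z.1 ^ (-p j) := by
      intro j
      have hK1 : 1 ≤ Ka j := Real.one_le_rpow hc₀1 (abs_nonneg _)
      rcases le_total 0 (p j) with hpj | hpj
      · have h1 : c₀⁻¹ * jb z.1 ≤ jb ‖z.2‖ := by rwa [inv_mul_le_iff₀ (by linarith)]
        refine (Real.rpow_le_rpow_of_nonpos (by positivity) h1 (by linarith)).trans_eq ?_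
        rw [Real.mul_rpow (by positivity) hjt.le, hKa]
        simp only [abs_of_nonneg hpj]
        rw [Real.inv_rpow (by linarith), Real.rpow_neg (by linarith), inv_inv]
      -- For a negative exponent p the factor ⟨r⟩^{-p} grows, and r ≤ t is what bounds it by
      -- ⟨t⟩^{-p}. If all exponents are nonnegative, only p = 0 is left here.
      · rcases hpz with hall | hx
        · have : p j = 0 := le_antisymm hpj (hall j)
          rw [this, neg_zero, Real.rpow_zero, Real.rpow_zero, mul_one]
          exact hK1
        · refine (Real.rpow_le_rpow (jb_pos _).le (jb_mono ?_) (by linarith)).trans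
            (le_mul_of_one_le_left (hjp _ _) hK1)
          rwa [abs_of_nonneg (norm_nonneg _), abs_of_nonneg hz]
    have hwW : w z ≤ (∑ j, Ka j) * W := by
      rw [Finset.sum_mul]
      refine Finset.sum_le_sum fun j _ => ?_
      calc jb ‖z.2‖ ^ (-p j) * jb z.1 ^ (-q j) * jb (z.1 - ‖z.2‖) ^ (-η j)
          ≤ Ka j * jb z.1 ^ (-p j) * jb z.1 ^ (-q j) * jb (z.1 - ‖z.2‖) ^ (-η j) :=
            mul_le_mul_of_nonneg_right (mul_le_mul_of_nonneg_right (hle j) (hjp _ _)) (hjp _ _)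
        _ = Ka j * (jb z.1 ^ (-p j - q j) * jb (z.1 - ‖z.2‖) ^ (-η j)) := by
            rw [sub_eq_add_neg (-p j), Real.rpow_add hjt]; ring
        _ ≤ Ka j * W := mul_le_mul_of_nonneg_left (hWj j) (hKa0 j)
    calc |φ z| ≤ C * w z := hφw
      _ ≤ C * ((∑ j, Ka j) * W) := by gcongr
      _ = (∑ j, Ka j) * C * W := by ring
      _ ≤ _ := by
        gcongr
        have : 0 ≤ Kc * (2 * ∑ j, Kb j * 2 ^ |η j|) := by positivity
        linarith

end WaveDecay

end

theorem mainTheorem3 :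
    ∃ M : ℕ, ∀ (σ δ : ℝ), 0 < σ → 0 < δ →
      ∀ (g : Spacetime → Matrix (Fin 4) (Fin 4) ℝ) (A : Fin 4 → Spacetime → ℝ)
        (V : Spacetime → ℝ),
        AdmissibleCoeffs σ δ g A V →
        (WeakLED g A V ∨ StationaryLED g A V) →
        -- a single bound
        (∀ p q η : ℝ, p ≤ 1 →
          ∃ K : ℝ, ∀ (φ₀ φ₁ : Space → ℝ) (φ : Spacetime → ℝ), SolvesMain g A V φ₀ φ₁ φ →
            ∀ C : ℝ,
              BoundUpTo M φ C
                (fun z => jb ‖z.2‖ ^ (-p) * jb z.1 ^ (-q) * jb (z.1 - ‖z.2‖) ^ (-η)) →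
              ∀ z : Spacetime, 0 ≤ z.1 → (0 ≤ p ∨ ‖z.2‖ ≤ z.1) →
                |φ z| ≤ K * C * (jb z.1 ^ (-p - q) * jb (z.1 - ‖z.2‖) ^ (-η))) ∧
        -- finite sums of bounds
        (∀ k : ℕ, 1 ≤ k → ∀ p q η : Fin k → ℝ, (∀ j, p j ≤ 1) →
          ∃ K : ℝ, ∀ (φ₀ φ₁ : Space → ℝ) (φ : Spacetime → ℝ), SolvesMain g A V φ₀ φ₁ φ →
            ∀ C : ℝ,
              BoundUpTo M φ C
                (fun z => ∑ j, jb ‖z.2‖ ^ (-p j) * jb z.1 ^ (-q j)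
                  * jb (z.1 - ‖z.2‖) ^ (-η j)) →
              ∀ z : Spacetime, 0 ≤ z.1 → ((∀ j, 0 ≤ p j) ∨ ‖z.2‖ ≤ z.1) →
                |φ z| ≤ K * C * ∑ j, jb z.1 ^ (-p j - q j) * jb (z.1 - ‖z.2‖) ^ (-η j)) := by
  -- 28 = 16 + 12: sixteen derivatives for the three rounds of the iteration, and 12 for the
  -- weighted length of S². The single bound is the case of one summand.
  refine ⟨28, fun σ δ hσ hδ g A V hadm hled => ⟨fun p q η hp => ?_, fun k hk p q η hp =>
    exists_decay_sum hσ hδ hadm hled hk p q η hp⟩⟩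
  obtain ⟨K, hK⟩ := exists_decay_sum hσ hδ hadm hled (k := 1) le_rfl (fun _ => p) (fun _ => q) (fun _ => η)
    fun _ => hp
  refine ⟨K, fun φ₀ φ₁ φ hφ C hC z hz hpz => ?_⟩
  simpa using hK φ₀ φ₁ φ hφ C (by simpa using hC) z hz (hpz.imp_left fun h _ => h)
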